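/- Let $k\ge 0$ and let $T_{2,2k+1}$ be the standard diagram of the positive $(2,2k+1)$-torus knot, the closure of the 2-braid $\sigma_1^{2k+1}$, with a base point $p$ on one strand; number the crossings $c_0,\dots,c_{2k}$ cyclically along the braid, starting at $p$. Let $R$ be a commutative ring, and let $\mathrm{Cob}$ be the $R$-linear category of closed 1-manifolds and dotted cobordisms modulo the relations (sphere $=0$), (dotted sphere $=1$) and neck-cutting $\mathrm{cyl}=\bullet|\circ+\circ|\bullet-h\,(\circ|\circ)$, where $h$ is the sphere with two dots; a cobordism $S$ has degree $-\chi(S)+2\#\{\text{dots}\}$, and on a circle $1$ and $X$ have quantum degrees $-1$ and $+1$. The bracket $[T_{2,2k+1}]$ is the cube-of-resolutions complex over $\mathrm{Cob}$: the vertex $v\in\{0,1\}^{2k+1}$ has homological degree $|v|$ and quantum shift $-(2k+1)-|v|$. Let $\chi_c$ be the reversal of the part of the differential at the crossing $c$, with the same sign, let $x$ be the dot at $p$, and put $\xi_j=(-1)^j\chi_{c_j}$ for $0\le j<2(2k+1)$ (indices of $c$ mod $2k+1$; this is the walk once around the knot from $p$), $\bar\xi=\sum_j\xi_j$, $\bar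 u=\sum_{j<j'}\xi_j\xi_{j'}$. A $\mathcal{CA}_1$-module is a complex with supercommuting operators $x,\xi,u$ of bidegrees $(0,2),(-1,2),(-2,4)$ with $\xi^2=0$, $[d,x]=[d,\xi]=0$, $[d,u]=2x\xi$. **(1)** $([T_{2,2k+1}],d,x,\bar\xi,\bar u)$ is a $\mathcal{CA}_1$-module, and as a complex over $R$ it strongly deformation retracts, by maps $g:[T_{2,2k+1}]\to E$, $f:E\to[T_{2,2k+1}]$ and a homotopy $s$ (with $gf=1$, $fg-1=ds+sd$, $gs=0$, $sf=0$, $s^2=0$), onto the complex $E$ that has one circle $\mathsf U_1$ in each homological degree $t\in\{0,2,3,\dots,2k+1\}$ with quantum shift $-2k-2t$ and zero elsewhere, whose differential is $H=2X-h$ from degree $2j$ to $2j+1$ for $1\le j\le k$ and zero otherwise. The transferred operators $gxf=X$, $g\bar\xi f=0$ and $g\bar uf$ make $E$ a $\mathcal{CA}_1$-module, and $g\bar uf$ is $2(k-j+1)I$ from degree $2j$ to $2j-2$ ($1\le j\le k$) and from degree $2j+1$ to $2j-1$ ($2\le j\le k$), and zero otherwise. Now apply the TQFT of $\mathbb Q[X]/(X^2)$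 (so $R=\mathbb Q$, $h=t=0$). Then $x$ and $\bar u$ are chain maps preserving the image of $x$. Let $Kh=Kh(T_{2,2k+1};\mathbb Q)$ be the homology of the resulting complex, and let $\widetilde{Kh}$ be the homology of the image of $x$, with quantum degree lowered by $1$ (so that the reduced homology of the unknot lies in bidegree $(0,0)$). On both, let $e$ be the operator of bidegree $(-2,4)$ induced by $\bar u$. Put $\delta=2i+j$ in bidegree $(i,j)$. By an $e$-string of length $n$ from $(i,j)$ we mean vectors $b_0,\dots,b_{n-1}$ with $b_m$ of bidegree $(i+2m,j-4m)$, $e\,b_0=0$ and $e\,b_m=2(n-m)\,b_{m-1}$ for $1\le m<n$. **(2)** $Kh$ is supported on $\delta=-2k\pm1$, and it has a basis consisting of an $e$-string of length $k+1$ from $(0,-2k+1)$ (on $\delta=-2k+1$), one vector in bidegree $(0,-2k-1)$ annihilated by $e$, and an $e$-string of length $k$ from $(3,-2k-7)$ (both on $\delta=-2k-1$). **(3)** $\widetilde{Kh}$ is supported on $\delta=-2k$, and it has a basis consisting of an $e$-string of length $k+1$ from $(0,-2k)$ and an $e$-string of length $k$ from $(3,-2k-6)$. **(4)** In both cases $e$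 extends uniquely to a bigraded action of $\mathfrak{sl}_2$, that is, there is exactly one $\mathfrak{sl}_2$-action in which $\begin{pmatrix}0&1\\0&0\end{pmatrix}$ acts as $e$ and $\begin{pmatrix}0&0\\1&0\end{pmatrix}$ acts with bidegree $(2,-4)$. -/

import Mathlib

open CategoryTheory

namespace TorusKh

/-! ### Dotted surfaces -/

open Classical in
/-- The sum of `f` over the fibre of `p` above `c`. -/
noncomputable def fibreSum {A C M : Type} [AddCommMonoid M] (p : A → C) (f : A → M) (c : C) : M :=
  ∑ᶠ a, if p a = c then f a else 0

section FibreSum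

variable {A B C D M : Type} [AddCommMonoid M]

open Classical in
theorem fibreSum_eq [Fintype A] (p : A → C) (f : A → M) (c : C) :
    fibreSum p f c = ∑ a, if p a = c then f a else 0 :=
  finsum_eq_sum_of_fintype _

theorem fibreSum_fibreSum [Finite A] [Finite C] (p : A → C) (s : C → D) (f : A → M) :
    fibreSum s (fibreSum p f) = fibreSum (s ∘ p) f := by
  classical
  have := Fintype.ofFinite A
  have := Fintype.ofFinite C
  funext d
  simp only [fibreSum_eq, Function.comp]
  have h : ∀ c, (if s c = d then ∑ a, (if p a = c then f a else 0) else 0)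
      = ∑ a, if p a = c then (if s c = d then f a else 0) else 0 := by
    intro c; split_ifs <;> simp
  simp_rw [h]
  rw [Finset.sum_comm]
  simp

theorem fibreSum_add [Finite A] (p : A → C) (f g : A → M) :
    fibreSum p (f + g) = fibreSum p f + fibreSum p g := by
  classical
  have := Fintype.ofFinite A
  funext c
  simp only [fibreSum_eq, Pi.add_apply, ← Finset.sum_add_distrib]
  congr 1; funext a; split_ifs <;> simp

theorem fibreSum_equiv (e : A ≃ B) (s : B → C) (f : A → M) (g : B → M) (h : ∀ a, f a = g (e a)) :
    fibreSum (s ∘ e) f = fibreSum s g := by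
  classical
  funext c
  unfold fibreSum
  rw [← finsum_comp_equiv e]
  simp [h]

theorem fibreSum_comp_injective (p : A → B) (e : B → C) (he : Function.Injective e) (f : A → M)
    (b : B) : fibreSum (e ∘ p) f (e b) = fibreSum p f b := by
  unfold fibreSum
  congr 1; funext a
  by_cases h : p a = b
  · simp [h]
  · simp [h, he.ne h]

theorem fibreSum_id (f : A → M) : fibreSum (fun a => a) f = f := by
  classical
  funext c
  unfold fibreSum
  rw [finsum_eq_single _ c] <;> simp +contextual

theorem fibreSum_zero (p : A → C) : fibreSum p (0 : A → M) = 0 := by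
  funext c
  simp [fibreSum]

theorem fibreSum_sum [Finite A] [Finite B] (p : A ⊕ B → C) (f : A ⊕ B → M) :
    fibreSum p f = fibreSum (p ∘ Sum.inl) (f ∘ Sum.inl) + fibreSum (p ∘ Sum.inr) (f ∘ Sum.inr) := by
  classical
  have := Fintype.ofFinite A
  have := Fintype.ofFinite B
  funext c
  simp [fibreSum_eq]

theorem natCast_fibreSum [Finite A] (p : A → C) (f : A → ℕ) (c : C) :
    ((fibreSum p f c : ℕ) : ℤ) = fibreSum p (fun a => (f a : ℤ)) c := by
  classical
  have := Fintype.ofFinite A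
  simp [fibreSum_eq]

theorem fibreSum_one [Finite A] (p : A → C) (c : C) :
    fibreSum p (fun _ => 1) c = Nat.card {a // p a = c} := by
  classical
  have := Fintype.ofFinite A
  rw [fibreSum_eq, Nat.card_eq_fintype_card, Fintype.card_subtype]
  simp

end FibreSum

/-- A dotted compact oriented cobordism between the closed 1-manifolds whose sets of components
(circles) are `X` (bottom) and `Y` (top), recorded up to homeomorphism relative to the boundary by
its set of connected components, the component in which each boundary circle lies, and the genus
and the number of dots of each component. -/
structure DSurf (X Y : Type) where
  /-- the connected components -/
  Comp : Type
  /-- a compact surface has finitely many components -/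
  fin : Finite Comp
  /-- the component bounded by a bottom circle -/
  bot : X → Comp
  /-- the component bounded by a top circle -/
  top : Y → Comp
  /-- the genus of a component -/
  genus : Comp → ℕ
  /-- the number of dots on a component -/
  dots : Comp → ℕ

attribute [instance] DSurf.fin

namespace DSurf

variable {W X Y Z : Type}

/-- Two surfaces are identified when they have the same homeomorphism type
relative to the boundary. -/
structure Iso (S T : DSurf X Y) where
  /-- the bijection of components -/
  e : S.Comp ≃ T.Comp
  bot : ∀ x, e (S.bot x) = T.bot x
  top : ∀ y, e (S.top y) = T.top y
  genus : ∀ c, T.genus (e c) = S.genus c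
  dots : ∀ c, T.dots (e c) = S.dots c

/-- The setoid of homeomorphism relative to the boundary. -/
def setoid (X Y : Type) : Setoid (DSurf X Y) where
  r S T := Nonempty (Iso S T)
  iseqv :=
    { refl := fun _ => ⟨⟨Equiv.refl _, fun _ => rfl, fun _ => rfl, fun _ => rfl, fun _ => rfl⟩⟩
      symm := fun ⟨i⟩ => ⟨⟨i.e.symm, fun x => by simp [← i.bot], fun x => by simp [← i.top],
        fun c => by simp [← i.genus], fun c => by simp [← i.dots]⟩⟩
      trans := fun ⟨i⟩ ⟨j⟩ => ⟨⟨i.e.trans j.e, fun x => by simp [i.bot, j.bot],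
        fun x => by simp [i.top, j.top], fun c => by simp [i.genus, j.genus],
        fun c => by simp [i.dots, j.dots]⟩⟩ }

/-- The Euler characteristic of a surface, the sum over its components of
`2 - 2 * genus - (number of boundary circles)`. -/
noncomputable def eulerChar (S : DSurf X Y) : ℤ :=
  ∑ᶠ c, (2 - 2 * (S.genus c : ℤ) - Nat.card {x // S.bot x = c} - Nat.card {y // S.top y = c})

/-- The quantum degree `-χ + 2 * (number of dots)` of a dotted surface. -/
noncomputable def deg (S : DSurf X Y) : ℤ := -S.eulerChar + 2 * ∑ᶠ c, (S.dots c : ℤ)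

/-- The cylinder on `X`. -/
abbrev cylinder (X : Type) [Finite X] : DSurf X X where
  Comp := X
  fin := inferInstance
  bot := fun x => x
  top := fun x => x
  genus := fun _ => 0
  dots := fun _ => 0

/-- Components of the union of `S` and `T` along the circles `Y`: the components of `S` and of `T`,
where those that meet in a circle of `Y` are joined. -/
abbrev GlueComp (S : DSurf X Y) (T : DSurf Y Z) : Type :=
  Quot (fun a b : S.Comp ⊕ T.Comp => ∃ y, a = Sum.inl (S.top y) ∧ b = Sum.inr (T.bot y))

section Glue

variable (S : DSurf X Y) (T : DSurf Y Z)

/-- The component of the union that contains a component of `S`. -/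
def ofBot (a : S.Comp) : GlueComp S T := Quot.mk _ (Sum.inl a)

/-- The component of the union that contains a component of `T`. -/
def ofTop (b : T.Comp) : GlueComp S T := Quot.mk _ (Sum.inr b)

/-- The component of the union that contains a circle of `Y`. -/
def ofMid (y : Y) : GlueComp S T := ofTop S T (T.bot y)

theorem ofBot_top (y : Y) : ofBot S T (S.top y) = ofTop S T (T.bot y) :=
  Quot.sound ⟨y, rfl, rfl⟩

/-- Stacking of cobordisms, `S` below `T`. The genus of a component of the union
is the sum of the genera of the pieces plus the first Betti number
`1 + (number of gluing circles) - (number of pieces)` of the graph of pieces. -/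
noncomputable abbrev glue : DSurf X Z where
  Comp := GlueComp S T
  fin := inferInstance
  bot := fun x => ofBot S T (S.bot x)
  top := fun z => ofTop S T (T.top z)
  genus := fun c => fibreSum (ofBot S T) S.genus c + fibreSum (ofTop S T) T.genus c +
    (1 + Nat.card {y // ofMid S T y = c}
      - (Nat.card {a // ofBot S T a = c} + Nat.card {b // ofTop S T b = c}))
  dots := fun c => fibreSum (ofBot S T) S.dots c + fibreSum (ofTop S T) T.dots c

end Glue

/-- A connected graph has at most one vertex more than it has edges. -/
theorem card_class_le {V E : Type} [Finite V] [Finite E] (s t : E → V)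
    (r : V → V → Prop)
    (hr : ∀ a b, r a b ↔ ∃ e, a = s e ∧ b = t e) (c : Quot r) :
    Nat.card {a : V // Quot.mk r a = c} ≤ Nat.card {e : E // Quot.mk r (t e) = c} + 1 := by
  classical
  let G : SimpleGraph {a : V // Quot.mk r a = c} :=
    { Adj := fun a b => a ≠ b ∧ (r a b ∨ r b a)
      symm := ⟨fun a b h => ⟨h.1.symm, h.2.symm⟩⟩
      loopless := ⟨fun a h => h.1 rfl⟩ }
  have key : ∀ a b : V, Relation.EqvGen r a b → ∀ (ha : Quot.mk r a = c) (hb : Quot.mk r b = c),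
      G.Reachable ⟨a, ha⟩ ⟨b, hb⟩ := by
    intro a b h
    induction h with
    | rel a b h =>
      intro ha hb
      by_cases hab : a = b
      · subst hab; exact SimpleGraph.Reachable.refl _
      · exact SimpleGraph.Adj.reachable ⟨fun h' => hab (congrArg Subtype.val h'), Or.inl h⟩
    | refl a => intro ha hb; exact SimpleGraph.Reachable.refl _
    | symm a b _ ih => intro ha hb; exact (ih hb ha).symm
    | trans a b d h1 _ ih1 ih2 =>
      intro ha hd
      have hb : Quot.mk r b = c := by rw [← ha]; exact (Quot.eqvGen_sound h1).symm
      exact (ih1 ha hb).trans (ih2 hb hd)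
  have hconn : G.Connected := by
    have hne : Nonempty {a : V // Quot.mk r a = c} := by
      obtain ⟨a, ha⟩ := Quot.exists_rep c
      exact ⟨⟨a, ha⟩⟩
    refine (SimpleGraph.connected_iff _).2 ⟨?_, hne⟩
    rintro ⟨a, ha⟩ ⟨b, hb⟩
    exact key a b (Quot.eqvGen_exact (ha.trans hb.symm)) ha hb
  refine hconn.card_vert_le_card_edgeSet_add_one.trans (Nat.add_le_add_right ?_ 1)
  have hs : ∀ e : E, Quot.mk r (s e) = Quot.mk r (t e) := fun e => Quot.sound ((hr _ _).2 ⟨e, rfl, rfl⟩)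
  let φ : {e : E // Quot.mk r (t e) = c} → Sym2 {a : V // Quot.mk r a = c} :=
    fun e => s(⟨s e.1, (hs e.1).trans e.2⟩, ⟨t e.1, e.2⟩)
  have hsub : G.edgeSet ⊆ Set.range φ := by
    intro z
    induction z with
    | _ a b =>
      intro h
      replace h := h.2.imp (hr _ _).1 (hr _ _).1
      obtain ⟨e, h1, h2⟩ | ⟨e, h1, h2⟩ := h
      · refine ⟨⟨e, by rw [← h2]; exact b.2⟩, ?_⟩
        exact congrArg₂ (fun p q => s(p, q)) (Subtype.ext h1.symm) (Subtype.ext h2.symm)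
      · refine ⟨⟨e, by rw [← h2]; exact a.2⟩, ?_⟩
        rw [Sym2.eq_swap]
        exact congrArg₂ (fun p q => s(p, q)) (Subtype.ext h1.symm) (Subtype.ext h2.symm)
  calc Nat.card G.edgeSet ≤ Nat.card (Set.range φ) :=
        Nat.card_mono (Set.finite_range φ) hsub
    _ ≤ _ := Finite.card_range_le φ

/-- The genus of the union, with a subtraction in the integers. -/
theorem glue_genus [Finite Y] (S : DSurf X Y) (T : DSurf Y Z) :
    (fun c => ((glue S T).genus c : ℤ) - 1) =
      fibreSum (ofBot S T) (fun a => (S.genus a : ℤ) - 1) +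
      fibreSum (ofTop S T) (fun b => (T.genus b : ℤ) - 1) +
      fibreSum (ofMid S T) (fun _ => (1 : ℤ)) := by
  classical
  have := Fintype.ofFinite S.Comp
  have := Fintype.ofFinite T.Comp
  have := Fintype.ofFinite Y
  funext c
  have h := card_class_le (fun y => Sum.inl (S.top y) : Y → S.Comp ⊕ T.Comp)
    (fun y => Sum.inr (T.bot y)) _ (fun _ _ => Iff.rfl) c
  have h1 : Nat.card {a : S.Comp ⊕ T.Comp // Quot.mk _ a = c}
      = Nat.card {a // ofBot S T a = c} + Nat.card {b // ofTop S T b = c} := by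
    simp only [← fibreSum_one]
    rw [fibreSum_sum]; rfl
  rw [h1] at h
  change _ ≤ Nat.card {y // ofMid S T y = c} + 1 at h
  simp only [Pi.add_apply]
  push_cast
  rw [Nat.cast_sub (by omega)]
  push_cast
  simp only [← fibreSum_one]
  simp only [fibreSum_eq]
  push_cast
  have e1 : ∀ (f : S.Comp → ℤ) , (∑ a, if ofBot S T a = c then f a - 1 else 0)
      = (∑ a, if ofBot S T a = c then f a else 0) - ∑ a, if ofBot S T a = c then 1 else 0 := by
    intro f; rw [← Finset.sum_sub_distrib]; congr 1; funext a; split_ifs <;> simp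
  have e2 : ∀ (f : T.Comp → ℤ) , (∑ a, if ofTop S T a = c then f a - 1 else 0)
      = (∑ a, if ofTop S T a = c then f a else 0) - ∑ a, if ofTop S T a = c then 1 else 0 := by
    intro f; rw [← Finset.sum_sub_distrib]; congr 1; funext a; split_ifs <;> simp
  rw [e1, e2]
  ring

theorem glue_dots [Finite Y] (S : DSurf X Y) (T : DSurf Y Z) :
    (glue S T).dots = fibreSum (ofBot S T) S.dots + fibreSum (ofTop S T) T.dots := rfl

/-- Build an isomorphism from a bijection that satisfies the additive form of the genus rule. -/
def Iso.mk' {S T : DSurf X Y} (e : S.Comp ≃ T.Comp) (bot : ∀ x, e (S.bot x) = T.bot x)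
    (top : ∀ y, e (S.top y) = T.top y)
    (genus : ∀ c, (T.genus (e c) : ℤ) - 1 = (S.genus c : ℤ) - 1)
    (dots : ∀ c, T.dots (e c) = S.dots c) : Iso S T :=
  ⟨e, bot, top, fun c => by have := genus c; omega, dots⟩

/-- Stacking respects homeomorphism. -/
theorem glue_congr [Finite Y] {S S' : DSurf X Y} {T T' : DSurf Y Z} (i : Iso S S') (j : Iso T T') :
    Nonempty (Iso (glue S T) (glue S' T')) := by
  let e : GlueComp S T ≃ GlueComp S' T' :=
    { toFun := Quot.lift (Sum.elim (fun a => ofBot S' T' (i.e a)) (fun b => ofTop S' T' (j.e b)))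
        (by rintro _ _ ⟨y, rfl, rfl⟩; simp [i.top, j.bot, ofBot_top])
      invFun := Quot.lift
        (Sum.elim (fun a => ofBot S T (i.e.symm a)) (fun b => ofTop S T (j.e.symm b)))
        (by rintro _ _ ⟨y, rfl, rfl⟩; simp [← i.top, ← j.bot, ofBot_top])
      left_inv := by rintro ⟨a | b⟩ <;> simp [ofBot, ofTop]
      right_inv := by rintro ⟨a | b⟩ <;> simp [ofBot, ofTop] }
  have hb : e ∘ ofBot S T = ofBot S' T' ∘ i.e := rfl
  have ht : e ∘ ofTop S T = ofTop S' T' ∘ j.e := rfl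
  have hm : e ∘ ofMid S T = ofMid S' T' := by
    funext y
    change ofTop S' T' (j.e (T.bot y)) = _
    rw [j.bot]; rfl
  refine ⟨Iso.mk' e (fun x => congrArg (ofBot S' T') (i.bot x))
    (fun z => congrArg (ofTop S' T') (j.top z)) (fun c => ?_) (fun c => ?_)⟩
  · rw [congrFun (glue_genus S' T') (e c), congrFun (glue_genus S T) c]
    simp only [Pi.add_apply]
    rw [← fibreSum_comp_injective _ e e.injective, ← fibreSum_comp_injective _ e e.injective,
      ← fibreSum_comp_injective _ e e.injective, hb, ht, hm]
    rw [fibreSum_equiv i.e _ _ (fun a => (S'.genus a : ℤ) - 1) (by simp [i.genus]),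
      fibreSum_equiv j.e _ _ (fun a => (T'.genus a : ℤ) - 1) (by simp [j.genus])]
  · rw [glue_dots, glue_dots]
    simp only [Pi.add_apply]
    rw [← fibreSum_comp_injective (ofBot S T) e e.injective,
      ← fibreSum_comp_injective (ofTop S T) e e.injective, hb, ht]
    rw [fibreSum_equiv i.e _ _ S'.dots (by simp [i.dots]),
      fibreSum_equiv j.e _ _ T'.dots (by simp [j.dots])]

theorem cylinder_glue [Finite X] (S : DSurf X Y) : Nonempty (Iso (glue (cylinder X) S) S) := by
  let e : GlueComp (cylinder X) S ≃ S.Comp :=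
    { toFun := Quot.lift (Sum.elim S.bot (fun b => b)) (by rintro _ _ ⟨y, rfl, rfl⟩; rfl)
      invFun := ofTop _ _
      left_inv := by
        rintro (⟨a | b⟩)
        · exact (ofBot_top (cylinder X) S a).symm
        · rfl
      right_inv := fun _ => rfl }
  have hb : e ∘ ofBot (cylinder X) S = S.bot := rfl
  have ht : e ∘ ofTop (cylinder X) S = fun c => c := rfl
  have hm : e ∘ ofMid (cylinder X) S = S.bot := rfl
  refine ⟨Iso.mk' e (fun _ => rfl) (fun _ => rfl) (fun c => ?_) (fun c => ?_)⟩
  · rw [congrFun (glue_genus (cylinder X) S) c]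
    simp only [Pi.add_apply]
    rw [← fibreSum_comp_injective _ e e.injective, ← fibreSum_comp_injective _ e e.injective,
      ← fibreSum_comp_injective _ e e.injective, hb, ht, hm, fibreSum_id]
    have h := congrFun (fibreSum_add S.bot (fun _ => ((0 : ℕ) : ℤ) - 1) (fun _ => 1)) (e c)
    have h0 : ((fun _ => ((0 : ℕ) : ℤ) - 1) + (fun _ => 1) : X → ℤ) = 0 := by funext; simp
    rw [h0, fibreSum_zero] at h
    simp only [Pi.add_apply, Pi.zero_apply] at h
    linarith
  · rw [glue_dots]
    simp only [Pi.add_apply]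
    rw [← fibreSum_comp_injective (ofBot (cylinder X) S) e e.injective,
      ← fibreSum_comp_injective (ofTop (cylinder X) S) e e.injective, hb, ht, fibreSum_id]
    change _ = fibreSum S.bot 0 (e c) + _
    simp [fibreSum_zero]

theorem glue_cylinder [Finite Y] (S : DSurf X Y) : Nonempty (Iso (glue S (cylinder Y)) S) := by
  let e : GlueComp S (cylinder Y) ≃ S.Comp :=
    { toFun := Quot.lift (Sum.elim (fun a => a) S.top) (by rintro _ _ ⟨y, rfl, rfl⟩; rfl)
      invFun := ofBot _ _
      left_inv := by
        rintro (⟨a | b⟩)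
        · rfl
        · exact ofBot_top S (cylinder Y) b
      right_inv := fun _ => rfl }
  have hb : e ∘ ofBot S (cylinder Y) = fun c => c := rfl
  have ht : e ∘ ofTop S (cylinder Y) = S.top := rfl
  have hm : e ∘ ofMid S (cylinder Y) = S.top := rfl
  refine ⟨Iso.mk' e (fun _ => rfl) (fun _ => rfl) (fun c => ?_) (fun c => ?_)⟩
  · rw [congrFun (glue_genus S (cylinder Y)) c]
    simp only [Pi.add_apply]
    rw [← fibreSum_comp_injective _ e e.injective, ← fibreSum_comp_injective _ e e.injective,
      ← fibreSum_comp_injective _ e e.injective, hb, ht, hm, fibreSum_id]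
    have h := congrFun (fibreSum_add S.top (fun _ => ((0 : ℕ) : ℤ) - 1) (fun _ => 1)) (e c)
    have h0 : ((fun _ => ((0 : ℕ) : ℤ) - 1) + (fun _ => 1) : Y → ℤ) = 0 := by funext; simp
    rw [h0, fibreSum_zero] at h
    simp only [Pi.add_apply, Pi.zero_apply] at h
    linarith
  · rw [glue_dots]
    simp only [Pi.add_apply]
    rw [← fibreSum_comp_injective (ofBot S (cylinder Y)) e e.injective,
      ← fibreSum_comp_injective (ofTop S (cylinder Y)) e e.injective, hb, ht, fibreSum_id]
    change _ = _ + fibreSum S.top 0 (e c)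
    simp [fibreSum_zero]

theorem glue_assoc [Finite X] [Finite Y] (R : DSurf W X) (S : DSurf X Y) (T : DSurf Y Z) :
    Nonempty (Iso (glue (glue R S) T) (glue R (glue S T))) := by
  let e : GlueComp (glue R S) T ≃ GlueComp R (glue S T) :=
    { toFun := Quot.lift (Sum.elim
        (Quot.lift (Sum.elim (fun a => ofBot R (glue S T) a)
          (fun b => ofTop R (glue S T) (ofBot S T b)))
          (by rintro _ _ ⟨x, rfl, rfl⟩; exact ofBot_top R (glue S T) x))
        (fun c => ofTop R (glue S T) (ofTop S T c)))
        (by rintro _ _ ⟨y, rfl, rfl⟩; exact congrArg (ofTop R (glue S T)) (ofBot_top S T y))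
      invFun := Quot.lift (Sum.elim
        (fun a => ofBot (glue R S) T (ofBot R S a))
        (Quot.lift (Sum.elim (fun b => ofBot (glue R S) T (ofTop R S b))
          (fun c => ofTop (glue R S) T c))
          (by rintro _ _ ⟨y, rfl, rfl⟩; exact ofBot_top (glue R S) T y)))
        (by rintro _ _ ⟨x, rfl, rfl⟩; exact congrArg (ofBot (glue R S) T) (ofBot_top R S x))
      left_inv := by
        intro z
        induction z using Quot.ind with | _ z =>
        rcases z with z | c
        · induction z using Quot.ind with | _ z =>
          rcases z with a | b <;> rfl
        · rfl
      right_inv := by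
        intro z
        induction z using Quot.ind with | _ z =>
        rcases z with a | z
        · rfl
        · induction z using Quot.ind with | _ z =>
          rcases z with b | c <;> rfl }
  refine ⟨Iso.mk' e (fun _ => rfl) (fun _ => rfl) (fun c => ?_) (fun c => ?_)⟩
  · rw [congrFun (glue_genus R (glue S T)) (e c), congrFun (glue_genus (glue R S) T) c]
    rw [glue_genus S T, glue_genus R S]
    simp only [fibreSum_add, fibreSum_fibreSum, Pi.add_apply]
    rw [← fibreSum_comp_injective (_ ∘ ofBot R S) e e.injective,
      ← fibreSum_comp_injective (_ ∘ ofTop R S) e e.injective,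
      ← fibreSum_comp_injective (_ ∘ ofMid R S) e e.injective,
      ← fibreSum_comp_injective (ofTop (glue R S) T) e e.injective,
      ← fibreSum_comp_injective (ofMid (glue R S) T) e e.injective]
    have h1 : e ∘ ofBot (glue R S) T ∘ ofBot R S = ofBot R (glue S T) := rfl
    have h2 : e ∘ ofBot (glue R S) T ∘ ofTop R S = ofTop R (glue S T) ∘ ofBot S T := rfl
    have h3 : e ∘ ofTop (glue R S) T = ofTop R (glue S T) ∘ ofTop S T := rfl
    have h4 : e ∘ ofBot (glue R S) T ∘ ofMid R S = ofMid R (glue S T) := rfl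
    have h5 : e ∘ ofMid (glue R S) T = ofTop R (glue S T) ∘ ofMid S T := rfl
    rw [h1, h2, h3, h4, h5]
    ring
  · change (fibreSum (ofBot R (glue S T)) R.dots
        + fibreSum (ofTop R (glue S T)) (fibreSum (ofBot S T) S.dots + fibreSum (ofTop S T) T.dots))
        (e c) = (fibreSum (ofBot (glue R S) T)
          (fibreSum (ofBot R S) R.dots + fibreSum (ofTop R S) S.dots)
        + fibreSum (ofTop (glue R S) T) T.dots) c
    simp only [fibreSum_add, fibreSum_fibreSum, Pi.add_apply]
    rw [← fibreSum_comp_injective (_ ∘ ofBot R S) e e.injective,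
      ← fibreSum_comp_injective (_ ∘ ofTop R S) e e.injective,
      ← fibreSum_comp_injective (ofTop (glue R S) T) e e.injective]
    have h1 : e ∘ ofBot (glue R S) T ∘ ofBot R S = ofBot R (glue S T) := rfl
    have h2 : e ∘ ofBot (glue R S) T ∘ ofTop R S = ofTop R (glue S T) ∘ ofBot S T := rfl
    have h3 : e ∘ ofTop (glue R S) T = ofTop R (glue S T) ∘ ofTop S T := rfl
    rw [h1, h2, h3]
    ring

end DSurf

/-! ### The category of dotted cobordisms -/

/-- A closed 1-manifold, recorded by the finite set of its circles. -/
structure DCob where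
  /-- the set of circles -/
  Circle : Type
  fin : Finite Circle

attribute [instance] DCob.fin

/-- Morphisms are homeomorphism types of dotted surfaces. -/
noncomputable instance : Category DCob where
  Hom X Y := Quotient (DSurf.setoid X.Circle Y.Circle)
  id X := Quotient.mk _ (DSurf.cylinder X.Circle)
  comp f g := Quotient.liftOn₂ f g (fun S T => Quotient.mk _ (DSurf.glue S T))
    (by rintro _ _ _ _ ⟨i⟩ ⟨j⟩; exact Quotient.sound (DSurf.glue_congr i j))
  id_comp f := Quotient.inductionOn f fun S => Quotient.sound (DSurf.cylinder_glue S)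
  comp_id f := Quotient.inductionOn f fun S => Quotient.sound (DSurf.glue_cylinder S)
  assoc f g h := Quotient.inductionOn₃ f g h fun R S T => Quotient.sound (DSurf.glue_assoc R S T)

namespace DSurf

variable {X Y : Type}

/-- The disjoint union with a closed sphere carrying `m` dots. -/
abbrev addSphere (S : DSurf X Y) (m : ℕ) : DSurf X Y where
  Comp := Option S.Comp
  fin := inferInstance
  bot := fun x => some (S.bot x)
  top := fun y => some (S.top y)
  genus := fun c => c.elim 0 S.genus
  dots := fun c => c.elim m S.dots

open Classical in
/-- The surface with one more dot on the component `c`. -/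
noncomputable abbrev addDot (S : DSurf X Y) (c : S.Comp) : DSurf X Y where
  Comp := S.Comp
  fin := S.fin
  bot := S.bot
  top := S.top
  genus := S.genus
  dots := fun b => S.dots b + if b = c then 1 else 0

open Classical in
/-- The cylinder on `X` with the annulus over the circle `x` replaced by two discs,
a bottom disc (component `some x`) with `m` dots and a top disc (component `none`)
with `m'` dots. -/
noncomputable abbrev cut [Finite X] (x : X) (m m' : ℕ) : DSurf X X where
  Comp := Option X
  fin := inferInstance
  bot := fun y => some y
  top := fun y => if y = x then none else some y
  genus := fun _ => 0
  dots := fun c => c.elim m' (fun y => if y = x then m else 0)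

end DSurf

section Cob

variable (R : Type*) [CommRing R]

/-- A surface as a morphism of the `R`-linear category of formal combinations of dotted surfaces. -/
noncomputable def single {X Y : DCob} (S : DSurf X.Circle Y.Circle) :
    Free.of R X ⟶ Free.of R Y :=
  (Free.embedding R DCob).map (show X ⟶ Y from Quotient.mk _ S)

/-- The congruence generated by the local relations: a sphere without dots is `0`, a sphere with
one dot is `1`, and neck-cutting, where a sphere with two dots plays the role of `h`. -/
inductive LocalRel : HomRel (Free R DCob)
  | sphere {X Y : DCob} (S : DSurf X.Circle Y.Circle) : LocalRel (single R (S.addSphere 0)) 0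
  | dottedSphere {X Y : DCob} (S : DSurf X.Circle Y.Circle) :
      LocalRel (single R (S.addSphere 1)) (single R S)
  | neck (X : DCob) (x : X.Circle) :
      LocalRel (𝟙 (Free.of R X))
        (single R (DSurf.cut x 1 0) + single R (DSurf.cut x 0 1)
          - single R ((DSurf.cut x 0 0).addSphere 2))
  | refl {X Y : Free R DCob} (f : X ⟶ Y) : LocalRel f f
  | symm {X Y : Free R DCob} {f g : X ⟶ Y} : LocalRel f g → LocalRel g f
  | trans {X Y : Free R DCob} {f g h : X ⟶ Y} : LocalRel f g → LocalRel g h → LocalRel f h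
  | add {X Y : Free R DCob} {f f' g g' : X ⟶ Y} :
      LocalRel f f' → LocalRel g g' → LocalRel (f + g) (f' + g')
  | comp_left {X Y Z : Free R DCob} (f : X ⟶ Y) {g g' : Y ⟶ Z} :
      LocalRel g g' → LocalRel (f ≫ g) (f ≫ g')
  | comp_right {X Y Z : Free R DCob} {f f' : X ⟶ Y} (g : Y ⟶ Z) :
      LocalRel f f' → LocalRel (f ≫ g) (f' ≫ g)

instance : Congruence (LocalRel R) where
  equivalence := ⟨LocalRel.refl, LocalRel.symm, LocalRel.trans⟩
  comp_left f _ _ h := LocalRel.comp_left f h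
  comp_right g h := LocalRel.comp_right g h

/-- The `R`-linear category of dotted cobordisms modulo the local relations. -/
abbrev Cob := CategoryTheory.Quotient (LocalRel R)

noncomputable instance : Preadditive (Cob R) :=
  Quotient.preadditive (LocalRel R) (fun _ _ _ _ _ _ h h' => LocalRel.add h h')

/-- The object of `Cob R` with set of circles `X`. -/
def circles (X : Type) [Finite X] : Cob R := ⟨Free.of R ⟨X, inferInstance⟩⟩

/-- The set of circles of an object. -/
abbrev Circ (A : Cob R) : Type := DCob.Circle A.as

variable {R}

/-- The class of `r • S` in `Cob R`. -/
noncomputable def surf {A B : Cob R} (r : R) (S : DSurf (Circ R A) (Circ R B)) : A ⟶ B :=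
  (Quotient.functor (LocalRel R)).map (r • single R S)

/-- The homogeneous morphisms of degree `m`. -/
noncomputable def homog (m : ℤ) (A B : Cob R) : AddSubgroup (A ⟶ B) :=
  AddSubgroup.closure {f | ∃ (r : R) (S : DSurf (Circ R A) (Circ R B)), S.deg = m ∧ f = surf r S}

end Cob


/-! ### Graded objects, `CA_1`-modules and strong deformation retracts -/

section Graded

variable {R : Type*} [CommRing R]

/-- A formal direct sum of objects of `Cob R`, each with a homological degree `t`
and a quantum shift `q`. -/
structure GrMat (R : Type*) [CommRing R] where
  /-- the underlying formal direct sum -/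
  obj : Mat_ (Cob R)
  /-- the homological degree of a summand -/
  t : obj.ι → ℤ
  /-- the quantum shift of a summand -/
  q : obj.ι → ℤ

/-- The map `f` has bidegree `(a, b)`: a surface of degree `m` from a summand with shift `q` to a
summand with shift `q'` has quantum degree `m + q' - q`. -/
def HasBidegree {C D : GrMat R} (f : C.obj ⟶ D.obj) (a b : ℤ) : Prop :=
  ∀ i j, (D.t j = C.t i + a → f i j ∈ homog (b + C.q i - D.q j) (C.obj.X i) (D.obj.X j)) ∧
    (D.t j ≠ C.t i + a → f i j = 0)

/-- A module over the dg algebra `CA_1`: a complex with differential `d`, together with operators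
`x`, `ξ`, `u` of bidegrees `(0, 2)`, `(-1, 2)`, `(-2, 4)` that supercommute with each other
and satisfy `ξ ^ 2 = 0`, `[d, x] = 0`, `[d, ξ] = 0` and `[d, u] = 2 x ξ`. -/
structure IsCA1Module (C : GrMat R) (d x ξ u : End C.obj) : Prop where
  d_deg : HasBidegree (C := C) (D := C) d 1 0
  x_deg : HasBidegree (C := C) (D := C) x 0 2
  ξ_deg : HasBidegree (C := C) (D := C) ξ (-1) 2
  u_deg : HasBidegree (C := C) (D := C) u (-2) 4
  d_sq : d * d = 0
  x_ξ : x * ξ = ξ * x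
  x_u : x * u = u * x
  ξ_u : ξ * u = u * ξ
  ξ_sq : ξ * ξ = 0
  d_x : d * x - x * d = 0
  d_ξ : d * ξ + ξ * d = 0
  d_u : d * u - u * d = x * ξ + x * ξ

/-- `g : C ⟶ D`, `f : D ⟶ C` and `s` form a strong deformation retraction of the complex `(C, d)`
onto the complex `(D, d')`. -/
structure IsStrongDeformationRetract (C D : GrMat R) (d : End C.obj) (d' : End D.obj)
    (g : C.obj ⟶ D.obj) (f : D.obj ⟶ C.obj) (s : End C.obj) : Prop where
  g_deg : HasBidegree g 0 0
  f_deg : HasBidegree f 0 0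
  s_deg : HasBidegree (C := C) (D := C) s (-1) 0
  g_chain : d ≫ g = g ≫ d'
  f_chain : f ≫ d = d' ≫ f
  homotopy : g ≫ f - 𝟙 C.obj = d * s + s * d
  retract : f ≫ g = 𝟙 D.obj
  g_s : s ≫ g = 0
  s_f : f ≫ s = 0
  s_sq : s * s = 0

end Graded

/-! ### The cube of resolutions of the `(2, 2k+1)`-torus knot

The diagram is the closure of the 2-braid with `2k + 1` positive crossings. Crossing `c` lies between
the levels `c` and `c + 1` (cyclically), and the edges at a level are the two strands
`false` (left) and `true` (right). The orientation runs along the braid, so the `0`-resolution of a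
(positive) crossing joins `(c, s)` to `(c + 1, s)`, and its `1`-resolution joins `(c, false)` to
`(c, true)` and `(c + 1, false)` to `(c + 1, true)`. -/

section Cube

/-- The crossings of the diagram (and the levels between them). -/
abbrev Crossing (k : ℕ) : Type := Fin (2 * k + 1)

/-- The edges of the diagram. -/
abbrev Edge (k : ℕ) : Type := Crossing k × Bool

/-- The vertices of the cube of resolutions, `true` standing for the `1`-resolution. -/
abbrev Vertex (k : ℕ) : Type := Crossing k → Bool

variable {k : ℕ}

/-- Two edges that are joined at a crossing in the resolution `v`. -/
inductive Joined (v : Vertex k) : Edge k → Edge k → Prop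
  | zero (c : Crossing k) (s : Bool) : v c = false → Joined v (c, s) (c + 1, s)
  | one_bot (c : Crossing k) : v c = true → Joined v (c, false) (c, true)
  | one_top (c : Crossing k) : v c = true → Joined v (c + 1, false) (c + 1, true)

/-- The circles of the resolution `v`. -/
abbrev ResCircle (v : Vertex k) : Type := Quot (Joined v)

/-- The number of `1`-resolutions. -/
def Vertex.weight (v : Vertex k) : ℕ := (Finset.univ.filter fun c => v c = true).card

/-- The surface between the resolutions `v` and `w` swept out by the diagram:
all components have genus 0, and circles that share an edge lie on the same component.
It is the cylinder when `w = v`, and the saddle (and cylinders) when `v` and `w` differ at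
exactly one crossing. -/
def sweep (v w : Vertex k) : DSurf (ResCircle v) (ResCircle w) where
  Comp := Quot (fun a b => Joined v a b ∨ Joined w a b)
  fin := inferInstance
  bot := Quot.map id fun _ _ h => Or.inl h
  top := Quot.map id fun _ _ h => Or.inr h
  genus := fun _ => 0
  dots := fun _ => 0

/-- The cylinder over the resolution `v` (for `w = v`) with a dot at the base point, which lies on
the edge `(0, false)`. -/
noncomputable def dottedSweep (v w : Vertex k) : DSurf (ResCircle v) (ResCircle w) :=
  (sweep v w).addDot (Quot.mk _ (0, false))

/-- The incidence number of the edge of the cube from `v` to `w` in direction `c`. -/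
def incidence (c : Crossing k) (v w : Vertex k) : ℤ :=
  if v c = false ∧ w = Function.update v c true then
    (-1) ^ (Finset.univ.filter fun i => i < c ∧ v i = true).card
  else 0

/-- The quantum shift of the resolution `v` in the bracket (all `2k + 1` crossings are positive). -/
def Vertex.shift (v : Vertex k) : ℤ := -(2 * k + 1) - v.weight

/-- The crossing that is passed in step `j` of a walk along the knot that starts at the edge
`(0, false)`. -/
def passed (k j : ℕ) : Crossing k := Fin.ofNat (2 * k + 1) j

variable {A : Type*} [Ring A]

/-- The operator `ξ̄ = ∑ ε_j χ_j`, summed over the `2 (2k + 1)` crossing passages of the knot, where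
`χ_j` is the reverse differential at the crossing passed in step `j`. The checkerboard colour of the
edge before step `j` alternates, whence `ε_j = (-1) ^ j`. -/
def loopXi (χ : Crossing k → A) : A :=
  ∑ j ∈ Finset.range (2 * (2 * k + 1)), (-1) ^ j * χ (passed k j)

/-- The operator `ū = ∑_{j < j'} (ε_j χ_j) (ε_j' χ_j')`, with the same conventions. -/
def loopU (χ : Crossing k → A) : A :=
  ∑ j' ∈ Finset.range (2 * (2 * k + 1)), ∑ j ∈ Finset.range j',
    ((-1) ^ j * χ (passed k j)) * ((-1) ^ j' * χ (passed k j'))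

end Cube

/-! ### The bracket of the torus knot and its small model -/

section Bracket

variable (R : Type*) [CommRing R] (k : ℕ)

/-- The graded object underlying the bracket of the `(2, 2k+1)`-torus knot. -/
noncomputable def bracket : GrMat R where
  obj := { ι := Vertex k, X := fun v => circles R (ResCircle v) }
  t := fun v => v.weight
  q := fun v => v.shift

/-- The differential of the bracket. -/
noncomputable def bracketD : End (bracket R k).obj :=
  fun v w => ∑ c, incidence c v w • surf (1 : R) (sweep v w)

/-- The reverse of the differential in direction `c`. -/
noncomputable def bracketChi (c : Crossing k) : End (bracket R k).obj :=
  fun v w => incidence c w v • surf (1 : R) (sweep v w)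

/-- The operator `ξ̄` on the bracket. -/
noncomputable def bracketXi : End (bracket R k).obj := loopXi (bracketChi R k)

/-- The operator `ū` on the bracket. -/
noncomputable def bracketU : End (bracket R k).obj := loopU (bracketChi R k)

open Classical in
/-- The dot at the base point. -/
noncomputable def bracketX : End (bracket R k).obj :=
  fun v w => if v = w then surf (1 : R) (dottedSweep v w) else 0

/-- The circle `U_1`. -/
noncomputable abbrev unknot : Cob R := circles R Unit

/-- The endomorphism `X` of `U_1`, the cylinder with a dot. -/
noncomputable def dotX : unknot R ⟶ unknot R :=
  surf (1 : R) ((DSurf.cylinder Unit).addDot ())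

/-- The endomorphism `h` of `U_1`, the union of the cylinder and a sphere with two dots. -/
noncomputable def hU : unknot R ⟶ unknot R :=
  surf (1 : R) ((DSurf.cylinder Unit).addSphere 2)

/-- The endomorphism `H = 2 X - h` of `U_1`. -/
noncomputable def mapH : unknot R ⟶ unknot R := dotX R + dotX R - hU R

/-- The graded object with one copy of `U_1` in each of the homological degrees
`0, 2, 3, 4, …, 2k + 1`, where the copy in degree `t` has quantum shift `-2k - 2t`. -/
noncomputable def small : GrMat R where
  obj := { ι := {t : Fin (2 * k + 2) // t.val ≠ 1}, X := fun _ => unknot R }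
  t := fun i => i.1.val
  q := fun i => -(2 * k) - 2 * i.1.val

/-- The differential of the small model: `H` from degree `2j` to degree `2j + 1` for `1 ≤ j ≤ k`. -/
noncomputable def smallD : End (small R k).obj :=
  fun i j => if 2 ≤ i.1.val ∧ Even i.1.val ∧ j.1.val = i.1.val + 1 then mapH R else 0

open Classical in
/-- The dot acting on each copy of `U_1`. -/
noncomputable def smallX : End (small R k).obj :=
  fun i j => if i = j then dotX R else 0

/-- The operator `ū` of the small model: `2 (k - j + 1) I` from degree `t = 2j` or `t = 2j + 1` to
degree `t - 2` (unless `t = 3`, where the target is zero). -/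
noncomputable def smallU : End (small R k).obj :=
  fun i j => if i.1.val = j.1.val + 2 then (2 * (k + 1 - i.1.val / 2)) • 𝟙 (unknot R) else 0

end Bracket

/-! ### Rational Khovanov homology -/

section Khovanov

/-- The value of a closed component of genus `g` with `m` dots under the TQFT of the Frobenius
algebra `ℚ[X] / (X ^ 2)` with counit `1 ↦ 0`, `X ↦ 1`, that is, `ε (X ^ m (2 X) ^ g)`. -/
def evalComp (g m : ℕ) : ℚ := if m + g = 1 then 2 ^ g else 0

/-- The matrix coefficient of the TQFT on a dotted surface, from the basis vector `a` to the basis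
vector `b`, where `true` stands for `X` and `false` for `1`. A bottom circle labelled `X` acts as
a dotted disc, and a top circle labelled `1` is dual to a dotted disc. -/
noncomputable def DSurf.coeff {X Y : Type} (S : DSurf X Y) (a : X → Bool) (b : Y → Bool) : ℚ :=
  ∏ᶠ c, evalComp (S.genus c)
    (S.dots c + Nat.card {x // S.bot x = c ∧ a x = true} + Nat.card {y // S.top y = c ∧ b y = false})

variable (k : ℕ)

/-- The generators of the Khovanov complex: a resolution with its circles labelled by `1` or `X`. -/
abbrev Gen : Type := Σ v : Vertex k, ResCircle v → Bool

noncomputable instance : Fintype (Gen k) := Fintype.ofFinite _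

noncomputable instance : DecidableEq (Gen k) := Classical.decEq _

variable {k}

/-- The homological degree of a generator. -/
def Gen.t (g : Gen k) : ℤ := g.1.weight

/-- The quantum degree of a generator: on a circle `1` has degree `-1` and `X` has degree `1`. -/
noncomputable def Gen.q (g : Gen k) : ℤ := g.1.shift + ∑ᶠ x, if g.2 x = true then 1 else -1

variable (k)

/-- The matrix of the differential. -/
noncomputable def khD : Matrix (Gen k) (Gen k) ℚ := Matrix.of fun g' g =>
  ∑ c, (incidence c g.1 g'.1 : ℚ) * (sweep g.1 g'.1).coeff g.2 g'.2

/-- The matrix of the reverse of the differential in direction `c`. -/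
noncomputable def khChi (c : Crossing k) : Matrix (Gen k) (Gen k) ℚ := Matrix.of fun g' g =>
  (incidence c g'.1 g.1 : ℚ) * (sweep g.1 g'.1).coeff g.2 g'.2

open Classical in
/-- The matrix of the dot at the base point. -/
noncomputable def khX : Matrix (Gen k) (Gen k) ℚ := Matrix.of fun g' g =>
  if g.1 = g'.1 then (dottedSweep g.1 g'.1).coeff g.2 g'.2 else 0

/-- The Khovanov complex `CKh(T_{2,2k+1}; ℚ)`. -/
abbrev CKh : Type := Gen k → ℚ

/-- The differential of the Khovanov complex. -/
noncomputable def ckhD : CKh k →ₗ[ℚ] CKh k := (khD k).mulVecLin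

/-- The operator `ū` on the Khovanov complex. -/
noncomputable def ckhU : CKh k →ₗ[ℚ] CKh k := (loopU (khChi k)).mulVecLin

/-- The action of `X` at the base point on the Khovanov complex. -/
noncomputable def ckhX : CKh k →ₗ[ℚ] CKh k := (khX k).mulVecLin

/-- The chains of bidegree `(i, j)`. -/
def ckhPiece (i j : ℤ) : Submodule ℚ (CKh k) where
  carrier := {z | ∀ g, ¬ (g.t = i ∧ g.q = j) → z g = 0}
  add_mem' := fun ha hb g hg => by simp [ha g hg, hb g hg]
  zero_mem' := fun _ _ => rfl
  smul_mem' := fun r z hz g hg => by simp [hz g hg]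

/-- The cycles of the subcomplex `S`. -/
noncomputable abbrev cycles (S : Submodule ℚ (CKh k)) : Submodule ℚ (CKh k) :=
  LinearMap.ker (ckhD k) ⊓ S

/-- The homology of the subcomplex `S`. -/
abbrev SubHomology (S : Submodule ℚ (CKh k)) : Type :=
  cycles k S ⧸ (S.map (ckhD k)).comap (cycles k S).subtype

/-- The classes in the homology of `S` of the cycles of bidegree `(i, j)`. -/
noncomputable def homPiece (S : Submodule ℚ (CKh k)) (i j : ℤ) : Submodule ℚ (SubHomology k S) :=
  ((ckhPiece k i j).comap (cycles k S).subtype).map (Submodule.mkQ _)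

/-- The endomorphism `e` of the homology of `S` is induced by the operator `ū`. -/
def IsInducedByU (S : Submodule ℚ (CKh k)) (e : Module.End ℚ (SubHomology k S)) : Prop :=
  ∀ z : cycles k S, ∃ z' : cycles k S, (z' : CKh k) = ckhU k z ∧
    e (Submodule.Quotient.mk z) = Submodule.Quotient.mk z'

/-- Unreduced Khovanov homology `Kh(T_{2,2k+1}; ℚ)`. -/
abbrev Kh : Type := SubHomology k ⊤

/-- The part of unreduced Khovanov homology of bidegree `(i, j)`. -/
noncomputable def khPiece (i j : ℤ) : Submodule ℚ (Kh k) := homPiece k ⊤ i j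

/-- The subcomplex `X · CKh` that computes reduced Khovanov homology. -/
noncomputable abbrev redSub : Submodule ℚ (CKh k) := LinearMap.range (ckhX k)

/-- Reduced Khovanov homology of `T_{2,2k+1}` over `ℚ`. -/
abbrev RKh : Type := SubHomology k (redSub k)

/-- The part of reduced Khovanov homology of bidegree `(i, j)`. The quantum degree is that of the
subcomplex lowered by `1`, so that the reduced homology of the unknot has bidegree `(0, 0)`. -/
noncomputable def rkhPiece (i j : ℤ) : Submodule ℚ (RKh k) := homPiece k (redSub k) i (j + 1)

section Strings

variable {H : Type} [AddCommGroup H] [Module ℚ H]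

/-- The vectors `b 0, …, b (n - 1)` form an `e`-string of length `n`, where `b m` has bidegree
`(i + 2m, j - 4m)`, `e (b 0) = 0` and `e (b m) = 2 (n - m) b (m - 1)` for `1 ≤ m < n`. -/
structure IsString (P : ℤ → ℤ → Submodule ℚ H) (e : Module.End ℚ H) (i j : ℤ) {n : ℕ}
    (b : Fin n → H) : Prop where
  mem : ∀ m, b m ∈ P (i + 2 * m.val) (j - 4 * m.val)
  bottom : ∀ m, m.val = 0 → e (b m) = 0
  step : ∀ m m', m'.val = m.val + 1 → e (b m') = (2 * ((n : ℚ) - m'.val)) • b m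

attribute [local instance 100] LieRing.ofAssociativeRing

/-- An action of the Lie algebra `sl_2` on `H`. -/
abbrev Sl2Action (H : Type) [AddCommGroup H] [Module ℚ H] : Type :=
  LieAlgebra.SpecialLinear.sl (Fin 2) ℚ →ₗ⁅ℚ⁆ Module.End ℚ H

/-- The `sl_2`-action `ρ` extends the operator `e`: the raising operator acts as `e`, and the
lowering operator has bidegree `(2, -4)` with respect to the bigrading `P`, opposite to `e`. -/
structure ExtendsToSl2 (P : ℤ → ℤ → Submodule ℚ H) (e : Module.End ℚ H) (ρ : Sl2Action H) :
    Prop where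
  e_eq : ρ (LieAlgebra.SpecialLinear.single 0 1 (by decide) 1) = e
  f_deg : ∀ i j, (P i j).map (ρ (LieAlgebra.SpecialLinear.single 1 0 (by decide) 1))
    ≤ P (i + 2) (j - 4)

end Strings

end Khovanov

end TorusKh

/-! ### Stacking genus-0 pieces, and additivity of the degree. -/

namespace TorusKh

section FibreSum

variable {A B C M : Type} [AddCommMonoid M]

/-! Cobordisms are turned into operator algebra. By neck-cutting at every circle, a morphism of
`Cob` vanishes once it vanishes on all dotted cups (`eq_zero_of_cup_dots`), so an endomorphism of
the cube that commutes with the dots is determined by its values on the undotted cups, one for each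
vertex (`eq_of_one`). On cups a merging saddle is trivial and a splitting saddle yields $x_a+x_b-h$
(`cup_split`). Hence the parts $d_c$ of the differential and their reversals $\chi_c$ satisfy the
expected anticommutation relations, and $d\chi_c+\chi_cd=Y_c$ is a sum of two dots minus $h$
(`opD_chi_self`).

The walk passes the $2k+1$ crossings twice, and since this number is odd the second round has the
opposite signs. So $\bar\xi=0$, and $\bar u$ is twice the sum over pairs within the first round
(`loopU_eq`); it commutes with $d$ because the commutator telescopes (`commute_halfU`).

For the retraction, observe that if the crossings $m-1$ and $m$ both have the 1-resolution, a small
circle sits at level $m$. Cutting it and reversing $\chi_m$ gives a homotopy $\kappa_m$ that cancels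
vertices with a 1 at $m-1$ and a 0 at $m$ (`opd_kap`). A further homotopy cancels the zero vertex,
in part, against weight one (`opd_kapZero`). Each $1-[d,\kappa_m]$ is triangular for the height, the
sum of the positions of the 1-resolutions. The composite of all of them is homotopic to 1, and its
diagonal part lives on the monotone vertices (all 1-resolutions at the end) of weight $\ne1$, where
it factors through a single circle (`opE_twistDiags`).

The inclusion `mapF` of the small model is explicit: the cup in degree $t\ge2$ goes to the sum of
the cups at all vertices of weight $t$, and the cup in degree 0 to the difference of the two dots on
the cups of the zero vertex. The homotopies kill it because cuts kill cups (`homot_mapF`). So the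
composite of all twists is $p+q$ with $p^2=p$, $qp=0$ and $q$ nilpotent (`lowers_opQ`, `opQ_mapF`),
and a high power of it is $p(1+q+q^2+\cdots)$, which is a projection onto the image of `mapF`
(`exists_retraction`). The usual modification of the homotopy gives the side conditions.

To transfer $\bar u$, one evaluates it on the sum of the cups of a given weight. A count of signs
gives $\lfloor z/2\rfloor$ times the sum of the cups two steps lower, with $z$ the number of
0-resolutions there (`halfU_layer`); apart from the zero vertex, the bidegree of the projection and
$gf=1$ do the rest.

Over the rationals, a state sum over the ways to dot the ends of the gluing circles shows that the
TQFT coefficients multiply under gluing (`isStateSum`, `coeff_glue`), so the retraction descends to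
Khovanov complexes, compatibly with the base point dot. In the small model the only differential is
$1\mapsto2X$, and in the image of $x$ there is none; what survives splits into strings. Finally, for
degree reasons the lowering operator moves each string vector to a multiple of the next one, and the
relations of $\mathfrak{sl}_2$ fix all the multiples (`existsUnique_sl2`). -/

theorem fibreSum_injective (e : A → C) (he : Function.Injective e) (f : A → M) (a : A) :
    fibreSum e f (e a) = f a := by
  have h := fibreSum_comp_injective (fun a => a) e he f a
  rw [fibreSum_id] at h
  exact h

theorem fibreSum_of_notMem (p : A → C) (f : A → M) (c : C) (h : ∀ a, p a ≠ c) :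
    fibreSum p f c = 0 := by
  simp [fibreSum, h]

end FibreSum

namespace DSurf

variable {W X Y Z : Type}

/-- A genus-0 surface each of whose components has at most one bottom circle:
the components are the bottom circles and the elements of `D`. -/
abbrev upper {D : Type} [Finite D] [Finite Y] (ψ : Z → Y ⊕ D) (a : Y ⊕ D → ℕ) : DSurf Y Z where
  Comp := Y ⊕ D
  fin := inferInstance
  bot := Sum.inl
  top := ψ
  genus := fun _ => 0
  dots := a

/-- The result of stacking `upper ψ a` on `S`. -/
noncomputable abbrev glueUpperResult {D : Type} [Finite D] [Finite Y] (S : DSurf X Y)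
    (ψ : Z → Y ⊕ D) (a : Y ⊕ D → ℕ) : DSurf X Z where
  Comp := S.Comp ⊕ D
  fin := inferInstance
  bot := fun x => Sum.inl (S.bot x)
  top := fun z => Sum.map S.top id (ψ z)
  genus := Sum.elim S.genus fun _ => 0
  dots := Sum.elim (fun c => S.dots c + fibreSum S.top (fun y => a (Sum.inl y)) c)
    fun d => a (Sum.inr d)

/-- Each component of the upper surface meets the lower one in at most one circle, so the graph of
pieces gains no cycle. In the additive genus rule the $-1$ of each such disc or annulus cancels the
$+1$ of its gluing circle. -/
theorem glue_upper {D : Type} [Finite D] [Finite Y] (S : DSurf X Y)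
    (ψ : Z → Y ⊕ D) (a : Y ⊕ D → ℕ) :
    Nonempty (Iso (glue S (upper ψ a)) (glueUpperResult S ψ a)) := by
  let e : GlueComp S (upper ψ a) ≃ S.Comp ⊕ D :=
    { toFun := Quot.lift (Sum.elim Sum.inl (Sum.map S.top id)) (by rintro _ _ ⟨y, rfl, rfl⟩; rfl)
      invFun := Sum.elim (ofBot _ _) (fun d => ofTop S (upper ψ a) (Sum.inr d))
      left_inv := by
        rintro (⟨a | b | b⟩)
        · rfl
        · exact ofBot_top S (upper ψ a) b
        · rfl
      right_inv := by rintro (c | d) <;> rfl }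
  have hb : e ∘ ofBot S (upper ψ a) = Sum.inl := rfl
  have ht : e ∘ ofTop S (upper ψ a) = Sum.map S.top id := rfl
  have hm : e ∘ ofMid S (upper ψ a) = Sum.inl ∘ S.top := rfl
  refine ⟨Iso.mk' e (fun _ => rfl) (fun _ => rfl) (fun c => ?_) (fun c => ?_)⟩
  · rw [congrFun (glue_genus S (upper ψ a)) c]
    simp only [Pi.add_apply]
    rw [← fibreSum_comp_injective _ e e.injective, ← fibreSum_comp_injective _ e e.injective,
      ← fibreSum_comp_injective _ e e.injective, hb, ht, hm, fibreSum_sum (Sum.map S.top id)]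
    generalize e c = c'
    have h := congrFun (fibreSum_add (Sum.inl ∘ S.top : Y → S.Comp ⊕ D)
      (fun _ => ((0 : ℕ) : ℤ) - 1) (fun _ => 1)) c'
    have h0 : ((fun _ => ((0 : ℕ) : ℤ) - 1) + (fun _ => 1) : Y → ℤ) = 0 := by funext; simp
    rw [h0, fibreSum_zero] at h
    simp only [Pi.add_apply, Pi.zero_apply] at h
    have h1 : (Sum.map S.top id ∘ Sum.inl : Y → S.Comp ⊕ D) = Sum.inl ∘ S.top := rfl
    have h2 : (Sum.map S.top id ∘ Sum.inr : D → S.Comp ⊕ D) = Sum.inr := rfl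
    rw [h1, h2]
    simp only [Pi.add_apply, Function.comp_def] at h ⊢
    rcases c' with c | d
    · rw [fibreSum_injective _ Sum.inl_injective, fibreSum_of_notMem Sum.inr _ _ (by simp)]
      simp only [Sum.elim_inl]; linarith
    · rw [fibreSum_of_notMem Sum.inl _ _ (by simp), fibreSum_injective _ Sum.inr_injective]
      simp only [Sum.elim_inr]; linarith
  · rw [glue_dots]
    simp only [Pi.add_apply]
    rw [← fibreSum_comp_injective (ofBot S (upper ψ a)) e e.injective,
      ← fibreSum_comp_injective (ofTop S (upper ψ a)) e e.injective, hb, ht,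
      fibreSum_sum (Sum.map S.top id)]
    generalize e c = c'
    have h1 : (Sum.map S.top id ∘ Sum.inl : Y → S.Comp ⊕ D) = Sum.inl ∘ S.top := rfl
    have h2 : (Sum.map S.top id ∘ Sum.inr : D → S.Comp ⊕ D) = Sum.inr := rfl
    rw [h1, h2]
    simp only [Pi.add_apply]
    rcases c' with c | d
    · rw [fibreSum_injective _ Sum.inl_injective, fibreSum_of_notMem Sum.inr _ _ (by simp),
        fibreSum_comp_injective S.top _ Sum.inl_injective]
      simp [Function.comp_def]
    · rw [fibreSum_of_notMem Sum.inl _ _ (by simp), fibreSum_injective _ Sum.inr_injective,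
        fibreSum_of_notMem _ _ _ (by simp)]
      simp

/-- A genus-0 surface whose components are its top circles. -/
abbrev lower [Finite Y] (φ : X → Y) (a : Y → ℕ) : DSurf X Y where
  Comp := Y
  fin := inferInstance
  bot := φ
  top := fun y => y
  genus := fun _ => 0
  dots := a

/-- The result of stacking `T` on `lower φ a`. -/
noncomputable abbrev lowerGlueResult [Finite Y] (φ : X → Y) (a : Y → ℕ) (T : DSurf Y Z) :
    DSurf X Z where
  Comp := T.Comp
  fin := inferInstance
  bot := fun x => T.bot (φ x)
  top := T.top
  genus := T.genus
  dots := fun c => T.dots c + fibreSum T.bot a c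

/-- The mirror image of `glue_upper`: each lower component has one top circle, so it is absorbed by
the component of `T` above it, without new genus. -/
theorem lower_glue [Finite Y] (φ : X → Y) (a : Y → ℕ) (T : DSurf Y Z) :
    Nonempty (Iso (glue (lower φ a) T) (lowerGlueResult φ a T)) := by
  let e : GlueComp (lower φ a) T ≃ T.Comp :=
    { toFun := Quot.lift (Sum.elim T.bot (fun b => b)) (by rintro _ _ ⟨y, rfl, rfl⟩; rfl)
      invFun := ofTop _ _
      left_inv := by
        rintro (⟨b | b⟩)
        · exact (ofBot_top (lower φ a) T b).symm
        · rfl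
      right_inv := fun _ => rfl }
  have hb : e ∘ ofBot (lower φ a) T = T.bot := rfl
  have ht : e ∘ ofTop (lower φ a) T = fun c => c := rfl
  have hm : e ∘ ofMid (lower φ a) T = T.bot := rfl
  refine ⟨Iso.mk' e (fun _ => rfl) (fun _ => rfl) (fun c => ?_) (fun c => ?_)⟩
  · rw [congrFun (glue_genus (lower φ a) T) c]
    simp only [Pi.add_apply]
    rw [← fibreSum_comp_injective _ e e.injective, ← fibreSum_comp_injective _ e e.injective,
      ← fibreSum_comp_injective _ e e.injective, hb, ht, hm, fibreSum_id]
    have h := congrFun (fibreSum_add T.bot (fun _ => ((0 : ℕ) : ℤ) - 1) (fun _ => 1)) (e c)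
    have h0 : ((fun _ => ((0 : ℕ) : ℤ) - 1) + (fun _ => 1) : Y → ℤ) = 0 := by funext; simp
    rw [h0, fibreSum_zero] at h
    simp only [Pi.add_apply, Pi.zero_apply] at h
    linarith
  · rw [glue_dots]
    simp only [Pi.add_apply]
    rw [← fibreSum_comp_injective (ofBot (lower φ a) T) e e.injective,
      ← fibreSum_comp_injective (ofTop (lower φ a) T) e e.injective, hb, ht, fibreSum_id]
    exact add_comm _ _

/-- Relabelling by equal data. -/
theorem iso_of_equiv {S T : DSurf X Y} (e : S.Comp ≃ T.Comp) (bot : ∀ x, e (S.bot x) = T.bot x)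
    (top : ∀ y, e (S.top y) = T.top y) (genus : ∀ c, T.genus (e c) = S.genus c)
    (dots : ∀ c, T.dots (e c) = S.dots c) : Nonempty (Iso S T) :=
  ⟨⟨e, bot, top, genus, dots⟩⟩

theorem iso_trans {S T U : DSurf X Y} (h : Nonempty (Iso S T)) (h' : Nonempty (Iso T U)) :
    Nonempty (Iso S U) := (setoid X Y).trans h h'

theorem iso_symm {S T : DSurf X Y} (h : Nonempty (Iso S T)) : Nonempty (Iso T S) :=
  (setoid X Y).symm h

/-! ### Degrees -/

theorem finsum_fibreSum {A C : Type} [Finite A] [Finite C] (p : A → C) (f : A → ℤ) :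
    ∑ᶠ c, fibreSum p f c = ∑ᶠ a, f a := by
  classical
  have := Fintype.ofFinite A
  have := Fintype.ofFinite C
  simp only [fibreSum_eq, finsum_eq_sum_of_fintype]
  rw [Finset.sum_comm]
  simp

/-- Every boundary circle bounds exactly one component, so the boundary terms of the Euler
characteristic add up to the total numbers of circles. The remaining terms are additive in genus
minus one and in dots, which is the form that `glue_genus` uses. -/
theorem deg_eq [Finite X] [Finite Y] (S : DSurf X Y) :
    S.deg = 2 * ∑ᶠ c, ((S.genus c : ℤ) - 1) + Nat.card X + Nat.card Y
      + 2 * ∑ᶠ c, (S.dots c : ℤ) := by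
  classical
  have := Fintype.ofFinite X
  have := Fintype.ofFinite Y
  have := Fintype.ofFinite S.Comp
  unfold deg eulerChar
  have hx := finsum_fibreSum S.bot (fun _ => (1 : ℤ))
  have hy := finsum_fibreSum S.top (fun _ => (1 : ℤ))
  simp only [fibreSum_eq, finsum_eq_sum_of_fintype, Finset.sum_const, Finset.card_univ,
    nsmul_eq_mul, mul_one, Finset.sum_boole] at hx hy ⊢
  simp only [Nat.card_eq_fintype_card, Fintype.card_subtype, Finset.sum_sub_distrib] at *
  simp only [← Finset.mul_sum] at *
  rw [hx, hy]
  simp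
  ring

/-- A gluing circle is counted once as a top circle and once as a bottom circle; twice the $+1$ per
gluing circle in `glue_genus` accounts for both. -/
theorem deg_glue [Finite X] [Finite Y] [Finite Z] (S : DSurf X Y) (T : DSurf Y Z) :
    (glue S T).deg = S.deg + T.deg := by
  rw [deg_eq, deg_eq, deg_eq, glue_genus, glue_dots]
  have h1 : ∑ᶠ c, (((fibreSum (ofBot S T) S.dots + fibreSum (ofTop S T) T.dots) c : ℕ) : ℤ)
      = ∑ᶠ c, (S.dots c : ℤ) + ∑ᶠ c, (T.dots c : ℤ) := by
    simp only [Pi.add_apply, Nat.cast_add, natCast_fibreSum]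
    rw [finsum_add_distrib (Set.toFinite _) (Set.toFinite _), finsum_fibreSum, finsum_fibreSum]
  have h2 : ∑ᶠ c, (fibreSum (ofBot S T) (fun a => (S.genus a : ℤ) - 1) +
      fibreSum (ofTop S T) (fun b => (T.genus b : ℤ) - 1) +
      fibreSum (ofMid S T) (fun _ => (1 : ℤ))) c
      = ∑ᶠ c, ((S.genus c : ℤ) - 1) + ∑ᶠ c, ((T.genus c : ℤ) - 1) + Nat.card Y := by
    simp only [Pi.add_apply]
    rw [finsum_add_distrib (Set.toFinite _) (Set.toFinite _),
      finsum_add_distrib (Set.toFinite _) (Set.toFinite _), finsum_fibreSum, finsum_fibreSum,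
      finsum_fibreSum]
    have := Fintype.ofFinite Y
    simp [finsum_eq_sum_of_fintype]
  rw [h1, h2]
  ring

end DSurf

end TorusKh

/-! ### Surfaces as morphisms of `Cob`. -/

namespace TorusKh

namespace Cob

section Surf

variable {R : Type*} [CommRing R]

theorem single_comp {X Y Z : DCob} (S : DSurf X.Circle Y.Circle) (T : DSurf Y.Circle Z.Circle) :
    single R S ≫ single R T = single R (DSurf.glue S T) :=
  ((Free.embedding R DCob).map_comp _ _).symm

theorem surf_comp {A B C : Cob R} (r s : R) (S : DSurf (Circ R A) (Circ R B))
    (T : DSurf (Circ R B) (Circ R C)) :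
    surf r S ≫ surf s T = surf (r * s) (DSurf.glue S T) := by
  refine ((Quotient.functor (LocalRel R)).map_comp (r • single R S) (s • single R T)).symm.trans
    (congrArg (Quotient.functor (LocalRel R)).map ?_)
  rw [Linear.smul_comp, Linear.comp_smul, smul_smul]
  exact congrArg (fun z => (r * s) • z) (single_comp S T)

theorem surf_congr {A B : Cob R} (r : R) {S T : DSurf (Circ R A) (Circ R B)}
    (h : Nonempty (DSurf.Iso S T)) : surf r S = surf r T := by
  have : single R S = single R T :=
    congrArg (Free.embedding R DCob).map (Quotient.sound h)
  unfold surf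
  rw [this]

instance (A : Cob R) : Finite (Circ R A) := DCob.fin _

theorem id_eq_surf (A : Cob R) : 𝟙 A = surf (1 : R) (DSurf.cylinder (Circ R A)) := by
  unfold surf
  rw [one_smul]
  rfl

end Surf

section Mor

variable (R : Type*) [CommRing R] {W X Y Z : Type} [Finite W] [Finite X] [Finite Y] [Finite Z]

/-- A surface as a morphism of `Cob R`. -/
noncomputable def mor (S : DSurf X Y) : circles R X ⟶ circles R Y := surf (1 : R) S

variable {R}

theorem mor_comp (S : DSurf X Y) (T : DSurf Y Z) : mor R S ≫ mor R T = mor R (DSurf.glue S T) := by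
  refine (surf_comp (1 : R) 1 _ _).trans ?_
  rw [one_mul]
  rfl

theorem mor_congr {S T : DSurf X Y} (h : Nonempty (DSurf.Iso S T)) : mor R S = mor R T :=
  surf_congr 1 h

theorem mor_cylinder : mor R (DSurf.cylinder X) = 𝟙 (circles R X) := (id_eq_surf (R := R) _).symm

theorem mor_addSphere_zero (S : DSurf X Y) : mor R (S.addSphere 0) = 0 := by
  unfold mor surf
  rw [one_smul]
  exact CategoryTheory.Quotient.sound _ (LocalRel.sphere (R := R) (X := ⟨X, inferInstance⟩) (Y := ⟨Y, inferInstance⟩) S)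

theorem mor_addSphere_one (S : DSurf X Y) : mor R (S.addSphere 1) = mor R S := by
  unfold mor surf
  rw [one_smul, one_smul]
  exact CategoryTheory.Quotient.sound _ (LocalRel.dottedSphere (R := R) (X := ⟨X, inferInstance⟩) (Y := ⟨Y, inferInstance⟩) S)

theorem neck_cutting (x : X) : 𝟙 (circles R X) =
    mor R (DSurf.cut x 1 0) + mor R (DSurf.cut x 0 1) - mor R ((DSurf.cut x 0 0).addSphere 2) := by
  have h := CategoryTheory.Quotient.sound _ (LocalRel.neck (R := R) ⟨X, inferInstance⟩ x)
  unfold mor surf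
  simp only [one_smul]
  have hadd : (Quotient.functor (LocalRel R)).Additive := Quotient.functor_additive _ _
  rw [Functor.map_sub, Functor.map_add] at h
  exact h

/-- The dot on the circle `x`. -/
noncomputable def dot (x : X) : circles R X ⟶ circles R X := mor R ((DSurf.cylinder X).addDot x)

variable (R X) in
/-- Multiplication by `h`, a sphere with two dots. -/
noncomputable def sph : circles R X ⟶ circles R X := mor R ((DSurf.cylinder X).addSphere 2)

/-- The disjoint union of the cylinder and the cut cylinder over the circle `x`. -/
noncomputable def cutAt (x : X) : circles R X ⟶ circles R X := mor R (DSurf.cut x 0 0)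

open DSurf in
theorem cylinder_addDot_glue (x : X) (S : DSurf X Y) :
    Nonempty (Iso (glue ((cylinder X).addDot x) S) (S.addDot (S.bot x))) := by
  classical
  refine iso_trans (T := lowerGlueResult (fun x => x) _ S) (lower_glue (fun x => x) _ S) ?_
  refine iso_of_equiv (Equiv.refl _) (fun _ => rfl) (fun _ => rfl) (fun _ => rfl) fun c => ?_
  simp only [Equiv.refl_apply]
  congr 1
  simp only [fibreSum]
  rw [finsum_eq_single _ x (by intro a ha; simp [ha])]
  by_cases hc : S.bot x = c
  · subst hc; simp
  · simp [hc, Ne.symm hc]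

open DSurf in
theorem glue_cylinder_addDot (S : DSurf X Y) (y : Y) :
    Nonempty (Iso (glue S ((cylinder Y).addDot y)) (S.addDot (S.top y))) := by
  classical
  have h : Nonempty (Iso ((cylinder Y).addDot y) (upper (D := Empty) (Sum.inl : Y → Y ⊕ Empty)
      (Sum.elim (fun b => 0 + if b = y then 1 else 0) Empty.elim))) :=
    iso_of_equiv (Equiv.sumEmpty Y Empty).symm (fun _ => rfl) (fun _ => rfl) (fun _ => rfl)
      (fun _ => by simp)
  obtain ⟨h⟩ := h
  refine iso_trans ((setoid _ _).refl S |>.elim fun i => glue_congr i h) (iso_trans (glue_upper _ _ _) ?_)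
  refine iso_of_equiv (Equiv.sumEmpty S.Comp Empty) (fun _ => rfl) (fun _ => rfl) ?_ ?_
  · rintro (c | c)
    · rfl
    · exact c.elim
  rintro (c | c)
  · simp only [Equiv.sumEmpty_apply_inl, Sum.elim_inl]
    congr 1
    simp only [fibreSum]
    rw [finsum_eq_single _ y (by intro a ha; simp [ha])]
    by_cases hc : S.top y = c
    · subst hc; simp
    · simp [hc, Ne.symm hc]
  · exact c.elim

end Mor
end Cob
end TorusKh

/-! ### Spheres and cut cylinders under stacking. -/

namespace TorusKh

namespace DSurf

variable {X Y Z : Type}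

/-- The sphere has no top circle, so `lower_glue` does not apply and the components are matched by
hand. On the other side the sphere is an extra component of an `upper` surface. -/
theorem addSphere_cylinder_glue [Finite X] (m : ℕ) (S : DSurf X Y) :
    Nonempty (Iso (glue ((cylinder X).addSphere m) S) (S.addSphere m)) := by
  let C := (cylinder X).addSphere m
  let e : GlueComp C S ≃ Option S.Comp :=
    { toFun := Quot.lift (Sum.elim (Option.map S.bot) some) (by rintro _ _ ⟨y, rfl, rfl⟩; rfl)
      invFun := fun c => c.elim (ofBot C S none) (ofTop C S)
      left_inv := by
        intro z
        induction z using Quot.ind with | _ z =>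
        rcases z with (_ | b) | b
        · rfl
        · exact (ofBot_top C S b).symm
        · rfl
      right_inv := by rintro (_ | c) <;> rfl }
  have hb : e ∘ ofBot C S = Option.map S.bot := rfl
  have ht : e ∘ ofTop C S = some := rfl
  have hm : e ∘ ofMid C S = some ∘ S.bot := rfl
  have key : ∀ (f : Option X → ℤ), fibreSum (Option.map S.bot) f
      = fibreSum (some ∘ S.bot) (fun x => f (some x)) + fibreSum (fun _ : Unit => none) (fun _ => f none) := by
    intro f
    rw [← fibreSum_equiv (Equiv.optionEquivSumPUnit X).symm (Option.map S.bot)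
      (fun z => f ((Equiv.optionEquivSumPUnit X).symm z)) f (fun _ => rfl), fibreSum_sum]
    rfl
  have keyN : ∀ (f : Option X → ℕ), fibreSum (Option.map S.bot) f
      = fibreSum (some ∘ S.bot) (fun x => f (some x)) + fibreSum (fun _ : Unit => none) (fun _ => f none) := by
    intro f
    rw [← fibreSum_equiv (Equiv.optionEquivSumPUnit X).symm (Option.map S.bot)
      (fun z => f ((Equiv.optionEquivSumPUnit X).symm z)) f (fun _ => rfl), fibreSum_sum]
    rfl
  refine ⟨Iso.mk' e (fun _ => rfl) (fun _ => rfl) (fun c => ?_) (fun c => ?_)⟩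
  · rw [congrFun (glue_genus C S) c]
    simp only [Pi.add_apply]
    rw [← fibreSum_comp_injective _ e e.injective, ← fibreSum_comp_injective _ e e.injective,
      ← fibreSum_comp_injective _ e e.injective, hb, ht, hm, key]
    generalize e c = c'
    have h := congrFun (fibreSum_add (some ∘ S.bot)
      (fun _ => ((0 : ℕ) : ℤ) - 1) (fun _ => 1)) c'
    have h0 : ((fun _ => ((0 : ℕ) : ℤ) - 1) + (fun _ => 1) : X → ℤ) = 0 := by funext; simp
    rw [h0, fibreSum_zero] at h
    simp only [Pi.add_apply, Pi.zero_apply] at h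
    rcases c' with _ | d
    · rw [fibreSum_of_notMem some _ _ (by simp)]
      have h1 := fibreSum_injective (fun _ : Unit => (none : Option S.Comp))
        (fun _ _ _ => rfl) (fun _ => ((0 : ℕ) : ℤ) - 1) ()
      simp only [Pi.add_apply, C, Option.elim] at h1 ⊢
      linarith
    · rw [fibreSum_injective _ (Option.some_injective _)]
      have h1 := fibreSum_of_notMem (fun _ : Unit => (none : Option S.Comp))
        (fun _ => ((0 : ℕ) : ℤ) - 1) (some d) (by simp)
      simp only [Pi.add_apply, C, Option.elim] at h1 ⊢
      linarith
  · rw [glue_dots]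
    simp only [Pi.add_apply]
    rw [← fibreSum_comp_injective (ofBot C S) e e.injective,
      ← fibreSum_comp_injective (ofTop C S) e e.injective, hb, ht, keyN]
    generalize e c = c'
    have h := congrFun (fibreSum_zero (some ∘ S.bot : X → Option S.Comp) (M := ℕ)) c'
    rcases c' with _ | d
    · rw [fibreSum_of_notMem some _ _ (by simp)]
      have h1 := fibreSum_injective (fun _ : Unit => (none : Option S.Comp))
        (fun _ _ _ => rfl) (fun _ => m) ()
      simp only [Pi.add_apply, Option.elim] at h1 h ⊢
      rw [h1]
      erw [h]
      simp
    · rw [fibreSum_injective _ (Option.some_injective _)]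
      have h1 := fibreSum_of_notMem (fun _ : Unit => (none : Option S.Comp))
        (fun _ => m) (some d) (by simp)
      simp only [Pi.add_apply, Option.elim] at h1 h ⊢
      rw [h1]
      erw [h]
      simp

theorem glue_cylinder_addSphere [Finite Y] (m : ℕ) (S : DSurf X Y) :
    Nonempty (Iso (glue S ((cylinder Y).addSphere m)) (S.addSphere m)) := by
  have h : Nonempty (Iso ((cylinder Y).addSphere m) (upper (D := Unit) (Sum.inl : Y → Y ⊕ Unit)
      (Sum.elim (fun _ => 0) fun _ => m))) :=
    iso_of_equiv (Equiv.optionEquivSumPUnit Y) (fun _ => rfl) (fun _ => rfl)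
      (by rintro (_ | _) <;> rfl) (by rintro (_ | _) <;> rfl)
  obtain ⟨h⟩ := h
  obtain ⟨i⟩ := (setoid _ _).refl S
  refine iso_trans (glue_congr i h) (iso_trans (glue_upper _ _ _) ?_)
  refine iso_of_equiv (Equiv.optionEquivSumPUnit _).symm (fun _ => rfl) (fun _ => rfl) ?_ ?_
  · rintro (c | c) <;> rfl
  · rintro (c | c)
    · change S.dots c = S.dots c + fibreSum S.top 0 c
      simp [fibreSum_zero]
    · rfl

/-- The bottom disc keeps its bottom circle, and the top disc is the one extra component; thus
`glue_upper` describes stacking a cut on top of any surface. -/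
theorem cut_iso_upper [Finite X] (x : X) (m m' : ℕ) [DecidableEq X] :
    Nonempty (Iso (cut x m m') (upper (D := Unit)
      (fun y : X => if y = x then Sum.inr () else Sum.inl y)
      (Sum.elim (fun y => if y = x then m else 0) fun _ => m'))) := by
  refine iso_of_equiv (Equiv.optionEquivSumPUnit X) (fun _ => rfl) (fun y => ?_)
    (by rintro (_ | _) <;> rfl) ?_
  · by_cases h : y = x <;> simp [h]
  · rintro (_ | y)
    · rfl
    · by_cases h : y = x <;> simp [h]

theorem glue_cut [Finite Y] [DecidableEq Y] (S : DSurf X Y) (y : Y) (m m' : ℕ) :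
    Nonempty (Iso (glue S (cut y m m')) (glueUpperResult (D := Unit) S
      (fun z : Y => if z = y then Sum.inr () else Sum.inl z)
      (Sum.elim (fun z => if z = y then m else 0) fun _ => m'))) := by
  obtain ⟨h⟩ := cut_iso_upper y m m'
  obtain ⟨i⟩ := (setoid _ _).refl S
  exact iso_trans (glue_congr i h) (glue_upper _ _ _)

end DSurf

/-! ### Calculus of dots, cuts and cups. -/

namespace Cob

open DSurf

variable {R : Type*} [CommRing R] {W X Y Z : Type} [Finite W] [Finite X] [Finite Y] [Finite Z]

theorem dot_comp_mor (x : X) (S : DSurf X Y) :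
    dot x ≫ mor R S = mor R (S.addDot (S.bot x)) :=
  (mor_comp _ _).trans (mor_congr (cylinder_addDot_glue x S))

theorem mor_comp_dot (S : DSurf X Y) (y : Y) :
    mor R S ≫ dot y = mor R (S.addDot (S.top y)) :=
  (mor_comp _ _).trans (mor_congr (glue_cylinder_addDot S y))

theorem sph_comp_mor (S : DSurf X Y) : sph R X ≫ mor R S = mor R (S.addSphere 2) :=
  (mor_comp _ _).trans (mor_congr (addSphere_cylinder_glue 2 S))

theorem mor_comp_sph (S : DSurf X Y) : mor R S ≫ sph R Y = mor R (S.addSphere 2) :=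
  (mor_comp _ _).trans (mor_congr (glue_cylinder_addSphere 2 S))

theorem sph_comm (S : DSurf X Y) : sph R X ≫ mor R S = mor R S ≫ sph R Y :=
  (sph_comp_mor S).trans (mor_comp_sph S).symm

/-- Both composites put the dot on the same component, and its place on the component is immaterial.
All commutation of dots with cobordisms comes from this. -/
theorem dot_slide (S : DSurf X Y) (x : X) (y : Y) (h : S.bot x = S.top y) :
    dot x ≫ mor R S = mor R S ≫ dot y := by
  rw [dot_comp_mor, mor_comp_dot, h]

theorem dot_comm (x y : X) : (dot x ≫ dot y : circles R X ⟶ _) = dot y ≫ dot x :=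
  dot_slide _ _ _ rfl

theorem dot_cutAt_comm {x y : X} (h : y ≠ x) :
    (dot y ≫ cutAt x : circles R X ⟶ _) = cutAt x ≫ dot y :=
  dot_slide _ _ _ (by simp [h])

/-- Neck-cutting as an identity between operators: the dotted discs become dots before and after an
undotted cut, and the two-dotted sphere becomes `sph`. -/
theorem neck (x : X) : 𝟙 (circles R X) =
    dot x ≫ cutAt x + cutAt x ≫ dot x - cutAt x ≫ sph R X := by
  rw [neck_cutting x]
  unfold cutAt
  rw [dot_comp_mor, mor_comp_dot, mor_comp_sph]
  refine congrArg₂ (· - ·) (congrArg₂ (· + ·) (mor_congr ?_) (mor_congr ?_)) rfl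
  · refine iso_of_equiv (Equiv.refl _) (fun _ => rfl) (fun _ => rfl) (fun _ => rfl) ?_
    rintro (_ | y)
    · simp
    · by_cases h : y = x <;> simp [h]
  · refine iso_of_equiv (Equiv.refl _) (fun _ => rfl) (fun _ => rfl) (fun _ => rfl) ?_
    rintro (_ | y)
    · simp
    · by_cases h : y = x <;> simp [h]

variable (R X) in
/-- The cups, one undotted disc for each circle. -/
noncomputable def cup : circles R Empty ⟶ circles R X := mor R (lower Empty.elim fun _ => 0)

theorem cup_comp_mor (S : DSurf X Y) : cup R X ≫ mor R S =
    mor R (⟨S.Comp, S.fin, Empty.elim, S.top, S.genus, S.dots⟩ : DSurf Empty Y) := by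
  refine (mor_comp _ _).trans (mor_congr (iso_trans (lower_glue _ _ S) ?_))
  refine iso_of_equiv (Equiv.refl _) (fun x => x.elim) (fun _ => rfl) (fun _ => rfl) fun c => ?_
  change S.dots c = S.dots c + fibreSum S.bot 0 c
  simp [fibreSum_zero]

theorem cup_comp_lower (φ : X → Y) : cup R X ≫ mor R (lower φ fun _ => 0) = cup R Y :=
  (cup_comp_mor _).trans (mor_congr
    (iso_of_equiv (Equiv.refl _) (fun x => x.elim) (fun _ => rfl) (fun _ => rfl) fun _ => rfl))

/-- The cup at `x` and the bottom disc of the cut close up to an undotted sphere. The new cup is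
called `none` and the sphere `some x`, the reverse of the names in `addSphere`, whence the swap. -/
theorem cup_cutAt (x : X) : cup R X ≫ cutAt x = 0 := by
  refine (cup_comp_mor _).trans (Eq.trans ?_
    (mor_addSphere_zero (lower (Empty.elim : Empty → X) fun _ => 0)))
  classical
  refine mor_congr (iso_of_equiv (Equiv.swap none (some x)) (fun x => x.elim) (fun y => ?_)
    (fun c => ?_) fun c => ?_)
  · by_cases h : y = x
    · simp [h]
    · simp [h, Equiv.swap_apply_of_ne_of_ne]
  · generalize Equiv.swap none (some x) c = z
    rcases z with _ | _ <;> rfl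
  · generalize Equiv.swap none (some x) c = z
    rcases z with _ | _ <;> rcases c with _ | _ <;> simp

/-- Here the closed sphere carries the dot and equals 1; the top disc replaces the cup. So a cut
detects a dot on a cup. -/
theorem cup_dot_cutAt (x : X) : cup R X ≫ dot x ≫ cutAt x = cup R X := by
  rw [cutAt, dot_comp_mor]
  refine (cup_comp_mor _).trans (Eq.trans ?_
    (mor_addSphere_one (lower (Empty.elim : Empty → X) fun _ => 0)))
  classical
  refine mor_congr (iso_of_equiv (Equiv.swap none (some x)) (fun x => x.elim) (fun y => ?_)
    (fun c => ?_) fun c => ?_)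
  · by_cases h : y = x
    · simp [h]
    · simp [h, Equiv.swap_apply_of_ne_of_ne]
  · generalize Equiv.swap none (some x) c = z
    rcases z with _ | _ <;> rfl
  · rcases c with _ | y
    · simp
    · by_cases h : y = x
      · simp [h]
      · simp [h, Equiv.swap_apply_of_ne_of_ne]

/-! ### Separation -/

/-- A composite of dots. -/
noncomputable def dots (R : Type*) [CommRing R] (l : List X) : circles R X ⟶ circles R X :=
  l.foldr (fun x φ => dot x ≫ φ) (𝟙 _)

theorem dots_cons (x : X) (l : List X) : dots R (x :: l) = dot x ≫ dots R l := rfl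

open Classical in
/-- The cylinder on `X` where the annuli over the circles in `A` are replaced by discs. -/
noncomputable abbrev multicut (A : Finset X) : DSurf X X :=
  upper (D := A) (fun y => if h : y ∈ A then Sum.inr ⟨y, h⟩ else Sum.inl y) fun _ => 0

theorem multicut_empty : mor R (multicut (∅ : Finset X)) = 𝟙 _ := by
  rw [← mor_cylinder]
  have : IsEmpty (∅ : Finset X) := ⟨fun x => Finset.notMem_empty _ x.2⟩
  refine mor_congr (iso_of_equiv (Equiv.sumEmpty _ _) (fun _ => rfl) (fun _ => by simp) ?_ ?_)
  all_goals rintro (_ | ⟨_, h⟩)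
  all_goals rfl

open Classical in
theorem multicut_insert {A : Finset X} {x : X} (hx : x ∉ A) :
    mor R (multicut A) ≫ cutAt x = mor R (multicut (insert x A)) := by
  refine (mor_comp _ _).trans (mor_congr (iso_trans (glue_cut _ _ _ _) ?_))
  let e : (X ⊕ A) ⊕ Unit ≃ X ⊕ (insert x A : Finset X) :=
    { toFun := Sum.elim (Sum.map id fun a => ⟨a.1, Finset.mem_insert_of_mem a.2⟩)
        fun _ => Sum.inr ⟨x, Finset.mem_insert_self _ _⟩
      invFun := Sum.elim (fun y => Sum.inl (Sum.inl y)) fun a =>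
        if h : a.1 ∈ A then Sum.inl (Sum.inr ⟨a.1, h⟩) else Sum.inr ()
      left_inv := by
        rintro ((y | ⟨a, ha⟩) | _)
        · rfl
        · simp [ha]
        · simp [hx]
      right_inv := by
        rintro (y | ⟨a, ha⟩)
        · rfl
        · by_cases h : a ∈ A
          · simp [h]
          · have : a = x := by simpa [h] using ha
            subst this
            simp [h] }
  refine iso_of_equiv e (fun _ => rfl) (fun y => ?_) ?_ ?_
  · by_cases h : y = x
    · subst h; simp [e]
    · by_cases h' : y ∈ A
      · simp [e, h, h']
      · simp [e, h, h']
  · rintro ((y | a) | _) <;> rfl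
  · rintro ((y | a) | _)
    · simp [fibreSum]
    · simp [fibreSum]
    · simp

/-- Once all necks are cut, nothing connects bottom to top: the bottom discs cap everything off and
the top discs are the cups. -/
theorem multicut_univ [Fintype X] : mor R (multicut (Finset.univ : Finset X)) =
    mor R (⟨X, inferInstance, id, Empty.elim, fun _ => 0, fun _ => 0⟩ : DSurf X Empty) ≫
      cup R X := by
  have h : Nonempty (Iso (lower (Empty.elim : Empty → X) fun _ => 0)
      (upper (Y := Empty) (D := X) Sum.inr fun _ => 0)) :=
    iso_of_equiv (Equiv.emptySum Empty X).symm (fun x => x.elim) (fun _ => rfl) (fun _ => rfl)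
      fun _ => rfl
  rw [cup, mor_congr h]
  refine Eq.trans ?_ (mor_comp _ _).symm
  refine (mor_congr (iso_trans (glue_upper _ _ _) ?_)).symm
  refine iso_of_equiv (Equiv.sumCongr (Equiv.refl X)
    ⟨fun x => ⟨x, Finset.mem_univ x⟩, Subtype.val, fun _ => rfl, fun _ => rfl⟩) (fun _ => rfl)
    (fun y => by simp) ?_ ?_
  · rintro (_ | _) <;> rfl
  · rintro (_ | _)
    · simp [fibreSum]
    · simp

/-- Neck-cutting at every circle writes the identity as a combination of morphisms that end in a
dotted cup. The induction is on the number of circles not yet cut. Cutting one more either adds its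
dot to the list or not, so each circle is dotted at most once and lists without repetition suffice.
-/
theorem eq_zero_of_cup_dots {B : Cob R} (δ : circles R X ⟶ B)
    (h : ∀ l : List X, l.Nodup → cup R X ≫ dots R l ≫ δ = 0) : δ = 0 := by
  classical
  have := Fintype.ofFinite X
  have key : ∀ (n : ℕ) (A : Finset X), Aᶜ.card = n → ∀ l : List X, l.Nodup → (∀ x ∈ l, x ∈ A) →
      mor R (multicut A) ≫ dots R l ≫ δ = 0 := by
    intro n
    induction n with
    | zero =>
      intro A hA l hl _
      have : A = Finset.univ := by simpa [Finset.card_eq_zero] using hA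
      rw [this, multicut_univ, Category.assoc, h l hl, Limits.comp_zero]
    | succ n ih =>
      intro A hA l hl hlA
      obtain ⟨x, hx⟩ : Aᶜ.Nonempty := by rw [← Finset.card_pos]; omega
      have hxA : x ∉ A := by simpa using hx
      have hc : (insert x A)ᶜ.card = n := by
        rw [Finset.compl_insert, Finset.card_erase_of_mem hx, hA]; rfl
      have hxl : x ∉ l := fun h => hxA (hlA x h)
      have h1 := ih _ hc l hl fun y hy => Finset.mem_insert_of_mem (hlA y hy)
      have h2 := ih _ hc (x :: l) (List.nodup_cons.2 ⟨hxl, hl⟩) (by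
        intro y hy
        rcases List.mem_cons.1 hy with rfl | hy
        · exact Finset.mem_insert_self _ _
        · exact Finset.mem_insert_of_mem (hlA y hy))
      -- The circle `x` is not cut yet, so its dot slides down the annulus and out of the way.
      have h3 : mor R (multicut A) ≫ dot x = dot x ≫ mor R (multicut A) :=
        (dot_slide _ _ _ (by simp [hxA])).symm
      rw [← multicut_insert hxA] at h1 h2
      rw [dots_cons] at h2
      have h4 : mor R (multicut A) ≫ dots R l ≫ δ = mor R (multicut A) ≫ 𝟙 _ ≫ dots R l ≫ δ := by
        simp
      have h5 : sph R X ≫ cutAt x = cutAt x ≫ sph R X := sph_comm _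
      have h6 : sph R X ≫ mor R (multicut A) = mor R (multicut A) ≫ sph R X := sph_comm _
      rw [h4, neck x]
      simp only [Preadditive.add_comp, Preadditive.sub_comp, Preadditive.comp_add,
        Preadditive.comp_sub, ← h5]
      simp only [← Category.assoc] at h1 h2 ⊢
      rw [h3, ← h6]
      simp only [Category.assoc] at h1 h2 ⊢
      rw [h1, h2]
      simp
  have := key _ ∅ rfl [] List.nodup_nil (by simp)
  rw [multicut_empty] at this
  simpa [dots] using this

/-! ### Merging and splitting two circles -/

/-- After capping the bottom, the split circle bounds an annulus with top circles `a` and `b`.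
Cutting this annulus near `a` gives two discs, one of them dotted, or both undotted together with
$-h$. -/
theorem cup_split {π : Y → Z} (hπ : Function.Surjective π) {a b : Y} (hab : a ≠ b)
    (h : π a = π b) (hinj : ∀ y y', π y = π y' → y = y' ∨ (y = a ∧ y' = b) ∨ (y = b ∧ y' = a)) :
    cup R Z ≫ mor R (⟨Z, inferInstance, id, π, fun _ => 0, fun _ => 0⟩ : DSurf Z Y) =
      cup R Y ≫ (dot a + dot b - sph R Y) := by
  classical
  set S : DSurf Empty Y := ⟨Z, inferInstance, Empty.elim, π, fun _ => 0, fun _ => 0⟩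
  have hS : cup R Z ≫ mor R (⟨Z, inferInstance, id, π, fun _ => 0, fun _ => 0⟩ : DSurf Z Y)
      = mor R S := cup_comp_mor _
  rw [hS]
  -- The cut separates `a` from the annulus; the rest of the annulus becomes the disc at `b`. The
  -- bijection names the discs by their boundary circles.
  have hcut : mor R S ≫ cutAt a = cup R Y := by
    refine (mor_comp _ _).trans (mor_congr (iso_trans (glue_cut _ _ _ _) (iso_symm ?_)))
    have hbij : Function.Bijective (fun y => if y = a then Sum.inr () else Sum.inl (π y) :
        Y → Z ⊕ Unit) := by
      constructor
      · intro y y' hy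
        by_cases h1 : y = a <;> by_cases h2 : y' = a <;> simp [h1, h2] at hy ⊢
        have := hinj _ _ hy
        tauto
      · rintro (z | _)
        · obtain ⟨y, rfl⟩ := hπ z
          by_cases hy : y = a
          · exact ⟨b, by simp [hab.symm, hy, h]⟩
          · exact ⟨y, by simp [hy]⟩
        · exact ⟨a, by simp⟩
    refine iso_of_equiv (Equiv.ofBijective _ hbij) (fun x => x.elim) (fun y => ?_) (fun y => ?_)
      fun y => ?_
    · by_cases hy : y = a <;> simp [hy, S]
    · by_cases hy : y = a <;> simp [hy, S]
    · by_cases hy : y = a <;> simp [hy, S, fibreSum]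
  -- Before the cut, `a` and `b` bound the same annulus, so the dot at `a` may be moved to `b`,
  -- where it does not interfere with the cut at `a`.
  have hdot : mor R S ≫ dot a = mor R S ≫ dot b := by
    rw [mor_comp_dot, mor_comp_dot]
    simp only [S, h]
  calc mor R S = mor R S ≫ 𝟙 _ := (Category.comp_id _).symm
    _ = (mor R S ≫ dot a) ≫ cutAt a + (mor R S ≫ cutAt a) ≫ dot a
        - (mor R S ≫ cutAt a) ≫ sph R Y := by
      rw [neck a]
      simp only [Preadditive.comp_add, Preadditive.comp_sub, Category.assoc]
    _ = _ := by
      rw [hdot, Category.assoc, dot_cutAt_comm hab.symm, ← Category.assoc, hcut]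
      simp only [Preadditive.comp_add, Preadditive.comp_sub]
      abel

end Cob
end TorusKh

/-! ### The circles of the resolutions. -/

namespace TorusKh

variable {k : ℕ}

/-- The circle of the resolution `v` that contains the edge `e`. -/
abbrev circ (v : Vertex k) (e : Edge k) : ResCircle v := Quot.mk _ e

open Fin.CommRing in
theorem crossing_induction {P : Crossing k → Prop} (c₀ : Crossing k) (h₀ : P c₀)
    (h : ∀ c, P c → P (c + 1)) (c : Crossing k) : P c := by
  have key : ∀ r : ℕ, P (c₀ + (r : Crossing k)) := by
    intro r
    induction r with
    | zero => simpa using h₀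
    | succ r ih => have := h _ ih; rwa [add_assoc, ← Nat.cast_succ] at this
  have := key (c - c₀).val
  rwa [Fin.cast_val_eq_self, add_sub_cancel] at this

theorem circ_zero {v : Vertex k} {c : Crossing k} (h : v c = false) (s : Bool) :
    circ v (c, s) = circ v (c + 1, s) := Quot.sound (.zero c s h)

/-- Start just below the 1-resolved crossing `c`, where the two strands are joined. A 0-resolution
carries the joined pair up by one level, and a 1-resolution joins the pair above it anyway. So away
from the zero vertex left and right edges need not be distinguished. -/
theorem circ_false_true {v : Vertex k} {c : Crossing k} (hc : v c = true) (l : Crossing k) :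
    circ v (l, false) = circ v (l, true) := by
  refine crossing_induction (P := fun l => circ v (l, false) = circ v (l, true)) c
    (Quot.sound (.one_bot c hc)) (fun l hl => ?_) l
  cases h : v l
  · rw [← circ_zero h, ← circ_zero h, hl]
  · exact Quot.sound (.one_top l h)

theorem circ_eq_bool {v : Vertex k} {c : Crossing k} (hc : v c = true) (l : Crossing k)
    (s s' : Bool) : circ v (l, s) = circ v (l, s') := by
  cases s <;> cases s' <;> simp [circ_false_true hc]

theorem circ_zero_level (l l' : Crossing k) (s : Bool) :
    circ (fun _ => false : Vertex k) (l, s) = circ (fun _ => false) (l', s) := by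
  have : ∀ l : Crossing k,
      circ (fun _ => false : Vertex k) (0, s) = circ (fun _ => false) (l, s) := fun l =>
    crossing_induction (P := fun l => circ (fun _ => false : Vertex k) (0, s) = circ _ (l, s)) 0 rfl
      (fun l hl => hl.trans (circ_zero rfl s)) l
  rw [← this l, this l']

/-- Without 1-resolutions the side of the braid is an invariant of the circle. -/
theorem circ_zero_ne (l l' : Crossing k) :
    circ (fun _ => false : Vertex k) (l, false) ≠ circ (fun _ => false) (l', true) := by
  intro h
  have := congrArg (Quot.lift (fun e : Edge k => e.2) (by
    rintro _ _ (⟨c, s, _⟩ | ⟨c, h⟩ | ⟨c, h⟩)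
    · rfl
    · exact absurd h (by simp)
    · exact absurd h (by simp))) h
  simp at this

open Fin.CommRing in
/-- At a vertex of weight one all edges lie on one circle. -/
theorem circ_single (c : Crossing k) (e e' : Edge k) :
    circ (Function.update (fun _ => false) c true) e =
      circ (Function.update (fun _ => false) c true) e' := by
  have hc : Function.update (fun _ => false : Vertex k) c true c = true := by simp
  have : ∀ e : Edge k, circ (Function.update (fun _ => false) c true) (c + 1, false) =
      circ (Function.update (fun _ => false) c true) e := by
    rintro ⟨l, s⟩
    rw [circ_eq_bool hc l s false]
    -- Going up from level `c + 1`, only 0-resolved crossings are met until the walk is back at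
    -- level `c` after `2 * k` steps.
    have key : ∀ r : ℕ, r ≤ 2 * k → circ (Function.update (fun _ => false) c true) (c + 1, false) =
        circ (Function.update (fun _ => false) c true) (c + 1 + (r : Crossing k), false) := by
      intro r
      induction r with
      | zero => intro _; simp
      | succ r ih =>
        intro hr
        rw [ih (by omega), circ_zero, add_assoc (c + 1), Nat.cast_succ]
        rw [Function.update_of_ne]
        intro h
        rw [add_assoc, add_eq_left, add_comm, ← Nat.cast_succ] at h
        have h2 := congrArg Fin.val h
        rw [Fin.val_natCast, Nat.mod_eq_of_lt (by omega)] at h2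
        simp at h2
    have h := key (l - (c + 1)).val (by omega)
    rwa [Fin.cast_val_eq_self, add_sub_cancel] at h
  rw [← this e, this e']

/-- The levels from `c + 1` cyclically up to `c'` form a block closed off by two 1-resolutions,
hence a union of circles. The block contains level `c + 1` but not level `c`. -/
theorem circ_ne {v : Vertex k} {c c' : Crossing k} (hcc : c' ≠ c) (hc : v c = true)
    (hc' : v c' = true) : circ v (c, false) ≠ circ v (c + 1, false) := by
  intro h
  have hl : ∀ l : Crossing k, l ≠ c →
      (l + 1 - (c + 1)).val = (l - (c + 1)).val + 1 := by
    intro l hl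
    have h1 : l + 1 - (c + 1) = l - (c + 1) + 1 := by abel
    rw [h1, Fin.val_add_one, if_neg]
    intro h2
    have h3 : l - (c + 1) + 1 = 0 := by rw [h2]; exact Fin.last_add_one _
    apply hl
    rw [← sub_eq_zero, ← h3]; abel
  -- Membership in the block, measured by the cyclic distance from `c + 1`. It only changes on
  -- passing `c` or `c'`, and these crossings do not join successive levels.
  have := congrArg (Quot.lift (fun e : Edge k => (e.1 - (c + 1)).val ≤ (c' - (c + 1)).val) (by
    rintro _ _ (⟨l, s, h0⟩ | ⟨l, h0⟩ | ⟨l, h0⟩)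
    · have h1 : l ≠ c := by rintro rfl; simp [hc] at h0
      have h2 : l ≠ c' := by rintro rfl; simp [hc'] at h0
      have h3 : (l - (c + 1)).val ≠ (c' - (c + 1)).val := fun h =>
        h2 (sub_left_injective (Fin.ext h))
      simp only [eq_iff_iff]
      rw [hl l h1]
      omega
    · rfl
    · rfl)) h
  simp only [sub_self, eq_iff_iff] at this
  have h1 := this.2 (by simp)
  have h2 := hl c' hcc
  have h3 : (c - (c + 1)).val = 2 * k := by
    have : c - (c + 1) = Fin.last (2 * k) := by
      rw [← sub_eq_zero, ← Fin.neg_last]; abel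
    rw [this]; rfl
  omega

/-- Between two adjacent 1-resolutions the circle consists of the two edges of level `m` only. -/
theorem circ_ne_of_level {v : Vertex k} {m l : Crossing k} (hm : v (m - 1) = true)
    (hm' : v m = true) (hl : l ≠ m) (s s' : Bool) : circ v (l, s) ≠ circ v (m, s') := by
  intro h
  have := congrArg (Quot.lift (fun e : Edge k => e.1 = m) (by
    rintro _ _ (⟨c, s, h0⟩ | ⟨c, h0⟩ | ⟨c, h0⟩)
    · simp only [eq_iff_iff]
      refine ⟨?_, ?_⟩
      · rintro rfl; simp [hm'] at h0
      · rintro rfl; simp [h0] at hm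
    · rfl
    · rfl)) h
  simp [hl] at this

/-- The map of circles when the resolution `v` joins all edges that `w` joins. -/
def coarsen {v w : Vertex k} (h : ∀ a b, Joined w a b → circ v a = circ v b) :
    ResCircle w → ResCircle v := Quot.lift (circ v) h

section Update

variable {v : Vertex k} {c : Crossing k}

theorem joined_update {c' : Crossing k} (hc' : v c' = true) (a b : Edge k)
    (h : Joined (Function.update v c true) a b) : circ v a = circ v b := by
  rcases h with ⟨l, s, h⟩ | ⟨l, h⟩ | ⟨l, h⟩
  · by_cases hl : l = c
    · subst hl; simp at h
    · exact circ_zero (by simpa [hl] using h) s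
  · exact circ_eq_bool hc' _ _ _
  · exact circ_eq_bool hc' _ _ _

theorem joined_zero (a b : Edge k) (_ : Joined (fun _ => false : Vertex k) a b) :
    circ (Function.update (fun _ => false) c true) a =
      circ (Function.update (fun _ => false) c true) b := circ_single c a b

theorem coarsen_surjective {v w : Vertex k} (h : ∀ a b, Joined w a b → circ v a = circ v b) :
    Function.Surjective (coarsen h) := by
  rintro ⟨e⟩; exact ⟨circ w e, rfl⟩

/-- As another crossing has the 1-resolution, the new one at `c` cuts a single circle in two, the
one below and the one above `c`; no other circles are affected. -/
theorem coarsen_update_inj {c' : Crossing k} (hc' : v c' = true)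
    (y y' : ResCircle (Function.update v c true))
    (h : coarsen (joined_update hc') y = coarsen (joined_update hc') y') :
    y = y' ∨ (y = circ _ (c, false) ∧ y' = circ _ (c + 1, false)) ∨
      (y = circ _ (c + 1, false) ∧ y' = circ _ (c, false)) := by
  classical
  have hwc : Function.update v c true c = true := by simp
  -- Renaming the circle above `c` as the one below it respects the joins of `v`, so it gives a
  -- partial inverse of the coarsening map.
  let F : Edge k → ResCircle (Function.update v c true) := fun e =>
    if circ (Function.update v c true) e = circ (Function.update v c true) (c + 1, false) then circ (Function.update v c true) (c, false) else circ (Function.update v c true) e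
  have hF : ∀ a b, Joined v a b → F a = F b := by
    have hFe : ∀ a b, circ (Function.update v c true) a = circ (Function.update v c true) b → F a = F b := by
      intro a b hab; simp only [F, hab]
    rintro _ _ (⟨l, s, h⟩ | ⟨l, h⟩ | ⟨l, h⟩)
    · by_cases hl : l = c
      · subst hl
        rw [hFe (l, s) (l, false) (circ_eq_bool hwc _ _ _),
          hFe (l + 1, s) (l + 1, false) (circ_eq_bool hwc _ _ _)]
        simp [F]
      · exact hFe _ _ (circ_zero (by simp [hl, h]) s)
    · exact hFe _ _ (circ_eq_bool hwc _ _ _)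
    · exact hFe _ _ (circ_eq_bool hwc _ _ _)
  rcases y with ⟨e⟩
  rcases y' with ⟨e'⟩
  have h2 : F e = F e' := congrArg (Quot.lift F hF) h
  simp only [F] at h2
  split_ifs at h2 with h3 h4 h4
  · exact Or.inl (h3.trans h4.symm)
  · exact Or.inr (Or.inr ⟨h3, h2.symm⟩)
  · exact Or.inr (Or.inl ⟨h2, h4⟩)
  · exact Or.inl h2

theorem coarsen_zero_inj (y y' : ResCircle (fun _ => false : Vertex k)) :
    y = y' ∨ (y = circ _ (c, false) ∧ y' = circ _ (c + 1, true)) ∨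
      (y = circ _ (c + 1, true) ∧ y' = circ _ (c, false)) := by
  obtain ⟨⟨l, s⟩, rfl⟩ := Quot.exists_rep y
  obtain ⟨⟨l', s'⟩, rfl⟩ := Quot.exists_rep y'
  cases s <;> cases s'
  · exact Or.inl (circ_zero_level _ _ _)
  · exact Or.inr (Or.inl ⟨circ_zero_level _ _ _, circ_zero_level _ _ _⟩)
  · exact Or.inr (Or.inr ⟨circ_zero_level _ _ _, circ_zero_level _ _ _⟩)
  · exact Or.inl (circ_zero_level _ _ _)

end Update

/-! ### Sweeps -/

namespace Cob

open DSurf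

variable {R : Type*} [CommRing R]

/-- If `v` already joins whatever `w` joins, no circles of `v` become connected in the sweep; its
components are the circles of `v`. -/
theorem mor_sweep_up {v w : Vertex k} (h : ∀ a b, Joined w a b → circ v a = circ v b) :
    mor R (sweep v w) = mor R (⟨ResCircle v, inferInstance, id, coarsen h, fun _ => 0, fun _ => 0⟩ :
      DSurf (ResCircle v) (ResCircle w)) := by
  refine mor_congr (iso_of_equiv (S := sweep v w)
    { toFun := Quot.lift (circ v) fun a b hab => hab.elim (fun h' => Quot.sound h') (h a b)
      invFun := Quot.map id fun _ _ h => Or.inl h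
      left_inv := by rintro ⟨_⟩; rfl
      right_inv := by rintro ⟨_⟩; rfl } ?_ ?_ (fun _ => rfl) fun _ => rfl)
  · rintro ⟨_⟩; rfl
  · rintro ⟨_⟩; rfl

theorem mor_sweep_down {v w : Vertex k} (h : ∀ a b, Joined w a b → circ v a = circ v b) :
    mor R (sweep w v) = mor R (lower (coarsen h) fun _ => 0) := by
  refine mor_congr (iso_of_equiv (S := sweep w v)
    { toFun := Quot.lift (circ v) fun a b hab => hab.elim (h a b) fun h' => Quot.sound h'
      invFun := Quot.map id fun _ _ h => Or.inr h
      left_inv := by rintro ⟨_⟩; rfl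
      right_inv := by rintro ⟨_⟩; rfl } ?_ ?_ (fun _ => rfl) fun _ => rfl)
  · rintro ⟨_⟩; rfl
  · rintro ⟨_⟩; rfl

theorem mor_sweep_self (v : Vertex k) : mor R (sweep v v) = 𝟙 _ := by
  rw [mor_sweep_down (v := v) (w := v) fun _ _ h => Quot.sound h, ← mor_cylinder]
  refine mor_congr (iso_of_equiv (Equiv.refl _) ?_ (fun _ => rfl) (fun _ => rfl) fun _ => rfl)
  rintro ⟨_⟩; rfl

theorem dot_sweep (v w : Vertex k) (e : Edge k) :
    dot (circ v e) ≫ mor R (sweep v w) = mor R (sweep v w) ≫ dot (circ w e) :=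
  dot_slide _ _ _ rfl

theorem mor_dotted_sweep (v : Vertex k) (e : Edge k) :
    mor R ((sweep v v).addDot (Quot.mk _ e)) = dot (circ v e) := by
  have : (mor R (sweep v v)) ≫ dot (circ v e) = _ := mor_comp_dot _ _
  rw [mor_sweep_self, Category.id_comp] at this
  rw [this]
  rfl

variable {v : Vertex k} {c : Crossing k}

theorem cup_sweep_down {c' : Crossing k} (hc' : v c' = true) :
    cup R _ ≫ mor R (sweep (Function.update v c true) v) = cup R _ := by
  rw [mor_sweep_down (joined_update hc')]
  exact cup_comp_lower _

theorem cup_sweep_up {c' : Crossing k} (hc' : v c' = true) (hc : v c = false) :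
    cup R _ ≫ mor R (sweep v (Function.update v c true)) =
      cup R _ ≫ (dot (circ _ (c, false)) + dot (circ _ (c + 1, true)) - sph R _) := by
  have hcc : c' ≠ c := by rintro rfl; simp [hc] at hc'
  have hw : Function.update v c true c = true := by simp
  rw [mor_sweep_up (joined_update hc'), circ_eq_bool hw (c + 1) true false]
  refine cup_split (coarsen_surjective _) (circ_ne hcc hw (by simp [hcc, hc'])) ?_
    (coarsen_update_inj hc')
  exact circ_zero hc false

/-- At the zero vertex the roles are exchanged: going up merges the two strands, and going down
splits. This is the source of all special cases at weight 0. -/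
theorem cup_sweep_zero_up :
    cup R _ ≫ mor R (sweep (fun _ => false) (Function.update (fun _ => false) c true)) =
      cup R _ := by
  rw [mor_sweep_down (v := Function.update (fun _ => false) c true) joined_zero]
  exact cup_comp_lower _

theorem cup_sweep_zero_down :
    cup R _ ≫ mor R (sweep (Function.update (fun _ => false) c true) (fun _ => false)) =
      cup R _ ≫ (dot (circ _ (c, false)) + dot (circ _ (c + 1, true)) - sph R _) := by
  rw [mor_sweep_up (v := Function.update (fun _ => false) c true) joined_zero]
  exact cup_split (coarsen_surjective _) (circ_zero_ne _ _) (circ_single c _ _)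
    fun y y' _ => coarsen_zero_inj y y'

end Cob
end TorusKh

/-! ### Operators on the cube and their values on cups. -/

namespace TorusKh

open Cob

section Matrices

variable {𝒞 : Type*} [Category 𝒞] [Preadditive 𝒞] {L M N : Mat_ 𝒞}

/-- The entries of a morphism of `Mat_`. -/
def ent (f : M ⟶ N) (i : M.ι) (j : N.ι) : M.X i ⟶ N.X j := f i j

/-- The morphism of `Mat_` with given entries. -/
def ofEnt (f : ∀ (i : M.ι) (j : N.ι), M.X i ⟶ N.X j) : M ⟶ N := f

theorem ent_ofEnt (f : ∀ (i : M.ι) (j : N.ι), M.X i ⟶ N.X j) (i : M.ι) (j : N.ι) :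
    ent (ofEnt f) i j = f i j := rfl

theorem ent_ext {f g : M ⟶ N} (h : ∀ i j, ent f i j = ent g i j) : f = g := Mat_.hom_ext _ _ h

theorem ent_comp (f : L ⟶ M) (g : M ⟶ N) (i : L.ι) (j : N.ι) :
    ent (f ≫ g) i j = ∑ a, ent f i a ≫ ent g a j := rfl

/-- Taking an entry, as an additive map. -/
def entHom (i : M.ι) (j : N.ι) : (M ⟶ N) →+ (M.X i ⟶ N.X j) := ⟨⟨fun f => ent f i j, rfl⟩, fun _ _ => rfl⟩

theorem ent_zero (i : M.ι) (j : N.ι) : ent (0 : M ⟶ N) i j = 0 := rfl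

theorem ent_add (f g : M ⟶ N) (i : M.ι) (j : N.ι) : ent (f + g) i j = ent f i j + ent g i j := rfl

theorem ent_sub (f g : M ⟶ N) (i : M.ι) (j : N.ι) : ent (f - g) i j = ent f i j - ent g i j :=
  map_sub (entHom i j) f g

theorem ent_neg (f : M ⟶ N) (i : M.ι) (j : N.ι) : ent (-f) i j = -ent f i j :=
  map_neg (entHom i j) f

theorem ent_zsmul (n : ℤ) (f : M ⟶ N) (i : M.ι) (j : N.ι) : ent (n • f) i j = n • ent f i j :=
  map_zsmul (entHom i j) n f

theorem ent_sum {ι : Type*} (s : Finset ι) (f : ι → (M ⟶ N)) (i : M.ι) (j : N.ι) :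
    ent (∑ a ∈ s, f a) i j = ∑ a ∈ s, ent (f a) i j :=
  map_sum (entHom i j) f s

theorem ent_id_self (i : M.ι) : ent (𝟙 M) i i = 𝟙 (M.X i) := Mat_.id_apply_self M i

theorem ent_id_ne {i j : M.ι} (h : i ≠ j) : ent (𝟙 M) i j = 0 := Mat_.id_apply_of_ne M i j h

end Matrices

section Operators

variable {R : Type*} [CommRing R] {k : ℕ}

/-- The object of circles of a resolution. -/
noncomputable abbrev vobj (R : Type*) [CommRing R] {k : ℕ} (v : Vertex k) : Cob R :=
  circles R (ResCircle v)

variable (R k) in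
/-- The underlying object of the bracket. -/
noncomputable abbrev cubeObj : Mat_ (Cob R) where
  ι := Vertex k
  X := fun v => vobj R v

/-- A block diagonal endomorphism of the bracket. -/
noncomputable def diag (φ : ∀ v : Vertex k, vobj R v ⟶ vobj R v) : End (cubeObj R k) :=
  ofEnt (M := cubeObj R k) (N := cubeObj R k) fun v w => if h : v = w then φ v ≫ eqToHom (by rw [h]) else 0

theorem diag_self (φ : ∀ v : Vertex k, vobj R v ⟶ vobj R v) (v : Vertex k) :
    ent (diag φ) v v = φ v := by
  rw [diag, ent_ofEnt, dif_pos rfl, eqToHom_refl]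
  exact Category.comp_id _

theorem diag_ne (φ : ∀ v : Vertex k, vobj R v ⟶ vobj R v) {v w : Vertex k} (h : v ≠ w) :
    ent (diag φ) v w = 0 := by rw [diag, ent_ofEnt, dif_neg h]

theorem comp_diag_apply {M : Mat_ (Cob R)} (f : M ⟶ cubeObj R k)
    (φ : ∀ v : Vertex k, vobj R v ⟶ vobj R v) (i : M.ι) (v : Vertex k) :
    ent (f ≫ (diag φ : cubeObj R k ⟶ cubeObj R k)) i v = ent f i v ≫ φ v := by
  rw [ent_comp, Finset.sum_eq_single v (fun w _ hw => by rw [diag_ne φ hw, Limits.comp_zero])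
    (by simp), diag_self]

theorem diag_comp_apply {M : Mat_ (Cob R)} (f : cubeObj R k ⟶ M)
    (φ : ∀ v : Vertex k, vobj R v ⟶ vobj R v) (v : Vertex k) (i : M.ι) :
    ent ((diag φ : cubeObj R k ⟶ cubeObj R k) ≫ f) v i = φ v ≫ ent f v i := by
  rw [ent_comp, Finset.sum_eq_single v (fun w _ hw => by rw [diag_ne φ hw.symm, Limits.zero_comp])
    (by simp), diag_self]

theorem commute_diag {T : End (cubeObj R k)} {φ : ∀ v : Vertex k, vobj R v ⟶ vobj R v}
    (h : ∀ v w, φ v ≫ ent T v w = ent T v w ≫ φ w) :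
    Commute T (diag φ) := by
  refine ent_ext fun v w => ?_
  refine (diag_comp_apply T φ v w).trans ((h v w).trans (comp_diag_apply T φ v w).symm)

theorem commute_diag_diag {φ ψ : ∀ v : Vertex k, vobj R v ⟶ vobj R v}
    (h : ∀ v, φ v ≫ ψ v = ψ v ≫ φ v) :
    Commute (diag φ) (diag ψ) := by
  refine commute_diag fun v w => ?_
  by_cases hvw : v = w
  · subst hvw; rw [diag_self]; exact (h v).symm
  · rw [diag_ne _ hvw, Limits.comp_zero, Limits.zero_comp]

variable (R k)

/-- The dot on the edge `e`. -/
noncomputable def opX (e : Edge k) : End (cubeObj R k) := diag fun v => dot (circ v e)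

/-- Multiplication by `h`. -/
noncomputable def opH : End (cubeObj R k) := diag fun v => sph R (ResCircle v)

/-- The part of the differential at the crossing `c`. -/
noncomputable def opD (c : Crossing k) : End (cubeObj R k) :=
  ofEnt (M := cubeObj R k) (N := cubeObj R k) fun v w => incidence c v w • mor R (sweep v w)

/-- The reverse of the differential at the crossing `c`. -/
noncomputable def opΧ (c : Crossing k) : End (cubeObj R k) :=
  ofEnt (M := cubeObj R k) (N := cubeObj R k) fun v w => incidence c w v • mor R (sweep v w)

/-- `opC m` cuts the small circle at the level `m`, at the vertices where the crossings `m - 1` and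
`m` both have the `1`-resolution. -/
noncomputable def opC (m : Crossing k) : End (cubeObj R k) :=
  diag fun v => if v (m - 1) = true ∧ v m = true then cutAt (circ v (m, false)) else 0

open Classical in
/-- The cut of the right strand at the zero vertex. -/
noncomputable def opC₀ : End (cubeObj R k) :=
  diag fun v => if v = fun _ => false then cutAt (circ v (0, true)) else 0

/-- The operator `[d, χ_c]`. -/
noncomputable def opY (c : Crossing k) : End (cubeObj R k) :=
  opX R k (c, false) + opX R k (c + 1, true) - opH R k

/-- The object of `Mat_` of the empty 1-manifold. -/
noncomputable abbrev emptyObj : Mat_ (Cob R) where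
  ι := Unit
  X := fun _ => circles R Empty

open Classical in
/-- The cups at the vertex `v`. -/
noncomputable def one (v : Vertex k) : emptyObj R ⟶ cubeObj R k :=
  ofEnt fun _ w => if v = w then cup R (ResCircle w) else 0

/-- A composite of dots on the bracket. -/
noncomputable def opXs (l : List (Edge k)) : End (cubeObj R k) :=
  l.foldr (fun e T => T * opX R k e) 1

variable {R k}

theorem ent_opD (c : Crossing k) (v w : Vertex k) : ent (opD R k c) v w = incidence c v w • mor R (sweep v w) := rfl

theorem ent_opΧ (c : Crossing k) (v w : Vertex k) : ent (opΧ R k c) v w = incidence c w v • mor R (sweep v w) := rfl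

theorem bracketD_eq : bracketD R k = ∑ c, opD R k c :=
  ent_ext (M := cubeObj R k) (N := cubeObj R k) fun v w => (ent_sum (M := cubeObj R k) (N := cubeObj R k) Finset.univ (opD R k) v w).symm

theorem bracketX_eq : bracketX R k = opX R k (0, false) := by
  refine ent_ext (M := cubeObj R k) (N := cubeObj R k) fun v w => ?_
  by_cases h : v = w
  · subst h
    exact (if_pos rfl).trans ((mor_dotted_sweep v (0, false)).trans
      (diag_self (fun v => dot (circ v (0, false))) v).symm)
  · exact (if_neg h).trans (diag_ne (fun v => dot (circ v (0, false))) h).symm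

theorem opX_comm (e e' : Edge k) : Commute (opX R k e) (opX R k e') :=
  commute_diag_diag fun _ => dot_comm _ _

theorem opH_opX (e : Edge k) : Commute (opH R k) (opX R k e) :=
  commute_diag_diag fun _ => sph_comm _

theorem opY_opX (c : Crossing k) (e : Edge k) : Commute (opY R k c) (opX R k e) :=
  ((opX_comm _ _).add_left (opX_comm _ _)).sub_left (opH_opX _)

theorem opD_opX (c : Crossing k) (e : Edge k) : Commute (opD R k c) (opX R k e) := by
  refine commute_diag fun v w => ?_
  rw [ent_opD]
  rw [Preadditive.comp_zsmul, Preadditive.zsmul_comp, dot_sweep]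

theorem chi_opX (c : Crossing k) (e : Edge k) : Commute (opΧ R k c) (opX R k e) := by
  refine commute_diag fun v w => ?_
  rw [ent_opΧ]
  rw [Preadditive.comp_zsmul, Preadditive.zsmul_comp, dot_sweep]

theorem opD_opH (c : Crossing k) : Commute (opD R k c) (opH R k) := by
  refine commute_diag fun v w => ?_
  rw [ent_opD]
  rw [Preadditive.comp_zsmul, Preadditive.zsmul_comp, sph_comm]

theorem chi_opH (c : Crossing k) : Commute (opΧ R k c) (opH R k) := by
  refine commute_diag fun v w => ?_
  rw [ent_opΧ]
  rw [Preadditive.comp_zsmul, Preadditive.zsmul_comp, sph_comm]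

theorem opD_opY (c c' : Crossing k) : Commute (opD R k c) (opY R k c') :=
  ((opD_opX _ _).add_right (opD_opX _ _)).sub_right (opD_opH _)

theorem chi_opY (c c' : Crossing k) : Commute (opΧ R k c) (opY R k c') :=
  ((chi_opX _ _).add_right (chi_opX _ _)).sub_right (chi_opH _)

theorem opH_opY (c : Crossing k) : Commute (opH R k) (opY R k c) :=
  ((opH_opX _).add_right (opH_opX _)).sub_right (Commute.refl _)

theorem opY_comm (c c' : Crossing k) : Commute (opY R k c) (opY R k c') :=
  ((opY_opX _ _).add_right (opY_opX _ _)).sub_right (opH_opY _).symm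

theorem opH_opC (m : Crossing k) : Commute (opH R k) (opC R k m) := by
  refine commute_diag_diag fun v => ?_
  split_ifs
  · exact sph_comm _
  · rw [Limits.comp_zero, Limits.zero_comp]

theorem opC_opX {m l : Crossing k} (h : l ≠ m) (s : Bool) :
    Commute (opC R k m) (opX R k (l, s)) := by
  refine commute_diag_diag fun v => ?_
  split_ifs with hv
  · exact (dot_cutAt_comm (circ_ne_of_level hv.1 hv.2 h s false)).symm
  · rw [Limits.comp_zero, Limits.zero_comp]

theorem opC₀_opX (l : Crossing k) : Commute (opC₀ R k) (opX R k (l, false)) := by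
  refine commute_diag_diag fun v => ?_
  split_ifs with hv
  · subst hv
    exact (dot_cutAt_comm (circ_zero_ne _ _)).symm
  · rw [Limits.comp_zero, Limits.zero_comp]

/-! ### The action on cups -/

/-- Products in `End` are composites in reverse order, so endomorphisms act on the left on morphisms
into the object. A cup thus behaves like a vector. -/
theorem smul_hom {𝒞 : Type*} [Category 𝒞] [Preadditive 𝒞] {A B : 𝒞} (T : End B) (z : A ⟶ B) :
    T • z = z ≫ (T : B ⟶ B) := rfl

theorem ent_one_self (v : Vertex k) (i : Unit) : ent (one R k v) i v = cup R (ResCircle v) :=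
  if_pos rfl

theorem ent_one_ne {v w : Vertex k} (h : v ≠ w) (i : Unit) : ent (one R k v) i w = 0 :=
  if_neg h

theorem one_comp_apply {M : Mat_ (Cob R)} (v : Vertex k) (f : cubeObj R k ⟶ M)
    (i : Unit) (j : M.ι) : ent (one R k v ≫ f) i j = cup R (ResCircle v) ≫ ent f v j := by
  rw [ent_comp, Finset.sum_eq_single v (fun w _ hw => by
    rw [ent_one_ne hw.symm, Limits.zero_comp]) (by simp), ent_one_self]

theorem one_smul_apply (v : Vertex k) (T : End (cubeObj R k))
    (i : Unit) (w : Vertex k) : ent (T • one R k v) i w = cup R (ResCircle v) ≫ ent T v w :=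
  one_comp_apply v T i w

theorem ent_diag_smul_self (φ : ∀ v : Vertex k, vobj R v ⟶ vobj R v) (v : Vertex k) (i : Unit) :
    ent (diag φ • one R k v) i v = cup R (ResCircle v) ≫ φ v := by
  rw [one_smul_apply, diag_self]

theorem ent_diag_smul_ne (φ : ∀ v : Vertex k, vobj R v ⟶ vobj R v) {v w : Vertex k} (h : v ≠ w)
    (i : Unit) : ent (diag φ • one R k v) i w = 0 := by
  rw [one_smul_apply, diag_ne _ h, Limits.comp_zero]

theorem diag_smul_one_congr {φ ψ : ∀ v : Vertex k, vobj R v ⟶ vobj R v} {v : Vertex k}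
    (h : cup R (ResCircle v) ≫ φ v = cup R (ResCircle v) ≫ ψ v) :
    diag φ • one R k v = diag ψ • one R k v := by
  refine ent_ext fun i w => ?_
  by_cases hv : v = w
  · subst hv; rw [ent_diag_smul_self, ent_diag_smul_self, h]
  · rw [ent_diag_smul_ne _ hv, ent_diag_smul_ne _ hv]

theorem diag_smul_one {φ : ∀ v : Vertex k, vobj R v ⟶ vobj R v} {v : Vertex k}
    (h : cup R (ResCircle v) ≫ φ v = 0) :
    diag φ • one R k v = 0 := by
  refine ent_ext fun i w => ?_
  by_cases hv : v = w
  · subst hv; rw [ent_diag_smul_self, h]; rfl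
  · rw [ent_diag_smul_ne _ hv]; rfl

theorem opX_one_congr {v : Vertex k} {e e' : Edge k} (h : circ v e = circ v e') :
    opX R k e • one R k v = opX R k e' • one R k v :=
  diag_smul_one_congr (φ := fun v => dot (circ v e)) (ψ := fun v => dot (circ v e')) (by rw [h])

theorem opC_one (m : Crossing k) (v : Vertex k) : opC R k m • one R k v = 0 := by
  refine diag_smul_one ?_
  split_ifs
  · exact cup_cutAt _
  · exact Limits.comp_zero

theorem opC₀_one (v : Vertex k) : opC₀ R k • one R k v = 0 := by
  refine diag_smul_one ?_
  split_ifs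
  · exact cup_cutAt _
  · exact Limits.comp_zero

theorem diag_mul (φ ψ : ∀ v : Vertex k, vobj R v ⟶ vobj R v) :
    diag φ * diag ψ = diag fun v => ψ v ≫ φ v := by
  refine ent_ext fun v w => ?_
  refine (diag_comp_apply _ _ _ _).trans ?_
  by_cases h : v = w
  · subst h; rw [diag_self, diag_self]
  · rw [diag_ne _ h, diag_ne _ h, Limits.comp_zero]

theorem diag_id : diag (fun v : Vertex k => 𝟙 (vobj R v)) = (1 : End (cubeObj R k)) := by
  refine ent_ext fun v w => ?_
  by_cases h : v = w
  · subst h; rw [diag_self]; exact (ent_id_self (M := cubeObj R k) v).symm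
  · rw [diag_ne _ h]; exact (ent_id_ne (M := cubeObj R k) h).symm

/-- The dot makes the sphere that the cut closes off equal to 1, and an undotted cup is put in its
place. -/
theorem opC_opX_one {m : Crossing k} {v : Vertex k} (h1 : v (m - 1) = true) (h2 : v m = true)
    (s : Bool) : opC R k m • opX R k (m, s) • one R k v = one R k v := by
  rw [← mul_smul, opC, opX, diag_mul]
  refine (diag_smul_one_congr (ψ := fun v => 𝟙 (vobj R v)) ?_).trans ?_
  · rw [if_pos ⟨h1, h2⟩, circ_eq_bool h2 m s false, cup_dot_cutAt]
    rw [Category.comp_id]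
  · rw [diag_id, one_smul]

theorem opC₀_opX_one (l : Crossing k) :
    opC₀ R k • opX R k (l, true) • one R k (fun _ => false) = one R k (fun _ => false) := by
  rw [← mul_smul, opC₀, opX, diag_mul]
  refine (diag_smul_one_congr (ψ := fun v => 𝟙 (vobj R v)) ?_).trans ?_
  · rw [if_pos rfl, circ_zero_level l 0, cup_dot_cutAt]
    rw [Category.comp_id]
  · rw [diag_id, one_smul]

theorem opXs_cons (e : Edge k) (l : List (Edge k)) : opXs R k (e :: l) = opXs R k l * opX R k e := rfl

theorem commute_opXs {T : End (cubeObj R k)} {l : List (Edge k)}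
    (h : ∀ e ∈ l, Commute T (opX R k e)) : Commute T (opXs R k l) := by
  induction l with
  | nil => exact Commute.one_right _
  | cons e l ih =>
    exact (ih fun e he => h e (List.mem_cons_of_mem _ he)).mul_right (h e List.mem_cons_self)

theorem opXs_eq_diag (l : List (Edge k)) :
    opXs R k l = diag fun v => dots R (l.map (circ v)) := by
  induction l with
  | nil => exact diag_id.symm
  | cons e l ih => rw [opXs_cons, ih, opX, diag_mul]; rfl

/-- A morphism from the bracket is zero if it vanishes on dotted cups. -/
theorem eq_zero_of_one {M : Mat_ (Cob R)} (T : cubeObj R k ⟶ M)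
    (h : ∀ (v : Vertex k) (l : List (Edge k)), (l.map (circ v)).Nodup →
      (opXs R k l • one R k v) ≫ T = 0) : T = 0 := by
  refine ent_ext fun v j => ?_
  refine eq_zero_of_cup_dots (X := ResCircle v) (ent T v j) fun l hl => ?_
  -- Choose an edge on each dotted circle, so that dots on circles become the operators `opX`.
  have hl' : (l.map Quot.out).map (circ v) = l := by
    rw [List.map_map]
    conv_rhs => rw [← List.map_id l]
    congr 1
    funext y
    exact Quot.out_eq y
  have := h v (l.map Quot.out) (by rwa [hl'])
  rw [smul_hom, Category.assoc, opXs_eq_diag] at this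
  have h2 := congrArg (fun f => ent f () j) this
  rwa [one_comp_apply, diag_comp_apply, hl'] at h2

/-- The sign of the cube at the vertex `v` in the direction `c`. -/
def sgn (c : Crossing k) (v : Vertex k) : ℤ :=
  (-1) ^ (Finset.univ.filter fun i => i < c ∧ v i = true).card

theorem sgn_mul_self (c : Crossing k) (v : Vertex k) : sgn c v * sgn c v = 1 := by
  unfold sgn; rw [← mul_pow]; simp

theorem sgn_update_self (c : Crossing k) (v : Vertex k) (s : Bool) :
    sgn c (Function.update v c s) = sgn c v := by
  unfold sgn
  congr 2
  ext i
  simp only [Finset.mem_filter, Finset.mem_univ, true_and]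
  refine and_congr_right fun h => ?_
  rw [Function.update_of_ne h.ne]

theorem sgn_update_of_lt {c c' : Crossing k} (h : c' < c) {v : Vertex k} (hv : v c' = false) :
    sgn c (Function.update v c' true) = - sgn c v := by
  unfold sgn
  have : (Finset.univ.filter fun i => i < c ∧ Function.update v c' true i = true)
      = insert c' (Finset.univ.filter fun i => i < c ∧ v i = true) := by
    ext i
    by_cases hi : i = c'
    · subst hi; simp [h]
    · simp [hi]
  rw [this, Finset.card_insert_of_notMem (by simp [hv]), pow_succ]
  ring

theorem sgn_update_of_gt {c c' : Crossing k} (h : c < c') (v : Vertex k) (s : Bool) :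
    sgn c (Function.update v c' s) = sgn c v := by
  unfold sgn
  congr 2
  ext i
  simp only [Finset.mem_filter, Finset.mem_univ, true_and]
  refine and_congr_right fun hi => ?_
  rw [Function.update_of_ne (hi.trans h).ne]

/-- The signs around a square of the cube. -/
theorem sgn_square {c c' : Crossing k} (h : c ≠ c') {v : Vertex k} (hc : v c = false)
    (hc' : v c' = false) : sgn c v * sgn c' (Function.update v c true) =
      - (sgn c' v * sgn c (Function.update v c' true)) := by
  rcases lt_or_gt_of_ne h with h | h
  · rw [sgn_update_of_lt h hc, sgn_update_of_gt h]; ring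
  · rw [sgn_update_of_lt h hc', sgn_update_of_gt h]; ring

theorem incidence_update {c : Crossing k} {v : Vertex k} (h : v c = false) :
    incidence c v (Function.update v c true) = sgn c v := if_pos ⟨h, rfl⟩

theorem incidence_of_true {c : Crossing k} {v : Vertex k} (h : v c = true) (w : Vertex k) :
    incidence c v w = 0 := if_neg (by simp [h])

theorem incidence_of_ne {c : Crossing k} {v w : Vertex k} (h : w ≠ Function.update v c true) :
    incidence c v w = 0 := if_neg (by simp [h])

theorem opD_one_of_true {c : Crossing k} {v : Vertex k} (h : v c = true) :
    opD R k c • one R k v = 0 := by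
  refine ent_ext fun i w => ?_
  rw [one_smul_apply, ent_opD, incidence_of_true h, zero_smul, Limits.comp_zero, ent_zero]

theorem chi_one_of_false {c : Crossing k} {v : Vertex k} (h : v c = false) :
    opΧ R k c • one R k v = 0 := by
  refine ent_ext fun i w => ?_
  have : incidence c w v = 0 := incidence_of_ne fun h' => by simp [h'] at h
  rw [one_smul_apply, ent_opΧ, this, zero_smul, Limits.comp_zero, ent_zero]

theorem opY_eq_diag (c : Crossing k) : opY R k c = diag fun v =>
    dot (circ v (c, false)) + dot (circ v (c + 1, true)) - sph R (ResCircle v) := by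
  refine ent_ext fun v w => ?_
  refine (ent_sub _ _ _ _).trans ?_
  refine (congrArg (· - _) (ent_add _ _ _ _)).trans ?_
  rw [opX, opX, opH]
  by_cases h : v = w
  · subst h; rw [diag_self, diag_self, diag_self, diag_self]
  · rw [diag_ne _ h, diag_ne _ h, diag_ne _ h, diag_ne _ h]; simp

theorem ent_opY_one_self (c : Crossing k) (v : Vertex k) (i : Unit) :
    ent (opY R k c • one R k v) i v = cup R (ResCircle v) ≫
      (dot (circ v (c, false)) + dot (circ v (c + 1, true)) - sph R (ResCircle v)) := by
  rw [opY_eq_diag, ent_diag_smul_self]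

theorem ent_opY_one_ne (c : Crossing k) {v w : Vertex k} (h : v ≠ w) (i : Unit) :
    ent (opY R k c • one R k v) i w = 0 := by
  rw [opY_eq_diag, ent_diag_smul_ne _ h]

theorem incidence_ne_source {c : Crossing k} {v w : Vertex k} (hc : v c = false) (h : w ≠ v) :
    incidence c w (Function.update v c true) = 0 := by
  refine if_neg ?_
  rintro ⟨h1, h2⟩
  apply h
  have := congrArg (fun u => Function.update u c false) h2
  simp only [Function.update_idem] at this
  rw [← hc, Function.update_eq_self] at this
  rw [this, hc, ← h1, Function.update_eq_self]

/-- This formula and the next three express every saddle on cups: a merge gives a cup with a sign,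
and a split gives in addition the operator `opY`, the two dots minus $h$ of `cup_split`. -/
theorem opD_one_zero (c : Crossing k) :
    opD R k c • one R k (fun _ => false) =
      sgn c (fun _ => false) • one R k (Function.update (fun _ => false) c true) := by
  refine ent_ext fun i w => ?_
  rw [one_smul_apply, ent_opD, ent_zsmul]
  by_cases h : Function.update (fun _ => false) c true = w
  · subst h
    rw [ent_one_self, incidence_update rfl, Preadditive.comp_zsmul, cup_sweep_zero_up]
  · rw [ent_one_ne h, incidence_of_ne (Ne.symm h), zero_smul, smul_zero, Limits.comp_zero]

theorem opD_one {c c' : Crossing k} {v : Vertex k} (hc : v c = false) (hc' : v c' = true) :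
    opD R k c • one R k v = sgn c v • opY R k c • one R k (Function.update v c true) := by
  refine ent_ext fun i w => ?_
  rw [one_smul_apply, ent_opD, ent_zsmul]
  by_cases h : Function.update v c true = w
  · subst h
    rw [ent_opY_one_self, incidence_update hc, Preadditive.comp_zsmul, cup_sweep_up hc' hc]
  · rw [ent_opY_one_ne _ h, incidence_of_ne (Ne.symm h), zero_smul, smul_zero, Limits.comp_zero]

theorem chi_one_single (c : Crossing k) :
    opΧ R k c • one R k (Function.update (fun _ => false) c true) =
      sgn c (fun _ => false) • opY R k c • one R k (fun _ => false) := by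
  refine ent_ext fun i w => ?_
  rw [one_smul_apply, ent_opΧ, ent_zsmul]
  by_cases h : (fun _ => false) = w
  · subst h
    rw [ent_opY_one_self, incidence_update rfl, Preadditive.comp_zsmul, cup_sweep_zero_down]
  · rw [ent_opY_one_ne _ h, incidence_ne_source (v := fun _ => false) rfl (Ne.symm h), zero_smul,
      smul_zero, Limits.comp_zero]

theorem chi_one {c c' : Crossing k} {v : Vertex k} (hc : v c = false) (hc' : v c' = true) :
    opΧ R k c • one R k (Function.update v c true) = sgn c v • one R k v := by
  refine ent_ext fun i w => ?_
  rw [one_smul_apply, ent_opΧ, ent_zsmul]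
  by_cases h : v = w
  · subst h
    rw [ent_one_self, incidence_update hc, Preadditive.comp_zsmul, cup_sweep_down hc']
  · rw [ent_one_ne h, incidence_ne_source hc (Ne.symm h), zero_smul, smul_zero, Limits.comp_zero]

end Operators
end TorusKh

/-! ### Commutation relations between saddles. -/

namespace TorusKh

open Cob

section Identities

variable {R : Type*} [CommRing R] {k : ℕ}

/-- An endomorphism of the bracket that commutes with all dots is determined by its values on cups. -/
theorem eq_of_one {S T : End (cubeObj R k)} (hS : ∀ e, Commute S (opX R k e))
    (hT : ∀ e, Commute T (opX R k e)) (h : ∀ v, S • one R k v = T • one R k v) : S = T := by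
  rw [← sub_eq_zero]
  refine eq_zero_of_one (M := cubeObj R k) (S - T) fun v l _ => ?_
  have hc : Commute (S - T) (opXs R k l) := commute_opXs fun e _ => (hS e).sub_left (hT e)
  change (S - T) • opXs R k l • one R k v = 0
  rw [← mul_smul, hc.eq, mul_smul, sub_smul, h, sub_self, smul_zero]

theorem update_eq_true (c : Crossing k) (v : Vertex k) : Function.update v c true c = true := by simp

theorem zero_or_exists (v : Vertex k) : v = (fun _ => false) ∨ ∃ c, v c = true := by
  by_cases h : ∃ c, v c = true
  · exact Or.inr h
  · refine Or.inl (funext fun c => ?_)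
    push Not at h
    simpa using h c

theorem exists_update {v : Vertex k} {c : Crossing k} (h : v c = true) :
    ∃ u : Vertex k, u c = false ∧ v = Function.update u c true :=
  ⟨Function.update v c false, by simp, by rw [Function.update_idem, ← h, Function.update_eq_self]⟩

theorem commute_smul_comm {S T : End (cubeObj R k)} (h : Commute S T) (z : emptyObj R ⟶ cubeObj R k) :
    S • T • z = T • S • z := by rw [← mul_smul, h.eq, mul_smul]

theorem opY_one_congr {v : Vertex k} {c c' : Crossing k}
    (h : (circ v (c, false) = circ v (c', false) ∧ circ v (c + 1, true) = circ v (c' + 1, true)) ∨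
      (circ v (c, false) = circ v (c' + 1, true) ∧ circ v (c + 1, true) = circ v (c', false))) :
    opY R k c • one R k v = opY R k c' • one R k v := by
  unfold opY
  simp only [sub_smul, add_smul]
  rcases h with ⟨h1, h2⟩ | ⟨h1, h2⟩
  · rw [opX_one_congr h1, opX_one_congr h2]
  · rw [opX_one_congr h1, opX_one_congr h2, add_comm]

theorem opY_one_zero (c c' : Crossing k) :
    opY R k c • one R k (fun _ => false) = opY R k c' • one R k (fun _ => false) :=
  opY_one_congr (Or.inl ⟨circ_zero_level _ _ _, circ_zero_level _ _ _⟩)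

theorem opY_one_single (d c c' : Crossing k) :
    opY R k c • one R k (Function.update (fun _ => false) d true) =
      opY R k c' • one R k (Function.update (fun _ => false) d true) :=
  opY_one_congr (Or.inl ⟨circ_single _ _ _, circ_single _ _ _⟩)

/-- At weight two there are only two circles, and both crossings have one of them below and the
other above. So the two sums of dots agree, possibly with the summands interchanged. -/
theorem opY_one_pair {c c' : Crossing k} (h : c ≠ c') :
    opY R k c • one R k (Function.update (Function.update (fun _ => false) c true) c' true) =
      opY R k c' • one R k (Function.update (Function.update (fun _ => false) c true) c' true) := by
  set v : Vertex k := Function.update (Function.update (fun _ => false) c true) c' true with hv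
  have hc : v c = true := by simp [hv, h]
  have hc' : v c' = true := by simp [hv]
  have hn : circ v (c, false) ≠ circ v (c + 1, false) := circ_ne h.symm hc hc'
  have hs : (Function.update (fun _ => false) c true : Vertex k) c = true := by simp
  have key := fun y y' : ResCircle v => coarsen_update_inj (c := c') hs y y'
    (by
      obtain ⟨e, rfl⟩ := Quot.exists_rep y
      obtain ⟨e', rfl⟩ := Quot.exists_rep y'
      exact circ_single c e e')
  refine opY_one_congr ?_
  rw [circ_eq_bool hc (c + 1) true false, circ_eq_bool hc (c' + 1) true false]
  rcases key (circ v (c, false)) (circ v (c + 1, false)) with h1 | ⟨h1, h2⟩ | ⟨h1, h2⟩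
  · exact absurd h1 hn
  · exact Or.inl ⟨h1, h2⟩
  · exact Or.inr ⟨h1, h2⟩

theorem opD_mul_self (c : Crossing k) : opD R k c * opD R k c = 0 := by
  refine eq_of_one (fun e => (opD_opX c e).mul_left (opD_opX c e)) (fun e => Commute.zero_left _)
    fun v => ?_
  rw [mul_smul, zero_smul]
  cases hc : v c
  · have hu : Function.update v c true c = true := by simp
    rcases zero_or_exists v with rfl | ⟨c', hc'⟩
    · rw [opD_one_zero, smul_comm, opD_one_of_true hu, smul_zero]
    · rw [opD_one hc hc', smul_comm, commute_smul_comm (opD_opY c c), opD_one_of_true hu, smul_zero,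
        smul_zero]
  · rw [opD_one_of_true hc, smul_zero]

theorem chi_mul_self (c : Crossing k) : opΧ R k c * opΧ R k c = 0 := by
  refine eq_of_one (fun e => (chi_opX c e).mul_left (chi_opX c e)) (fun e => Commute.zero_left _)
    fun v => ?_
  rw [mul_smul, zero_smul]
  cases hc : v c
  · rw [chi_one_of_false hc, smul_zero]
  · obtain ⟨u, hu, rfl⟩ := exists_update hc
    rcases zero_or_exists u with rfl | ⟨c', hc'⟩
    · rw [chi_one_single, smul_comm, commute_smul_comm (chi_opY c c), chi_one_of_false hu, smul_zero,
        smul_zero]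
    · rw [chi_one hu hc', smul_comm, chi_one_of_false hu, smul_zero]

/-- On cups both orders give the same dots times a sign, and the signs around a square of the cube
are opposite. From the zero vertex, where the first saddle merges, only one factor `opY` occurs, and
`opY_one_pair` compares the two. -/
theorem opD_anticomm {c c' : Crossing k} (h : c ≠ c') :
    opD R k c * opD R k c' + opD R k c' * opD R k c = 0 := by
  refine eq_of_one (fun e => ((opD_opX _ e).mul_left (opD_opX _ e)).add_left
    ((opD_opX _ e).mul_left (opD_opX _ e))) (fun e => Commute.zero_left _) fun v => ?_
  rw [add_smul, mul_smul, mul_smul, zero_smul]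
  cases hc : v c
  swap
  · rw [opD_one_of_true hc, smul_zero, add_zero]
    cases hc' : v c'
    swap
    · rw [opD_one_of_true hc', smul_zero]
    have hu : Function.update v c' true c = true := by simp [h, hc]
    rw [opD_one hc' hc, smul_comm, commute_smul_comm (opD_opY _ _), opD_one_of_true hu, smul_zero,
      smul_zero]
  cases hc' : v c'
  swap
  · have hu : Function.update v c true c' = true := by simp [h.symm, hc']
    rw [opD_one_of_true hc', smul_zero, zero_add]
    rw [opD_one hc hc', smul_comm, commute_smul_comm (opD_opY _ _), opD_one_of_true hu, smul_zero,
      smul_zero]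
  have h1 : Function.update v c true c' = false := by simp [h.symm, hc']
  have h2 : Function.update v c' true c = false := by simp [h, hc]
  have hs := sgn_square h hc hc'
  rcases zero_or_exists v with rfl | ⟨d, hd⟩
  · rw [opD_one_zero, opD_one_zero, smul_comm, smul_comm (opD R k c'),
      opD_one h2 (update_eq_true c' _), opD_one h1 (update_eq_true c _),
      smul_smul, smul_smul, Function.update_comm h.symm, opY_one_pair h, hs, neg_smul,
      add_neg_cancel]
  · have hd1 : Function.update v c true d = true := by
      rw [Function.update_of_ne, hd]; rintro rfl; simp [hc] at hd
    have hd2 : Function.update v c' true d = true := by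
      rw [Function.update_of_ne, hd]; rintro rfl; simp [hc'] at hd
    rw [opD_one hc hd, opD_one hc' hd, smul_comm, smul_comm (opD R k c'),
      commute_smul_comm (opD_opY _ _), commute_smul_comm (opD_opY c' _), opD_one h2 hd2,
      opD_one h1 hd1, smul_comm _ (sgn c _), smul_comm _ (sgn c' _), smul_smul (sgn c' _),
      smul_smul (sgn c _), Function.update_comm h.symm, commute_smul_comm (opY_comm c' c), hs, neg_smul,
      add_neg_cancel]

theorem chi_anticomm {c c' : Crossing k} (h : c ≠ c') :
    opΧ R k c * opΧ R k c' + opΧ R k c' * opΧ R k c = 0 := by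
  refine eq_of_one (fun e => ((chi_opX _ e).mul_left (chi_opX _ e)).add_left
    ((chi_opX _ e).mul_left (chi_opX _ e))) (fun e => Commute.zero_left _) fun v => ?_
  rw [add_smul, mul_smul, mul_smul, zero_smul]
  have aux : ∀ {c c' : Crossing k} (_ : c ≠ c') {v : Vertex k} (_ : v c = false),
      opΧ R k c • opΧ R k c' • one R k v = 0 := by
    intro c c' h v hc
    cases hc' : v c'
    · rw [chi_one_of_false hc', smul_zero]
    obtain ⟨u, hu, rfl⟩ := exists_update hc'
    have huc : u c = false := by simpa [h] using hc
    rcases zero_or_exists u with rfl | ⟨d, hd⟩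
    · rw [chi_one_single, smul_comm, commute_smul_comm (chi_opY _ _), chi_one_of_false huc, smul_zero,
        smul_zero]
    · rw [chi_one hu hd, smul_comm, chi_one_of_false huc, smul_zero]
  cases hc : v c
  · rw [aux h hc, chi_one_of_false hc, smul_zero, add_zero]
  cases hc' : v c'
  · rw [aux h.symm hc', chi_one_of_false hc', smul_zero, add_zero]
  obtain ⟨w, hw, rfl⟩ := exists_update hc'
  obtain ⟨u, hu, rfl⟩ := exists_update (show w c = true by simpa [h] using hc)
  have hu' : u c' = false := by simpa [h.symm] using hw
  have h2 : Function.update u c' true c = false := by simp [h, hu]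
  have hs := sgn_square h hu hu'
  have hs' : sgn c' (Function.update u c true) * sgn c u =
      - (sgn c (Function.update u c' true) * sgn c' u) := by linarith
  rw [chi_one hw (update_eq_true c _), Function.update_comm h, chi_one h2
    (update_eq_true c' _), smul_comm, smul_comm (opΧ R k c')]
  rcases zero_or_exists u with rfl | ⟨d, hd⟩
  · rw [chi_one_single, chi_one_single, smul_smul, smul_smul, opY_one_zero c c', hs', neg_smul,
      neg_add_cancel]
  · rw [chi_one hu hd, chi_one hu' hd, smul_smul, smul_smul, hs', neg_smul, neg_add_cancel]

theorem opD_chi_anticomm {c c' : Crossing k} (h : c ≠ c') :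
    opD R k c * opΧ R k c' + opΧ R k c' * opD R k c = 0 := by
  refine eq_of_one (fun e => ((opD_opX _ e).mul_left (chi_opX _ e)).add_left
    ((chi_opX _ e).mul_left (opD_opX _ e))) (fun e => Commute.zero_left _) fun v => ?_
  rw [add_smul, mul_smul, mul_smul, zero_smul]
  cases hc' : v c'
  · rw [chi_one_of_false hc', smul_zero, zero_add]
    cases hc : v c
    swap
    · rw [opD_one_of_true hc, smul_zero]
    have h1 : Function.update v c true c' = false := by simp [h.symm, hc']
    rcases zero_or_exists v with rfl | ⟨d, hd⟩
    · rw [opD_one_zero, smul_comm, chi_one_of_false h1, smul_zero]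
    · rw [opD_one hc hd, smul_comm, commute_smul_comm (chi_opY _ _), chi_one_of_false h1, smul_zero,
        smul_zero]
  obtain ⟨u, hu, rfl⟩ := exists_update hc'
  cases hc : u c
  swap
  · rw [opD_one_of_true (c := c) (v := Function.update u c' true) (by simp [h, hc]), smul_zero,
      add_zero, chi_one hu hc, smul_comm, opD_one_of_true hc, smul_zero]
  have h1 : Function.update u c true c' = false := by simp [h.symm, hu]
  have h2 : Function.update u c' true c = false := by simp [h, hc]
  have hs := sgn_square h hc hu
  have e1 := sgn_mul_self c' u
  have e2 := sgn_mul_self c' (Function.update u c true)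
  have hs' : sgn c' u * sgn c u =
      - (sgn c (Function.update u c' true) * sgn c' (Function.update u c true)) := by
    -- The sign rule of the square, solved for the other pair of edges by means of signs squaring to
    -- 1.
    linear_combination (sgn c' u * sgn c' (Function.update u c true)) * hs
      - (sgn c u * sgn c' u) * e2 -
        sgn c (Function.update u c' true) * sgn c' (Function.update u c true) * e1
  rw [opD_one h2 (update_eq_true c' _), smul_comm (opΧ R k c'),
    commute_smul_comm (chi_opY _ _), Function.update_comm h.symm, chi_one h1
    (update_eq_true c _)]
  rcases zero_or_exists u with rfl | ⟨d, hd⟩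
  · rw [chi_one_single, smul_comm (opD R k c), commute_smul_comm (opD_opY _ _), opD_one_zero,
      smul_comm _ (sgn c _), smul_comm _ (sgn c' _), smul_smul, smul_smul, opY_one_single c c' c, hs',
      neg_smul, neg_add_cancel]
  · rw [chi_one hu hd, smul_comm (opD R k c), opD_one hc hd, smul_comm _ (sgn c' _), smul_smul,
      smul_smul, hs', neg_smul, neg_add_cancel]

/-- Of the two saddles at `c`, one merges and one splits, in whichever order; on cups only the split
contributes, and it contributes `opY`. The sign of the edge appears twice. -/
theorem opD_chi_self (c : Crossing k) :
    opD R k c * opΧ R k c + opΧ R k c * opD R k c = opY R k c := by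
  refine eq_of_one (fun e => ((opD_opX _ e).mul_left (chi_opX _ e)).add_left
    ((chi_opX _ e).mul_left (opD_opX _ e))) (fun e => opY_opX _ _) fun v => ?_
  rw [add_smul, mul_smul, mul_smul]
  cases hc : v c
  · rw [chi_one_of_false hc, smul_zero, zero_add]
    rcases zero_or_exists v with rfl | ⟨d, hd⟩
    · rw [opD_one_zero, smul_comm, chi_one_single, smul_smul, sgn_mul_self, one_smul]
    · rw [opD_one hc hd, smul_comm, commute_smul_comm (chi_opY _ _), chi_one hc hd,
        smul_comm _ (sgn c _), smul_smul, sgn_mul_self, one_smul]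
  · rw [opD_one_of_true hc, smul_zero, add_zero]
    obtain ⟨u, hu, rfl⟩ := exists_update hc
    rcases zero_or_exists u with rfl | ⟨d, hd⟩
    · rw [chi_one_single, smul_comm, commute_smul_comm (opD_opY _ _), opD_one_zero,
        smul_comm _ (sgn c _), smul_smul, sgn_mul_self, one_smul]
    · rw [chi_one hu hd, smul_comm, opD_one hu hd, smul_smul, sgn_mul_self, one_smul]

end Identities
end TorusKh

/-! ### The walk around the knot. -/

namespace TorusKh

open Cob

section Loops

variable {A : Type*} [Ring A] {k : ℕ}

theorem passed_add (k j : ℕ) : passed k (2 * k + 1 + j) = passed k j := by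
  unfold passed
  ext
  simp [Fin.ofNat]

theorem passed_succ (k j : ℕ) : passed k (j + 1) = passed k j + 1 := by
  unfold passed
  ext
  rw [Fin.val_add]
  simp [Fin.ofNat]

theorem passed_val (c : Crossing k) : passed k c.val = c := by
  ext; simp [passed, Fin.ofNat, Nat.mod_eq_of_lt c.2]

theorem passed_val_of_lt {j : ℕ} (h : j < 2 * k + 1) : (passed k j).val = j := by
  simp [passed, Fin.ofNat, Nat.mod_eq_of_lt h]

/-- The sum of the products of two of the first `2k + 1` terms of the loop. -/
def halfU (χ : Crossing k → A) : A :=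
  ∑ b ∈ Finset.range (2 * k + 1), ∑ a ∈ Finset.range b,
    ((-1) ^ a * χ (passed k a)) * ((-1) ^ b * χ (passed k b))

theorem neg_one_pow_add_odd (j : ℕ) : (-1 : A) ^ (2 * k + 1 + j) = -(-1) ^ j := by
  rw [pow_add, pow_succ, pow_mul]; simp

/-- One round has odd length, so each crossing is passed a second time with the opposite sign. -/
theorem loopXi_eq_zero (χ : Crossing k → A) : loopXi χ = 0 := by
  unfold loopXi
  rw [two_mul (2 * k + 1), Finset.sum_range_add]
  simp only [passed_add, neg_one_pow_add_odd, neg_mul, Finset.sum_neg_distrib, add_neg_cancel]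

/-- Pairs within the first round and pairs within the second round give the same sum, as the two
sign changes cancel. The mixed pairs add up to minus the square of the sum over one round, which
vanishes. -/
theorem loopU_eq (χ : Crossing k → A) (h0 : ∀ c, χ c * χ c = 0)
    (h : ∀ c c', c ≠ c' → χ c * χ c' + χ c' * χ c = 0) : loopU χ = halfU χ + halfU χ := by
  -- A sum of anticommuting elements of square zero has square zero.
  have hsq : ∀ m : ℕ, (∑ a ∈ Finset.range m, (-1) ^ a * χ (passed k a)) *
      (∑ a ∈ Finset.range m, (-1) ^ a * χ (passed k a)) = 0 := by
    have hc : ∀ (a : ℕ) (z : A), z * (-1) ^ a = (-1) ^ a * z := fun a z =>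
      ((Commute.neg_one_left z).pow_left a).eq.symm
    have key : ∀ a b : ℕ, ((-1) ^ a * χ (passed k a)) * ((-1) ^ b * χ (passed k b)) +
        ((-1) ^ b * χ (passed k b)) * ((-1) ^ a * χ (passed k a)) = 0 := by
      intro a b
      have e : ∀ a b : ℕ, ((-1) ^ a * χ (passed k a)) * ((-1) ^ b * χ (passed k b)) =
          (-1) ^ (a + b) * (χ (passed k a) * χ (passed k b)) := by
        intro a b
        rw [mul_assoc, ← mul_assoc (χ _), hc b, pow_add]; simp only [mul_assoc]
      rw [e, e, add_comm b a, ← mul_add]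
      by_cases hab : passed k a = passed k b
      · rw [hab, h0]; simp
      · rw [h _ _ hab, mul_zero]
    have key0 : ∀ a : ℕ, ((-1) ^ a * χ (passed k a)) * ((-1) ^ a * χ (passed k a)) = 0 := by
      intro a
      rw [mul_assoc, ← mul_assoc (χ _), hc a, mul_assoc, h0]; simp
    intro m
    induction m with
    | zero => simp
    | succ m ih =>
      rw [Finset.sum_range_succ, add_mul, mul_add, mul_add, ih, key0, zero_add, add_zero,
        Finset.sum_mul, Finset.mul_sum, ← Finset.sum_add_distrib]
      exact Finset.sum_eq_zero fun a _ => key a m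
  unfold loopU
  rw [two_mul (2 * k + 1), Finset.sum_range_add]
  refine congrArg (halfU χ + ·) ?_
  have h1 : ∀ b, ∑ a ∈ Finset.range (2 * k + 1 + b), ((-1) ^ a * χ (passed k a)) *
      ((-1) ^ (2 * k + 1 + b) * χ (passed k (2 * k + 1 + b))) =
      -(∑ a ∈ Finset.range (2 * k + 1), ((-1) ^ a * χ (passed k a)) * ((-1) ^ b * χ (passed k b))) +
      ∑ a ∈ Finset.range b, ((-1) ^ a * χ (passed k a)) * ((-1) ^ b * χ (passed k b)) := by
    intro b
    rw [Finset.sum_range_add]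
    simp only [passed_add, neg_one_pow_add_odd, neg_mul, mul_neg, neg_neg, Finset.sum_neg_distrib]
  have := hsq (2 * k + 1)
  rw [Finset.sum_mul_sum, Finset.sum_comm] at this
  rw [Finset.sum_congr rfl fun b _ => h1 b, Finset.sum_add_distrib, Finset.sum_neg_distrib, this,
    neg_zero, zero_add]
  rfl

/-- Interchange of summation: the coefficient of `ξ a` collects the `w b` with $a<b<n$, written as a
difference of partial sums so that `sum_alternating` applies. -/
theorem sum_tail (w ξ : ℕ → A) (n : ℕ) :
    ∑ b ∈ Finset.range n, ∑ a ∈ Finset.range b, w b * ξ a =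
      ∑ a ∈ Finset.range n, (∑ i ∈ Finset.range n, w i - ∑ i ∈ Finset.range (a + 1), w i) * ξ a := by
  induction n with
  | zero => simp
  | succ n ih =>
    rw [Finset.sum_range_succ, ih, Finset.sum_range_succ _ n, sub_self, zero_mul, add_zero,
      ← Finset.sum_add_distrib]
    refine Finset.sum_congr rfl fun a _ => ?_
    rw [Finset.sum_range_succ w n, ← add_mul]
    congr 1; abel

theorem sum_alternating (x : ℕ → A) (h : A) (m : ℕ) :
    ∑ a ∈ Finset.range m, (-1) ^ a * (x a + x (a + 1) - h) =
      x 0 - (-1) ^ m * x m - if Even m then 0 else h := by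
  induction m with
  | zero => simp
  | succ m ih =>
    rw [Finset.sum_range_succ, ih, pow_succ]
    rcases Nat.even_or_odd m with hm | hm
    · simp [hm.neg_one_pow, Nat.even_add_one, hm]; try abel
    · have := Nat.not_even_iff_odd.2 hm
      simp [hm.neg_one_pow, Nat.even_add_one, this]; try abel

/-- The commutator of $d$ with $\xi_a\xi_b$ is $w_a\xi_b-w_b\xi_a$. The coefficient of $\xi_b$ in
the sum is that of all $w$ before $b$ minus all after $b$, and telescopes to $\pm(x_{b+1}-x_b)$
because the walk closes up and has odd length. This kills $\chi_b$, since a dot passes through the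
crossing. -/
theorem commute_halfU {χ Y : Crossing k → A} {d h : A} {x : ℕ → A}
    (hd : ∀ c, d * χ c + χ c * d = Y c) (hY : ∀ c c', Commute (χ c) (Y c'))
    (hYx : ∀ a b, Y (passed k a) * χ (passed k b) = (x a + x (a + 1) - h) * χ (passed k b))
    (hx : ∀ b, x (b + 1) * χ (passed k b) = x b * χ (passed k b)) (hn : x (2 * k + 1) = x 0) :
    Commute d (halfU χ) := by
  have hc : ∀ (a : ℕ) (z : A), z * (-1) ^ a = (-1) ^ a * z := fun a z =>
    ((Commute.neg_one_left z).pow_left a).eq.symm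
  have hc' : ∀ (a : ℕ) (z z' : A), z * ((-1) ^ a * z') = (-1) ^ a * (z * z') := fun a z z' => by
    rw [← mul_assoc, hc, mul_assoc]
  set w : ℕ → A := fun a => (-1) ^ a * (x a + x (a + 1) - h) with hw
  set ξ : ℕ → A := fun a => (-1) ^ a * χ (passed k a) with hξ
  have key : ∀ a b, d * (ξ a * ξ b) - ξ a * ξ b * d = w a * ξ b - w b * ξ a := by
    intro a b
    have h1 : d * ξ a + ξ a * d = (-1) ^ a * Y (passed k a) := by
      simp only [hξ]; rw [hc', mul_assoc, ← mul_add, hd]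
    have h2 : d * ξ b + ξ b * d = (-1) ^ b * Y (passed k b) := by
      simp only [hξ]; rw [hc', mul_assoc, ← mul_add, hd]
    have h3 : d * (ξ a * ξ b) - ξ a * ξ b * d = (d * ξ a + ξ a * d) * ξ b -
        ξ a * (d * ξ b + ξ b * d) := by noncomm_ring
    have h4 : ξ a * ((-1) ^ b * Y (passed k b)) = ((-1) ^ b * Y (passed k b)) * ξ a := by
      simp only [hξ]
      rw [hc', hc', mul_assoc, mul_assoc, (hY _ _).eq, hc' a]
    have h5 : ∀ a b, ((-1) ^ a * Y (passed k a)) * ξ b = w a * ξ b := by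
      intro a b
      simp only [hξ, hw]
      rw [hc', hc', mul_assoc, mul_assoc, hYx]
    rw [h3, h1, h2, h4, h5, h5]
  refine sub_eq_zero.1 ?_
  have h1 : d * halfU χ - halfU χ * d = ∑ b ∈ Finset.range (2 * k + 1), ∑ a ∈ Finset.range b,
      (w a * ξ b - w b * ξ a) := by
    unfold halfU
    simp only [Finset.mul_sum, Finset.sum_mul, ← Finset.sum_sub_distrib]
    exact Finset.sum_congr rfl fun b _ => Finset.sum_congr rfl fun a _ => key a b
  rw [h1]
  simp only [Finset.sum_sub_distrib]
  rw [sum_tail, ← Finset.sum_sub_distrib]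
  refine Finset.sum_eq_zero fun b _ => ?_
  rw [← Finset.sum_mul, ← sub_mul]
  have h2 : (∑ i ∈ Finset.range b, w i - (∑ i ∈ Finset.range (2 * k + 1), w i -
      ∑ i ∈ Finset.range (b + 1), w i)) = (-1) ^ b * (x (b + 1) - x b) := by
    simp only [hw]
    rw [sum_alternating, sum_alternating, sum_alternating, hn]
    have : (-1 : A) ^ (2 * k + 1) = -1 := by rw [pow_succ, pow_mul]; simp
    rw [this, pow_succ]
    rcases Nat.even_or_odd b with hm | hm
    · simp [hm.neg_one_pow, Nat.even_add_one, hm]; try abel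
    · have := Nat.not_even_iff_odd.2 hm
      simp [hm.neg_one_pow, Nat.even_add_one, this]; try abel
  rw [h2, mul_assoc]
  simp only [hξ]
  rw [sub_mul, hc', hc', hx, sub_self, mul_zero]

end Loops

section Bracket

variable {R : Type*} [CommRing R] {k : ℕ}

theorem bracketXi_eq : bracketXi R k = 0 := loopXi_eq_zero _

theorem bracketU_eq : bracketU R k = halfU (opΧ R k) + halfU (opΧ R k) :=
  loopU_eq (opΧ R k) chi_mul_self fun _ _ => chi_anticomm

/-- Two endomorphisms that commute with dots agree after a `χ` if they agree on the cups at the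
vertices where it lands. -/
theorem mul_chi_congr {S T : End (cubeObj R k)} (hS : ∀ e, Commute S (opX R k e))
    (hT : ∀ e, Commute T (opX R k e)) (hSc : ∀ c, Commute S (opΧ R k c)) (hTc : ∀ c, Commute T (opΧ R k c))
    (c : Crossing k) (h : ∀ v c', v c = false → v c' = true → S • one R k v = T • one R k v)
    (h' : ∀ c, S • one R k (Function.update (fun _ => false) c true) =
      T • one R k (Function.update (fun _ => false) c true)) :
    S * opΧ R k c = T * opΧ R k c := by
  refine eq_of_one (fun e => (hS e).mul_left (chi_opX _ _)) (fun e => (hT e).mul_left (chi_opX _ _))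
    fun v => ?_
  cases hv : v c
  · rw [mul_smul, mul_smul, chi_one_of_false hv, smul_zero, smul_zero]
  obtain ⟨u, hu, rfl⟩ := exists_update hv
  -- When `χ` lands at the zero vertex the operators may differ there, as the strands are separate
  -- circles. They are moved to the other side of `χ`, to a vertex with a single circle.
  rcases zero_or_exists u with rfl | ⟨d, hd⟩
  · rw [(hSc c).eq, (hTc c).eq, mul_smul, mul_smul, h']
  · rw [mul_smul, mul_smul, chi_one hu hd, smul_comm S, smul_comm T, h _ _ hu hd]

theorem opX_bool_chi (l : Crossing k) (s s' : Bool) (c : Crossing k) :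
    opX R k (l, s) * opΧ R k c = opX R k (l, s') * opΧ R k c :=
  mul_chi_congr (fun _ => opX_comm _ _) (fun _ => opX_comm _ _) (fun c => (chi_opX c _).symm)
    (fun c => (chi_opX c _).symm) c (fun _ _ _ h => opX_one_congr (circ_eq_bool h _ _ _))
    fun _ => opX_one_congr (circ_single _ _ _)

theorem opX_succ_chi (c : Crossing k) (s : Bool) :
    opX R k (c + 1, s) * opΧ R k c = opX R k (c, s) * opΧ R k c :=
  mul_chi_congr (fun _ => opX_comm _ _) (fun _ => opX_comm _ _) (fun c => (chi_opX c _).symm)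
    (fun c => (chi_opX c _).symm) c (fun _ _ h _ => opX_one_congr (circ_zero h _).symm)
    fun _ => opX_one_congr (circ_single _ _ _)

variable (R k) in
/-- The differential of the bracket, as the sum of its parts. -/
noncomputable def opd : End (cubeObj R k) := ∑ c, opD R k c

theorem bracketD_eq_opd : bracketD R k = opd R k := bracketD_eq

theorem opd_chi (c : Crossing k) : opd R k * opΧ R k c + opΧ R k c * opd R k = opY R k c := by
  unfold opd
  rw [Finset.sum_mul, Finset.mul_sum, ← Finset.sum_add_distrib,
    Finset.sum_eq_single c (fun c' _ h => opD_chi_anticomm h) (by simp), opD_chi_self]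

theorem opd_sq : opd R k * opd R k = 0 := by
  unfold opd
  rw [Finset.sum_mul_sum]
  have : ∀ s : Finset (Crossing k), ∑ i ∈ s, ∑ j ∈ s, opD R k i * opD R k j = 0 := by
    intro s
    induction s using Finset.induction_on with
    | empty => simp
    | insert a s ha ih =>
      simp only [Finset.sum_insert ha, Finset.sum_add_distrib]
      rw [ih, opD_mul_self, zero_add, add_zero, ← Finset.sum_add_distrib]
      refine Finset.sum_eq_zero fun i hi => opD_anticomm ?_
      rintro rfl; exact ha hi
  exact this _

theorem opd_opX (e : Edge k) : Commute (opd R k) (opX R k e) :=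
  Commute.sum_left _ _ _ fun _ _ => opD_opX _ _

/-- The dots of `commute_halfU` are those on the left edges. Behind a `χ` the right dot in `opY` may
be replaced by the left one, by `opX_bool_chi`. -/
theorem opd_halfU : Commute (opd R k) (halfU (opΧ R k)) := by
  refine commute_halfU (Y := opY R k) (h := opH R k) (x := fun a => opX R k (passed k a, false))
    opd_chi chi_opY (fun a b => ?_) (fun b => ?_) ?_
  · rw [opY, passed_succ, sub_mul, add_mul, opX_bool_chi _ true false, ← add_mul, ← sub_mul]
  · rw [passed_succ, opX_succ_chi]
  · rw [← passed_add k 0]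

theorem commute_loop_mul {T : End (cubeObj R k)} (h : ∀ c, Commute T (opΧ R k c)) :
    Commute T (halfU (opΧ R k)) := by
  have : ∀ a : ℕ, Commute T ((-1) ^ a * opΧ R k (passed k a)) := fun a =>
    ((Commute.neg_one_right T).pow_right a).mul_right (h _)
  exact Commute.sum_right _ _ _ fun b _ => Commute.sum_right _ _ _ fun a _ =>
    (this a).mul_right (this b)

end Bracket
end TorusKh

/-! ### Projections and neck-cutting as operators on the cube. -/

namespace TorusKh

open Cob

section Projections

variable {R : Type*} [CommRing R] {k : ℕ}

open Classical in
variable (R k) in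
/-- The projection to the vertices that satisfy `p`. -/
noncomputable def proj (p : Vertex k → Prop) : End (cubeObj R k) :=
  diag fun v => if p v then 𝟙 _ else 0

theorem ent_mul (S T : End (cubeObj R k)) (v w : Vertex k) :
    ent (S * T) v w = ∑ a, ent T v a ≫ ent S a w := rfl

theorem ent_mul_proj {T : End (cubeObj R k)} {p : Vertex k → Prop} {v : Vertex k} (h : p v)
    (w : Vertex k) : ent (T * proj R k p) v w = ent T v w := by
  refine (diag_comp_apply _ _ _ _).trans ?_
  rw [if_pos h, Category.id_comp]

theorem ent_mul_proj_neg {T : End (cubeObj R k)} {p : Vertex k → Prop} {v : Vertex k} (h : ¬ p v)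
    (w : Vertex k) : ent (T * proj R k p) v w = 0 := by
  refine (diag_comp_apply _ _ _ _).trans ?_
  rw [if_neg h, Limits.zero_comp]

theorem ent_proj_mul {T : End (cubeObj R k)} {p : Vertex k → Prop} {w : Vertex k} (h : p w)
    (v : Vertex k) : ent (proj R k p * T) v w = ent T v w := by
  refine (comp_diag_apply _ _ _ _).trans ?_
  rw [if_pos h, Category.comp_id]

theorem ent_proj_mul_neg {T : End (cubeObj R k)} {p : Vertex k → Prop} {w : Vertex k} (h : ¬ p w)
    (v : Vertex k) : ent (proj R k p * T) v w = 0 := by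
  refine (comp_diag_apply _ _ _ _).trans ?_
  rw [if_neg h, Limits.comp_zero]

theorem mul_proj_eq_self {T : End (cubeObj R k)} {p : Vertex k → Prop}
    (h : ∀ v w, ¬ p v → ent T v w = 0) : T * proj R k p = T := by
  refine ent_ext fun v w => ?_
  by_cases hp : p v
  · exact ent_mul_proj hp w
  · exact (ent_mul_proj_neg hp w).trans (h v w hp).symm

theorem proj_mul_eq_self {T : End (cubeObj R k)} {p : Vertex k → Prop}
    (h : ∀ v w, ¬ p w → ent T v w = 0) : proj R k p * T = T := by
  refine ent_ext fun v w => ?_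
  by_cases hp : p w
  · exact ent_proj_mul hp v
  · exact (ent_proj_mul_neg hp v).trans (h v w hp).symm

theorem mul_proj_eq_zero {T : End (cubeObj R k)} {p : Vertex k → Prop}
    (h : ∀ v w, p v → ent T v w = 0) : T * proj R k p = 0 := by
  refine ent_ext fun v w => ?_
  by_cases hp : p v
  · exact (ent_mul_proj hp w).trans (h v w hp)
  · exact ent_mul_proj_neg hp w

theorem proj_mul_eq_zero {T : End (cubeObj R k)} {p : Vertex k → Prop}
    (h : ∀ v w, p w → ent T v w = 0) : proj R k p * T = 0 := by
  refine ent_ext fun v w => ?_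
  by_cases hp : p w
  · exact (ent_proj_mul hp v).trans (h v w hp)
  · exact ent_proj_mul_neg hp v

theorem commute_diag_proj (φ : ∀ v : Vertex k, vobj R v ⟶ vobj R v) (p : Vertex k → Prop) :
    Commute (diag φ) (proj R k p) :=
  commute_diag_diag fun v => by
    split_ifs
    · rw [Category.id_comp, Category.comp_id]
    · rw [Limits.comp_zero, Limits.zero_comp]

theorem proj_opX (p : Vertex k → Prop) (e : Edge k) : Commute (proj R k p) (opX R k e) :=
  (commute_diag_proj _ _).symm

theorem proj_opH (p : Vertex k → Prop) : Commute (proj R k p) (opH R k) :=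
  (commute_diag_proj _ _).symm

theorem proj_opC (p : Vertex k → Prop) (m : Crossing k) : Commute (proj R k p) (opC R k m) :=
  (commute_diag_proj _ _).symm

theorem proj_opC₀ (p : Vertex k → Prop) : Commute (proj R k p) (opC₀ R k) :=
  (commute_diag_proj _ _).symm

theorem proj_opY (p : Vertex k → Prop) (c : Crossing k) : Commute (proj R k p) (opY R k c) :=
  ((proj_opX _ _).add_right (proj_opX _ _)).sub_right (proj_opH _)

theorem proj_one {p : Vertex k → Prop} {v : Vertex k} (h : p v) :
    proj R k p • one R k v = one R k v := by
  refine (diag_smul_one_congr (ψ := fun v => 𝟙 (vobj R v)) ?_).trans ?_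
  · rw [if_pos h]
  · rw [diag_id, one_smul]

theorem proj_one_neg {p : Vertex k → Prop} {v : Vertex k} (h : ¬ p v) :
    proj R k p • one R k v = 0 :=
  diag_smul_one (by rw [if_neg h, Limits.comp_zero])

/-- An endomorphism is zero if it vanishes on cups and carries dots to something. -/
theorem eq_zero_of_intertwine {T : End (cubeObj R k)}
    (h : ∀ e, ∃ Z : End (cubeObj R k), T * opX R k e = Z * T) (h1 : ∀ v, T • one R k v = 0) :
    T = 0 := by
  refine eq_zero_of_one (M := cubeObj R k) T fun v l _ => ?_
  change T • opXs R k l • one R k v = 0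
  have : ∀ l, ∃ Z : End (cubeObj R k), T * opXs R k l = Z * T := by
    intro l
    induction l with
    | nil => exact ⟨1, by rw [one_mul]; exact mul_one _⟩
    | cons e l ih =>
      obtain ⟨Z, hZ⟩ := ih
      obtain ⟨Z', hZ'⟩ := h e
      exact ⟨Z * Z', by rw [opXs_cons, ← mul_assoc, hZ, mul_assoc, hZ', mul_assoc]⟩
  obtain ⟨Z, hZ⟩ := this l
  rw [← mul_smul, hZ, mul_smul, h1, smul_zero]

/-- Endomorphisms that commute with dots agree on the vertices in `p` if they agree on the cups there. -/
theorem mul_proj_congr {S T : End (cubeObj R k)} (hS : ∀ e, Commute S (opX R k e))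
    (hT : ∀ e, Commute T (opX R k e)) {p : Vertex k → Prop}
    (h : ∀ v, p v → S • one R k v = T • one R k v) : S * proj R k p = T * proj R k p := by
  refine eq_of_one (fun e => (hS e).mul_left (proj_opX _ _)) (fun e => (hT e).mul_left (proj_opX _ _))
    fun v => ?_
  rw [mul_smul, mul_smul]
  by_cases hp : p v
  · rw [proj_one hp, h v hp]
  · rw [proj_one_neg hp, smul_zero, smul_zero]

end Projections

section Cuts

variable {R : Type*} [CommRing R] {k : ℕ}

/-- The vertices where the crossings below and above the level `m` have the `1`-resolution. -/
def Both (m : Crossing k) (v : Vertex k) : Prop := v (m - 1) = true ∧ v m = true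

theorem diag_add (φ ψ : ∀ v : Vertex k, vobj R v ⟶ vobj R v) :
    diag φ + diag ψ = diag fun v => φ v + ψ v := by
  refine ent_ext fun v w => ?_
  refine (ent_add _ _ _ _).trans ?_
  by_cases h : v = w
  · subst h; rw [diag_self, diag_self, diag_self]
  · rw [diag_ne _ h, diag_ne _ h, diag_ne _ h, add_zero]

theorem diag_sub (φ ψ : ∀ v : Vertex k, vobj R v ⟶ vobj R v) :
    diag φ - diag ψ = diag fun v => φ v - ψ v := by
  refine ent_ext fun v w => ?_
  refine (ent_sub _ _ _ _).trans ?_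
  by_cases h : v = w
  · subst h; rw [diag_self, diag_self, diag_self]
  · rw [diag_ne _ h, diag_ne _ h, diag_ne _ h, sub_zero]

theorem opC_proj (m : Crossing k) : opC R k m * proj R k (Both m) = opC R k m :=
  mul_proj_eq_self fun v w h => by
    by_cases hvw : v = w
    · subst hvw; rw [opC, diag_self]; exact if_neg h
    · rw [opC, diag_ne _ hvw]

theorem opC₀_proj : opC₀ R k * proj R k (fun v => v = fun _ => false) = opC₀ R k :=
  mul_proj_eq_self fun v w h => by
    by_cases hvw : v = w
    · subst hvw; rw [opC₀, diag_self, if_neg h]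
    · rw [opC₀, diag_ne _ hvw]

theorem proj_mul_opC₀ : proj R k (fun v => v = fun _ => false) * opC₀ R k = opC₀ R k := by
  rw [(proj_opC₀ _).eq, opC₀_proj]

theorem opX_bool_proj {p : Vertex k → Prop} (hp : ∀ v, p v → ∃ c, v c = true) (l : Crossing k)
    (s s' : Bool) : opX R k (l, s) * proj R k p = opX R k (l, s') * proj R k p :=
  mul_proj_congr (fun _ => opX_comm _ _) (fun _ => opX_comm _ _) fun v hv => by
    obtain ⟨c, hc⟩ := hp v hv
    exact opX_one_congr (circ_eq_bool hc _ _ _)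

theorem both_exists (m : Crossing k) (v : Vertex k) (h : Both m v) : ∃ c, v c = true := ⟨m, h.2⟩

theorem opC_opX_bool (l m : Crossing k) (s s' : Bool) :
    opC R k m * opX R k (l, s) = opC R k m * opX R k (l, s') := by
  rw [← opC_proj, mul_assoc, mul_assoc, (proj_opX _ _).eq, (proj_opX _ _).eq,
    opX_bool_proj (both_exists m) l s s']

/-- Neck cutting at the circle of level `m`. -/
theorem opC_neck (m : Crossing k) : opC R k m * opX R k (m, false) =
    proj R k (Both m) + opH R k * opC R k m - opX R k (m, false) * opC R k m := by
  rw [opC, opX, opH, proj, diag_mul, diag_mul, diag_mul, diag_add, diag_sub]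
  congr 1
  funext v
  by_cases h : Both m v
  · have h' : v (m - 1) = true ∧ v m = true := h
    rw [if_pos h', if_pos h, neck (circ v (m, false))]
    abel
  · have h' : ¬ (v (m - 1) = true ∧ v m = true) := h
    rw [if_neg h', if_neg h]; simp

theorem opC₀_neck : opC₀ R k * opX R k (0, true) =
    proj R k (fun v => v = fun _ => false) + opH R k * opC₀ R k - opX R k (0, true) * opC₀ R k := by
  rw [opC₀, opX, opH, proj, diag_mul, diag_mul, diag_mul, diag_add, diag_sub]
  congr 1
  funext v
  split_ifs with h
  · rw [neck (circ v (0, true))]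
    abel
  · simp

theorem ent_opD_eq_zero {c : Crossing k} {v w : Vertex k}
    (h : ¬ (v c = false ∧ w = Function.update v c true)) : ent (opD R k c) v w = 0 := by
  rw [ent_opD, incidence, if_neg h, zero_smul]

theorem ent_chi_eq_zero {c : Crossing k} {v w : Vertex k}
    (h : ¬ (w c = false ∧ v = Function.update w c true)) : ent (opΧ R k c) v w = 0 := by
  rw [ent_opΧ, incidence, if_neg h, zero_smul]

theorem opD_mul_proj_true (c : Crossing k) : opD R k c * proj R k (fun v => v c = true) = 0 :=
  mul_proj_eq_zero fun v w h => ent_opD_eq_zero fun h' => by simp [h] at h'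

theorem proj_mul_opD (c : Crossing k) (p : Vertex k → Prop) (hp : ∀ v, v c = true → ¬ p v) :
    proj R k p * opD R k c = 0 :=
  proj_mul_eq_zero fun v w h => ent_opD_eq_zero fun h' => hp w (by simp [h'.2]) h

theorem proj_opD {c : Crossing k} {p : Vertex k → Prop}
    (hp : ∀ v, p (Function.update v c true) ↔ p v) : Commute (proj R k p) (opD R k c) := by
  refine ent_ext fun v w => ?_
  by_cases h : v c = false ∧ w = Function.update v c true
  · obtain ⟨h1, rfl⟩ := h
    by_cases hv : p v
    · exact (ent_proj_mul ((hp v).2 hv) v).trans (ent_mul_proj hv _).symm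
    · exact (ent_proj_mul_neg (mt (hp v).1 hv) v).trans (ent_mul_proj_neg hv _).symm
  · by_cases hv : p v <;> by_cases hw : p w
    · exact (ent_proj_mul hw v).trans (ent_mul_proj hv w).symm
    · exact (ent_proj_mul_neg hw v).trans ((ent_mul_proj hv w).trans (ent_opD_eq_zero h)).symm
    · exact ((ent_proj_mul hw v).trans (ent_opD_eq_zero h)).trans (ent_mul_proj_neg hv w).symm
    · exact (ent_proj_mul_neg hw v).trans (ent_mul_proj_neg hv w).symm

theorem sub_one_ne {m : Crossing k} (hm : m ≠ 0) : m - 1 ≠ m := by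
  intro h
  have h1 : (m - 1).val = m.val - 1 := Fin.val_sub_one_of_ne_zero hm
  rw [h] at h1
  have : m.val ≠ 0 := fun h => hm (Fin.ext h)
  omega

theorem add_one_ne {m : Crossing k} (hm : m ≠ 0) : m + 1 ≠ m := by
  intro h
  exact sub_one_ne hm (by rw [sub_eq_iff_eq_add, h])

/-- The small circle at level `m` does not meet the crossing `c`. Since a cut does not commute with
the dot on its own circle, `eq_of_one` is not available; the commutator is shown to intertwine each
dot with some operator, and then its values on cups suffice. -/
theorem opD_opC {c m : Crossing k} (h1 : c ≠ m) (h2 : c ≠ m - 1) :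
    Commute (opD R k c) (opC R k m) := by
  refine sub_eq_zero.1 (eq_zero_of_intertwine ?_ fun v => ?_)
  · rintro ⟨l, s⟩
    by_cases hl : l = m
    · subst hl
      -- By `opC_neck` moving the dot past the cut gives $h-x$ and a projection, and the projection
      -- drops out because it commutes with $d_c$.
      refine ⟨opH R k - opX R k (l, false), ?_⟩
      have hs : opD R k c * opC R k l * opX R k (l, s) - opC R k l * opD R k c * opX R k (l, s) =
          opD R k c * (opC R k l * opX R k (l, false)) -
          opC R k l * opX R k (l, false) * opD R k c := by
        rw [mul_assoc, mul_assoc, (opD_opX _ _).eq, ← mul_assoc (opC R k l), opC_opX_bool l l s false]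
      have hp : Commute (proj R k (Both l)) (opD R k c) := proj_opD fun v => by
        unfold Both
        rw [Function.update_of_ne h1.symm, Function.update_of_ne h2.symm]
      rw [sub_mul, hs, opC_neck, mul_sub, mul_add, sub_mul, add_mul, hp.eq, ← mul_assoc, ← mul_assoc,
        (opD_opH c).eq, (opD_opX c _).eq]
      noncomm_ring
    · refine ⟨opX R k (l, s), ?_⟩
      exact (((opD_opX c _).mul_left (opC_opX hl s)).sub_left
        ((opC_opX hl s).mul_left (opD_opX c _))).eq
  · rw [sub_smul, mul_smul, mul_smul, opC_one, smul_zero, zero_sub, neg_eq_zero]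
    have hY : ∀ w : Vertex k, opC R k m • opY R k c • one R k w = 0 := by
      intro w
      have : c + 1 ≠ m := fun h => h2 (by rw [← h]; abel)
      have : Commute (opC R k m) (opY R k c) :=
        ((opC_opX h1 _).add_right (opC_opX this _)).sub_right (opH_opC m).symm
      rw [commute_smul_comm this, opC_one, smul_zero]
    cases hc : v c
    · rcases zero_or_exists v with rfl | ⟨d, hd⟩
      · rw [opD_one_zero, smul_comm, opC_one, smul_zero]
      · rw [opD_one hc hd, smul_comm, hY, smul_zero]
    · rw [opD_one_of_true hc, smul_zero]

end Cuts
end TorusKh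

/-! ### The contracting homotopies. -/

namespace TorusKh

open Cob

section Contractions

variable {R : Type*} [CommRing R] {k : ℕ}

variable (R k) in
/-- The homotopy that cuts the circle of level `m` and reverses the crossing `m`. -/
noncomputable def kap (m : Crossing k) : End (cubeObj R k) := opΧ R k m * opC R k m

variable (R k) in
/-- The homotopy that reverses the last crossing and cuts the right strand. -/
noncomputable def kapZero : End (cubeObj R k) := opC₀ R k * opΧ R k (Fin.last (2 * k))

theorem opD_proj_false (c : Crossing k) : opD R k c * proj R k (fun v => v c = false) = opD R k c :=
  mul_proj_eq_self fun _ _ h => ent_opD_eq_zero fun h' => h h'.1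

theorem opD_opX_succ (c : Crossing k) (s : Bool) :
    opD R k c * opX R k (c, s) = opD R k c * opX R k (c + 1, s) := by
  rw [← opD_proj_false c, mul_assoc, mul_assoc, (proj_opX _ _).eq, (proj_opX _ _).eq,
    mul_proj_congr (fun _ => opX_comm _ _) (fun _ => opX_comm _ _) fun v hv =>
      opX_one_congr (circ_zero hv s)]

theorem opC_opY_one {m : Crossing k} (hm : m ≠ 0) {v : Vertex k} (h1 : v (m - 1) = true)
    (h2 : v m = true) : opC R k m • opY R k m • one R k v = one R k v := by
  unfold opY
  rw [sub_smul, add_smul, smul_sub, smul_add, opC_opX_one h1 h2,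
    commute_smul_comm (opC_opX (add_one_ne hm) true), commute_smul_comm (opH_opC m).symm, opC_one,
    smul_zero, smul_zero, add_zero, sub_zero]

/-- If the crossing `m - 1` is 1-resolved and `m` is not, $d_m$ splits off the small circle of level
`m`, the cut retains only the term with the dot on it, and $\chi_m$ merges the circle back. In all
other cases one of the factors vanishes on the cup. -/
theorem chi_opC_opD {m : Crossing k} (hm : m ≠ 0) : opΧ R k m * opC R k m * opD R k m =
    proj R k (fun v => v (m - 1) = true ∧ v m = false) := by
  have hX : ∀ l s, l ≠ m → Commute (opΧ R k m * opC R k m * opD R k m) (opX R k (l, s)) := fun l s h =>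
    ((chi_opX _ _).mul_left (opC_opX h _)).mul_left (opD_opX _ _)
  refine eq_of_one ?_ (fun e => proj_opX _ _) fun v => ?_
  · rintro ⟨l, s⟩
    by_cases hl : l = m
    · subst hl
      have h1 := hX (l + 1) s (add_one_ne hm)
      -- The dot on the circle that is cut is first pushed through the crossing to the next level,
      -- where it commutes with everything, and then pushed back on the other side.
      have e1 : opΧ R k l * opC R k l * opD R k l * opX R k (l, s) =
          opΧ R k l * opC R k l * opD R k l * opX R k (l + 1, s) := by
        rw [mul_assoc, opD_opX_succ, ← mul_assoc]
      have e2 : opX R k (l, s) * (opΧ R k l * opC R k l * opD R k l) =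
          opX R k (l + 1, s) * (opΧ R k l * opC R k l * opD R k l) := by
        simp only [← mul_assoc]
        rw [opX_succ_chi]
      exact e1.trans (h1.eq.trans e2.symm)
    · exact hX l s hl
  · rw [mul_smul, mul_smul]
    cases h : v m
    swap
    · rw [opD_one_of_true h, smul_zero, smul_zero, proj_one_neg (by simp [h])]
    cases h' : v (m - 1)
    · rw [proj_one_neg (by simp [h'])]
      have hn : ¬ Both m (Function.update v m true) := fun hb => by
        have := hb.1
        rw [Function.update_of_ne (sub_one_ne hm), h'] at this
        exact absurd this (by simp)
      rcases zero_or_exists v with rfl | ⟨d, hd⟩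
      · rw [opD_one_zero, smul_comm (opC R k m), opC_one, smul_zero, smul_zero]
      · rw [opD_one h hd, smul_comm (opC R k m), ← opC_proj, mul_smul, commute_smul_comm (proj_opY _ _),
          proj_one_neg hn]
        simp only [smul_zero]
    · rw [proj_one ⟨h', h⟩, opD_one h h', smul_comm (opC R k m), opC_opY_one hm
        (by rw [Function.update_of_ne (sub_one_ne hm), h']) (update_eq_true m v), smul_comm, chi_one h h',
        smul_smul, sgn_mul_self, one_smul]

theorem opC_mul_opD_pred {m : Crossing k} (hm : m ≠ 0) :
    opD R k (m - 1) * kap R k m = 0 := by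
  have h1 : opC R k m = proj R k (fun v => v (m - 1) = true) * opC R k m :=
    (proj_mul_eq_self fun v w h => by
      by_cases hvw : v = w
      · subst hvw; rw [opC, diag_self]; exact if_neg fun h' => h h'.1
      · rw [opC, diag_ne _ hvw]).symm
  have h2 : opD R k (m - 1) * opΧ R k m = - (opΧ R k m * opD R k (m - 1)) :=
    eq_neg_of_add_eq_zero_left (opD_chi_anticomm (sub_one_ne hm))
  rw [kap, h1, ← mul_assoc, h2, ← mul_assoc, neg_mul, mul_assoc (opΧ R k m), opD_mul_proj_true,
    mul_zero, neg_zero, zero_mul]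

theorem opD_mul_opC (m : Crossing k) : opD R k m * opC R k m = 0 := by
  have h1 : opC R k m = proj R k (fun v => v m = true) * opC R k m :=
    (proj_mul_eq_self fun v w h => by
      by_cases hvw : v = w
      · subst hvw; rw [opC, diag_self]; exact if_neg fun h' => h h'.2
      · rw [opC, diag_ne _ hvw]).symm
  rw [h1, ← mul_assoc, opD_mul_proj_true, zero_mul]

theorem opd_kap {m : Crossing k} (hm : m ≠ 0) : opd R k * kap R k m + kap R k m * opd R k =
    opY R k m * opC R k m + proj R k (fun v => v (m - 1) = true ∧ v m = false) +
      kap R k m * opD R k (m - 1) := by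
  unfold opd
  rw [Finset.sum_mul, Finset.mul_sum, ← Finset.sum_add_distrib,
    Finset.sum_eq_add m (m - 1) (sub_one_ne hm).symm _ (by simp) (by simp), opC_mul_opD_pred hm,
    zero_add]
  · congr 1
    have h1 : opD R k m * kap R k m = opY R k m * opC R k m := by
      rw [kap, ← mul_assoc, eq_sub_of_add_eq (opD_chi_self m), sub_mul, mul_assoc (opΧ R k m),
        opD_mul_opC, mul_zero, sub_zero]
    rw [h1, ← chi_opC_opD hm, kap]
  · rintro c - ⟨h1, h2⟩
    rw [kap, ← mul_assoc, eq_neg_of_add_eq_zero_left (opD_chi_anticomm h1), mul_assoc _ (opC R k m),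
      ← (opD_opC h1 h2).eq, neg_mul, mul_assoc, neg_add_cancel]

variable (k) in
/-- The vertex with a `1`-resolution at the last crossing only. -/
def lastVertex : Vertex k := Function.update (fun _ => false) (Fin.last (2 * k)) true

theorem opC₀_mul_opD (c : Crossing k) : opC₀ R k * opD R k c = 0 := by
  rw [← opC₀_proj, mul_assoc, proj_mul_opD c _ (fun v h h' => by subst h'; simp at h), mul_zero]

theorem opC₀_opH : Commute (opC₀ R k) (opH R k) := commute_diag_diag fun v => by
  split_ifs
  · exact (sph_comm _).symm
  · rw [Limits.comp_zero, Limits.zero_comp]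

theorem opC₀_opY_one (c : Crossing k) :
    opC₀ R k • opY R k c • one R k (fun _ => false) = one R k (fun _ => false) := by
  unfold opY
  rw [sub_smul, add_smul, smul_sub, smul_add, commute_smul_comm (opC₀_opX _), opC₀_one, smul_zero,
    zero_add, opC₀_opX_one, commute_smul_comm opC₀_opH, opC₀_one, smul_zero, sub_zero]

/-- At `lastVertex`, $\chi$ splits the only circle, the cut retains the term with the dot on the
right circle, and $d$ merges again. At any other vertex $\chi$ gives zero or an undotted cup, which
the cut kills. -/
theorem chi_opC₀_opD : opD R k (Fin.last (2 * k)) * kapZero R k =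
    proj R k (fun v => v = lastVertex k) := by
  set n := Fin.last (2 * k) with hn
  have hX : ∀ l, Commute (opD R k n * kapZero R k) (opX R k (l, false)) := fun l =>
    (opD_opX _ _).mul_left ((opC₀_opX l).mul_left (chi_opX _ _))
  -- The cut lives at the zero vertex, and the last saddle leads from there to `lastVertex`, where
  -- left and right dots agree. Behind a `χ` they agree as well, so right dots reduce to left dots
  -- on both sides.
  have hp : opD R k n * opC₀ R k = proj R k (fun v => v = lastVertex k) * (opD R k n * opC₀ R k) := by
    have h0 : opD R k n * proj R k (fun v => v = fun _ => false) = proj R k (fun v => v = lastVertex k) *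
        (opD R k n * proj R k (fun v => v = fun _ => false)) := by
      refine (proj_mul_eq_self (T := opD R k n * proj R k (fun v => v = fun _ => false))
        fun v w h => ?_).symm
      by_cases hv : v = fun _ => false
      · refine (ent_mul_proj (p := fun v => v = fun _ => false) hv w).trans (ent_opD_eq_zero fun h' => ?_)
        subst hv
        exact h h'.2
      · exact ent_mul_proj_neg (p := fun v => v = fun _ => false) hv w
    rw [← proj_mul_opC₀, ← mul_assoc, ← mul_assoc, ← h0]
  refine eq_of_one ?_ (fun e => proj_opX _ _) fun v => ?_
  · rintro ⟨l, s⟩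
    cases s
    · exact hX l
    have e1 : opD R k n * kapZero R k * opX R k (l, true) =
        opD R k n * kapZero R k * opX R k (l, false) := by
      unfold kapZero
      rw [mul_assoc, mul_assoc, (chi_opX _ _).eq, opX_bool_chi l true false, ← (chi_opX _ _).eq,
        ← mul_assoc, ← mul_assoc, ← mul_assoc]
    have e2 : opX R k (l, true) * (opD R k n * kapZero R k) =
        opX R k (l, false) * (opD R k n * kapZero R k) := by
      unfold kapZero
      rw [← mul_assoc (opD R k n), ← mul_assoc, ← mul_assoc (opX R k (l, false)), hp, ← mul_assoc,
        ← mul_assoc (opX R k (l, false)), opX_bool_proj (fun v hv => ⟨n, by simp [hv, lastVertex, hn]⟩)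
          l true false]
    exact e1.trans ((hX l).eq.trans e2.symm)
  · rw [kapZero, mul_smul, mul_smul]
    by_cases hv : v = lastVertex k
    · subst hv
      rw [proj_one (p := fun v => v = lastVertex k) rfl, lastVertex, chi_one_single,
        smul_comm (opC₀ R k), opC₀_opY_one, smul_comm (opD R k n), opD_one_zero, smul_smul,
        sgn_mul_self, one_smul]
    · rw [proj_one_neg (p := fun v => v = lastVertex k) hv]
      cases h : v n
      · rw [chi_one_of_false h, smul_zero, smul_zero]
      obtain ⟨u, hu, rfl⟩ := exists_update h
      rcases zero_or_exists u with rfl | ⟨d, hd⟩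
      · exact absurd rfl hv
      · rw [chi_one hu hd, smul_comm (opC₀ R k), opC₀_one, smul_zero, smul_zero]

/-- No differential ends at the zero vertex, so one half of the anticommutator is diagonal. In the
other half the last crossing gives the projection, and every other crossing moves the single
1-resolution to a lower position. -/
theorem opd_kapZero : opd R k * kapZero R k + kapZero R k * opd R k =
    opC₀ R k * opY R k (Fin.last (2 * k)) + proj R k (fun v => v = lastVertex k) +
      ∑ c ∈ Finset.univ.erase (Fin.last (2 * k)), opD R k c * kapZero R k := by
  have h1 : kapZero R k * opd R k = opC₀ R k * opY R k (Fin.last (2 * k)) := by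
    unfold opd kapZero
    rw [Finset.mul_sum, Finset.sum_eq_single (Fin.last (2 * k)) _ (by simp)]
    · rw [mul_assoc, eq_sub_of_add_eq' (opD_chi_self _), mul_sub, ← mul_assoc _ (opD R k _),
        opC₀_mul_opD, zero_mul, sub_zero]
    · intro c _ hc
      rw [mul_assoc, eq_neg_of_add_eq_zero_right (opD_chi_anticomm hc), mul_neg, ← mul_assoc,
        opC₀_mul_opD, zero_mul, neg_zero]
  rw [h1]
  unfold opd
  rw [Finset.sum_mul, ← Finset.add_sum_erase _ _ (Finset.mem_univ (Fin.last (2 * k))), chi_opC₀_opD]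
  abel

end Contractions

/-! ### Triangularity with respect to the height. -/

section Triangular

variable {R : Type*} [CommRing R] {k : ℕ}

/-- The sum of the positions of the `1`-resolutions. -/
def height (v : Vertex k) : ℤ := ∑ c, if v c = true then (c.val : ℤ) else 0

theorem height_update {v : Vertex k} {c : Crossing k} (h : v c = false) :
    height (Function.update v c true) = height v + c.val := by
  unfold height
  rw [← Finset.add_sum_erase _ _ (Finset.mem_univ c), ← Finset.add_sum_erase _ (fun c => if v c = true
    then (c.val : ℤ) else 0) (Finset.mem_univ c)]
  rw [Function.update_self, if_pos rfl, if_neg (by simp [h]), zero_add, add_comm]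
  refine congrArg (· + _) (Finset.sum_congr rfl fun i hi => ?_)
  rw [Function.update_of_ne (Finset.ne_of_mem_erase hi)]

/-- An endomorphism whose entries shift the height by `a`. -/
def Shifts (T : End (cubeObj R k)) (a : ℤ) : Prop :=
  ∀ v w, ent T v w ≠ 0 → height w = height v + a

/-- An endomorphism whose entries lower the height. -/
def Lowers (T : End (cubeObj R k)) : Prop := ∀ v w, ent T v w ≠ 0 → height w < height v

/-- An endomorphism whose entries between different vertices vanish. -/
def IsDiag (T : End (cubeObj R k)) : Prop := ∀ v w, v ≠ w → ent T v w = 0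

theorem Shifts.mul {S T : End (cubeObj R k)} {a b : ℤ} (hS : Shifts S a) (hT : Shifts T b) :
    Shifts (S * T) (a + b) := by
  intro v w h
  rw [ent_mul] at h
  obtain ⟨u, -, hu⟩ := Finset.exists_ne_zero_of_sum_ne_zero h
  have h1 := hT v u fun h => hu (by rw [h, Limits.zero_comp])
  have h2 := hS u w fun h => hu (by rw [h, Limits.comp_zero])
  rw [h2, h1]; ring

theorem IsDiag.shifts {T : End (cubeObj R k)} (hT : IsDiag T) : Shifts T 0 := by
  intro v w h
  by_cases hvw : v = w
  · subst hvw; rw [add_zero]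
  · exact absurd (hT v w hvw) h

theorem isDiag_diag (φ : ∀ v : Vertex k, vobj R v ⟶ vobj R v) : IsDiag (diag φ) := fun _ _ h =>
  diag_ne φ h

theorem isDiag_iff {T : End (cubeObj R k)} : IsDiag T ↔ T = diag fun v => ent T v v := by
  refine ⟨fun h => ent_ext fun v w => ?_, fun h => h ▸ isDiag_diag _⟩
  by_cases hvw : v = w
  · subst hvw; rw [diag_self]
  · rw [diag_ne _ hvw]; exact h v w hvw

theorem IsDiag.mul {S T : End (cubeObj R k)} (hS : IsDiag S) (hT : IsDiag T) : IsDiag (S * T) := by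
  rw [isDiag_iff.1 hS, isDiag_iff.1 hT, diag_mul]
  exact isDiag_diag _

theorem IsDiag.sub {S T : End (cubeObj R k)} (hS : IsDiag S) (hT : IsDiag T) : IsDiag (S - T) :=
  fun v w h => by rw [ent_sub, hS v w h, hT v w h, sub_zero]

theorem IsDiag.one : IsDiag (1 : End (cubeObj R k)) := diag_id (R := R) (k := k) ▸ isDiag_diag _

theorem IsDiag.opY (c : Crossing k) : IsDiag (opY R k c) := opY_eq_diag (R := R) c ▸ isDiag_diag _

theorem IsDiag.opC (m : Crossing k) : IsDiag (opC R k m) := isDiag_diag _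

theorem IsDiag.opC₀ : IsDiag (opC₀ R k) := isDiag_diag _

theorem IsDiag.proj (p : Vertex k → Prop) : IsDiag (proj R k p) := isDiag_diag _

theorem shifts_opD (c : Crossing k) : Shifts (opD R k c) c.val := by
  intro v w h
  by_cases h' : v c = false ∧ w = Function.update v c true
  · rw [h'.2, height_update h'.1]
  · exact absurd (ent_opD_eq_zero h') h

theorem shifts_chi (c : Crossing k) : Shifts (opΧ R k c) (-c.val) := by
  intro v w h
  by_cases h' : w c = false ∧ v = Function.update w c true
  · rw [h'.2, height_update h'.1]; ring
  · exact absurd (ent_chi_eq_zero h') h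

theorem Shifts.lowers {T : End (cubeObj R k)} {a : ℤ} (h : Shifts T a) (ha : a < 0) : Lowers T :=
  fun v w hvw => by rw [h v w hvw]; linarith

theorem Lowers.add {S T : End (cubeObj R k)} (hS : Lowers S) (hT : Lowers T) : Lowers (S + T) := by
  intro v w h
  by_cases h1 : ent S v w = 0
  · exact hT v w fun h2 => h (by rw [ent_add, h1, h2, add_zero])
  · exact hS v w h1

theorem Lowers.neg {T : End (cubeObj R k)} (hT : Lowers T) : Lowers (-T) := by
  intro v w h
  exact hT v w fun h2 => h (by rw [ent_neg, h2, neg_zero])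

theorem Lowers.sum {ι : Type*} {s : Finset ι} {T : ι → End (cubeObj R k)} (hT : ∀ i ∈ s, Lowers (T i)) :
    Lowers (∑ i ∈ s, T i) := by
  classical
  induction s using Finset.induction_on with
  | empty => intro v w h; exact absurd rfl h
  | insert a s ha ih =>
    rw [Finset.sum_insert ha]
    exact (hT a (Finset.mem_insert_self _ _)).add (ih fun i hi => hT i (Finset.mem_insert_of_mem hi))

theorem Lowers.mul {S T : End (cubeObj R k)} (hS : Lowers S) (hT : Lowers T) : Lowers (S * T) := by
  intro v w h
  rw [ent_mul] at h
  obtain ⟨u, -, hu⟩ := Finset.exists_ne_zero_of_sum_ne_zero h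
  have h1 := hT v u fun h => hu (by rw [h, Limits.zero_comp])
  have h2 := hS u w fun h => hu (by rw [h, Limits.comp_zero])
  exact h2.trans h1

theorem Lowers.mul_diag {S T : End (cubeObj R k)} (hS : Lowers S) (hT : IsDiag T) : Lowers (S * T) := by
  intro v w h
  rw [ent_mul] at h
  obtain ⟨u, -, hu⟩ := Finset.exists_ne_zero_of_sum_ne_zero h
  have h1 := hT.shifts v u fun h => hu (by rw [h, Limits.zero_comp])
  have h2 := hS u w fun h => hu (by rw [h, Limits.comp_zero])
  linarith

theorem IsDiag.mul_lowers {S T : End (cubeObj R k)} (hS : IsDiag S) (hT : Lowers T) : Lowers (S * T) := by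
  intro v w h
  rw [ent_mul] at h
  obtain ⟨u, -, hu⟩ := Finset.exists_ne_zero_of_sum_ne_zero h
  have h1 := hT v u fun h => hu (by rw [h, Limits.zero_comp])
  have h2 := hS.shifts u w fun h => hu (by rw [h, Limits.comp_zero])
  linarith

/-- A lowering endomorphism is nilpotent. -/
theorem Lowers.exists_pow_eq_zero {T : End (cubeObj R k)} (hT : Lowers T) : ∃ N : ℕ, T ^ N = 0 := by
  -- Each factor lowers the height by at least 1, and heights lie between 0 and the sum of all
  -- positions.
  have key : ∀ (i : ℕ) (v w : Vertex k), ent (T ^ i) v w ≠ 0 → height w + i ≤ height v := by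
    intro i
    induction i with
    | zero =>
      intro v w h
      rw [pow_zero] at h
      by_cases hvw : v = w
      · subst hvw; simp
      · exact absurd (IsDiag.one v w hvw) h
    | succ i ih =>
      intro v w h
      rw [pow_succ, ent_mul] at h
      obtain ⟨u, -, hu⟩ := Finset.exists_ne_zero_of_sum_ne_zero h
      have h1 := hT v u fun h => hu (by rw [h, Limits.zero_comp])
      have h2 := ih u w fun h => hu (by rw [h, Limits.comp_zero])
      push_cast
      linarith
  have hb : ∀ v : Vertex k, 0 ≤ height v ∧ height v ≤ ∑ c : Crossing k, (c.val : ℤ) := fun v =>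
    ⟨Finset.sum_nonneg fun c _ => by split_ifs <;> simp,
      Finset.sum_le_sum fun c _ => by split_ifs <;> simp⟩
  refine ⟨(∑ c : Crossing k, c.val) + 1, ent_ext fun v w => ?_⟩
  by_contra h
  have h1 := key _ v w h
  have h2 := hb v
  have h3 := hb w
  push_cast at h1
  linarith

/-- `δ` is the diagonal part of the lower triangular endomorphism `T`. -/
def DiagPart (T δ : End (cubeObj R k)) : Prop := IsDiag δ ∧ Lowers (T - δ)

theorem DiagPart.one : DiagPart (1 : End (cubeObj R k)) 1 :=
  ⟨IsDiag.one, fun v w h => absurd (by rw [sub_self]; rfl) h⟩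

theorem DiagPart.mul {S T δ ε : End (cubeObj R k)} (hS : DiagPart S δ) (hT : DiagPart T ε) :
    DiagPart (S * T) (δ * ε) := by
  refine ⟨hS.1.mul hT.1, ?_⟩
  have : S * T - δ * ε = (S - δ) * (T - ε) + ((S - δ) * ε + δ * (T - ε)) := by noncomm_ring
  rw [this]
  exact (hS.2.mul hT.2).add ((hS.2.mul_diag hT.1).add (hS.1.mul_lowers hT.2))

end Triangular

section Twists

variable (R : Type*) [CommRing R] (k : ℕ)

/-- The homotopy at the level `m`. -/
noncomputable def homot (m : Crossing k) : End (cubeObj R k) := if m = 0 then kapZero R k else kap R k m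

/-- The chain map that is homotopic to the identity by `homot`. -/
noncomputable def twist (m : Crossing k) : End (cubeObj R k) :=
  1 - (opd R k * homot R k m + homot R k m * opd R k)

/-- The diagonal part of `twist`. -/
noncomputable def twistDiag (m : Crossing k) : End (cubeObj R k) :=
  if m = 0 then 1 - (opC₀ R k * opY R k (Fin.last (2 * k)) + proj R k (fun v => v = lastVertex k))
  else 1 - (opY R k m * opC R k m + proj R k (fun v => v (m - 1) = true ∧ v m = false))

variable {R k}

/-- The off-diagonal terms of `opd_kap` and `opd_kapZero` move a 1-resolution to a smaller position,
so they lower the height. -/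
theorem twist_diagPart (m : Crossing k) : DiagPart (twist R k m) (twistDiag R k m) := by
  unfold twist twistDiag homot
  by_cases hm : m = 0
  · simp only [if_pos hm]
    refine ⟨IsDiag.one.sub ?_, ?_⟩
    · intro v w h
      rw [ent_add, (IsDiag.opC₀.mul (IsDiag.opY _)) v w h, IsDiag.proj _ v w h, add_zero]
    · rw [opd_kapZero, sub_sub_sub_cancel_left, sub_add_cancel_left]
      refine (Lowers.sum fun c hc => ?_).neg
      have h1 : Shifts (opD R k c * kapZero R k) (c.val + (0 + -(Fin.last (2 * k)).val)) :=
        (shifts_opD c).mul (IsDiag.opC₀.shifts.mul (shifts_chi _))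
      refine h1.lowers ?_
      have h2 : c ≠ Fin.last (2 * k) := Finset.ne_of_mem_erase hc
      have h3 : c.val < 2 * k := by
        have := c.2
        have h4 : c.val ≠ 2 * k := fun h => h2 (Fin.ext h)
        omega
      simp only [Fin.val_last]
      push_cast
      omega
  · simp only [if_neg hm]
    refine ⟨IsDiag.one.sub ?_, ?_⟩
    · intro v w h
      rw [ent_add, ((IsDiag.opY _).mul (IsDiag.opC _)) v w h, IsDiag.proj _ v w h, add_zero]
    · rw [opd_kap hm, sub_sub_sub_cancel_left, sub_add_cancel_left]
      have h1 : Shifts (kap R k m * opD R k (m - 1)) (-m.val + 0 + (m - 1).val) :=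
        ((shifts_chi m).mul (IsDiag.opC m).shifts).mul (shifts_opD _)
      refine (h1.lowers ?_).neg
      have h2 : (m - 1).val = m.val - 1 := Fin.val_sub_one_of_ne_zero hm
      have h3 : m.val ≠ 0 := fun h => hm (Fin.ext h)
      omega

end Twists
end TorusKh

/-! ### Monotone vertices and the diagonal part of the twists. -/

namespace TorusKh

open Cob

section Monotone

variable {k : ℕ}

/-- The vertices whose `1`-resolutions are at the last crossings. -/
def Mono (v : Vertex k) : Prop := ∀ m : Crossing k, m ≠ 0 → v (m - 1) = true → v m = true

theorem Mono.le {v : Vertex k} (hv : Mono v) {i j : Crossing k} (h : i ≤ j) (hi : v i = true) :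
    v j = true := by
  have : ∀ d : ℕ, ∀ j : Crossing k, j.val = i.val + d → v j = true := by
    intro d
    induction d with
    | zero => intro j hj; rwa [show j = i from Fin.ext hj]
    | succ d ih =>
      intro j hj
      have hj0 : j ≠ 0 := fun h => by rw [h] at hj; simp at hj
      exact hv j hj0 (ih _ (by rw [Fin.val_sub_one_of_ne_zero hj0]; omega))
  exact this (j.val - i.val) j (by have : i.val ≤ j.val := h; omega)

theorem weight_eq_zero {v : Vertex k} : v.weight = 0 ↔ v = fun _ => false := by
  unfold Vertex.weight
  rw [Finset.card_eq_zero, Finset.filter_eq_empty_iff]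
  refine ⟨fun h => funext fun c => by simpa using h (Finset.mem_univ c), ?_⟩
  rintro rfl c - h
  simp at h

theorem weight_update {v : Vertex k} {c : Crossing k} (h : v c = false) :
    Vertex.weight (Function.update v c true) = v.weight + 1 := by
  unfold Vertex.weight
  have : (Finset.univ.filter fun i => Function.update v c true i = true)
      = insert c (Finset.univ.filter fun i => v i = true) := by
    ext i
    by_cases hi : i = c
    · subst hi; simp
    · simp [hi]
  rw [this, Finset.card_insert_of_notMem (by simp [h])]

theorem weight_le (v : Vertex k) : v.weight ≤ 2 * k + 1 :=
  (Finset.card_le_univ _).trans (by simp)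

theorem Mono.last {v : Vertex k} (hv : Mono v) (h : v.weight ≠ 0) : v (Fin.last (2 * k)) = true := by
  rcases zero_or_exists v with rfl | ⟨c, hc⟩
  · exact absurd (weight_eq_zero.2 rfl) h
  · exact hv.le (Fin.le_last c) hc

theorem eq_lastVertex {v : Vertex k} (hv : v (Fin.last (2 * k)) = true) (h : v.weight = 1) :
    v = lastVertex k := by
  obtain ⟨u, hu, rfl⟩ := exists_update hv
  rw [weight_update hu] at h
  rw [weight_eq_zero.1 (by omega : u.weight = 0)]
  rfl

theorem weight_lastVertex : (lastVertex k).weight = 1 := by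
  rw [lastVertex, weight_update rfl, weight_eq_zero.2 rfl]

/-- Among the vertices of the same weight, the monotone one has the largest height. -/
theorem Mono.height_lt {v w : Vertex k} (hv : Mono v) (hw : w.weight = v.weight) (hne : w ≠ v) :
    height w < height v := by
  classical
  set A := Finset.univ.filter fun c => v c = true with hA
  set B := Finset.univ.filter fun c => w c = true with hB
  have hcard : B.card = A.card := hw
  have hh : ∀ u : Vertex k, height u = ∑ c ∈ Finset.univ.filter (fun c => u c = true), (c.val : ℤ) :=
    fun u => (Finset.sum_filter _ _).symm
  rw [hh, hh, ← hA, ← hB, ← Finset.sum_sdiff (Finset.inter_subset_left : A ∩ B ⊆ A),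
    ← Finset.sum_sdiff (Finset.inter_subset_right : A ∩ B ⊆ B)]
  refine add_lt_add_left ?_ _
  have hAB : (A \ (A ∩ B)).card = (B \ (A ∩ B)).card := by
    rw [Finset.card_sdiff_of_subset Finset.inter_subset_left,
      Finset.card_sdiff_of_subset Finset.inter_subset_right, hcard]
  -- The 1-resolutions of a monotone vertex form an upper set, so whatever `w` has outside it lies
  -- below whatever it misses. The two differences have the same size, and comparing with the least
  -- element of $A\setminus B$ finishes the proof.
  have hlt : ∀ x ∈ B \ (A ∩ B), ∀ y ∈ A \ (A ∩ B), x < y := by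
    intro x hx y hy
    simp only [hA, hB, Finset.mem_sdiff, Finset.mem_inter, Finset.mem_filter, Finset.mem_univ,
      true_and, not_and, Bool.not_eq_true] at hx hy
    by_contra h
    have := hv.le (not_lt.1 h) hy.1
    exact absurd hx.1 (by rw [hx.2 this]; simp)
  have hpos : (A \ (A ∩ B)).Nonempty := by
    by_contra h
    rw [Finset.not_nonempty_iff_eq_empty] at h
    have h' : B \ (A ∩ B) = ∅ := by rw [← Finset.card_eq_zero, ← hAB, h]; rfl
    apply hne
    have hs : A = B := Finset.Subset.antisymm
      (fun c hc => by
        by_contra hcb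
        have : c ∈ A \ (A ∩ B) := by simp [hc, hcb]
        rw [h] at this; simp at this)
      (fun c hc => by
        by_contra hcb
        have : c ∈ B \ (A ∩ B) := by simp [hc, hcb]
        rw [h'] at this; simp at this)
    funext c
    have : c ∈ A ↔ c ∈ B := by rw [hs]
    simp only [hA, hB, Finset.mem_filter, Finset.mem_univ, true_and] at this
    cases h1 : v c <;> cases h2 : w c <;> simp_all
  obtain ⟨y, hy, hmin⟩ := Finset.exists_min_image _ (fun c : Crossing k => (c.val : ℤ)) hpos
  have h1 : ∑ c ∈ B \ (A ∩ B), (c.val : ℤ) < ∑ c ∈ B \ (A ∩ B), (y.val : ℤ) := by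
    refine Finset.sum_lt_sum_of_nonempty ?_ fun c hc => ?_
    · rw [← Finset.card_pos, ← hAB, Finset.card_pos]; exact hpos
    · exact_mod_cast hlt c hc y hy
  refine h1.trans_le ?_
  rw [Finset.sum_const, ← hAB, ← Finset.sum_const]
  exact Finset.sum_le_sum hmin

end Monotone

section Diagonal

variable (R : Type*) [CommRing R] (k : ℕ)

/-- The composite of the twists at the levels `1, …, j`. -/
noncomputable def twists : ℕ → End (cubeObj R k)
  | 0 => 1
  | j + 1 => twist R k (passed k (j + 1)) * twists j

/-- The diagonal part of `twists`. -/
noncomputable def twistDiags : ℕ → End (cubeObj R k)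
  | 0 => 1
  | j + 1 => twistDiag R k (passed k (j + 1)) * twistDiags j

variable {R k}

theorem twists_diagPart (j : ℕ) : DiagPart (twists R k j) (twistDiags R k j) := by
  induction j with
  | zero => exact DiagPart.one
  | succ j ih => exact (twist_diagPart _).mul ih

theorem passed_ne_zero {j : ℕ} (h : 0 < j) (h' : j ≤ 2 * k) : passed k j ≠ 0 := by
  intro h0
  have := congrArg Fin.val h0
  rw [passed_val_of_lt (by omega)] at this
  simp at this
  omega

theorem IsDiag.commute_proj {T : End (cubeObj R k)} (hT : IsDiag T) (p : Vertex k → Prop) :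
    Commute T (TorusKh.proj R k p) := by rw [isDiag_iff.1 hT]; exact commute_diag_proj _ _

theorem proj_mul_proj {p q : Vertex k → Prop} (h : ∀ v, q v → p v) :
    proj R k p * proj R k q = proj R k q := by
  refine (mul_proj_congr (S := proj R k p) (T := 1) (fun _ => proj_opX _ _)
    (fun _ => Commute.one_left _) fun v hv => ?_).trans (one_mul _)
  rw [proj_one (h v hv), one_smul]

theorem proj_mul_proj_disjoint {p q : Vertex k → Prop} (h : ∀ v, q v → ¬ p v) :
    proj R k p * proj R k q = 0 := by
  refine (mul_proj_congr (S := proj R k p) (T := 0) (fun _ => proj_opX _ _)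
    (fun _ => Commute.zero_left _) fun v hv => ?_).trans (zero_mul _)
  rw [proj_one_neg (h v hv), zero_smul]

theorem opC_mul_proj {m : Crossing k} {q : Vertex k → Prop} (h : ∀ v, q v → ¬ Both m v) :
    opC R k m * proj R k q = 0 := by
  rw [← opC_proj, mul_assoc, proj_mul_proj_disjoint h, mul_zero]

theorem opC₀_mul_proj {q : Vertex k → Prop} (h : ∀ v, q v → v ≠ fun _ => false) :
    opC₀ R k * proj R k q = 0 := by
  rw [← opC₀_proj, mul_assoc, proj_mul_proj_disjoint h, mul_zero]

variable (R) in
/-- The projection to a vertex. -/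
noncomputable abbrev vertexProj (v : Vertex k) : End (cubeObj R k) := proj R k (fun w => w = v)

theorem twistDiag_mul_at {m : Crossing k} (hm : m ≠ 0) {v : Vertex k}
    (h : ¬ (v (m - 1) = true ∧ v m = false)) :
    twistDiag R k m * vertexProj R v = vertexProj R v - opY R k m * opC R k m * vertexProj R v := by
  rw [twistDiag, if_neg hm, sub_mul, one_mul, add_mul, proj_mul_proj_disjoint (q := fun w => w = v)
    (fun w hw => by subst hw; exact h), add_zero]

theorem twistDiag_mul_at_eq_zero {m : Crossing k} (hm : m ≠ 0) {v : Vertex k}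
    (h : v (m - 1) = true ∧ v m = false) : twistDiag R k m * vertexProj R v = 0 := by
  rw [twistDiag, if_neg hm, sub_mul, one_mul, add_mul, proj_mul_proj (q := fun w => w = v)
    (fun w hw => by subst hw; exact h), mul_assoc, opC_mul_proj, mul_zero, zero_add, sub_self]
  rintro w rfl hb
  exact absurd h.2 (by rw [hb.2]; simp)

theorem IsDiag.twistDiags (j : ℕ) : IsDiag (twistDiags R k j) := (twists_diagPart j).1

/-- A vertex that is not monotone has a 1-resolution at some `m - 1` followed by a 0-resolution at
`m`, and the diagonal part at level `m` kills it. The other factors are diagonal, so they keep the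
vertex. -/
theorem twistDiags_mul_at_eq_zero {v : Vertex k} (h : ¬ Mono v) : twistDiags R k (2 * k) * vertexProj R v = 0 := by
  unfold Mono at h
  push Not at h
  obtain ⟨m, hm, h1, h2⟩ := h
  have hm0 : m.val ≠ 0 := fun h => hm (Fin.ext h)
  have key : ∀ j, m.val ≤ j → twistDiags R k j * vertexProj R v = 0 := by
    refine Nat.le_induction ?_ fun j _ ih => ?_
    · obtain ⟨i, hi⟩ := Nat.exists_eq_add_one_of_ne_zero hm0
      rw [hi, twistDiags, ← hi, passed_val, mul_assoc,
        ((IsDiag.twistDiags i).commute_proj _).eq, ← mul_assoc,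
        twistDiag_mul_at_eq_zero hm ⟨h1, by simpa using h2⟩, zero_mul]
    · rw [twistDiags, mul_assoc, ih, mul_zero]
  exact key _ (by have := m.2; omega)

theorem twistDiags_mul_at_zero (j : ℕ) (hj : j ≤ 2 * k) :
    twistDiags R k j * vertexProj R (fun _ => false) = vertexProj R (fun _ => false) := by
  induction j with
  | zero => exact one_mul _
  | succ j ih =>
    rw [twistDiags, mul_assoc, ih (by omega), twistDiag_mul_at (passed_ne_zero (by omega) hj) (by simp),
      mul_assoc, opC_mul_proj, mul_zero, sub_zero]
    rintro w rfl hb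
    exact absurd hb.2 (by simp)

/-- With $x_L,x_R$ the dots of the two strands, neck-cutting gives $C_0x_R=1+hC_0-x_RC_0$ at the
zero vertex, while $x_L$ commutes with $C_0$. Substituting, $1-C_0(x_L+x_R-h)=(x_R-x_L)C_0$. -/
theorem twistDiag_zero_mul_at_zero : twistDiag R k 0 * vertexProj R (fun _ => false) =
    (opX R k (0, true) - opX R k (0, false)) * opC₀ R k * vertexProj R (fun _ => false) := by
  have h1 : opC₀ R k * opY R k (Fin.last (2 * k)) = opX R k (0, false) * opC₀ R k +
      (vertexProj R (fun _ => false) + opH R k * opC₀ R k - opX R k (0, true) * opC₀ R k) -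
        opC₀ R k * opH R k := by
    have h2 : opC₀ R k * opX R k (Fin.last (2 * k), false) = opX R k (0, false) * opC₀ R k := by
      rw [← (opC₀_opX 0).eq, ← opC₀_proj, mul_assoc, mul_assoc, (proj_opX _ _).eq, (proj_opX _ _).eq,
        mul_proj_congr (T := opX R k (0, false)) (fun _ => opX_comm _ _) (fun _ => opX_comm _ _)
        fun v hv => by subst hv; exact opX_one_congr (circ_zero_level _ _ _)]
    rw [opY, Fin.last_add_one, mul_sub, mul_add, h2, opC₀_neck]
  have h3 : proj R k (fun v => v = lastVertex k) * vertexProj R (fun _ => false) = 0 :=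
    proj_mul_proj_disjoint fun v hv h => by
      rw [hv] at h
      have := congrFun h (Fin.last (2 * k))
      simp [lastVertex] at this
  have h4 : vertexProj R (fun _ => false : Vertex k) * vertexProj R (fun _ => false) = vertexProj R (fun _ => false) :=
    proj_mul_proj fun _ h => h
  rw [twistDiag, if_pos rfl, h1, sub_mul, one_mul, add_mul, h3, (opC₀_opH).eq, sub_mul, add_mul, sub_mul,
    add_mul, h4, sub_mul, sub_mul]
  abel

/-- This is why the small model has no summand in degree 1: the only monotone vertex of weight one
is cancelled. -/
theorem twistDiag_zero_mul_at_last : twistDiag R k 0 * vertexProj R (lastVertex k) = 0 := by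
  have h1 : proj R k (fun v => v = lastVertex k) * vertexProj R (lastVertex k) = vertexProj R (lastVertex k) :=
    proj_mul_proj fun _ h => h
  have h2 : opC₀ R k * vertexProj R (lastVertex k) = 0 := opC₀_mul_proj fun v hv h => by
    rw [hv] at h
    have := congrFun h (Fin.last (2 * k))
    simp [lastVertex] at this
  rw [twistDiag, if_pos rfl, sub_mul, one_mul, add_mul, mul_assoc, (proj_opY _ _).symm.eq, ← mul_assoc,
    h2, zero_mul, zero_add, h1, sub_self]

theorem twistDiag_zero_mul_at {v : Vertex k} (h1 : v ≠ fun _ => false) (h2 : v ≠ lastVertex k) :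
    twistDiag R k 0 * vertexProj R v = vertexProj R v := by
  have h3 : proj R k (fun v => v = lastVertex k) * vertexProj R v = 0 :=
    proj_mul_proj_disjoint fun w hw h => h2 (hw ▸ h)
  have h4 : opC₀ R k * vertexProj R v = 0 := opC₀_mul_proj fun w hw h => h1 (hw ▸ h)
  rw [twistDiag, if_pos rfl, sub_mul, one_mul, add_mul, mul_assoc, (proj_opY _ _).symm.eq, ← mul_assoc,
    h4, zero_mul, zero_add, h3, sub_zero]

/-- On the cup, $Y_m$ is up to sign the image of a cup under $d_m$, and before this saddle the
levels `m` and `m + 1` lie on the same circle. -/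
theorem opY_sub_mul_at {m : Crossing k} (hm : m ≠ 0) {v : Vertex k} (h : Both m v) :
    opY R k m * (opX R k (m, false) - opX R k (m + 1, false)) * vertexProj R v = 0 := by
  refine (mul_proj_congr (T := 0) (fun e => (opY_opX _ _).mul_left ((opX_comm _ _).sub_left
    (opX_comm _ _))) (fun e => Commute.zero_left _) fun w hw => ?_).trans (zero_mul _)
  subst hw
  obtain ⟨u, hu, rfl⟩ := exists_update h.2
  have hu' : u (m - 1) = true := by
    have := h.1
    rwa [Function.update_of_ne (sub_one_ne hm)] at this
  have h1 : opY R k m • one R k (Function.update u m true) = sgn m u • opD R k m • one R k u := by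
    rw [opD_one hu hu', smul_smul, sgn_mul_self, one_smul]
  have hc : Commute (opY R k m) (opX R k (m, false) - opX R k (m + 1, false)) :=
    (opY_opX _ _).sub_right (opY_opX _ _)
  have hc' : Commute (opX R k (m, false) - opX R k (m + 1, false)) (opD R k m) :=
    ((opD_opX _ _).sub_right (opD_opX _ _)).symm
  rw [hc.eq, mul_smul, h1, smul_comm, commute_smul_comm hc', sub_smul,
    opX_one_congr (circ_zero hu false), sub_self, smul_zero, smul_zero, zero_smul]

theorem opY_mul_at {m : Crossing k} {v : Vertex k} (h : v m = true) : opY R k m * vertexProj R v =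
    (opX R k (m, false) + opX R k (m + 1, false) - opH R k) * vertexProj R v := by
  rw [opY, sub_mul, add_mul, opX_bool_proj (fun w hw => ⟨m, by rw [hw, h]⟩) (m + 1) true false,
    ← add_mul, ← sub_mul]

/-- The twist removes the small circle at level `m`: behind it a dot on that circle acts as $h$
minus the dot of the next level. This is neck-cutting together with `opY_sub_mul_at`. -/
theorem twistDiag_opX_at {m : Crossing k} (hm : m ≠ 0) {v : Vertex k} (h : Both m v) :
    twistDiag R k m * opX R k (m, false) * vertexProj R v =
      (opH R k - opX R k (m + 1, false)) * (twistDiag R k m * vertexProj R v) := by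
  have hJ : ¬ (v (m - 1) = true ∧ v m = false) := fun h' => by
    have := h.2; rw [h'.2] at this; exact absurd this (by simp)
  have hb : proj R k (Both m) * vertexProj R v = vertexProj R v := proj_mul_proj fun w hw => by rwa [hw]
  have e1 : opC R k m * opX R k (m, false) * vertexProj R v =
      vertexProj R v + (opH R k - opX R k (m, false)) * opC R k m * vertexProj R v := by
    rw [opC_neck, sub_mul, add_mul, hb, sub_mul, sub_mul]
    abel
  have e2 : opY R k m * (opX R k (m, false) - opX R k (m + 1, false)) * opC R k m * vertexProj R v = 0 := by
    rw [mul_assoc, ← (proj_opC (R := R) (fun w => w = v) m).eq, ← mul_assoc, opY_sub_mul_at hm h, zero_mul]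
  rw [mul_assoc, ← (proj_opX (R := R) (fun w => w = v) (m, false)).eq, ← mul_assoc,
    twistDiag_mul_at hm hJ, sub_mul, mul_assoc _ _ (opX R k (m, false)),
    (proj_opX (R := R) (fun w => w = v) (m, false)).eq, mul_assoc (opY R k m), ← mul_assoc (opC R k m),
    e1, mul_add, opY_mul_at h.2]
  have hc : (opH R k - opX R k (m + 1, false)) * opY R k m =
      opY R k m * (opH R k - opX R k (m + 1, false)) :=
    (((opH_opY m).sub_left (opY_opX _ _).symm)).eq
  have e3 : (opH R k - opX R k (m + 1, false)) * (vertexProj R v - opY R k m * opC R k m * vertexProj R v) =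
      (opH R k - opX R k (m + 1, false)) * vertexProj R v -
        opY R k m * (opH R k - opX R k (m + 1, false)) * opC R k m * vertexProj R v := by
    rw [mul_sub, ← hc]; simp only [mul_assoc]
  have e4 : opY R k m * ((opH R k - opX R k (m, false)) * opC R k m * vertexProj R v) =
      opY R k m * (opH R k - opX R k (m + 1, false)) * opC R k m * vertexProj R v -
        opY R k m * (opX R k (m, false) - opX R k (m + 1, false)) * opC R k m * vertexProj R v := by
    noncomm_ring
  rw [e3, e4, e2]
  noncomm_ring

theorem twistDiag_opX {m l : Crossing k} (hm : m ≠ 0) (hl : l ≠ m) (s : Bool) :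
    Commute (twistDiag R k m) (opX R k (l, s)) := by
  rw [twistDiag, if_neg hm]
  exact (Commute.one_left _).sub_left (((opY_opX _ _).mul_left (opC_opX hl s)).add_left (proj_opX _ _))

theorem twistDiags_opX {j : ℕ} (hj : j ≤ 2 * k) {l : Crossing k} (hl : l = 0 ∨ j < l.val) (s : Bool) :
    Commute (twistDiags R k j) (opX R k (l, s)) := by
  induction j with
  | zero => exact Commute.one_left _
  | succ j ih =>
    refine (twistDiag_opX (passed_ne_zero (by omega) hj) (fun h => ?_) s).mul_left
      (ih (by omega) (hl.imp id fun h => by omega))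
    have h1 := congrArg Fin.val h
    rw [passed_val_of_lt (by omega)] at h1
    rcases hl with hl | hl
    · rw [hl] at h1; simp at h1
    · omega

theorem twistDiags_opH (j : ℕ) (hj : j ≤ 2 * k) : Commute (twistDiags R k j) (opH R k) := by
  induction j with
  | zero => exact Commute.one_left _
  | succ j ih =>
    refine Commute.mul_left ?_ (ih (by omega))
    rw [twistDiag, if_neg (passed_ne_zero (by omega) hj)]
    exact (Commute.one_left _).sub_left (((opH_opY _).symm.mul_left (opH_opC _).symm).add_left
      (proj_opH _))

theorem twistDiags_opX_at {m : Crossing k} (hm : m ≠ 0) {v : Vertex k} (h : Both m v) :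
    twistDiags R k (2 * k) * opX R k (m, false) * vertexProj R v =
      twistDiags R k (2 * k) * (opH R k - opX R k (m + 1, false)) * vertexProj R v := by
  have hm0 : m.val ≠ 0 := fun h => hm (Fin.ext h)
  have hmk : m.val ≤ 2 * k := by have := m.2; omega
  have key : ∀ j, m.val ≤ j → twistDiags R k j * opX R k (m, false) * vertexProj R v =
      twistDiags R k j * (opH R k - opX R k (m + 1, false)) * vertexProj R v := by
    refine Nat.le_induction ?_ fun j _ ih => ?_
    · have hc : Commute (twistDiags R k m.val) (opH R k - opX R k (m + 1, false)) := by
        refine (twistDiags_opH _ hmk).sub_right (twistDiags_opX hmk ?_ _)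
        by_cases hl : m = Fin.last (2 * k)
        · left; rw [hl, Fin.last_add_one]
        · right; rw [Fin.val_add_one, if_neg hl]; omega
      rw [hc.eq]
      obtain ⟨i, hi⟩ := Nat.exists_eq_add_one_of_ne_zero hm0
      have hi' : Commute (twistDiags R k i) (opX R k (m, false)) :=
        twistDiags_opX (by omega) (Or.inr (by omega)) _
      have hp := ((IsDiag.twistDiags (R := R) (k := k) i).commute_proj (fun w => w = v)).eq
      rw [hi, twistDiags, ← hi, passed_val, mul_assoc (twistDiag R k m), hi'.eq,
        mul_assoc, mul_assoc, hp, ← mul_assoc, ← mul_assoc, twistDiag_opX_at hm h, mul_assoc, mul_assoc,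
        ← hp, ← mul_assoc, ← mul_assoc, ← mul_assoc]
    · rw [twistDiags, mul_assoc, mul_assoc, ← mul_assoc (twistDiags R k j), ih]
      simp only [mul_assoc]
  exact key _ hmk

theorem circ_initial {v : Vertex k} (l : ℕ) (hl : l ≤ 2 * k) (h : ∀ i : Crossing k, i.val < l → v i = false) :
    circ v (passed k l, false) = circ v (0, false) := by
  induction l with
  | zero => rfl
  | succ l ih =>
    rw [passed_succ, ← circ_zero (h _ (by rw [passed_val_of_lt (by omega)]; omega)),
      ih (by omega) fun i hi => h i (by omega)]

variable (R k) in
/-- The operators generated by the dot at the base point and `h`. -/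
noncomputable def baseRing : Subring (End (cubeObj R k)) :=
  Subring.closure {opX R k (0, false), opH R k}

theorem commute_of_mem_baseRing {T p : End (cubeObj R k)} (h1 : Commute T (opX R k (0, false)))
    (h2 : Commute T (opH R k)) (hp : p ∈ baseRing R k) : Commute T p := by
  have : baseRing R k ≤ Subring.centralizer {T} := by
    refine Subring.closure_le.2 ?_
    rintro S (rfl | rfl) <;> rw [SetLike.mem_coe, Subring.mem_centralizer_iff] <;>
      rintro _ rfl
    · exact h1.eq
    · exact h2.eq
  exact Subring.mem_centralizer_iff.1 (this hp) T rfl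

/-- At a monotone vertex a level either lies on the circle of the base point or carries a small
circle of its own. In the latter case its dot becomes $h$ minus the dot of the next level, and so on
until the walk returns to level 0. Hence every dot becomes a polynomial in $x$ and $h$. -/
theorem exists_twistDiags_opX {v : Vertex k} (hv : Mono v) (h0 : v ≠ fun _ => false) (e : Edge k) :
    ∃ p ∈ baseRing R k, twistDiags R k (2 * k) * opX R k e * vertexProj R v =
      p * twistDiags R k (2 * k) * vertexProj R v := by
  have hX : opX R k (0, false) ∈ baseRing R k := Subring.subset_closure (by simp)
  have hH : opH R k ∈ baseRing R k := Subring.subset_closure (by simp)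
  have hc := twistDiags_opX (R := R) (k := k) le_rfl (l := 0) (Or.inl rfl) false
  obtain ⟨c, hc'⟩ := (zero_or_exists v).resolve_left h0
  -- Induction on the distance to level `2 * k + 1`, which is level 0 again.
  have key : ∀ d l : ℕ, l + d = 2 * k + 1 → ∃ p ∈ baseRing R k,
      twistDiags R k (2 * k) * opX R k (passed k l, false) * vertexProj R v =
        p * twistDiags R k (2 * k) * vertexProj R v := by
    intro d
    induction d with
    | zero =>
      intro l hl
      refine ⟨_, hX, ?_⟩
      rw [show l = 2 * k + 1 + 0 by omega, passed_add, ← hc.eq]; rfl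
    | succ d ih =>
      intro l hl
      by_cases hb : l ≠ 0 ∧ v (passed k l - 1) = true
      · have hl0 := passed_ne_zero (k := k) (Nat.pos_of_ne_zero hb.1) (by omega)
        obtain ⟨p, hp, hp'⟩ := ih (l + 1) (by omega)
        refine ⟨opH R k - p, Subring.sub_mem _ hH hp, ?_⟩
        rw [twistDiags_opX_at hl0 ⟨hb.2, hv _ hl0 hb.2⟩, mul_sub, sub_mul, ← passed_succ, hp',
          (twistDiags_opH _ le_rfl).eq, sub_mul, sub_mul]
      · refine ⟨_, hX, ?_⟩
        -- By monotonicity, a 0-resolution at `l - 1` means that all crossings before `l` are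
        -- 0-resolved.
        have hi : ∀ i : Crossing k, i.val < l → v i = false := by
          intro i hi
          by_contra h
          have hl0 := passed_ne_zero (k := k) (j := l) (by omega) (by omega)
          refine hb ⟨by omega, hv.le (i := i) ?_ (by simpa using h)⟩
          change i.val ≤ (passed k l - 1).val
          rw [Fin.val_sub_one_of_ne_zero hl0, passed_val_of_lt (by omega)]
          omega
        have h1 : opX R k (passed k l, false) * vertexProj R v = opX R k (0, false) * vertexProj R v :=
          mul_proj_congr (fun _ => opX_comm _ _) (fun _ => opX_comm _ _) fun w hw => by
            subst hw; exact opX_one_congr (circ_initial l (by omega) hi)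
        rw [mul_assoc, h1, ← mul_assoc, hc.eq]
  obtain ⟨l, s⟩ := e
  obtain ⟨p, hp, hp'⟩ := key (2 * k + 1 - l.val) l.val (by have := l.2; omega)
  refine ⟨p, hp, ?_⟩
  rw [← hp', passed_val, mul_assoc, opX_bool_proj (fun w hw => ⟨c, by rw [hw, hc']⟩) l s false, mul_assoc]

theorem exists_twistDiags_opXs {v : Vertex k} (hv : Mono v) (h0 : v ≠ fun _ => false) (l : List (Edge k)) :
    ∃ p ∈ baseRing R k, twistDiags R k (2 * k) * opXs R k l * vertexProj R v =
      p * twistDiags R k (2 * k) * vertexProj R v := by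
  induction l with
  | nil => exact ⟨1, Subring.one_mem _, by rw [one_mul]; exact congrArg (· * _) (mul_one _)⟩
  | cons e l ih =>
    obtain ⟨p, hp, hp'⟩ := ih
    obtain ⟨p', hpp, hpp'⟩ := exists_twistDiags_opX (R := R) hv h0 e
    refine ⟨p * p', Subring.mul_mem _ hp hpp, ?_⟩
    rw [opXs_cons, ← mul_assoc, mul_assoc, ← (proj_opX _ e).eq, ← mul_assoc, hp', mul_assoc,
      (proj_opX _ e).eq, ← mul_assoc, mul_assoc p, mul_assoc p, hpp']
    simp only [mul_assoc]

theorem twistDiags_one {v : Vertex k} (hv : Mono v) (j : ℕ) (hj : j ≤ 2 * k) :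
    twistDiags R k j • one R k v = one R k v := by
  induction j with
  | zero => exact one_smul _ _
  | succ j ih =>
    have hm := passed_ne_zero (k := k) (j := j + 1) (by omega) hj
    rw [twistDiags, mul_smul, ih (by omega), twistDiag, if_neg hm, sub_smul, one_smul, add_smul, mul_smul,
      opC_one, smul_zero, zero_add, proj_one_neg, sub_zero]
    rintro ⟨h1, h2⟩
    rw [hv _ hm h1] at h2
    exact absurd h2 (by simp)

end Diagonal
end TorusKh

/-! ### Factoring through one circle, and the leading term of the retraction. -/

namespace TorusKh

open Cob

section Circle

variable (R : Type*) [CommRing R] {k : ℕ}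

/-- The cobordism from one circle to the circles of `v`, cylindrical at the base point. -/
noncomputable def inc (v : Vertex k) : unknot R ⟶ vobj R v :=
  mor R (DSurf.lower (fun _ : Unit => circ v (0, false)) fun _ => 0)

/-- The connected planar cobordism from the circles of `v` to one circle. -/
noncomputable def mrg (v : Vertex k) : vobj R v ⟶ unknot R :=
  mor R (DSurf.lower (fun _ : ResCircle v => ()) fun _ => 0)

variable {R}

theorem cup_inc (v : Vertex k) : cup R Unit ≫ inc R v = cup R (ResCircle v) := cup_comp_lower _

theorem cup_mrg (v : Vertex k) : cup R (ResCircle v) ≫ mrg R v = cup R Unit := cup_comp_lower _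

theorem dotX_inc (v : Vertex k) : dotX R ≫ inc R v = inc R v ≫ dot (circ v (0, false)) :=
  dot_slide _ _ _ rfl

theorem dot_mrg (v : Vertex k) : dot (circ v (0, false)) ≫ mrg R v = mrg R v ≫ dotX R :=
  dot_slide _ _ _ rfl

theorem hU_inc (v : Vertex k) : hU R ≫ inc R v = inc R v ≫ sph R (ResCircle v) := sph_comm _

theorem sph_mrg (v : Vertex k) : sph R (ResCircle v) ≫ mrg R v = mrg R v ≫ hU R := sph_comm _

variable (R k) in
/-- Merging all circles, and then splitting off discs from the circle of the base point. -/
noncomputable def opE : End (cubeObj R k) := diag fun v => mrg R v ≫ inc R v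

theorem opE_one (v : Vertex k) : opE R k • one R k v = one R k v := by
  refine (diag_smul_one_congr (ψ := fun v => 𝟙 (vobj R v)) ?_).trans (by rw [diag_id, one_smul])
  rw [← Category.assoc, cup_mrg, cup_inc]
  exact (Category.comp_id _).symm

theorem opE_opX : Commute (opE R k) (opX R k (0, false)) := commute_diag_diag fun v => by
  rw [Category.assoc, ← dotX_inc, ← Category.assoc, ← dot_mrg, Category.assoc]

theorem opE_opH : Commute (opE R k) (opH R k) := commute_diag_diag fun v => by
  rw [Category.assoc, ← hU_inc, ← Category.assoc, ← sph_mrg, Category.assoc]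

/-- On a dotted cup at the vertex `v` the twists turn the dots into a polynomial in $x$ and $h$
applied to the cup. The operator `opE` commutes with such polynomials and fixes cups. -/
theorem opE_twistDiags {v : Vertex k} (hv : Mono v) (h0 : v ≠ fun _ => false) :
    opE R k * (twistDiags R k (2 * k) * vertexProj R v) = twistDiags R k (2 * k) * vertexProj R v := by
  refine sub_eq_zero.1 (eq_zero_of_one (M := cubeObj R k) _ fun w l _ => ?_)
  change (opE R k * (twistDiags R k (2 * k) * vertexProj R v) - twistDiags R k (2 * k) * vertexProj R v) •
    opXs R k l • one R k w = 0
  have hc : Commute (vertexProj R v) (opXs R k l) := commute_opXs fun e _ => proj_opX _ e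
  have h1 : ∀ S : End (cubeObj R k), S • opXs R k l • one R k w = (S * opXs R k l) • one R k w :=
    fun S => (mul_smul _ _ _).symm
  obtain ⟨p, hp, hp'⟩ := exists_twistDiags_opXs (R := R) hv h0 l
  have h2 : twistDiags R k (2 * k) * vertexProj R v * opXs R k l =
      p * twistDiags R k (2 * k) * vertexProj R v := by
    rw [mul_assoc, hc.eq, ← mul_assoc, hp']
  rw [sub_smul, h1, h1, mul_assoc, h2]
  by_cases hw : w = v
  · subst hw
    have h3 : (p * twistDiags R k (2 * k) * vertexProj R w) • one R k w = p • one R k w := by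
      rw [mul_smul, mul_smul, proj_one (p := fun u => u = w) rfl, twistDiags_one hv _ le_rfl]
    rw [mul_smul, h3, commute_smul_comm (commute_of_mem_baseRing opE_opX opE_opH hp), opE_one, sub_self]
  · simp only [mul_smul, proj_one_neg (p := fun u => u = v) hw, smul_zero, sub_zero]

theorem exists_opXs_zero (l : List (Edge k)) (hl : ∀ e ∈ l, e.2 = false) :
    ∃ p ∈ baseRing R k, opXs R k l • one R k (fun _ => false) = p • one R k (fun _ => false) := by
  induction l with
  | nil => exact ⟨1, Subring.one_mem _, rfl⟩
  | cons e l ih =>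
    obtain ⟨p, hp, hp'⟩ := ih fun e he => hl e (List.mem_cons_of_mem _ he)
    obtain ⟨c, s⟩ := e
    obtain rfl : s = false := hl _ List.mem_cons_self
    have hc : Commute (opXs R k l) (opX R k (c, false)) :=
      (commute_opXs fun e _ => opX_comm _ _).symm
    refine ⟨p * opX R k (0, false), Subring.mul_mem _ hp (Subring.subset_closure (by simp)), ?_⟩
    have h1 : Commute (opX R k (c, false)) p :=
      commute_of_mem_baseRing (opX_comm _ _) (opH_opX _).symm hp
    rw [opXs_cons, hc.eq, mul_smul, hp', commute_smul_comm h1, opX_one_congr (circ_zero_level c 0 false),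
      mul_smul]

/-- The base point lies on the left strand, so left dots are polynomials in $x$. As no circle is
repeated, the right strand carries at most one dot. -/
theorem exists_opXs_zero' (l : List (Edge k)) (hl : (l.map (circ (fun _ => false : Vertex k))).Nodup) :
    ∃ p ∈ baseRing R k, opXs R k l • one R k (fun _ => false) = p • one R k (fun _ => false) ∨
      opXs R k l • one R k (fun _ => false) = p • opX R k (0, true) • one R k (fun _ => false) := by
  induction l with
  | nil => exact ⟨1, Subring.one_mem _, Or.inl rfl⟩
  | cons e l ih =>
    obtain ⟨c, s⟩ := e
    have hc : Commute (opXs R k l) (opX R k (c, s)) := (commute_opXs fun e _ => opX_comm _ _).symm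
    rw [List.map_cons, List.nodup_cons] at hl
    have h1 : ∀ p ∈ baseRing R k, Commute (opX R k (c, s)) p := fun p hp =>
      commute_of_mem_baseRing (opX_comm _ _) (opH_opX _).symm hp
    cases s
    · obtain ⟨p, hp, hp'⟩ := ih hl.2
      refine ⟨p * opX R k (0, false), Subring.mul_mem _ hp (Subring.subset_closure (by simp)), ?_⟩
      rw [opXs_cons, hc.eq, mul_smul]
      rcases hp' with hp' | hp'
      · left
        rw [hp', commute_smul_comm (h1 p hp), opX_one_congr (circ_zero_level c 0 false), mul_smul]
      · right
        rw [hp', commute_smul_comm (h1 p hp), commute_smul_comm (opX_comm (c, false) (0, true)),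
          opX_one_congr (circ_zero_level c 0 false), commute_smul_comm (opX_comm (0, true) _), mul_smul]
    · obtain ⟨p, hp, hp'⟩ := exists_opXs_zero (R := R) l fun e he => by
        by_contra h
        apply hl.1
        have h2 : e.2 = true := by simpa using h
        refine List.mem_map.2 ⟨e, he, ?_⟩
        rw [show e = (e.1, true) from Prod.ext rfl h2]
        exact circ_zero_level _ _ _
      refine ⟨p, hp, Or.inr ?_⟩
      rw [opXs_cons, hc.eq, mul_smul, hp', commute_smul_comm (h1 p hp),
        opX_one_congr (circ_zero_level c 0 true)]

/-- On dotted cups of the zero vertex the cut gives either zero or a polynomial in $x$ and $h$ times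
the undotted cup, and `opE` fixes the latter. -/
theorem opE_opC₀ : opE R k * opC₀ R k = opC₀ R k := by
  refine sub_eq_zero.1 (eq_zero_of_one (M := cubeObj R k) _ fun v l hl => ?_)
  change (opE R k * opC₀ R k - opC₀ R k) • opXs R k l • one R k v = 0
  rw [sub_smul, mul_smul, sub_eq_zero]
  by_cases hv : v = fun _ => false
  · subst hv
    obtain ⟨p, hp, hp' | hp'⟩ := exists_opXs_zero' (R := R) l hl
    all_goals rw [hp', commute_smul_comm (commute_of_mem_baseRing (opC₀_opX 0) opC₀_opH hp)]
    · rw [opC₀_one, smul_zero, smul_zero]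
    · rw [opC₀_opX_one, commute_smul_comm (commute_of_mem_baseRing opE_opX opE_opH hp), opE_one]
  · have : opC₀ R k • opXs R k l • one R k v = 0 := by
      have hc : Commute (proj R k (fun v => v = fun _ => false)) (opXs R k l) :=
        commute_opXs fun e _ => proj_opX _ e
      rw [← opC₀_proj, mul_smul, commute_smul_comm hc,
        proj_one_neg (p := fun v => v = fun _ => false) hv, smul_zero, smul_zero]
    rw [this, smul_zero]

theorem ext_vertexProj {S T : End (cubeObj R k)} (h : ∀ v, S * vertexProj R v = T * vertexProj R v) :
    S = T := by
  refine ent_ext fun v w => ?_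
  have := congrArg (fun T : End (cubeObj R k) => ent T v w) (h v)
  rwa [ent_mul_proj (p := fun u => u = v) rfl, ent_mul_proj (p := fun u => u = v) rfl] at this

variable (R k) in
/-- The part of the projection to the small model before merging all circles. -/
noncomputable def opΓ : End (cubeObj R k) :=
  opC₀ R k + twistDiags R k (2 * k) * proj R k (fun v => v ≠ fun _ => false)

variable (R k) in
/-- The part of the inclusion of the small model after splitting off discs. -/
noncomputable def opΦ : End (cubeObj R k) :=
  (opX R k (0, true) - opX R k (0, false)) * proj R k (fun v => v = fun _ => false) +
    proj R k (fun v => v ≠ fun _ => false)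

theorem proj_mul_vertexProj {p : Vertex k → Prop} {v : Vertex k} (h : p v) :
    proj R k p * vertexProj R v = vertexProj R v := proj_mul_proj fun w hw => by rwa [hw]

theorem proj_mul_vertexProj_neg {p : Vertex k → Prop} {v : Vertex k} (h : ¬ p v) :
    proj R k p * vertexProj R v = 0 := proj_mul_proj_disjoint fun w hw => by rwa [hw]

theorem opΓ_zero : opΓ R k * vertexProj R (fun _ => false) = opC₀ R k := by
  rw [opΓ, add_mul, opC₀_proj, mul_assoc, proj_mul_vertexProj_neg (by simp), mul_zero, add_zero]

theorem opΓ_ne {v : Vertex k} (h : v ≠ fun _ => false) :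
    opΓ R k * vertexProj R v = twistDiags R k (2 * k) * vertexProj R v := by
  rw [opΓ, add_mul, opC₀_mul_proj fun w hw => by rwa [hw], zero_add, mul_assoc,
    proj_mul_vertexProj (p := fun v => v ≠ fun _ => false) h]

theorem opΓ_eq_zero {v : Vertex k} (h : ¬ Mono v) : opΓ R k * vertexProj R v = 0 := by
  rw [opΓ_ne, twistDiags_mul_at_eq_zero h]
  rintro rfl
  exact h fun _ _ h => absurd h (by simp)

theorem opE_opΓ : opE R k * opΓ R k = opΓ R k := by
  refine ext_vertexProj fun v => ?_
  rw [mul_assoc]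
  by_cases h0 : v = fun _ => false
  · subst h0; rw [opΓ_zero, opE_opC₀]
  by_cases hv : Mono v
  · rw [opΓ_ne h0, opE_twistDiags hv h0]
  · rw [opΓ_eq_zero hv, mul_zero]

theorem IsDiag.opΓ : IsDiag (opΓ R k) := by
  intro v w h
  rw [TorusKh.opΓ, ent_add, IsDiag.opC₀ v w h, ((IsDiag.twistDiags _).mul (IsDiag.proj _)) v w h, add_zero]

theorem IsDiag.opX (e : Edge k) : IsDiag (opX R k e) := isDiag_diag _

theorem IsDiag.opΦ : IsDiag (opΦ R k) := by
  intro v w h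
  rw [TorusKh.opΦ, ent_add, (((IsDiag.opX _).sub (IsDiag.opX _)).mul (IsDiag.proj _)) v w h,
    (IsDiag.proj _) v w h, add_zero]

/-- The diagonal part of the composite of all twists. -/
theorem twistDiag_mul_twistDiags {v : Vertex k} (h : v.weight ≠ 1) :
    twistDiag R k 0 * twistDiags R k (2 * k) * vertexProj R v = opΦ R k * opΓ R k * vertexProj R v := by
  have hc := ((IsDiag.twistDiags (R := R) (2 * k)).commute_proj fun w => w = v).eq
  have hc' := ((IsDiag.opΓ (R := R)).commute_proj fun w => w = v).eq
  by_cases h0 : v = fun _ => false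
  · subst h0
    rw [mul_assoc, twistDiags_mul_at_zero _ le_rfl, twistDiag_zero_mul_at_zero, mul_assoc _ (opΓ R k),
      opΓ_zero, mul_assoc, opC₀_proj, opΦ, add_mul, mul_assoc, proj_mul_opC₀, ← proj_mul_opC₀,
      ← mul_assoc (proj R k _), proj_mul_proj_disjoint (fun _ h h' => h' h), zero_mul, add_zero]
  · by_cases hv : Mono v
    · have h1 : opΦ R k * vertexProj R v = vertexProj R v := by
        rw [opΦ, add_mul, mul_assoc, proj_mul_vertexProj_neg (p := fun v => v = fun _ => false) h0, mul_zero,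
          zero_add, proj_mul_vertexProj (p := fun v => v ≠ fun _ => false) h0]
      rw [mul_assoc, hc, ← mul_assoc, twistDiag_zero_mul_at h0, ← hc, mul_assoc _ (opΓ R k), hc',
        ← mul_assoc, h1, ← hc', opΓ_ne h0]
      rintro rfl
      exact h weight_lastVertex
    · rw [mul_assoc, twistDiags_mul_at_eq_zero hv, mul_zero, mul_assoc, opΓ_eq_zero hv, mul_zero]

theorem twistDiag_mul_twistDiags_eq_zero {v : Vertex k} (h : v.weight = 1) :
    twistDiag R k 0 * twistDiags R k (2 * k) * vertexProj R v = 0 := by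
  have hc := ((IsDiag.twistDiags (R := R) (2 * k)).commute_proj fun w => w = v).eq
  by_cases hv : Mono v
  · obtain rfl := eq_lastVertex (hv.last (by omega)) h
    rw [mul_assoc, hc, ← mul_assoc, twistDiag_zero_mul_at_last, zero_mul]
  · rw [mul_assoc, twistDiags_mul_at_eq_zero hv, mul_zero]

end Circle

section Small

variable (R : Type*) [CommRing R] (k : ℕ)

/-- The indices of the small model. -/
abbrev SmallIndex : Type := {t : Fin (2 * k + 2) // t.val ≠ 1}

/-- The underlying object of the small model. -/
noncomputable abbrev smallObj : Mat_ (Cob R) where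
  ι := SmallIndex k
  X := fun _ => unknot R

/-- Merging all circles. -/
noncomputable def mapM : cubeObj R k ⟶ smallObj R k :=
  ofEnt fun v i => if v.weight = i.1.val then mrg R v else 0

/-- Splitting off discs. -/
noncomputable def mapI : smallObj R k ⟶ cubeObj R k :=
  ofEnt fun i v => if v.weight = i.1.val then inc R v else 0

/-- The leading term of the projection to the small model. -/
noncomputable def mapG : cubeObj R k ⟶ smallObj R k := (opΓ R k : cubeObj R k ⟶ cubeObj R k) ≫ mapM R k

/-- The inclusion of the small model. -/
noncomputable def mapF : smallObj R k ⟶ cubeObj R k := mapI R k ≫ (opΦ R k : cubeObj R k ⟶ cubeObj R k)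

/-- The composite of `mapM` and `mapI`. -/
noncomputable def opMI : End (cubeObj R k) := mapM R k ≫ mapI R k

variable {R k}

theorem ent_mapM {v : Vertex k} {i : SmallIndex k} (h : v.weight = i.1.val) :
    ent (mapM R k) v i = mrg R v := if_pos h

theorem ent_mapM_ne {v : Vertex k} {i : SmallIndex k} (h : v.weight ≠ i.1.val) :
    ent (mapM R k) v i = 0 := if_neg h

theorem ent_mapI {v : Vertex k} {i : SmallIndex k} (h : v.weight = i.1.val) :
    ent (mapI R k) i v = inc R v := if_pos h

theorem ent_mapI_ne {v : Vertex k} {i : SmallIndex k} (h : v.weight ≠ i.1.val) :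
    ent (mapI R k) i v = 0 := if_neg h

/-- The index of the small model for the vertices of weight `t`. -/
def smallIndex (t : ℕ) (h : t ≤ 2 * k + 1) (h1 : t ≠ 1) : SmallIndex k := ⟨⟨t, by omega⟩, h1⟩

/-- Exactly one summand of the small model has the degree of `v`; it exists because the weight is
not 1. -/
theorem ent_opMI_self {v : Vertex k} (h : v.weight ≠ 1) : ent (opMI R k) v v = mrg R v ≫ inc R v := by
  refine (ent_comp _ _ _ _).trans ?_
  rw [Finset.sum_eq_single (smallIndex v.weight (weight_le v) h), ent_mapM rfl, ent_mapI rfl]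
  · intro i _ hi
    rw [ent_mapM_ne, Limits.zero_comp]
    exact fun h' => hi (Subtype.ext (Fin.ext h'.symm))
  · simp

theorem ent_opMI_eq_zero {v w : Vertex k} (h : v.weight = w.weight → v.weight = 1) :
    ent (opMI R k) v w = 0 := by
  refine (ent_comp _ _ _ _).trans (Finset.sum_eq_zero fun i _ => ?_)
  by_cases hv : v.weight = i.1.val
  · by_cases hw : w.weight = i.1.val
    · exact absurd ((h (by rw [hv, hw])).symm.trans hv).symm i.2
    · rw [ent_mapI_ne hw, Limits.comp_zero]
  · rw [ent_mapM_ne hv, Limits.zero_comp]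

theorem mapG_mapF : (mapG R k ≫ mapF R k : End (cubeObj R k)) = opΦ R k * opMI R k * opΓ R k := by
  change ((opΓ R k : cubeObj R k ⟶ cubeObj R k) ≫ mapM R k) ≫ mapI R k ≫
    (opΦ R k : cubeObj R k ⟶ cubeObj R k) = (opΓ R k : cubeObj R k ⟶ cubeObj R k) ≫
      (mapM R k ≫ mapI R k) ≫ (opΦ R k : cubeObj R k ⟶ cubeObj R k)
  simp only [Category.assoc]

theorem ent_diag_mul {S : End (cubeObj R k)} (hS : IsDiag S) (T : End (cubeObj R k)) (v w : Vertex k) :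
    ent (S * T) v w = ent T v w ≫ ent S w w := by
  rw [isDiag_iff.1 hS, diag_self]; exact comp_diag_apply _ _ _ _

theorem ent_mul_diag {S : End (cubeObj R k)} (hS : IsDiag S) (T : End (cubeObj R k)) (v w : Vertex k) :
    ent (T * S) v w = ent S v v ≫ ent T v w := by
  rw [isDiag_iff.1 hS, diag_self]; exact diag_comp_apply _ _ _ _

theorem ent_mapG_mapF (v w : Vertex k) : ent (opΦ R k * opMI R k * opΓ R k) v w =
    ent (opΓ R k) v v ≫ ent (opMI R k) v w ≫ ent (opΦ R k) w w := by
  rw [ent_mul_diag IsDiag.opΓ, ent_diag_mul IsDiag.opΦ]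

variable (R k) in
/-- The composite of all twists, a chain map homotopic to the identity. -/
noncomputable def allTwists : End (cubeObj R k) := twist R k 0 * twists R k (2 * k)

variable (R k) in
/-- The part of `allTwists` that lowers the height. -/
noncomputable def opQ : End (cubeObj R k) := allTwists R k - opΦ R k * opMI R k * opΓ R k

/-- The composite of all twists and the leading term have the same diagonal, because `opE` fixes the
image of `opΓ`. Off the diagonal, the leading term starts at monotone vertices only and preserves
the weight, and the monotone vertex is the highest one of its weight. -/
theorem lowers_opQ : Lowers (opQ R k) := by
  intro v w h
  obtain ⟨h1, h2⟩ := (twist_diagPart (R := R) (k := k) 0).mul (twists_diagPart (2 * k))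
  have hE : opE R k * opΓ R k = opΓ R k := opE_opΓ
  by_cases hvw : v = w
  · subst hvw
    exfalso
    apply h
    have h3 : ent (allTwists R k - twistDiag R k 0 * twistDiags R k (2 * k)) v v = 0 := by
      by_contra h'
      exact lt_irrefl _ (h2 v v h')
    have h4 : ent (twistDiag R k 0 * twistDiags R k (2 * k)) v v =
        ent (opΦ R k * opMI R k * opΓ R k) v v := by
      rw [← ent_mul_proj (p := fun w => w = v) rfl]
      by_cases hw : v.weight = 1
      · rw [twistDiag_mul_twistDiags_eq_zero hw, ent_mapG_mapF, ent_opMI_eq_zero fun _ => hw,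
          Limits.zero_comp, Limits.comp_zero]; rfl
      · have h5 : ent (opΓ R k) v v ≫ mrg R v ≫ inc R v = ent (opΓ R k) v v := by
          conv_rhs => rw [← hE]
          exact (comp_diag_apply (opΓ R k) (fun v => mrg R v ≫ inc R v) v v).symm
        rw [twistDiag_mul_twistDiags hw, ent_mul_proj (p := fun w => w = v) rfl,
          ent_diag_mul IsDiag.opΦ, ent_mapG_mapF, ent_opMI_self hw, ← Category.assoc, h5]
    rw [ent_sub] at h3
    rw [opQ, ent_sub, ← h4, h3]
  · by_cases h' : ent (allTwists R k - twistDiag R k 0 * twistDiags R k (2 * k)) v w = 0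
    · rw [ent_sub, h1 v w hvw, sub_zero] at h'
      rw [opQ, ent_sub, h', zero_sub, neg_ne_zero, ent_mapG_mapF] at h
      by_cases hm : Mono v
      · refine hm.height_lt ?_ (Ne.symm hvw)
        by_contra hw
        exact h (by rw [ent_opMI_eq_zero (fun h => absurd h.symm hw), Limits.zero_comp, Limits.comp_zero])
      · exfalso
        apply h
        rw [← ent_mul_proj (T := opΓ R k) (p := fun w => w = v) rfl, opΓ_eq_zero hm]
        exact Limits.zero_comp
    · exact h2 v w h'

end Small
end TorusKh

/-! ### Differential and $\bar u$ on the sum of all cups of a given weight. -/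

namespace TorusKh

open Cob

section Layers

variable {R : Type*} [CommRing R] {k : ℕ}

theorem sum_update_layer {M : Type*} [AddCommMonoid M] (c : Crossing k) (t : ℕ) (F : Vertex k → M) :
    ∑ v ∈ Finset.univ.filter (fun v : Vertex k => v.weight = t),
      (if v c = false then F (Function.update v c true) else 0) =
    ∑ z ∈ Finset.univ.filter (fun z : Vertex k => z.weight = t + 1), if z c = true then F z else 0 := by
  rw [← Finset.sum_filter, ← Finset.sum_filter, Finset.filter_filter, Finset.filter_filter]
  refine Finset.sum_nbij' (fun v => Function.update v c true) (fun v => Function.update v c false)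
    ?_ ?_ ?_ ?_ fun _ _ => rfl
  · intro v hv
    simp only [Finset.mem_filter, Finset.mem_univ, true_and] at hv ⊢
    exact ⟨by rw [weight_update hv.2, hv.1], update_eq_true c v⟩
  · intro z hz
    simp only [Finset.mem_filter, Finset.mem_univ, true_and] at hz ⊢
    obtain ⟨u, hu, rfl⟩ := exists_update hz.2
    rw [weight_update hu] at hz
    have hself : Function.update u c false = u := by rw [← hu, Function.update_eq_self]
    rw [Function.update_idem, hself]
    exact ⟨by omega, hu⟩
  · intro v hv
    simp only [Finset.mem_filter, Finset.mem_univ, true_and] at hv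
    rw [Function.update_idem, ← hv.2, Function.update_eq_self]
  · intro z hz
    simp only [Finset.mem_filter, Finset.mem_univ, true_and] at hz
    rw [Function.update_idem, ← hz.2, Function.update_eq_self]

variable (R k) in
/-- The sum of the cups at the vertices of weight `t`. -/
noncomputable def layer (t : ℕ) : emptyObj R ⟶ cubeObj R k :=
  ∑ v ∈ Finset.univ.filter (fun v : Vertex k => v.weight = t), one R k v

theorem layer_zero : layer R k 0 = one R k (fun _ => false) := by
  unfold layer
  have : (Finset.univ.filter fun v : Vertex k => v.weight = 0) = {fun _ => false} := by
    ext v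
    simp [weight_eq_zero]
  rw [this, Finset.sum_singleton]

theorem smul_layer_eq_zero {T : End (cubeObj R k)} {t : ℕ} (h : ∀ v, T • one R k v = 0) :
    T • layer R k t = 0 := by
  rw [layer, Finset.smul_sum]
  exact Finset.sum_eq_zero fun v _ => h v

/-- The number of crossings below `m` with a `1`-resolution. -/
def below (v : Vertex k) (m : ℕ) : ℕ := (Finset.univ.filter fun i : Crossing k => i.val < m ∧ v i = true).card

theorem below_succ (v : Vertex k) {m : ℕ} (hm : m < 2 * k + 1) :
    below v (m + 1) = below v m + if v (passed k m) = true then 1 else 0 := by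
  unfold below
  have hp := passed_val_of_lt hm
  split_ifs with h
  · have : (Finset.univ.filter fun i : Crossing k => i.val < m + 1 ∧ v i = true) =
        insert (passed k m) (Finset.univ.filter fun i : Crossing k => i.val < m ∧ v i = true) := by
      ext i
      simp only [Finset.mem_filter, Finset.mem_univ, true_and, Finset.mem_insert]
      constructor
      · rintro ⟨h1, h2⟩
        by_cases hi : i.val = m
        · left; rw [← hi, passed_val]
        · right; exact ⟨by omega, h2⟩
      · rintro (rfl | ⟨h1, h2⟩)
        · exact ⟨by omega, h⟩
        · exact ⟨by omega, h2⟩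
    rw [this, Finset.card_insert_of_notMem (by simp [hp])]
  · rw [add_zero]
    congr 1
    ext i
    simp only [Finset.mem_filter, Finset.mem_univ, true_and]
    constructor
    · rintro ⟨h1, h2⟩
      refine ⟨?_, h2⟩
      by_contra h3
      rw [show m = i.val by omega, passed_val] at h
      exact h h2
    · rintro ⟨h1, h2⟩
      exact ⟨by omega, h2⟩

theorem below_all (v : Vertex k) : below v (2 * k + 1) = v.weight := by
  unfold below Vertex.weight
  congr 1
  ext i
  have := i.isLt
  simp only [Finset.mem_filter, Finset.mem_univ, true_and]
  exact ⟨fun h => h.2, fun h => ⟨this, h⟩⟩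

theorem sgn_passed (v : Vertex k) {m : ℕ} (hm : m < 2 * k + 1) : sgn (passed k m) v = (-1) ^ below v m := by
  unfold sgn below
  congr 2
  ext i
  simp only [Finset.mem_filter, Finset.mem_univ, true_and, Fin.lt_def, passed_val_of_lt hm]

theorem sum_crossing {M : Type*} [AddCommMonoid M] (F : Crossing k → M) :
    ∑ c, F c = ∑ m ∈ Finset.range (2 * k + 1), F (passed k m) := by
  rw [Finset.sum_range]
  exact Finset.sum_congr rfl fun c _ => by rw [passed_val]

variable (R k) in
/-- The operator `2 x - h`. -/
noncomputable def opHH : End (cubeObj R k) := opX R k (0, false) + opX R k (0, false) - opH R k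

/-- Along the braid the signs alternate from one 1-resolution to the next, and the circle above one
is the circle below the next. So the dots telescope around the closed braid: for even weight
everything cancels, for odd weight $2x-h$ remains. -/
theorem sum_sgn_opY (v : Vertex k) {d : Crossing k} (hd : v d = true) :
    ∑ c, (if v c = true then sgn c v • opY R k c • one R k v else 0) =
      if Even v.weight then 0 else opHH R k • one R k v := by
  have key : ∀ m, m ≤ 2 * k + 1 → ∑ j ∈ Finset.range m,
      (if v (passed k j) = true then sgn (passed k j) v • opY R k (passed k j) • one R k v else 0) =
      opX R k (0, false) • one R k v - ((-1 : ℤ) ^ below v m) • opX R k (passed k m, false) • one R k v -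
        if Even (below v m) then 0 else opH R k • one R k v := by
    intro m
    induction m with
    | zero =>
      intro _
      have : below v 0 = 0 := by unfold below; simp
      rw [this]
      simp [passed]
    | succ m ih =>
      intro hm
      rw [Finset.sum_range_succ, ih (by omega), below_succ v (by omega), passed_succ]
      by_cases h : v (passed k m) = true
      · rw [if_pos h, if_pos h, sgn_passed v (by omega), opY, sub_smul, add_smul,
          opX_one_congr (circ_eq_bool hd (passed k m + 1) true false), pow_succ]
        rcases Nat.even_or_odd (below v m) with he | he
        · simp [he.neg_one_pow, he, Nat.even_add_one]
          abel
        · have he' := Nat.not_even_iff_odd.2 he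
          simp [he.neg_one_pow, he', Nat.even_add_one]
          abel
      · rw [if_neg h, if_neg h, add_zero, add_zero, opX_one_congr (circ_zero (c := passed k m) (v := v) (by simpa using h) false)]
  have h0 : passed k (2 * k + 1) = 0 := passed_add k 0
  rw [sum_crossing, key _ le_rfl, below_all, h0, opHH]
  rcases Nat.even_or_odd v.weight with he | he
  · simp [he.neg_one_pow, he]
  · simp [he.neg_one_pow, Nat.not_even_iff_odd.2 he, sub_smul, add_smul]

/-- A vertex of weight $t+1$ receives one contribution from each of its 1-resolutions, with the
signs of `sum_sgn_opY`. The sum survives if $t+1$ is odd. -/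
theorem opd_layer {t : ℕ} (ht : t ≠ 0) : opd R k • layer R k t =
    if Even t then opHH R k • layer R k (t + 1) else 0 := by
  have h1 : ∀ c, opD R k c • layer R k t =
      ∑ z ∈ Finset.univ.filter (fun z : Vertex k => z.weight = t + 1),
        if z c = true then sgn c z • opY R k c • one R k z else 0 := by
    intro c
    rw [layer, Finset.smul_sum, ← sum_update_layer c t fun z => sgn c z • opY R k c • one R k z]
    refine Finset.sum_congr rfl fun v hv => ?_
    have hv' : v.weight = t := (Finset.mem_filter.1 hv).2
    split_ifs with h
    · obtain ⟨d, hd⟩ := (zero_or_exists v).resolve_left fun h => ht (by rw [← hv', weight_eq_zero.2 h])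
      rw [opD_one h hd, sgn_update_self]
    · exact opD_one_of_true (by simpa using h)
  unfold opd
  rw [Finset.sum_smul, Finset.sum_congr rfl fun c _ => h1 c, Finset.sum_comm]
  have h2 : ∀ z ∈ Finset.univ.filter (fun z : Vertex k => z.weight = t + 1),
      ∑ c, (if z c = true then sgn c z • opY R k c • one R k z else 0) =
      if Even t then opHH R k • one R k z else 0 := by
    intro z hz
    have hz' : z.weight = t + 1 := (Finset.mem_filter.1 hz).2
    obtain ⟨d, hd⟩ := (zero_or_exists z).resolve_left fun h => by rw [weight_eq_zero.2 h] at hz'; omega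
    rw [sum_sgn_opY z hd, hz']
    by_cases he : Even t
    · rw [if_pos he, if_neg (by simpa [Nat.even_add_one] using he)]
    · rw [if_neg he, if_pos (by simpa [Nat.even_add_one] using he)]
  rw [Finset.sum_congr rfl h2]
  split_ifs
  · rw [layer, Finset.smul_sum]
  · exact Finset.sum_const_zero

variable (R k) in
/-- The operator of the second crossing of a pair to be reversed at the zero vertex. -/
noncomputable def opΨ : End (cubeObj R k) :=
  opY R k 0 * proj R k (fun v => v = fun _ => false) + proj R k (fun v => v ≠ fun _ => false)

theorem opΨ_one_zero : opΨ R k • one R k (fun _ => false) = opY R k 0 • one R k (fun _ => false) := by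
  rw [opΨ, add_smul, mul_smul, proj_one (p := fun v => v = fun _ => false) rfl, proj_one_neg (by simp),
    add_zero]

theorem opΨ_one {v : Vertex k} (h : v ≠ fun _ => false) : opΨ R k • one R k v = one R k v := by
  rw [opΨ, add_smul, mul_smul, proj_one_neg (p := fun v => v = fun _ => false) h, smul_zero, zero_add,
    proj_one (p := fun v => v ≠ fun _ => false) h]

/-- Reversal merges, except at the zero vertex, where it splits and gives `opY`, the same for all
crossings; `opΨ` covers both cases at once. -/
theorem chi_one_update {c : Crossing k} {v : Vertex k} (h : v c = false) :
    opΧ R k c • one R k (Function.update v c true) = sgn c v • opΨ R k • one R k v := by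
  rcases zero_or_exists v with rfl | ⟨d, hd⟩
  · rw [chi_one_single, opΨ_one_zero, opY_one_zero c 0]
  · rw [chi_one h hd, opΨ_one]
    rintro rfl
    simp at hd

theorem chi_layer (c : Crossing k) (t : ℕ) (ht : t ≠ 0) : opΧ R k c • layer R k (t + 1) =
    ∑ v ∈ Finset.univ.filter (fun v : Vertex k => v.weight = t),
      if v c = false then sgn c v • one R k v else 0 := by
  have h := sum_update_layer c t (fun z => sgn c z • one R k (Function.update z c false))
  have h1 : ∑ v ∈ Finset.univ.filter (fun v : Vertex k => v.weight = t),
      (if v c = false then sgn c v • one R k v else 0) =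
      ∑ v ∈ Finset.univ.filter (fun v : Vertex k => v.weight = t), if v c = false then
        sgn c (Function.update v c true) • one R k (Function.update (Function.update v c true) c false)
        else 0 := by
    refine Finset.sum_congr rfl fun v _ => ?_
    split_ifs with h
    · rw [sgn_update_self, Function.update_idem, ← h, Function.update_eq_self]
    · rfl
  rw [h1, h, layer, Finset.smul_sum]
  refine Finset.sum_congr rfl fun z hz => ?_
  have hz' : z.weight = t + 1 := (Finset.mem_filter.1 hz).2
  split_ifs with h
  · obtain ⟨u, hu, rfl⟩ := exists_update h
    rw [weight_update hu] at hz'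
    rw [chi_one_update hu, opΨ_one fun h => ht (by rw [← weight_eq_zero.2 h]; omega), sgn_update_self,
      Function.update_idem]
    rw [← hu, Function.update_eq_self]
  · exact chi_one_of_false (by simpa using h)

/-- The minus sign arises because the 1-resolution at `a` lies before `b` and is counted in the sign
of `b`. -/
theorem chi_chi_layer {a b : Crossing k} (hab : a < b) (t : ℕ) :
    opΧ R k a • opΧ R k b • layer R k (t + 2) =
    ∑ u ∈ Finset.univ.filter (fun u : Vertex k => u.weight = t),
      if u a = false ∧ u b = false then -(sgn a u * sgn b u) • opΨ R k • one R k u else 0 := by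
  rw [chi_layer b (t + 1) (by omega), Finset.smul_sum]
  have h := sum_update_layer a t fun v => if v b = false then
    sgn b v • opΧ R k a • one R k v else 0
  have h1 : ∀ v ∈ Finset.univ.filter (fun v : Vertex k => v.weight = t + 1),
      opΧ R k a • (if v b = false then sgn b v • one R k v else 0) =
      if v a = true then (if v b = false then sgn b v • opΧ R k a • one R k v else 0) else 0 := by
    intro v _
    split_ifs with hb ha ha
    · rw [smul_comm]
    · rw [smul_comm, chi_one_of_false (by simpa using ha), smul_zero]
    · rw [smul_zero]
    · rw [smul_zero]
  rw [Finset.sum_congr rfl h1, ← h]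
  refine Finset.sum_congr rfl fun u _ => ?_
  by_cases ha : u a = false
  · rw [if_pos ha, Function.update_of_ne hab.ne']
    by_cases hb : u b = false
    · rw [if_pos hb, if_pos ⟨ha, hb⟩, chi_one_update ha, sgn_update_of_lt hab ha, smul_smul]
      congr 1; ring
    · rw [if_neg hb, if_neg fun h => hb h.2]
  · rw [if_neg ha, if_neg fun h => ha h.1]

/-- At a 0-resolved crossing, the sign of the walk times the sign of the cube is $(-1)^i$, with $i$
the number of 0-resolutions before it. For $z$ of them, $\sum_{i<j<z}(-1)^{i+j}=-\lfloor
z/2\rfloor$. The 1-resolutions thus matter only through their number. -/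
theorem sum_sgn_sgn (u : Vertex k) (m : ℕ) (hm : m ≤ 2 * k + 1) :
    ∑ b ∈ Finset.range m, ∑ a ∈ Finset.range b,
      (if u (passed k a) = false ∧ u (passed k b) = false then
        (-1 : ℤ) ^ (a + b) * (sgn (passed k a) u * sgn (passed k b) u) else 0) =
      -((m - below u m) / 2 : ℕ) := by
  have hle : ∀ m, m ≤ 2 * k + 1 → below u m ≤ m := by
    intro m
    induction m with
    | zero => intro _; unfold below; simp
    | succ m ih => intro h; rw [below_succ u (by omega)]; have := ih (by omega); split_ifs <;> omega
  have hsign : ∀ m, m < 2 * k + 1 → (-1 : ℤ) ^ m * sgn (passed k m) u = (-1) ^ (m - below u m) := by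
    intro m hm
    rw [sgn_passed u hm]
    have h1 := hle m (by omega)
    generalize below u m = b at h1 ⊢
    obtain ⟨j, rfl⟩ := Nat.exists_eq_add_of_le h1
    rw [Nat.add_sub_cancel_left, ← pow_add, show b + j + b = 2 * b + j by omega, pow_add, pow_mul]
    simp
  -- The partial sums of $1-1+1-\cdots$ are 1 or 0 according to parity.
  have h1 : ∀ m, m ≤ 2 * k + 1 → ∑ a ∈ Finset.range m, (if u (passed k a) = false then
      (-1 : ℤ) ^ a * sgn (passed k a) u else 0) = ((m - below u m) % 2 : ℕ) := by
    intro m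
    induction m with
    | zero => intro _; simp
    | succ m ih =>
      intro hm
      have h2 := hle m (by omega)
      rw [Finset.sum_range_succ, ih (by omega), hsign m (by omega), below_succ u (by omega)]
      cases h : u (passed k m)
      · simp only [if_true]
        rw [if_neg (by simp), add_zero, show m + 1 - below u m = m - below u m + 1 by omega]
        rcases Nat.even_or_odd (m - below u m) with he | he
        · rw [he.neg_one_pow]; have := Nat.even_iff.1 he; omega
        · rw [he.neg_one_pow]; have := Nat.odd_iff.1 he; omega
      · simp
  induction m with
  | zero => simp
  | succ m ih =>
    have h2 := hle m (by omega)
    rw [Finset.sum_range_succ, ih (by omega), below_succ u (by omega)]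
    cases h : u (passed k m)
    · have h3 : ∑ a ∈ Finset.range m, (if u (passed k a) = false ∧ false = false then
          (-1 : ℤ) ^ (a + m) * (sgn (passed k a) u * sgn (passed k m) u) else 0) =
          ((m - below u m) % 2 : ℕ) * (-1) ^ (m - below u m) := by
        rw [← h1 m (by omega), ← hsign m (by omega), Finset.sum_mul]
        refine Finset.sum_congr rfl fun a _ => ?_
        split_ifs with h4 h5 h5
        · rw [pow_add]; ring
        · exact absurd h4.1 h5
        · exact absurd ⟨h5, rfl⟩ h4
        · rw [zero_mul]
      rw [h3, if_neg (by simp), add_zero, show m + 1 - below u m = m - below u m + 1 by omega]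
      rcases Nat.even_or_odd (m - below u m) with he | he
      · rw [he.neg_one_pow]; have := Nat.even_iff.1 he; rw [this]; push_cast; omega
      · rw [he.neg_one_pow]; have := Nat.odd_iff.1 he; rw [this]; push_cast; omega
    · simp

/-- Each vertex of weight $t$ receives the pairs of its $2k+1-t$ 0-resolved crossings, counted by
`sum_sgn_sgn`. -/
theorem halfU_layer (t : ℕ) : halfU (opΧ R k) • layer R k (t + 2) =
    ((2 * k + 1 - t) / 2) • opΨ R k • layer R k t := by
  have hc : ∀ (a : ℕ) (z : End (cubeObj R k)), z * (-1) ^ a = (-1) ^ a * z := fun a z =>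
    ((Commute.neg_one_left z).pow_left a).eq.symm
  have h1 : ∀ a b, a < b → b < 2 * k + 1 → (((-1) ^ a * opΧ R k (passed k a)) *
      ((-1) ^ b * opΧ R k (passed k b))) • layer R k (t + 2) =
      ∑ u ∈ Finset.univ.filter (fun u : Vertex k => u.weight = t),
        -(if u (passed k a) = false ∧ u (passed k b) = false then
        (-1 : ℤ) ^ (a + b) * (sgn (passed k a) u * sgn (passed k b) u) else 0) •
          opΨ R k • one R k u := by
    intro a b hab hb
    have e1 : ((-1) ^ a * opΧ R k (passed k a)) * ((-1) ^ b * opΧ R k (passed k b)) =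
        ((-1 : ℤ) ^ (a + b)) • (opΧ R k (passed k a) * opΧ R k (passed k b)) := by
      rw [mul_assoc, ← mul_assoc (opΧ R k _), hc b, pow_add, mul_smul]
      simp only [zsmul_eq_mul, Int.cast_pow, Int.cast_neg, Int.cast_one, mul_assoc]
    have hlt : passed k a < passed k b := by
      rw [Fin.lt_def, passed_val_of_lt (by omega), passed_val_of_lt hb]; exact hab
    rw [e1, smul_assoc, mul_smul, chi_chi_layer hlt, Finset.smul_sum]
    refine Finset.sum_congr rfl fun u _ => ?_
    split_ifs
    · rw [smul_smul]; congr 1; ring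
    · simp
  unfold halfU
  rw [Finset.sum_smul, Finset.sum_congr rfl fun b hb => (Finset.sum_smul ..).trans
    ((Finset.sum_congr rfl fun a ha => h1 a b (Finset.mem_range.1 ha) (Finset.mem_range.1 hb)).trans
      Finset.sum_comm), Finset.sum_comm, layer, Finset.smul_sum, Finset.smul_sum]
  refine Finset.sum_congr rfl fun u hu => ?_
  have hu' : u.weight = t := (Finset.mem_filter.1 hu).2
  simp only [← Finset.sum_smul, Finset.sum_neg_distrib]
  rw [sum_sgn_sgn u _ le_rfl, below_all, hu', neg_neg, natCast_zsmul]

end Layers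
end TorusKh

/-! ### The perturbation argument and the inclusion of the small model. -/

namespace TorusKh

open Cob

section Perturbation

variable {A : Type*} [Ring A]

/-- In a product of factors $p$ and $q$ no $q$ may stand to the left of a $p$, so only $p^aq^b$
survives. If $q$ is nilpotent, high powers stabilise at $p(1+q+q^2+\cdots)$. -/
theorem add_pow_of_mul_eq_zero {p q : A} (h : q * p = 0) (hp : p * p = p) (n : ℕ) :
    (p + q) ^ n = q ^ n + p * ∑ b ∈ Finset.range n, q ^ b := by
  induction n with
  | zero => simp
  | succ n ih =>
    rw [pow_succ', ih, Finset.sum_range_succ, add_mul, mul_add, mul_add, ← mul_assoc, hp, ← mul_assoc q p, h,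
      zero_mul, add_zero, ← pow_succ', mul_add]
    abel

/-- A contraction onto the image of an idempotent can be replaced by one that satisfies the side
conditions. -/
theorem side_conditions {d s e s₁ : A} (hd : d * d = 0) (he : e * e = e) (hde : d * e = e * d)
    (hs : e - 1 = d * s + s * d) (hs₁ : s₁ = (1 - e) * s * (1 - e)) :
    e - 1 = d * -(s₁ * d * s₁) + -(s₁ * d * s₁) * d ∧ e * (s₁ * d * s₁) = 0 ∧ s₁ * d * s₁ * e = 0 ∧
      s₁ * d * s₁ * (s₁ * d * s₁) = 0 := by
  have e1 : e * (1 - e) = 0 := by rw [mul_sub, mul_one, he, sub_self]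
  have e2 : (1 - e) * e = 0 := by rw [sub_mul, one_mul, he, sub_self]
  have es : e * s₁ = 0 := by rw [hs₁, ← mul_assoc, ← mul_assoc, e1, zero_mul, zero_mul]
  have se : s₁ * e = 0 := by rw [hs₁, mul_assoc, e2, mul_zero]
  have hdp : d * (1 - e) = (1 - e) * d := by rw [mul_sub, sub_mul, hde, mul_one, one_mul]
  -- Compressing by the idempotent `1 - e`, which commutes with `d`, changes nothing, as
  -- $ds+sd=-(1-e)$. The compressed `s₁` is killed by `e` on both sides; the sign in the final `-(s₁
  -- * d * s₁)` comes from $ds_1+s_1d$ being $-1$ on the complement.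
  have hds : d * s₁ + s₁ * d = e - 1 := by
    have h1 : d * s₁ = (1 - e) * (d * s) * (1 - e) := by
      rw [hs₁]; simp only [← mul_assoc]; rw [hdp]
    have h2 : s₁ * d = (1 - e) * (s * d) * (1 - e) := by
      rw [hs₁]; simp only [mul_assoc]; rw [hdp]
    have h3 : (1 - e) * (1 - e) = 1 - e := by rw [mul_sub, mul_one, e2, sub_zero]
    rw [h1, h2, ← add_mul, ← mul_add, ← hs, show e - 1 = -(1 - e) by abel, mul_neg, h3, neg_mul, h3]
  have h0 : d * s₁ * d = d * (e - 1) := by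
    rw [← hds, mul_add, ← mul_assoc, hd, zero_mul, zero_add, mul_assoc]
  have h1 : d * s₁ * (d * s₁) = -(d * s₁) := by
    rw [← mul_assoc, h0, mul_assoc, sub_mul, es, one_mul, zero_sub, mul_neg]
  have h2 : s₁ * d * s₁ * d = -(s₁ * d) := by
    rw [mul_assoc, mul_assoc, ← mul_assoc d, h0, mul_sub, hde, mul_one, mul_sub, ← mul_assoc, se, zero_mul,
      zero_sub]
  have h3 : d * s₁ * s₁ = -s₁ - s₁ * d * s₁ := by
    rw [eq_sub_iff_add_eq, ← add_mul, hds, sub_mul, es, one_mul, zero_sub]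
  refine ⟨?_, ?_, ?_, ?_⟩
  · rw [mul_neg, neg_mul, h2, ← hds, mul_assoc s₁, ← mul_assoc d s₁, h1, neg_neg, neg_neg]
  · rw [← mul_assoc, ← mul_assoc, es, zero_mul, zero_mul]
  · rw [mul_assoc, se, mul_zero]
  · calc s₁ * d * s₁ * (s₁ * d * s₁) = s₁ * (d * s₁ * s₁) * (d * s₁) := by simp only [mul_assoc]
      _ = -(s₁ * s₁ * (d * s₁)) - s₁ * s₁ * (d * s₁ * (d * s₁)) := by
        rw [h3]; simp only [mul_sub, sub_mul, mul_neg, neg_mul, mul_assoc]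
      _ = 0 := by rw [h1, mul_neg, sub_neg_eq_add, neg_add_cancel]

end Perturbation

section Retract

variable {R : Type*} [CommRing R] {k : ℕ}

/-- A diagonal endomorphism of the small model with equal entries. -/
noncomputable def sdiag (φ : unknot R ⟶ unknot R) : smallObj R k ⟶ smallObj R k :=
  ofEnt (M := smallObj R k) (N := smallObj R k) fun i j => if i = j then φ else 0

variable (R) in
/-- The disc in one copy of the circle. -/
noncomputable def cupI (i : SmallIndex k) : emptyObj R ⟶ smallObj R k :=
  ofEnt fun _ j => if i = j then cup R Unit else 0

theorem sdiag_comp_apply {M : Mat_ (Cob R)} (φ : unknot R ⟶ unknot R) (f : smallObj R k ⟶ M)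
    (i : SmallIndex k) (j : M.ι) : ent (sdiag φ ≫ f) i j = φ ≫ ent f i j := by
  rw [ent_comp, Finset.sum_eq_single i]
  · exact congrArg (· ≫ ent f i j) (if_pos rfl)
  · intro a _ ha
    exact (congrArg (· ≫ ent f a j) (if_neg ha.symm)).trans Limits.zero_comp
  · simp

theorem comp_sdiag_apply {M : Mat_ (Cob R)} (φ : unknot R ⟶ unknot R) (f : M ⟶ smallObj R k)
    (i : M.ι) (j : SmallIndex k) : ent (f ≫ sdiag φ) i j = ent f i j ≫ φ := by
  rw [ent_comp, Finset.sum_eq_single j]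
  · exact congrArg (ent f i j ≫ ·) (if_pos rfl)
  · intro a _ ha
    exact (congrArg (ent f i a ≫ ·) (if_neg ha)).trans Limits.comp_zero
  · simp

theorem cupI_comp_apply {M : Mat_ (Cob R)} (i : SmallIndex k) (f : smallObj R k ⟶ M) (a : Unit) (j : M.ι) :
    ent (cupI R i ≫ f) a j = cup R Unit ≫ ent f i j := by
  rw [ent_comp, Finset.sum_eq_single i]
  · exact congrArg (· ≫ ent f i j) (if_pos rfl)
  · intro b _ hb
    exact (congrArg (· ≫ ent f b j) (if_neg hb.symm)).trans Limits.zero_comp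
  · simp

/-- Morphisms from the small model that intertwine the dot are determined by the images of cups. -/
theorem small_ext {M : Mat_ (Cob R)} {φ ψ : smallObj R k ⟶ M} {Z : M ⟶ M} (hφ : sdiag (dotX R) ≫ φ = φ ≫ Z)
    (hψ : sdiag (dotX R) ≫ ψ = ψ ≫ Z) (h : ∀ i, cupI R i ≫ φ = cupI R i ≫ ψ) : φ = ψ := by
  rw [← sub_eq_zero]
  set δ := φ - ψ with hδ
  have h1 : sdiag (dotX R) ≫ δ = δ ≫ Z := by rw [hδ, Preadditive.comp_sub, Preadditive.sub_comp, hφ, hψ]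
  have h2 : ∀ i, cupI R i ≫ δ = 0 := fun i => by rw [hδ, Preadditive.comp_sub, h, sub_self]
  refine ent_ext fun i j => ?_
  rw [ent_zero]
  refine eq_zero_of_cup_dots _ fun l hl => ?_
  rcases l with _ | ⟨⟨⟩, _ | ⟨⟨⟩, l⟩⟩
  · refine Eq.trans ?_ (congrArg (fun f => ent f () j) (h2 i))
    rw [cupI_comp_apply]
    exact congrArg (cup R Unit ≫ ·) (Category.id_comp _)
  · have h3 : cupI R i ≫ sdiag (dotX R) ≫ δ = 0 := by
      rw [h1, ← Category.assoc, h2, Limits.zero_comp]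
    refine Eq.trans ?_ (congrArg (fun f => ent f () j) h3)
    rw [cupI_comp_apply, sdiag_comp_apply]
    exact congrArg (fun f => cup R Unit ≫ f ≫ ent δ i j) (Category.comp_id _)
  · simp at hl

theorem sdiag_mapI {φ : unknot R ⟶ unknot R} {ψ : ∀ v : Vertex k, vobj R v ⟶ vobj R v}
    (h : ∀ v, φ ≫ inc R v = inc R v ≫ ψ v) :
    sdiag φ ≫ mapI R k = mapI R k ≫ (diag ψ : cubeObj R k ⟶ cubeObj R k) := by
  refine ent_ext fun i v => ?_
  rw [sdiag_comp_apply, comp_diag_apply]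
  by_cases hv : v.weight = i.1.val
  · rw [ent_mapI hv, h]
  · rw [ent_mapI_ne hv, Limits.comp_zero, Limits.zero_comp]

theorem mapM_sdiag {φ : unknot R ⟶ unknot R} {ψ : ∀ v : Vertex k, vobj R v ⟶ vobj R v}
    (h : ∀ v, ψ v ≫ mrg R v = mrg R v ≫ φ) :
    (diag ψ : cubeObj R k ⟶ cubeObj R k) ≫ mapM R k = mapM R k ≫ sdiag φ := by
  refine ent_ext fun v i => ?_
  rw [comp_sdiag_apply, diag_comp_apply]
  by_cases hv : v.weight = i.1.val
  · rw [ent_mapM hv, h]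
  · rw [ent_mapM_ne hv, Limits.comp_zero, Limits.zero_comp]

theorem opΦ_opX (e : Edge k) : Commute (opΦ R k) (opX R k e) :=
  (((opX_comm _ _).sub_left (opX_comm _ _)).mul_left (proj_opX _ _)).add_left (proj_opX _ _)

theorem opΦ_opH : Commute (opΦ R k) (opH R k) :=
  (((opH_opX _).symm.sub_left (opH_opX _).symm).mul_left (proj_opH _)).add_left (proj_opH _)

theorem opΓ_opX : Commute (opΓ R k) (opX R k (0, false)) :=
  (opC₀_opX 0).add_left ((twistDiags_opX le_rfl (Or.inl rfl) false).mul_left (proj_opX _ _))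

theorem commute_smul_comm' {L : Mat_ (Cob R)} {S T : End (cubeObj R k)} (h : Commute S T)
    (z : L ⟶ cubeObj R k) : S • T • z = T • S • z := by rw [← mul_smul, h.eq, mul_smul]

theorem mapF_opX : sdiag (dotX R) ≫ mapF R k = mapF R k ≫ (opX R k (0, false) : cubeObj R k ⟶ cubeObj R k) := by
  rw [mapF, ← Category.assoc, sdiag_mapI dotX_inc, Category.assoc, Category.assoc]
  exact congrArg (mapI R k ≫ ·) (opΦ_opX (R := R) (0, false)).eq

theorem mapF_opH : sdiag (hU R) ≫ mapF R k = mapF R k ≫ (opH R k : cubeObj R k ⟶ cubeObj R k) := by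
  rw [mapF, ← Category.assoc, sdiag_mapI hU_inc, Category.assoc, Category.assoc]
  exact congrArg (mapI R k ≫ ·) (opΦ_opH (R := R)).eq

theorem sdiag_mapH : (sdiag (mapH R) : smallObj R k ⟶ _) = sdiag (dotX R) + sdiag (dotX R) - sdiag (hU R) := by
  refine ent_ext fun i j => ?_
  rw [ent_sub, ent_add]
  by_cases h : i = j
  · simp only [sdiag, ent_ofEnt, if_pos h]; rfl
  · simp only [sdiag, ent_ofEnt, if_neg h]; simp

theorem mapF_opHH : sdiag (mapH R) ≫ mapF R k = mapF R k ≫ (opHH R k : cubeObj R k ⟶ cubeObj R k) := by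
  rw [sdiag_mapH, Preadditive.sub_comp, Preadditive.add_comp, mapF_opX, mapF_opH]
  exact (by simp only [sub_smul, add_smul]; rfl :
    _ = (opX R k (0, false) + opX R k (0, false) - opH R k) • mapF R k)

theorem mapG_opX : (opX R k (0, false) : cubeObj R k ⟶ cubeObj R k) ≫ mapG R k = mapG R k ≫ sdiag (dotX R) := by
  rw [mapG, Category.assoc, ← mapM_sdiag dot_mrg, ← Category.assoc, ← Category.assoc]
  exact congrArg (· ≫ mapM R k) (opΓ_opX (R := R) (k := k)).eq

theorem ent_layer (t : ℕ) (a : Unit) (v : Vertex k) :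
    ent (layer R k t) a v = if v.weight = t then cup R (ResCircle v) else 0 := by
  rw [layer, ent_sum]
  split_ifs with h
  · rw [Finset.sum_eq_single v]
    · exact ent_one_self v a
    · exact fun w _ hw => ent_one_ne hw a
    · intro h'; simp [h] at h'
  · refine Finset.sum_eq_zero fun w hw => ent_one_ne ?_ a
    rintro rfl
    exact h (Finset.mem_filter.1 hw).2

theorem cupI_mapI (i : SmallIndex k) : cupI R i ≫ mapI R k = layer R k i.1.val := by
  refine ent_ext fun a v => ?_
  rw [cupI_comp_apply, ent_layer]
  split_ifs with h
  · rw [ent_mapI h]; exact cup_inc v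
  · rw [ent_mapI_ne h]; exact Limits.comp_zero

theorem cupI_mapF (i : SmallIndex k) : cupI R i ≫ mapF R k = opΦ R k • layer R k i.1.val := by
  rw [mapF, ← Category.assoc, cupI_mapI]; rfl

theorem opΦ_layer {t : ℕ} (ht : t ≠ 0) : opΦ R k • layer R k t = layer R k t := by
  rw [layer, Finset.smul_sum]
  refine Finset.sum_congr rfl fun v hv => ?_
  have h : v ≠ fun _ => false := fun h => ht (by
    rw [← (Finset.mem_filter.1 hv).2, weight_eq_zero.2 h])
  rw [opΦ, add_smul, mul_smul, proj_one_neg (p := fun v => v = fun _ => false) h, smul_zero, zero_add,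
    proj_one (p := fun v => v ≠ fun _ => false) h]

theorem opΦ_layer_zero : opΦ R k • layer R k 0 =
    (opX R k (0, true) - opX R k (0, false)) • one R k (fun _ => false) := by
  rw [layer_zero, opΦ, add_smul, mul_smul, proj_one (p := fun v => v = fun _ => false) rfl,
    proj_one_neg (by simp), add_zero]

/-- The monotone vertex of weight `t`. -/
def monoVertex (k t : ℕ) : Vertex k := fun c => decide (2 * k + 1 ≤ c.val + t)

theorem mono_monoVertex (t : ℕ) : Mono (monoVertex k t) := by
  intro m hm h
  simp only [monoVertex, decide_eq_true_eq] at h ⊢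
  have : (m - 1).val = m.val - 1 := by
    rw [Fin.val_sub_one_of_ne_zero hm]
  omega

theorem weight_monoVertex {t : ℕ} (ht : t ≤ 2 * k + 1) : (monoVertex k t).weight = t := by
  unfold Vertex.weight monoVertex
  simp only [decide_eq_true_eq]
  have h := Fin.card_filter_val_lt (n := 2 * k + 1) (m := 2 * k + 1 - t)
  have h' := Finset.card_filter_add_card_filter_not (s := (Finset.univ : Finset (Crossing k)))
    (fun c => c.val < 2 * k + 1 - t)
  rw [h] at h'
  have h2 : (Finset.univ.filter fun c : Crossing k => 2 * k + 1 ≤ c.val + t) =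
      Finset.univ.filter fun c : Crossing k => ¬ c.val < 2 * k + 1 - t := by
    ext c; simp only [Finset.mem_filter, Finset.mem_univ, true_and]; omega
  rw [h2]
  simp only [Finset.card_univ, Fintype.card_fin] at h'
  omega

theorem one_mapM (v : Vertex k) (h : v.weight ≠ 1) :
    one R k v ≫ mapM R k = cupI R (smallIndex v.weight (weight_le v) h) := by
  refine ent_ext fun a j => ?_
  rw [one_comp_apply]
  by_cases hj : v.weight = j.1.val
  · have : smallIndex v.weight (weight_le v) h = j := Subtype.ext (Fin.ext hj)
    rw [ent_mapM hj, cup_mrg, this]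
    exact (if_pos rfl).symm
  · have : smallIndex v.weight (weight_le v) h ≠ j := fun h' => hj (by rw [← h']; rfl)
    rw [ent_mapM_ne hj, Limits.comp_zero]
    exact (if_neg this).symm

theorem opΓ_one_zero (c : Crossing k) :
    opΓ R k • one R k (fun _ => false) = 0 ∧
    opΓ R k • opX R k (c, true) • one R k (fun _ => false) = one R k (fun _ => false) := by
  have h : opΓ R k • one R k (fun _ => false) = 0 ∧ ∀ T : End (cubeObj R k), 
      Commute (vertexProj R (fun _ => false)) T →
      opΓ R k • T • one R k (fun _ => false) = opC₀ R k • T • one R k (fun _ => false) := by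
    have h1 : ∀ T : End (cubeObj R k), Commute (vertexProj R (fun _ => false)) T →
      opΓ R k • T • one R k (fun _ => false) = opC₀ R k • T • one R k (fun _ => false) := by
      intro T hT
      conv_lhs => rw [← proj_one (R := R) (p := fun w : Vertex k => w = fun _ => false) rfl]
      rw [← commute_smul_comm hT, ← mul_smul, opΓ_zero]
    refine ⟨?_, h1⟩
    have := h1 1 (Commute.one_right _)
    rwa [one_smul, opC₀_one] at this
  exact ⟨h.1, by rw [h.2 _ (proj_opX _ _), opC₀_opX_one]⟩

theorem opΓ_opY_one_zero (c : Crossing k) :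
    opΓ R k • opY R k c • one R k (fun _ => false) = one R k (fun _ => false) := by
  conv_lhs => rw [← proj_one (R := R) (p := fun w : Vertex k => w = fun _ => false) rfl]
  rw [← commute_smul_comm (proj_opY _ _), ← mul_smul, opΓ_zero, opC₀_opY_one]

theorem opΓ_layer {t : ℕ} (ht : t ≤ 2 * k + 1) (h0 : t ≠ 0) :
    opΓ R k • layer R k t = one R k (monoVertex k t) := by
  have hw := weight_monoVertex ht
  have hne : ∀ v : Vertex k, v.weight = t → v ≠ fun _ => false := fun v hv h =>
    h0 (by rw [← hv, weight_eq_zero.2 h])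
  have h : ∀ v, opΓ R k • one R k v = (opΓ R k * vertexProj R v) • one R k v := fun v => by
    rw [mul_smul, proj_one (p := fun w => w = v) rfl]
  rw [layer, Finset.smul_sum, Finset.sum_eq_single (monoVertex k t)]
  · rw [h, opΓ_ne (hne _ hw), mul_smul, proj_one (p := fun w => w = monoVertex k t) rfl,
      twistDiags_one (mono_monoVertex t) _ le_rfl]
  · intro v hv hv'
    rw [h, opΓ_eq_zero, zero_smul]
    intro hm
    have hvw := (Finset.mem_filter.1 hv).2
    have h1 := hm.height_lt (w := monoVertex k t) (by rw [hw, hvw]) hv'.symm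
    have h2 := (mono_monoVertex (k := k) t).height_lt (w := v) (by rw [hw, hvw]) hv'
    exact lt_asymm h1 h2
  · intro h'; simp [hw] at h'

/-- Of the sum of the cups of one weight, `opΓ` retains the cup at the monotone vertex, and merging
its circles gives the cup of one circle. In degree 0 the cut retains the dot on the right strand and
replaces it by a cup. -/
theorem mapF_mapG : mapF R k ≫ mapG R k = 𝟙 (smallObj R k) := by
  refine small_ext (Z := sdiag (dotX R)) ?_ (by rw [Category.comp_id, Category.id_comp]) fun i => ?_
  · rw [← Category.assoc, mapF_opX, Category.assoc, mapG_opX, Category.assoc]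
  rw [← Category.assoc, cupI_mapF, Category.comp_id, mapG, ← Category.assoc]
  change (opΓ R k • opΦ R k • layer R k i.1.val) ≫ mapM R k = _
  by_cases h0 : i.1.val = 0
  · rw [h0, opΦ_layer_zero, sub_smul, smul_sub, (opΓ_one_zero 0).2, commute_smul_comm opΓ_opX,
      (opΓ_one_zero 0).1, smul_zero, sub_zero, one_mapM _ (by rw [weight_eq_zero.2 rfl]; decide)]
    congr 1
    exact Subtype.ext (Fin.ext (by rw [h0]; exact weight_eq_zero.2 rfl))
  · have hi : i.1.val ≤ 2 * k + 1 := by have := i.1.2; omega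
    rw [opΦ_layer h0, opΓ_layer hi h0, one_mapM _ (by rw [weight_monoVertex hi]; exact i.2)]
    congr 1
    exact Subtype.ext (Fin.ext (weight_monoVertex hi))

theorem homot_opX (m : Crossing k) : Commute (homot R k m) (opX R k (0, false)) := by
  unfold homot
  split_ifs with h
  · exact (opC₀_opX 0).mul_left (chi_opX _ _)
  · exact (chi_opX _ _).mul_left (opC_opX (Ne.symm h) _)

theorem chi_opΦ_layer_zero (c : Crossing k) : opΧ R k c • opΦ R k • layer R k 0 = 0 := by
  rw [opΦ_layer_zero, sub_smul, smul_sub, commute_smul_comm (chi_opX _ _), commute_smul_comm (chi_opX _ _),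
    chi_one_of_false rfl, smul_zero, smul_zero, sub_zero]

/-- Cuts kill undotted cups, and `mapF` produces undotted cups in positive degrees. In degree 0,
$\chi$ vanishes, and the cuts at positive levels are not defined at the zero vertex and hence 0. -/
theorem homot_mapF (m : Crossing k) : homot R k m • mapF R k = 0 := by
  refine small_ext (Z := (opX R k (0, false) : cubeObj R k ⟶ cubeObj R k)) ?_
    (by rw [Limits.comp_zero, Limits.zero_comp]) fun i => ?_
  · change sdiag (dotX R) ≫ mapF R k ≫ (homot R k m : cubeObj R k ⟶ cubeObj R k) = _
    rw [← Category.assoc, mapF_opX]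
    exact (commute_smul_comm' (homot_opX m) (mapF R k))
  rw [Limits.comp_zero]
  have h1 : cupI R i ≫ (homot R k m • mapF R k) = homot R k m • opΦ R k • layer R k i.1.val := by
    rw [← cupI_mapF]; exact (Category.assoc _ _ _).symm
  rw [h1]
  unfold homot
  split_ifs with hm
  · rw [kapZero, mul_smul]
    by_cases h0 : i.1.val = 0
    · rw [h0, chi_opΦ_layer_zero, smul_zero]
    · obtain ⟨t, ht⟩ : ∃ t, i.1.val = t + 1 := ⟨i.1.val - 1, by omega⟩
      -- The small model has nothing in degree 1, so $\chi$ does not reach the zero vertex and sends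
      -- cups to signed cups.
      have ht0 : t ≠ 0 := fun h => i.2 (by omega)
      rw [opΦ_layer h0, ht, chi_layer _ _ ht0, Finset.smul_sum]
      refine Finset.sum_eq_zero fun v _ => ?_
      split_ifs
      · rw [smul_comm (opC₀ R k), opC₀_one, smul_zero]
      · exact smul_zero _
  · rw [kap, mul_smul]
    by_cases h0 : i.1.val = 0
    · rw [h0, opΦ_layer_zero, ← opC_proj, mul_smul, commute_smul_comm ((proj_opX _ _).sub_right (proj_opX _ _)),
        proj_one_neg (by rintro ⟨h, _⟩; simp at h), smul_zero, smul_zero, smul_zero]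
    · rw [opΦ_layer h0, smul_layer_eq_zero fun v => opC_one m v, smul_zero]

variable (R k) in
/-- The differential of the small model. -/
noncomputable def opSD : smallObj R k ⟶ smallObj R k :=
  ofEnt (M := smallObj R k) (N := smallObj R k) fun i j =>
    if 2 ≤ i.1.val ∧ Even i.1.val ∧ j.1.val = i.1.val + 1 then mapH R else 0

theorem ent_opSD {i j : SmallIndex k} (h : 2 ≤ i.1.val ∧ Even i.1.val ∧ j.1.val = i.1.val + 1) :
    ent (opSD R k) i j = mapH R := if_pos h

theorem ent_opSD_ne {i j : SmallIndex k} (h : ¬ (2 ≤ i.1.val ∧ Even i.1.val ∧ j.1.val = i.1.val + 1)) :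
    ent (opSD R k) i j = 0 := if_neg h

theorem ent_cupI (i : SmallIndex k) (a : Unit) : ent (cupI R i) a i = cup R Unit := if_pos rfl

theorem ent_cupI_ne {i j : SmallIndex k} (h : i ≠ j) (a : Unit) : ent (cupI R i) a j = 0 := if_neg h

theorem dotX_mapH : dotX R ≫ mapH R = mapH R ≫ dotX R := by
  unfold mapH
  rw [Preadditive.comp_sub, Preadditive.comp_add, Preadditive.sub_comp, Preadditive.add_comp]
  congr 1
  exact (sph_comm _).symm

theorem sdiag_opSD : sdiag (dotX R) ≫ opSD R k = opSD R k ≫ sdiag (dotX R) := by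
  refine ent_ext fun i j => ?_
  rw [sdiag_comp_apply, comp_sdiag_apply]
  by_cases h : 2 ≤ i.1.val ∧ Even i.1.val ∧ j.1.val = i.1.val + 1
  · rw [ent_opSD h, dotX_mapH]
  · rw [ent_opSD_ne h, Limits.comp_zero, Limits.zero_comp]

/-- By `opd_layer` the sum of the cups of weight $t$ goes to $H$ times the next one or to zero,
according to the parity of $t$. Degree 0 is treated apart. -/
theorem mapF_opd : opd R k • mapF R k = opSD R k ≫ mapF R k := by
  refine small_ext (Z := (opX R k (0, false) : cubeObj R k ⟶ cubeObj R k)) ?_ ?_ fun i => ?_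
  · change sdiag (dotX R) ≫ mapF R k ≫ (opd R k : cubeObj R k ⟶ cubeObj R k) = _
    rw [← Category.assoc, mapF_opX]
    exact (commute_smul_comm' (opd_opX _) (mapF R k))
  · rw [← Category.assoc, sdiag_opSD, Category.assoc, mapF_opX, Category.assoc]
  have h1 : cupI R i ≫ (opd R k • mapF R k) = opd R k • opΦ R k • layer R k i.1.val := by
    rw [← cupI_mapF]; exact (Category.assoc _ _ _).symm
  rw [h1, ← Category.assoc]
  by_cases hi : 2 ≤ i.1.val ∧ Even i.1.val
  · have hlt : i.1.val + 1 < 2 * k + 2 := by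
      have := i.1.2
      obtain ⟨j, hj⟩ := hi.2
      omega
    have h2 : cupI R i ≫ opSD R k = cupI R (smallIndex (i.1.val + 1) (by omega) (by omega)) ≫ sdiag (mapH R) := by
      refine ent_ext fun a j => ?_
      rw [cupI_comp_apply, comp_sdiag_apply]
      by_cases hj : j.1.val = i.1.val + 1
      · have : smallIndex (i.1.val + 1) (by omega) (by omega) = j := Subtype.ext (Fin.ext hj.symm)
        rw [ent_opSD ⟨hi.1, hi.2, hj⟩, ← this, ent_cupI]
      · have : smallIndex (i.1.val + 1) (by omega) (by omega) ≠ j := fun h => hj (by rw [← h]; rfl)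
        rw [ent_opSD_ne fun h => hj h.2.2, ent_cupI_ne this, Limits.comp_zero, Limits.zero_comp]
    rw [h2, Category.assoc, mapF_opHH, ← Category.assoc, cupI_mapF, opΦ_layer (by omega), opd_layer (by omega),
      if_pos hi.2, opΦ_layer (by simp [smallIndex])]
    rfl
  · have h2 : cupI R i ≫ opSD R k = 0 := by
      refine ent_ext fun a j => ?_
      rw [cupI_comp_apply, ent_opSD_ne fun h => hi ⟨h.1, h.2.1⟩, Limits.comp_zero]; rfl
    rw [h2, Limits.zero_comp]
    by_cases h0 : i.1.val = 0
    · rw [h0, opΦ_layer_zero, commute_smul_comm ((opd_opX _).sub_right (opd_opX _)), opd, Finset.sum_smul,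
        Finset.smul_sum]
      refine Finset.sum_eq_zero fun c _ => ?_
      -- A saddle out of the zero vertex joins the two strands, so the difference of their dots
      -- becomes zero.
      rw [opD_one_zero, smul_comm (opX R k (0, true) - opX R k (0, false)), sub_smul,
        opX_one_congr (circ_single _ _ _), sub_self, smul_zero]
    · have h2 : 2 ≤ i.1.val := by have := i.2; omega
      rw [opΦ_layer h0, opd_layer h0, if_neg fun h => hi ⟨h2, h⟩]

/-- The image of `mapF` is a subcomplex that the homotopy kills, so the commutator with $d$ vanishes
on it. -/
theorem twist_mapF (m : Crossing k) : twist R k m • mapF R k = mapF R k := by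
  rw [twist, sub_smul, one_smul, add_smul, mul_smul, mul_smul, homot_mapF, smul_zero, mapF_opd, zero_add]
  have : homot R k m • (opSD R k ≫ mapF R k) = opSD R k ≫ (homot R k m • mapF R k) := Category.assoc _ _ _
  rw [this, homot_mapF, Limits.comp_zero, sub_zero]

theorem twists_mapF (j : ℕ) : twists R k j • mapF R k = mapF R k := by
  induction j with
  | zero => exact one_smul _ _
  | succ j ih => rw [twists, mul_smul, ih, twist_mapF]

theorem allTwists_mapF : allTwists R k • mapF R k = mapF R k := by
  rw [allTwists, mul_smul, twists_mapF, twist_mapF]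

theorem opQ_mapF : opQ R k • mapF R k = 0 := by
  rw [opQ, sub_smul, allTwists_mapF, ← mapG_mapF]
  have : (show End (cubeObj R k) from mapG R k ≫ mapF R k) • mapF R k = (mapF R k ≫ mapG R k) ≫ mapF R k :=
    (Category.assoc _ _ _).symm
  rw [this, mapF_mapG, Category.id_comp, sub_self]

end Retract
end TorusKh

/-! ### Counting circles, and degrees of all maps. -/

namespace TorusKh

open Cob

section CountCircles

variable {k : ℕ}

theorem card_eq_add_one {Y Z : Type} [Finite Y] [Finite Z] {π : Y → Z} (hπ : Function.Surjective π) {a b : Y}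
    (hab : a ≠ b) (h : π a = π b)
    (hinj : ∀ y y', π y = π y' → y = y' ∨ (y = a ∧ y' = b) ∨ (y = b ∧ y' = a)) :
    Nat.card Y = Nat.card Z + 1 := by
  classical
  have h1 : Nat.card {y // y ≠ b} = Nat.card Z := by
    refine Nat.card_eq_of_bijective (fun y => π y.1) ⟨?_, ?_⟩
    · rintro ⟨y, hy⟩ ⟨y', hy'⟩ h
      rcases hinj y y' h with h | ⟨_, h⟩ | ⟨h, _⟩
      · exact Subtype.ext h
      · exact absurd h hy'
      · exact absurd h hy
    · intro z
      obtain ⟨y, rfl⟩ := hπ z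
      by_cases hy : y = b
      · exact ⟨⟨a, hab⟩, by rw [hy]; exact h⟩
      · exact ⟨⟨y, hy⟩, rfl⟩
  rw [← h1, ← Nat.card_congr (Equiv.optionSubtypeNe b), Finite.card_option]

theorem card_update {v : Vertex k} {c c' : Crossing k} (hc : v c = false) (hc' : v c' = true) :
    Nat.card (ResCircle (Function.update v c true)) = Nat.card (ResCircle v) + 1 := by
  have hcc : c' ≠ c := by rintro rfl; simp [hc] at hc'
  refine card_eq_add_one (coarsen_surjective (joined_update hc'))
    (circ_ne (c := c) hcc (update_eq_true c v) ?_) ?_ (coarsen_update_inj hc')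
  · rw [Function.update_of_ne hcc]; exact hc'
  · exact circ_zero hc false

theorem card_single (c : Crossing k) : Nat.card (ResCircle (Function.update (fun _ => false) c true)) = 1 := by
  rw [Nat.card_eq_one_iff_unique]
  refine ⟨⟨?_⟩, ⟨circ _ (0, false)⟩⟩
  rintro ⟨e⟩ ⟨e'⟩
  exact circ_single c e e'

theorem card_zero : Nat.card (ResCircle (fun _ => false : Vertex k)) = 2 := by
  rw [card_eq_add_one (coarsen_surjective (joined_zero (c := 0))) (circ_zero_ne 0 (0 + 1)) (circ_single _ _ _)
    fun y y' _ => coarsen_zero_inj y y', card_single]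

/-- The first 1-resolution merges the two strands into one circle, and each further one splits a
circle. -/
theorem card_eq_weight {v : Vertex k} (h : v ≠ fun _ => false) : Nat.card (ResCircle v) = v.weight := by
  induction hw : v.weight generalizing v with
  | zero => exact absurd (weight_eq_zero.1 hw) h
  | succ w ih =>
    obtain ⟨c, hc⟩ := (zero_or_exists v).resolve_left h
    obtain ⟨u, hu, rfl⟩ := exists_update hc
    rw [weight_update hu] at hw
    rcases zero_or_exists u with rfl | ⟨c', hc'⟩
    · rw [card_single, ← hw, weight_eq_zero.2 rfl]
    · rw [card_update hu hc', ih (by rintro rfl; simp at hc') (by omega)]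

end CountCircles

section Homogeneous

variable {R : Type*} [CommRing R]

theorem homog_comp {A B C : Cob R} {f : A ⟶ B} {g : B ⟶ C} {m n : ℤ} (hf : f ∈ homog m A B)
    (hg : g ∈ homog n B C) : f ≫ g ∈ homog (m + n) A C := by
  unfold homog at hf
  induction hf using AddSubgroup.closure_induction with
  | zero => rw [Limits.zero_comp]; exact AddSubgroup.zero_mem _
  | add f f' _ _ h h' => rw [Preadditive.add_comp]; exact AddSubgroup.add_mem _ h h'
  | neg f _ h => rw [Preadditive.neg_comp]; exact AddSubgroup.neg_mem _ h
  | mem f hf =>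
    obtain ⟨r, S, hS, rfl⟩ := hf
    unfold homog at hg
    induction hg using AddSubgroup.closure_induction with
    | zero => rw [Limits.comp_zero]; exact AddSubgroup.zero_mem _
    | add f f' _ _ h h' => rw [Preadditive.comp_add]; exact AddSubgroup.add_mem _ h h'
    | neg f _ h => rw [Preadditive.comp_neg]; exact AddSubgroup.neg_mem _ h
    | mem g hg =>
      obtain ⟨s, T, hT, rfl⟩ := hg
      rw [surf_comp]
      exact AddSubgroup.subset_closure ⟨_, _, by rw [DSurf.deg_glue, hS, hT], rfl⟩

variable {X Y : Type} [Finite X] [Finite Y]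

theorem mor_mem {S : DSurf X Y} {m : ℤ} (h : S.deg = m) : mor R S ∈ homog m (circles R X) (circles R Y) :=
  AddSubgroup.subset_closure ⟨1, S, h, rfl⟩

theorem deg_plain {S : DSurf X Y} (hg : ∀ c, S.genus c = 0) (hd : ∀ c, S.dots c = 0) :
    S.deg = Nat.card X + Nat.card Y - 2 * Nat.card S.Comp := by
  have := Fintype.ofFinite S.Comp
  rw [DSurf.deg_eq]
  simp only [hg, hd, finsum_eq_sum_of_fintype]
  simp
  ring

theorem deg_addDot (S : DSurf X Y) (c : S.Comp) : (S.addDot c).deg = S.deg + 2 := by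
  classical
  have := Fintype.ofFinite S.Comp
  rw [DSurf.deg_eq, DSurf.deg_eq]
  simp only [finsum_eq_sum_of_fintype, Nat.cast_add, Finset.sum_add_distrib]
  simp
  ring

theorem deg_addSphere (S : DSurf X Y) (m : ℕ) : (S.addSphere m).deg = S.deg - 2 + 2 * m := by
  classical
  have := Fintype.ofFinite S.Comp
  rw [DSurf.deg_eq, DSurf.deg_eq]
  simp only [finsum_eq_sum_of_fintype, Fintype.sum_option]
  simp
  ring

theorem deg_cylinder : (DSurf.cylinder X).deg = 0 := by
  rw [deg_plain (fun _ => rfl) fun _ => rfl]; ring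

theorem dot_mem (x : X) : dot x ∈ homog 2 (circles R X) (circles R X) :=
  mor_mem (by rw [deg_addDot, deg_cylinder, zero_add])

theorem sph_mem : sph R X ∈ homog 2 (circles R X) (circles R X) :=
  mor_mem (by rw [deg_addSphere, deg_cylinder]; norm_num)

theorem cutAt_mem (x : X) : cutAt x ∈ homog (-2) (circles R X) (circles R X) := by
  refine mor_mem ?_
  rw [deg_plain (fun _ => rfl), Finite.card_option]
  · push_cast; ring
  · rintro (_ | y)
    · rfl
    · exact ite_self 0

theorem id_mem : 𝟙 (circles R X) ∈ homog 0 (circles R X) (circles R X) := by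
  rw [← mor_cylinder]; exact mor_mem deg_cylinder

theorem mapH_mem : mapH R ∈ homog 2 (unknot R) (unknot R) :=
  AddSubgroup.sub_mem _ (AddSubgroup.add_mem _ (dot_mem ()) (dot_mem ())) sph_mem

variable {k : ℕ}

theorem inc_mem (v : Vertex k) : inc R v ∈ homog (1 - Nat.card (ResCircle v)) (unknot R) (vobj R v) := by
  refine mor_mem ?_
  rw [deg_plain (fun _ => rfl) fun _ => rfl]
  change ((Nat.card Unit : ℕ) : ℤ) + Nat.card (ResCircle v) - 2 * Nat.card (ResCircle v) = _
  rw [Nat.card_unique]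
  push_cast; ring

theorem mrg_mem (v : Vertex k) : mrg R v ∈ homog (Nat.card (ResCircle v) - 1) (vobj R v) (unknot R) := by
  refine mor_mem ?_
  rw [deg_plain (fun _ => rfl) fun _ => rfl]
  change ((Nat.card (ResCircle v) : ℕ) : ℤ) + Nat.card Unit - 2 * Nat.card Unit = _
  rw [Nat.card_unique (α := Unit)]
  push_cast; ring

theorem sweep_mem {v : Vertex k} {c : Crossing k} (hc : v c = false) :
    mor R (sweep v (Function.update v c true)) ∈
      homog 1 (vobj R v) (vobj R (Function.update v c true)) ∧
    mor R (sweep (Function.update v c true) v) ∈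
      homog 1 (vobj R (Function.update v c true)) (vobj R v) := by
  rcases zero_or_exists v with rfl | ⟨c', hc'⟩
  · rw [mor_sweep_up (v := Function.update (fun _ => false) c true) joined_zero,
      mor_sweep_down (v := Function.update (fun _ => false) c true) joined_zero]
    constructor <;> refine mor_mem ?_ <;>
      rw [deg_plain (fun _ => rfl) fun _ => rfl, card_zero, card_single] <;> rfl
  · rw [mor_sweep_up (joined_update hc'), mor_sweep_down (joined_update hc')]
    constructor <;> refine mor_mem ?_ <;>
      rw [deg_plain (fun _ => rfl) fun _ => rfl, card_update hc hc'] <;> push_cast <;> ring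

end Homogeneous

section Bidegree

variable {R : Type*} [CommRing R] {C D E : GrMat R}

theorem HasBidegree.comp {f : C.obj ⟶ D.obj} {g : D.obj ⟶ E.obj} {a b a' b' : ℤ} (hf : HasBidegree f a b)
    (hg : HasBidegree g a' b') : HasBidegree (f ≫ g) (a + a') (b + b') := by
  intro i j
  refine ⟨fun h => AddSubgroup.sum_mem _ fun l _ => ?_, fun h => Finset.sum_eq_zero fun l _ => ?_⟩
  · by_cases hl : D.t l = C.t i + a
    · have h1 := (hf i l).1 hl
      have h2 := (hg l j).1 (by omega)
      have := homog_comp h1 h2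
      rwa [show b + C.q i - D.q l + (b' + D.q l - E.q j) = b + b' + C.q i - E.q j by ring] at this
    · rw [(hf i l).2 hl, Limits.zero_comp]; exact AddSubgroup.zero_mem _
  · by_cases hl : D.t l = C.t i + a
    · rw [(hg l j).2 (by omega), Limits.comp_zero]
    · rw [(hf i l).2 hl, Limits.zero_comp]

theorem HasBidegree.zero (a b : ℤ) : HasBidegree (0 : C.obj ⟶ D.obj) a b := fun _ _ =>
  ⟨fun _ => AddSubgroup.zero_mem _, fun _ => rfl⟩

theorem HasBidegree.add {f g : C.obj ⟶ D.obj} {a b : ℤ} (hf : HasBidegree f a b) (hg : HasBidegree g a b) :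
    HasBidegree (f + g) a b := fun i j =>
  ⟨fun h => AddSubgroup.add_mem _ ((hf i j).1 h) ((hg i j).1 h), fun h => by
    refine Eq.trans (ent_add f g i j) ?_
    unfold ent
    rw [(hf i j).2 h, (hg i j).2 h, add_zero]⟩

theorem HasBidegree.neg {f : C.obj ⟶ D.obj} {a b : ℤ} (hf : HasBidegree f a b) : HasBidegree (-f) a b := fun i j =>
  ⟨fun h => by
    rw [show (-f) i j = -(f i j) from ent_neg f i j]
    exact AddSubgroup.neg_mem _ ((hf i j).1 h), fun h => by
    refine Eq.trans (ent_neg f i j) ?_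
    unfold ent
    rw [(hf i j).2 h, neg_zero]⟩

theorem HasBidegree.sub {f g : C.obj ⟶ D.obj} {a b : ℤ} (hf : HasBidegree f a b) (hg : HasBidegree g a b) :
    HasBidegree (f - g) a b := sub_eq_add_neg f g ▸ hf.add hg.neg

theorem HasBidegree.sum {ι : Type*} {s : Finset ι} {f : ι → (C.obj ⟶ D.obj)} {a b : ℤ}
    (hf : ∀ i ∈ s, HasBidegree (f i) a b) : HasBidegree (∑ i ∈ s, f i) a b :=
  Finset.sum_induction _ (fun f => HasBidegree f a b) (fun _ _ => HasBidegree.add) (HasBidegree.zero a b) hf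

theorem HasBidegree.mul {S T : End C.obj} {a b a' b' : ℤ} (hS : HasBidegree (C := C) (D := C) S a b)
    (hT : HasBidegree (C := C) (D := C) T a' b') :
    HasBidegree (C := C) (D := C) (S * T) (a + a') (b + b') := by
  rw [add_comm a, add_comm b]; exact hT.comp hS

theorem HasBidegree.pow {T : End C.obj} (h1 : HasBidegree (C := C) (D := C) (1 : End C.obj) 0 0)
    (hT : HasBidegree (C := C) (D := C) T 0 0) (n : ℕ) : HasBidegree (C := C) (D := C) (T ^ n) 0 0 := by
  induction n with
  | zero => exact h1
  | succ n ih => rw [pow_succ]; exact ih.mul hT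

end Bidegree

section CubeDegrees

variable {R : Type*} [CommRing R] {k : ℕ}

/-- Endomorphisms of the bracket of a given bidegree. -/
abbrev CubeDeg (T : End (cubeObj R k)) (a b : ℤ) : Prop :=
  HasBidegree (C := bracket R k) (D := bracket R k) T a b

/-- The quantum shift drops by 1 with each homological degree, so an entry of bidegree $(a,b)$ is a
surface of degree $a+b$. -/
theorem cubeDeg_of {T : End (cubeObj R k)} {a b : ℤ} (h : ∀ v w, ent T v w = 0 ∨
    ((w.weight : ℤ) = v.weight + a ∧ ent T v w ∈ homog (b + a) (vobj R v) (vobj R w))) : CubeDeg T a b := by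
  intro v w
  change Vertex k at v w
  change ((w.weight : ℤ) = v.weight + a → ent T v w ∈ homog (b + v.shift - w.shift) (vobj R v) (vobj R w)) ∧
    ((w.weight : ℤ) ≠ v.weight + a → ent T v w = 0)
  refine ⟨fun hw => ?_, fun hw => ?_⟩
  · rcases h v w with h | ⟨_, h⟩
    · rw [h]; exact AddSubgroup.zero_mem _
    · rwa [show b + v.shift - w.shift = b + a by unfold Vertex.shift; omega]
  · exact (h v w).resolve_right fun h => hw h.1

theorem cubeDeg_diag {φ : ∀ v : Vertex k, vobj R v ⟶ vobj R v} {b : ℤ}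
    (h : ∀ v, φ v ∈ homog b (vobj R v) (vobj R v)) : CubeDeg (diag φ) 0 b := by
  refine cubeDeg_of fun v w => ?_
  by_cases hvw : v = w
  · subst hvw
    rw [diag_self, add_zero, add_zero]
    exact Or.inr ⟨rfl, h v⟩
  · exact Or.inl (diag_ne φ hvw)

theorem cubeDeg_one : CubeDeg (1 : End (cubeObj R k)) 0 0 := by
  rw [← diag_id]; exact cubeDeg_diag fun v => id_mem

theorem cubeDeg_opX (e : Edge k) : CubeDeg (opX R k e) 0 2 := cubeDeg_diag fun _ => dot_mem _

theorem cubeDeg_opH : CubeDeg (opH R k) 0 2 := cubeDeg_diag fun _ => sph_mem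

theorem cubeDeg_opY (c : Crossing k) : CubeDeg (opY R k c) 0 2 :=
  ((cubeDeg_opX _).add (cubeDeg_opX _)).sub cubeDeg_opH

theorem cubeDeg_proj (p : Vertex k → Prop) : CubeDeg (proj R k p) 0 0 := cubeDeg_diag fun v => by
  split_ifs
  · exact id_mem
  · exact AddSubgroup.zero_mem _

theorem cubeDeg_opC (m : Crossing k) : CubeDeg (opC R k m) 0 (-2) := cubeDeg_diag fun v => by
  split_ifs
  · exact cutAt_mem _
  · exact AddSubgroup.zero_mem _

theorem cubeDeg_opC₀ : CubeDeg (opC₀ R k) 0 (-2) := cubeDeg_diag fun v => by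
  split_ifs
  · exact cutAt_mem _
  · exact AddSubgroup.zero_mem _

theorem cubeDeg_opD (c : Crossing k) : CubeDeg (opD R k c) 1 0 := cubeDeg_of fun v w => by
  by_cases h : v c = false ∧ w = Function.update v c true
  · obtain ⟨h1, rfl⟩ := h
    refine Or.inr ⟨by rw [weight_update h1]; push_cast; rfl, ?_⟩
    rw [ent_opD]
    exact AddSubgroup.zsmul_mem _ (sweep_mem h1).1 _
  · exact Or.inl (ent_opD_eq_zero h)

theorem cubeDeg_chi (c : Crossing k) : CubeDeg (opΧ R k c) (-1) 2 := cubeDeg_of fun v w => by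
  by_cases h : w c = false ∧ v = Function.update w c true
  · obtain ⟨h1, rfl⟩ := h
    refine Or.inr ⟨by rw [weight_update h1]; push_cast; ring, ?_⟩
    rw [ent_opΧ]
    exact AddSubgroup.zsmul_mem _ (sweep_mem h1).2 _
  · exact Or.inl (ent_chi_eq_zero h)

theorem cubeDeg_opd : CubeDeg (opd R k) 1 0 := HasBidegree.sum fun c _ => cubeDeg_opD c

theorem cubeDeg_homot (m : Crossing k) : CubeDeg (homot R k m) (-1) 0 := by
  unfold homot
  split_ifs
  · exact cubeDeg_opC₀.mul (cubeDeg_chi _)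
  · exact (cubeDeg_chi _).mul (cubeDeg_opC _)

theorem cubeDeg_twistDiag (m : Crossing k) : CubeDeg (twistDiag R k m) 0 0 := by
  unfold twistDiag
  split_ifs
  · exact cubeDeg_one.sub ((cubeDeg_opC₀.mul (cubeDeg_opY _)).add (cubeDeg_proj _))
  · exact cubeDeg_one.sub (((cubeDeg_opY _).mul (cubeDeg_opC _)).add (cubeDeg_proj _))

theorem cubeDeg_twistDiags (j : ℕ) : CubeDeg (twistDiags R k j) 0 0 := by
  induction j with
  | zero => exact cubeDeg_one
  | succ j ih => exact (cubeDeg_twistDiag _).mul ih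

theorem cubeDeg_halfU : CubeDeg (halfU (opΧ R k)) (-2) 4 := by
  have h (a : ℕ) : CubeDeg ((-1 : End (cubeObj R k)) ^ a) 0 0 := HasBidegree.pow cubeDeg_one (HasBidegree.neg cubeDeg_one) a
  exact HasBidegree.sum fun b _ => HasBidegree.sum fun a _ =>
    ((h a).mul (cubeDeg_chi _)).mul ((h b).mul (cubeDeg_chi _))

/-- Away from the zero vertex there are as many circles as the weight, and merging has degree 0. The
zero vertex has two circles, and the discrepancy 2 is compensated by the cut in `mapG` or by the dot
in `mapF`. -/
theorem proj_mapM_deg {p : Vertex k → Prop} {b : ℤ}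
    (h : ∀ v, p v → (Nat.card (ResCircle v) : ℤ) = b + v.weight) :
    HasBidegree (C := bracket R k) (D := small R k)
      ((proj R k p : cubeObj R k ⟶ cubeObj R k) ≫ mapM R k) 0 b := by
  intro v i
  change Vertex k at v
  change SmallIndex k at i
  change ((i.1.val : ℤ) = v.weight + 0 → ent ((proj R k p : cubeObj R k ⟶ cubeObj R k) ≫ mapM R k) v i ∈
    homog (b + v.shift - (-(2 * k) - 2 * i.1.val)) (vobj R v) (unknot R)) ∧
    ((i.1.val : ℤ) ≠ v.weight + 0 → ent ((proj R k p : cubeObj R k ⟶ cubeObj R k) ≫ mapM R k) v i = 0)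
  rw [proj, diag_comp_apply]
  refine ⟨fun hi => ?_, fun hi => ?_⟩
  · split_ifs with hp
    · rw [ent_mapM (by omega), Category.id_comp]
      have h2 := mrg_mem (R := R) v
      have h3 := h v hp
      rwa [show (Nat.card (ResCircle v) : ℤ) - 1 = b + v.shift - (-(2 * k) - 2 * i.1.val) by
        unfold Vertex.shift; omega] at h2
    · rw [Limits.zero_comp]; exact AddSubgroup.zero_mem _
  · rw [ent_mapM_ne (by omega), Limits.comp_zero]

theorem mapI_proj_deg {p : Vertex k → Prop} {b : ℤ}
    (h : ∀ v, p v → (Nat.card (ResCircle v) : ℤ) = -b + v.weight) :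
    HasBidegree (C := small R k) (D := bracket R k)
      (mapI R k ≫ (proj R k p : cubeObj R k ⟶ cubeObj R k)) 0 b := by
  intro i v
  change Vertex k at v
  change SmallIndex k at i
  change ((v.weight : ℤ) = i.1.val + 0 → ent (mapI R k ≫ (proj R k p : cubeObj R k ⟶ cubeObj R k)) i v ∈
    homog (b + (-(2 * k) - 2 * i.1.val) - v.shift) (unknot R) (vobj R v)) ∧
    ((v.weight : ℤ) ≠ i.1.val + 0 → ent (mapI R k ≫ (proj R k p : cubeObj R k ⟶ cubeObj R k)) i v = 0)
  rw [proj, comp_diag_apply]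
  refine ⟨fun hi => ?_, fun hi => ?_⟩
  · split_ifs with hp
    · rw [ent_mapI (by omega), Category.comp_id]
      have h2 := inc_mem (R := R) v
      have h3 := h v hp
      rwa [show 1 - (Nat.card (ResCircle v) : ℤ) = b + (-(2 * k) - 2 * i.1.val) - v.shift by
        unfold Vertex.shift; omega] at h2
    · rw [Limits.comp_zero]; exact AddSubgroup.zero_mem _
  · rw [ent_mapI_ne (by omega), Limits.zero_comp]

theorem mapG_deg : HasBidegree (C := bracket R k) (D := small R k) (mapG R k) 0 0 := by
  have h1 : mapG R k = (opC₀ R k : cubeObj R k ⟶ cubeObj R k) ≫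
      (proj R k (fun v => v = fun _ => false) : cubeObj R k ⟶ cubeObj R k) ≫ mapM R k +
      (twistDiags R k (2 * k) : cubeObj R k ⟶ cubeObj R k) ≫
      (proj R k (fun v => v ≠ fun _ => false) : cubeObj R k ⟶ cubeObj R k) ≫ mapM R k := by
    rw [← Category.assoc, ← Category.assoc, ← Preadditive.add_comp, mapG]
    congr 1
    change opΓ R k = proj R k _ * opC₀ R k + proj R k _ * twistDiags R k (2 * k)
    rw [opΓ, proj_mul_opC₀, ((IsDiag.twistDiags (2 * k)).commute_proj _).eq]
  rw [h1]
  refine HasBidegree.add (C := bracket R k) (D := small R k)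
    ((HasBidegree.comp (D := bracket R k) cubeDeg_opC₀ (proj_mapM_deg (b := 2) ?_)))
    (HasBidegree.comp (D := bracket R k) (cubeDeg_twistDiags _) (proj_mapM_deg (b := 0) ?_))
  · rintro v rfl; rw [card_zero, weight_eq_zero.2 rfl]; rfl
  · intro v hv; rw [card_eq_weight hv, zero_add]

theorem mapF_deg : HasBidegree (C := small R k) (D := bracket R k) (mapF R k) 0 0 := by
  have h0 : HasBidegree (C := small R k) (D := bracket R k)
      (mapI R k ≫ (proj R k (fun v => v = fun _ => false) : cubeObj R k ⟶ cubeObj R k)) 0 (-2) :=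
    mapI_proj_deg fun v hv => by subst hv; rw [card_zero, weight_eq_zero.2 rfl]; rfl
  have h1 : HasBidegree (C := small R k) (D := bracket R k)
      (mapI R k ≫ (proj R k (fun v => v ≠ fun _ => false) : cubeObj R k ⟶ cubeObj R k)) 0 0 :=
    mapI_proj_deg fun v hv => by rw [card_eq_weight hv, neg_zero, zero_add]
  have h3 : CubeDeg (opX R k (0, true) - opX R k (0, false)) 0 2 := (cubeDeg_opX _).sub (cubeDeg_opX _)
  have h2 := (h0.comp h3).add h1
  have h4 : ∀ S T U : cubeObj R k ⟶ cubeObj R k, (mapI R k ≫ S) ≫ T + mapI R k ≫ U =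
      mapI R k ≫ (S ≫ T + U) := fun S T U => by rw [Preadditive.comp_add, Category.assoc]
  have h5 : mapF R k = _ := (h4 (proj R k fun v => v = fun _ => false)
    (show End (cubeObj R k) from opX R k (0, true) - opX R k (0, false))
    (proj R k fun v => v ≠ fun _ => false)).symm
  rw [h5]
  exact h2

end CubeDegrees
end TorusKh

/-! ### The strong deformation retraction and the transfer of $\bar u$. -/

namespace TorusKh

open Cob

section StrongRetract

variable {R : Type*} [CommRing R] {k : ℕ}

/-- Chain maps that are homotopic to the identity by a homotopy that commutes with the dot. -/
def HomotopicToOne (T : End (cubeObj R k)) : Prop :=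
  ∃ s : End (cubeObj R k), CubeDeg s (-1) 0 ∧ Commute s (opX R k (0, false)) ∧
    T - 1 = opd R k * s + s * opd R k

theorem HomotopicToOne.one : HomotopicToOne (1 : End (cubeObj R k)) :=
  ⟨0, HasBidegree.zero _ _, Commute.zero_left _, by rw [sub_self, mul_zero, zero_mul, add_zero]⟩

theorem HomotopicToOne.commute {T : End (cubeObj R k)} (h : HomotopicToOne T) : Commute (opd R k) T := by
  obtain ⟨s, -, -, hs⟩ := h
  rw [sub_eq_iff_eq_add.1 hs]
  refine Commute.add_right ?_ (Commute.one_right _)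
  change opd R k * (opd R k * s + s * opd R k) = (opd R k * s + s * opd R k) * opd R k
  rw [mul_add, add_mul, ← mul_assoc, opd_sq, zero_mul, zero_add, mul_assoc s, opd_sq, mul_zero, add_zero,
    mul_assoc]

theorem HomotopicToOne.cubeDeg {T : End (cubeObj R k)} (h : HomotopicToOne T) : CubeDeg T 0 0 := by
  obtain ⟨s, h1, -, hs⟩ := h
  rw [sub_eq_iff_eq_add.1 hs]
  exact HasBidegree.add (HasBidegree.add (cubeDeg_opd.mul h1) (h1.mul cubeDeg_opd)) cubeDeg_one

theorem HomotopicToOne.commute_opX {T : End (cubeObj R k)} (h : HomotopicToOne T) :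
    Commute T (opX R k (0, false)) := by
  obtain ⟨s, -, h1, hs⟩ := h
  rw [sub_eq_iff_eq_add.1 hs]
  exact (((opd_opX _).mul_left h1).add_left (h1.mul_left (opd_opX _))).add_left (Commute.one_left _)

theorem HomotopicToOne.mul {S T : End (cubeObj R k)} (hS : HomotopicToOne S) (hT : HomotopicToOne T) :
    HomotopicToOne (S * T) := by
  have hT' := hT.commute
  have hT0 := hT.cubeDeg
  have hTx := hT.commute_opX
  obtain ⟨s, h1, h2, h3⟩ := hS
  obtain ⟨t, h1', h2', h3'⟩ := hT
  refine ⟨s * T + t, HasBidegree.add (h1.mul hT0) h1', (h2.mul_left hTx).add_left h2', ?_⟩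
  rw [show S * T - 1 = (S - 1) * T + (T - 1) by rw [sub_mul, one_mul]; abel, h3, h3', mul_add, add_mul, add_mul,
    mul_assoc s T, ← hT'.eq, mul_assoc, mul_assoc]
  abel

theorem HomotopicToOne.pow {T : End (cubeObj R k)} (h : HomotopicToOne T) (n : ℕ) : HomotopicToOne (T ^ n) := by
  induction n with
  | zero => exact HomotopicToOne.one
  | succ n ih => rw [pow_succ]; exact ih.mul h

theorem homotopicToOne_twist (m : Crossing k) : HomotopicToOne (twist R k m) := by
  refine ⟨-homot R k m, HasBidegree.neg (cubeDeg_homot m), (homot_opX m).neg_left, ?_⟩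
  rw [twist, mul_neg, neg_mul]
  abel

theorem homotopicToOne_twists (j : ℕ) : HomotopicToOne (twists R k j) := by
  induction j with
  | zero => exact HomotopicToOne.one
  | succ j ih => exact (homotopicToOne_twist _).mul ih

theorem homotopicToOne_allTwists : HomotopicToOne (allTwists R k) :=
  (homotopicToOne_twist 0).mul (homotopicToOne_twists _)

variable (R k) in
/-- The dot on the small model. -/
noncomputable abbrev opSX : smallObj R k ⟶ smallObj R k := sdiag (dotX R)

theorem cubeDeg_opQ : CubeDeg (opQ R k) 0 0 := by
  rw [opQ, ← mapG_mapF]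
  exact HasBidegree.sub homotopicToOne_allTwists.cubeDeg (mapG_deg.comp mapF_deg)

theorem opQ_opX : Commute (opQ R k) (opX R k (0, false)) := by
  rw [opQ, ← mapG_mapF]
  refine homotopicToOne_allTwists.commute_opX.sub_left ?_
  change (opX R k (0, false) : cubeObj R k ⟶ cubeObj R k) ≫ mapG R k ≫ mapF R k =
    (mapG R k ≫ mapF R k) ≫ (opX R k (0, false) : cubeObj R k ⟶ cubeObj R k)
  rw [Category.assoc, ← mapF_opX, ← Category.assoc, mapG_opX, Category.assoc]

theorem height_nonneg (v : Vertex k) : 0 ≤ height v :=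
  Finset.sum_nonneg fun c _ => by split_ifs <;> simp

/-- No vertex is lower than the zero vertex. -/
theorem opQ_mul_vertexProj_zero : opQ R k * vertexProj R (fun _ => false) = 0 :=
  mul_proj_eq_zero fun v w hv => by
    by_contra h
    have h1 := lowers_opQ v w h
    have h2 := height_nonneg w
    rw [hv, show height (fun _ => false : Vertex k) = 0 by simp [height]] at h1
    omega

theorem opSX_eq : opSX R k = smallX R k := by
  refine ent_ext fun i j => ?_
  by_cases h : i = j
  · exact (if_pos h).trans (if_pos h).symm
  · exact (if_neg h).trans (if_neg h).symm

variable (R k) in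
/-- The operator `ū` of the small model. -/
noncomputable def opSU : smallObj R k ⟶ smallObj R k :=
  ofEnt (M := smallObj R k) (N := smallObj R k) fun i j =>
    if i.1.val = j.1.val + 2 then (2 * (k + 1 - i.1.val / 2)) • 𝟙 (unknot R) else 0

theorem ent_opSU {i j : SmallIndex k} (h : i.1.val = j.1.val + 2) :
    ent (opSU R k) i j = (2 * (k + 1 - i.1.val / 2)) • 𝟙 (unknot R) := if_pos h

theorem ent_opSU_ne {i j : SmallIndex k} (h : i.1.val ≠ j.1.val + 2) : ent (opSU R k) i j = 0 := if_neg h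

theorem opSX_opSU : opSX R k ≫ opSU R k = opSU R k ≫ opSX R k := by
  refine ent_ext fun i j => ?_
  rw [sdiag_comp_apply, comp_sdiag_apply]
  by_cases h : i.1.val = j.1.val + 2
  · rw [ent_opSU h, Preadditive.comp_nsmul, Preadditive.nsmul_comp, Category.comp_id, Category.id_comp]
  · rw [ent_opSU_ne h, Limits.comp_zero, Limits.zero_comp]

theorem halfU_opX : Commute (halfU (opΧ R k)) (opX R k (0, false)) :=
  (commute_loop_mul fun c => (chi_opX c _).symm).symm

theorem cupI_opSU_zero {i : SmallIndex k} (h : ∀ j : SmallIndex k, i.1.val ≠ j.1.val + 2) :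
    cupI R i ≫ opSU R k = 0 := by
  refine ent_ext fun a j => ?_
  rw [cupI_comp_apply, ent_opSU_ne (h j), Limits.comp_zero]; rfl

theorem cupI_opSU {i j : SmallIndex k} (h : i.1.val = j.1.val + 2) :
    cupI R i ≫ opSU R k = (2 * (k + 1 - i.1.val / 2)) • cupI R j := by
  have hn : ∀ (n : ℕ) (a : Unit) (l : SmallIndex k), ent (n • cupI R j) a l = n • ent (cupI R j) a l :=
    fun n a l => map_nsmul (entHom (M := emptyObj R) (N := smallObj R k) a l) n _
  refine ent_ext fun a l => ?_
  rw [cupI_comp_apply, hn]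
  by_cases hl : j = l
  · subst hl
    rw [ent_opSU h, ent_cupI, Preadditive.comp_nsmul, Category.comp_id]
  · rw [ent_opSU_ne, ent_cupI_ne hl, Limits.comp_zero, smul_zero]
    intro h'
    exact hl (Subtype.ext (Fin.ext (by omega)))

theorem opΨ_layer {t : ℕ} (ht : t ≠ 0) : opΨ R k • layer R k t = layer R k t := by
  rw [layer, Finset.smul_sum]
  refine Finset.sum_congr rfl fun v hv => opΨ_one ?_
  rintro rfl
  exact ht ((Finset.mem_filter.1 hv).2.symm.trans (weight_eq_zero.2 rfl))

theorem halfU_opΦ_layer_zero : halfU (opΧ R k) • opΦ R k • layer R k 0 = 0 := by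
  unfold halfU
  rw [Finset.sum_smul]
  refine Finset.sum_eq_zero fun b _ => ?_
  rw [Finset.sum_smul]
  refine Finset.sum_eq_zero fun a _ => ?_
  rw [mul_smul, mul_smul ((-1) ^ b), chi_opΦ_layer_zero, smul_zero, smul_zero]

/-- The small model has no summand in degree 1, so $\bar u$ from degree 3 transfers to zero although
it does not vanish on the cube. -/
theorem layer_one_comp {g : cubeObj R k ⟶ smallObj R k}
    (hg : HasBidegree (C := bracket R k) (D := small R k) g 0 0) : layer R k 1 ≫ g = 0 := by
  refine ent_ext fun a j => (ent_comp _ _ _ _).trans (Finset.sum_eq_zero fun v _ => ?_)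
  rw [ent_layer]
  split_ifs with hv
  · have h2 := (hg v j).2 (by
      change (j.1.val : ℤ) ≠ (v.weight : ℤ) + 0
      have := j.2
      omega)
    exact (congrArg _ h2).trans Limits.comp_zero
  · exact Limits.zero_comp

/-- The transfer of `ū` to the small model. -/
theorem mapF_halfU_comp {g : cubeObj R k ⟶ smallObj R k}
    (hg : HasBidegree (C := bracket R k) (D := small R k) g 0 0) (hfg : mapF R k ≫ g = 𝟙 _)
    (hgx : (opX R k (0, false) : cubeObj R k ⟶ cubeObj R k) ≫ g = g ≫ opSX R k)
    (h0 : (opY R k 0 • one R k (fun _ => false)) ≫ g = cupI R (smallIndex 0 (by omega) (by omega)))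
    {U : End (cubeObj R k)} (hU : U = halfU (opΧ R k) + halfU (opΧ R k)) :
    (U • mapF R k) ≫ g = opSU R k := by
  have hUx : Commute U (opX R k (0, false)) := hU ▸ halfU_opX.add_left halfU_opX
  refine small_ext (Z := opSX R k) ?_ opSX_opSU fun i => ?_
  · have h1 : opSX R k ≫ (U • mapF R k) = U • opX R k (0, false) • mapF R k := by
      have : opSX R k ≫ (U • mapF R k) = U • (opSX R k ≫ mapF R k) := (Category.assoc _ _ _).symm
      rw [this, mapF_opX]; rfl
    rw [← Category.assoc, h1, commute_smul_comm' hUx, Category.assoc, ← hgx]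
    exact Category.assoc _ _ _
  have h1 : cupI R i ≫ (U • mapF R k) ≫ g = (U • opΦ R k • layer R k i.1.val) ≫ g := by
    rw [← cupI_mapF, ← Category.assoc]
    exact congrArg (· ≫ g) (Category.assoc _ _ _).symm
  rw [h1]
  by_cases hi : i.1.val = 0
  · rw [cupI_opSU_zero fun j => by omega, hi, hU, add_smul, halfU_opΦ_layer_zero, add_zero, Limits.zero_comp]
  · obtain ⟨t, ht⟩ : ∃ t, i.1.val = t + 2 := ⟨i.1.val - 2, by have := i.2; omega⟩
    have hlt := i.1.2
    -- With $i=t+2$, for even and for odd $t$ alike, $\lfloor(2k+1-t)/2\rfloor=k+1-\lfloor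
    -- i/2\rfloor$; the factor 2 comes from the two rounds of the walk.
    have hc : 2 * (k + 1 - i.1.val / 2) = (2 * k + 1 - t) / 2 + (2 * k + 1 - t) / 2 := by omega
    have h2 : U • layer R k (t + 2) = (2 * (k + 1 - i.1.val / 2)) • opΨ R k • layer R k t := by
      rw [hU, add_smul, halfU_layer, ← add_smul, ← hc]
    rw [opΦ_layer hi, ht, h2, Preadditive.nsmul_comp]
    by_cases ht1 : t = 1
    · rw [cupI_opSU_zero fun j => by have := j.2; omega, ht1, opΨ_layer one_ne_zero, layer_one_comp hg, smul_zero]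
    · rw [cupI_opSU (j := smallIndex t (by omega) ht1) ht]
      congr 1
      by_cases ht0 : t = 0
      · subst ht0
        rw [layer_zero, opΨ_one_zero, h0]
      · have h3 : layer R k t = cupI R (smallIndex t (by omega) ht1) ≫ mapF R k := by
          rw [cupI_mapF]; exact (opΦ_layer ht0).symm
        rw [opΨ_layer ht0, h3, Category.assoc, hfg, Category.comp_id]

theorem opQ_pow_opY_one_zero (b : ℕ) (hb : b ≠ 0) : opQ R k ^ b • opY R k 0 • one R k (fun _ => false) = 0 := by
  obtain ⟨b, rfl⟩ := Nat.exists_eq_succ_of_ne_zero hb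
  rw [pow_succ, mul_smul]
  conv_lhs => rw [← proj_one (R := R) (p := fun w : Vertex k => w = fun _ => false) rfl]
  rw [← commute_smul_comm (proj_opY _ _), ← mul_smul (opQ R k), opQ_mul_vertexProj_zero, zero_smul, smul_zero]

/-- The retraction onto the small model before the side conditions are imposed. -/
theorem exists_retraction : ∃ (g : cubeObj R k ⟶ smallObj R k) (P : End (cubeObj R k)),
    HasBidegree (C := bracket R k) (D := small R k) g 0 0 ∧
    (opd R k : cubeObj R k ⟶ cubeObj R k) ≫ g = g ≫ opSD R k ∧ mapF R k ≫ g = 𝟙 _ ∧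
    (opX R k (0, false) : cubeObj R k ⟶ cubeObj R k) ≫ g = g ≫ opSX R k ∧
    P = g ≫ mapF R k ∧ HomotopicToOne P ∧
    (opY R k 0 • one R k (fun _ => false)) ≫ g = cupI R (smallIndex 0 (by omega) (by omega)) := by
  obtain ⟨N, hN⟩ := lowers_opQ.exists_pow_eq_zero (T := opQ R k)
  obtain ⟨p, hp⟩ : ∃ p : End (cubeObj R k), p = mapG R k ≫ mapF R k := ⟨_, rfl⟩
  obtain ⟨Z, hZ⟩ : ∃ Z : End (cubeObj R k), Z = ∑ b ∈ Finset.range (N + 1), opQ R k ^ b := ⟨_, rfl⟩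
  have hQp : opQ R k * p = 0 := by
    rw [hp]
    change (mapG R k ≫ mapF R k) ≫ (opQ R k : cubeObj R k ⟶ cubeObj R k) = 0
    rw [Category.assoc]
    exact (congrArg (mapG R k ≫ ·) opQ_mapF).trans Limits.comp_zero
  have hpp : p * p = p := by
    rw [hp]
    change (mapG R k ≫ mapF R k) ≫ mapG R k ≫ mapF R k = mapG R k ≫ mapF R k
    rw [Category.assoc, ← Category.assoc (mapF R k), mapF_mapG, Category.id_comp]
  have hP : allTwists R k = p + opQ R k := by rw [hp, opQ, mapG_mapF]; abel
  -- One more power than needed for `opQ` to vanish. The result factors through the small model and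
  -- is still homotopic to the identity.
  have hPN : allTwists R k ^ (N + 1) = p * Z := by
    rw [hP, add_pow_of_mul_eq_zero hQp hpp, pow_succ, hN, zero_mul, zero_add, hZ]
  have hZF : Z • mapF R k = mapF R k := by
    rw [hZ, Finset.sum_smul, Finset.sum_range_succ', Finset.sum_eq_zero, pow_zero, one_smul, zero_add]
    intro b _
    rw [pow_succ, mul_smul, opQ_mapF, smul_zero]
  have hZ0 : CubeDeg Z 0 0 := by
    rw [hZ]; exact HasBidegree.sum fun b _ => HasBidegree.pow cubeDeg_one cubeDeg_opQ b
  have hZx : Commute Z (opX R k (0, false)) := by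
    rw [hZ]; exact Commute.sum_left _ _ _ fun b _ => opQ_opX.pow_left b
  -- The corrections vanish at the zero vertex. This pins down the one value of the projection that
  -- the transfer of $\bar u$ to degree 0 needs and that $gf=1$ does not give.
  have hZY : Z • opY R k 0 • one R k (fun _ => false) = opY R k 0 • one R k (fun _ => false) := by
    rw [hZ, Finset.sum_smul, Finset.sum_eq_single 0 (fun b _ hb => opQ_pow_opY_one_zero b hb) (by simp), pow_zero,
      one_smul]
  clear hZ
  obtain ⟨g, hg⟩ : ∃ g : cubeObj R k ⟶ smallObj R k, g = (Z : cubeObj R k ⟶ cubeObj R k) ≫ mapG R k := ⟨_, rfl⟩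
  have hfg : mapF R k ≫ g = 𝟙 _ := by
    rw [hg, ← Category.assoc]
    exact (congrArg (· ≫ mapG R k) hZF).trans mapF_mapG
  have hgp : p * Z = g ≫ mapF R k := by
    rw [hg, hp]; exact (Category.assoc _ _ _).symm
  have hT : HomotopicToOne (p * Z) := hPN ▸ homotopicToOne_allTwists.pow (N + 1)
  refine ⟨g, p * Z, ?_, ?_, hfg, ?_, hgp, hT, ?_⟩
  · rw [hg]; exact HasBidegree.comp (D := bracket R k) hZ0 mapG_deg
  · have h1 : (g ≫ mapF R k) ≫ (opd R k : cubeObj R k ⟶ cubeObj R k) =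
        (opd R k : cubeObj R k ⟶ cubeObj R k) ≫ g ≫ mapF R k := by
      rw [← hgp]; exact hT.commute.eq
    have hd : mapF R k ≫ (opd R k : cubeObj R k ⟶ cubeObj R k) = opSD R k ≫ mapF R k := mapF_opd
    have h2 := congrArg (· ≫ g) h1
    simp only [Category.assoc, hfg, Category.comp_id] at h2
    rw [← h2, ← Category.assoc (mapF R k), hd, Category.assoc, hfg, Category.comp_id]
  · rw [hg, Category.assoc, ← mapG_opX, ← Category.assoc, ← Category.assoc]
    exact congrArg (· ≫ mapG R k) hZx.eq
  · have h4 : (opY R k 0 • one R k (fun _ => false)) ≫ g =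
        (opΓ R k • Z • opY R k 0 • one R k (fun _ => false)) ≫ mapM R k := by
      rw [hg, mapG, ← Category.assoc, ← Category.assoc]; rfl
    rw [h4, hZY, opΓ_opY_one_zero, one_mapM _ (by rw [weight_eq_zero.2 rfl]; decide)]
    congr 1
    exact Subtype.ext (Fin.ext (weight_eq_zero.2 rfl))

/-- The strong deformation retraction onto the small model, linear over the dot. -/
theorem exists_strongDeformationRetract : ∃ (g : cubeObj R k ⟶ smallObj R k) (s : End (cubeObj R k)),
    IsStrongDeformationRetract (bracket R k) (small R k) (opd R k) (opSD R k) g (mapF R k) s ∧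
    (opX R k (0, false) : cubeObj R k ⟶ cubeObj R k) ≫ g = g ≫ opSX R k ∧
    Commute s (opX R k (0, false)) ∧
    ((halfU (opΧ R k) + halfU (opΧ R k)) • mapF R k) ≫ g = opSU R k := by
  obtain ⟨g, e, hg, hdg, hfg, hgx, he, hT, h0⟩ := exists_retraction (R := R) (k := k)
  have hde := hT.commute.eq
  have hex := hT.commute_opX
  have hedeg := hT.cubeDeg
  obtain ⟨s, hs, hsx, hs'⟩ := hT
  have hee : e * e = e := by
    rw [he]
    change (g ≫ mapF R k) ≫ g ≫ mapF R k = g ≫ mapF R k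
    rw [Category.assoc, ← Category.assoc (mapF R k), hfg, Category.id_comp]
  obtain ⟨s₁, hs₁⟩ : ∃ s₁, s₁ = (1 - e) * s * (1 - e) := ⟨_, rfl⟩
  obtain ⟨h1, h2, h3, h4⟩ := side_conditions opd_sq hee hde hs' hs₁
  have hpdeg : CubeDeg (1 - e) 0 0 := HasBidegree.sub cubeDeg_one hedeg
  have hpx : Commute (1 - e) (opX R k (0, false)) := (Commute.one_left _).sub_left hex
  have hs₁deg : CubeDeg s₁ (-1) 0 := hs₁ ▸ (hpdeg.mul hs).mul hpdeg
  have hs₁x : Commute s₁ (opX R k (0, false)) := hs₁ ▸ (hpx.mul_left hsx).mul_left hpx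
  have hsdeg : CubeDeg (-(s₁ * opd R k * s₁)) (-1) 0 := HasBidegree.neg ((hs₁deg.mul cubeDeg_opd).mul hs₁deg)
  have hd : mapF R k ≫ (opd R k : cubeObj R k ⟶ cubeObj R k) = opSD R k ≫ mapF R k := mapF_opd
  obtain ⟨σ, hσ⟩ : ∃ σ, σ = -(s₁ * opd R k * s₁) := ⟨_, rfl⟩
  have hσe : σ * e = 0 := by rw [hσ, neg_mul, h3, neg_zero]
  have heσ : e * σ = 0 := by rw [hσ, mul_neg, h2, neg_zero]
  have hσσ : σ * σ = 0 := by rw [hσ, neg_mul_neg]; exact h4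
  have hhom : e - 1 = opd R k * σ + σ * opd R k := by rw [hσ]; exact h1
  rw [he] at hhom
  refine ⟨g, σ, ⟨hg, mapF_deg, hσ ▸ hsdeg, hdg, hd, hhom, hfg, ?_, ?_, hσσ⟩, hgx, ?_,
    mapF_halfU_comp hg hfg hgx h0 rfl⟩
  · have h5 : ((σ : cubeObj R k ⟶ cubeObj R k) ≫ g ≫ mapF R k) ≫ g = 0 := by
      rw [← he]; exact (congrArg (· ≫ g) heσ).trans Limits.zero_comp
    rw [Category.assoc, Category.assoc, hfg, Category.comp_id] at h5
    exact h5
  · have h5 : mapF R k ≫ (g ≫ mapF R k) ≫ (σ : cubeObj R k ⟶ cubeObj R k) = 0 := by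
      rw [← he]; exact (congrArg (mapF R k ≫ ·) hσe).trans Limits.comp_zero
    rw [Category.assoc, ← Category.assoc, hfg, Category.id_comp] at h5
    exact h5
  · rw [hσ]; exact ((hs₁x.mul_left (opd_opX _)).mul_left hs₁x).neg_left

theorem bracket_isCA1Module : IsCA1Module (bracket R k) (bracketD R k) (bracketX R k) (bracketXi R k)
    (bracketU R k) := by
  have hu := (opd_halfU (R := R) (k := k)).add_right opd_halfU
  have hx := (halfU_opX (R := R) (k := k)).add_left halfU_opX
  have hd : bracketD R k * bracketU R k - bracketU R k * bracketD R k = 0 := by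
    rw [bracketD_eq_opd, bracketU_eq]; exact sub_eq_zero.2 hu.eq
  rw [bracketXi_eq]
  refine ⟨?_, ?_, HasBidegree.zero _ _, ?_, ?_, ?_, ?_, ?_, ?_, ?_, ?_, ?_⟩
  · rw [bracketD_eq_opd]; exact cubeDeg_opd
  · rw [bracketX_eq]; exact cubeDeg_opX _
  · rw [bracketU_eq]; exact HasBidegree.add cubeDeg_halfU cubeDeg_halfU
  · rw [bracketD_eq_opd]; exact opd_sq
  · rw [mul_zero, zero_mul]
  · rw [bracketX_eq, bracketU_eq]; exact hx.eq.symm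
  · rw [mul_zero, zero_mul]
  · rw [mul_zero]
  · rw [bracketD_eq_opd, bracketX_eq]; exact sub_eq_zero.2 (opd_opX _).eq
  · rw [mul_zero, zero_mul, add_zero]
  · rw [hd, mul_zero, add_zero]

theorem opSU_eq : opSU R k = smallU R k := rfl

theorem opSD_opSD : opSD R k ≫ opSD R k = 0 := by
  refine ent_ext fun i j => (ent_comp _ _ _ _).trans (Finset.sum_eq_zero fun l _ => ?_)
  by_cases h : 2 ≤ i.1.val ∧ Even i.1.val ∧ l.1.val = i.1.val + 1
  · rw [ent_opSD_ne (i := l), Limits.comp_zero]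
    rintro ⟨-, h', -⟩
    rw [h.2.2, Nat.even_add_one] at h'
    exact h' h.2.1
  · rw [ent_opSD_ne h, Limits.zero_comp]

/-- Carried over from the cube, where $d$ and $\bar u$ commute: $f$ and $g$ are chain maps, and
`opSU` is the transfer of $\bar u$. -/
theorem opSD_opSU : opSD R k ≫ opSU R k = opSU R k ≫ opSD R k := by
  obtain ⟨g, s, h, -, -, hu⟩ := exists_strongDeformationRetract (R := R) (k := k)
  have hg : (opd R k : cubeObj R k ⟶ cubeObj R k) ≫ g = g ≫ opSD R k := h.g_chain
  obtain ⟨U, hU⟩ : ∃ U : End (cubeObj R k), U = halfU (opΧ R k) + halfU (opΧ R k) := ⟨_, rfl⟩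
  have hc : Commute (opd R k) U := hU ▸ opd_halfU.add_right opd_halfU
  rw [← hU] at hu
  have h1 : (U • opd R k • mapF R k) ≫ g = opSD R k ≫ opSU R k := by
    rw [mapF_opd, ← hu, ← Category.assoc]
    exact congrArg (· ≫ g) (Category.assoc _ _ _)
  rw [← h1, ← commute_smul_comm' hc, ← hu]
  have h2 : (opd R k • U • mapF R k) ≫ g = (U • mapF R k) ≫ (opd R k : cubeObj R k ⟶ cubeObj R k) ≫ g :=
    Category.assoc _ _ _
  rw [h2, hg, Category.assoc]

theorem small_deg {f : smallObj R k ⟶ smallObj R k} {a b : ℤ} (h : ∀ i j, ent f i j = 0 ∨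
    ((j.1.val : ℤ) = i.1.val + a ∧ ent f i j ∈ homog (b + 2 * a) (unknot R) (unknot R))) :
    HasBidegree (C := small R k) (D := small R k) f a b := by
  intro i j
  change SmallIndex k at i j
  change ((j.1.val : ℤ) = i.1.val + a → ent f i j ∈
    homog (b + (-(2 * k) - 2 * i.1.val) - (-(2 * k) - 2 * j.1.val)) (unknot R) (unknot R)) ∧
    ((j.1.val : ℤ) ≠ i.1.val + a → ent f i j = 0)
  refine ⟨fun hj => ?_, fun hj => (h i j).resolve_right fun h => hj h.1⟩
  rcases h i j with h | ⟨-, h⟩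
  · rw [h]; exact AddSubgroup.zero_mem _
  · rwa [show b + (-(2 * k) - 2 * (i.1.val : ℤ)) - (-(2 * k) - 2 * j.1.val) = b + 2 * a by rw [hj]; ring]

theorem small_isCA1Module : IsCA1Module (small R k) (smallD R k) (smallX R k) 0 (smallU R k) := by
  have hx : smallD R k * smallX R k - smallX R k * smallD R k = 0 := by
    rw [← opSX_eq]
    exact (sub_eq_zero.2 sdiag_opSD : opSX R k ≫ opSD R k - opSD R k ≫ opSX R k = 0)
  have hxu : smallX R k * smallU R k = smallU R k * smallX R k := by
    rw [← opSX_eq]; exact (opSX_opSU (R := R) (k := k)).symm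
  have hu : smallD R k * smallU R k - smallU R k * smallD R k = 0 :=
    (sub_eq_zero.2 opSD_opSU.symm : opSU R k ≫ opSD R k - opSD R k ≫ opSU R k = 0)
  have hdeg : HasBidegree (C := small R k) (D := small R k) (smallX R k) 0 2 := by
    rw [← opSX_eq]
    refine small_deg fun i j => ?_
    by_cases h : i = j
    · subst h
      rw [show ent (sdiag (dotX R)) i i = dotX R from if_pos rfl]
      exact Or.inr ⟨by omega, dot_mem ()⟩
    · exact Or.inl (if_neg h)
  refine ⟨small_deg (f := opSD R k) fun i j => ?_, hdeg, HasBidegree.zero _ _,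
    small_deg (f := opSU R k) fun i j => ?_, opSD_opSD, ?_, hxu, ?_, ?_, hx, ?_, ?_⟩
  · by_cases h : 2 ≤ i.1.val ∧ Even i.1.val ∧ j.1.val = i.1.val + 1
    · rw [ent_opSD h]; exact Or.inr ⟨by omega, mapH_mem⟩
    · exact Or.inl (ent_opSD_ne h)
  · by_cases h : i.1.val = j.1.val + 2
    · rw [ent_opSU h]
      exact Or.inr ⟨by omega, AddSubgroup.nsmul_mem _ id_mem _⟩
    · exact Or.inl (ent_opSU_ne h)
  · rw [mul_zero, zero_mul]
  · rw [mul_zero, zero_mul]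
  · rw [mul_zero]
  · rw [mul_zero, zero_mul, add_zero]
  · rw [hu, mul_zero, add_zero]

theorem exists_bracket_retract : ∃ (g : (bracket R k).obj ⟶ (small R k).obj)
    (f : (small R k).obj ⟶ (bracket R k).obj) (s : End (bracket R k).obj),
    IsStrongDeformationRetract (bracket R k) (small R k) (bracketD R k) (smallD R k) g f s ∧
    f ≫ bracketX R k ≫ g = smallX R k ∧ f ≫ bracketXi R k ≫ g = 0 ∧ f ≫ bracketU R k ≫ g = smallU R k := by
  obtain ⟨g, s, h, hx, -, hu⟩ := exists_strongDeformationRetract (R := R) (k := k)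
  have h1 : mapF R k ≫ (opX R k (0, false) : cubeObj R k ⟶ cubeObj R k) ≫ g = opSX R k := by
    have hr : mapF R k ≫ g = 𝟙 _ := h.retract
    rw [hx, ← Category.assoc, hr, Category.id_comp]
  refine ⟨g, mapF R k, s, ?_, ?_, ?_, ?_⟩
  · rw [bracketD_eq_opd]; exact h
  · rw [bracketX_eq, ← opSX_eq]; exact h1
  · rw [bracketXi_eq]
    exact (congrArg (mapF R k ≫ ·) Limits.zero_comp).trans Limits.comp_zero
  · rw [bracketU_eq, ← opSU_eq]
    exact (Category.assoc _ _ _).symm.trans hu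

end StrongRetract
end TorusKh

/-! ### The gluing formula for the evaluation of surfaces. -/

namespace TorusKh

section GluingFormula

/-- A handle is multiplication by $2X$ in $\mathbb Q[X]/(X^2)$: a tube from a component to itself,
with the dot at either end. -/
theorem evalComp_succ (g m : ℕ) : evalComp (g + 1) m = evalComp g (m + 1) + evalComp g (m + 1) := by
  unfold evalComp
  by_cases h : m + g = 0
  · rw [if_pos (by omega), if_pos (by omega), pow_succ]; ring
  · rw [if_neg (by omega), if_neg (by omega), add_zero]

/-- The tube between two components is the coproduct $1\mapsto1\otimes X+X\otimes1$: the dot sits at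
one of the two ends. -/
theorem evalComp_add (g g' m m' : ℕ) : evalComp (g + g') (m + m') =
    evalComp g (m + 1) * evalComp g' m' + evalComp g m * evalComp g' (m' + 1) := by
  unfold evalComp
  by_cases h : m + g = 0 <;> by_cases h' : m' + g' = 0 <;> by_cases h1 : m + g = 1 <;>
    by_cases h1' : m' + g' = 1 <;> first | omega | skip
  all_goals
    obtain ⟨e1, e2, e3, e4, e5⟩ : (m + m' + (g + g') = 1 ↔ (m + g = 0 ∧ m' + g' = 1) ∨ (m + g = 1 ∧ m' + g' = 0)) ∧
      (m + 1 + g = 1 ↔ m + g = 0) ∧ (m' + 1 + g' = 1 ↔ m' + g' = 0) ∧ True ∧ True :=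
      ⟨by omega, by omega, by omega, trivial, trivial⟩
    simp [e1, e2, e3, h, h', h1, h1', pow_add]

open Classical in
/-- The value of a graph with vertices `V` and edges `E`, whose vertices carry a genus and a number of
dots, is the sum over all ways to put a dot at one of the ends of each edge. -/
def IsStateSum (E : Type) [Fintype E] : Prop :=
  ∀ (V C : Type) [Fintype V] [Fintype C]
    (s t : E → V) (g m : V → ℕ) (π : V → C) (G M : C → ℕ), Function.Surjective π →
    (∀ e, π (s e) = π (t e)) →
    (∀ φ : V → Prop, (∀ e, φ (s e) = φ (t e)) → ∀ a b, π a = π b → φ a → φ b) →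
    (∀ c, (G c : ℤ) - 1 = ∑ v, (if π v = c then (g v : ℤ) - 1 else 0) + ∑ e, if π (s e) = c then 1 else 0) →
    (∀ c, M c = ∑ v, if π v = c then m v else 0) →
    ∏ c, evalComp (G c) (M c) = ∑ o : E → Bool, ∏ v, evalComp (g v)
      (m v + ∑ e, if (bif o e then t e else s e) = v then 1 else 0)

-- Induction on the edges. A loop adds 1 to the genus of its vertex, by `evalComp_succ`; any other
-- edge is contracted, by `evalComp_add`. The hypotheses say that the fibres of `π` are the
-- connected components and that `G` and `M` are the total genus, including cycles, and the total
-- number of dots.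
set_option maxHeartbeats 400000 in
open Finset in
theorem isStateSum (E : Type) [Fintype E] : IsStateSum E := by
  classical
  refine Fintype.induction_empty_option (P := fun E _ => IsStateSum E) ?_ ?_ ?_ E
  · intro α β _ i ih
    let : Fintype α := Fintype.ofEquiv β i.symm
    intro V C _ _ s t g m π G M h1 h2 h3 h4 h5
    rw [ih V C (s ∘ i) (t ∘ i) g m π G M h1 (fun e => h2 _) (fun φ hφ => h3 φ fun e => by
      have := hφ (i.symm e); simpa using this) (fun c => by
        rw [h4 c]; congr 1
        exact (Equiv.sum_comp i fun e => if π (s e) = c then (1 : ℤ) else 0).symm) h5]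
    refine Fintype.sum_equiv (Equiv.arrowCongr i (Equiv.refl Bool)) _ _ fun o => ?_
    refine Finset.prod_congr rfl fun v _ => ?_
    congr 2
    refine Fintype.sum_equiv i _ _ fun e => ?_
    simp
  · intro V C _ _ s t g m π G M h1 h2 h3 h4 h5
    -- Without edges a component is a single vertex.
    have hinj : Function.Injective π := fun a b hab => (h3 (fun v => v = a) (fun e => e.elim) a b hab rfl).symm
    rw [Fintype.sum_unique]
    symm
    refine Fintype.prod_bijective π ⟨hinj, h1⟩ _ _ fun v => ?_
    have e1 := h4 (π v)
    have e2 := h5 (π v)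
    simp only [hinj.eq_iff, Finset.sum_ite_eq', Finset.mem_univ, if_true, Finset.univ_eq_empty,
      Finset.sum_empty, add_zero] at e1 e2 ⊢
    rw [e2]; congr 1; omega
  · intro E _ ih V C _ _ s t g m π G M h1 h2 h3 h4 h5
    obtain ⟨x, hx⟩ : ∃ x, x = s none := ⟨_, rfl⟩
    obtain ⟨y, hy⟩ : ∃ y, y = t none := ⟨_, rfl⟩
    have hxy : π y = π x := by rw [hx, hy]; exact (h2 none).symm
    have hrhs : ∑ o : Option E → Bool, ∏ v, evalComp (g v)
        (m v + ∑ e, if (bif o e then t e else s e) = v then 1 else 0) =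
        ∑ o : E → Bool, (∏ v, evalComp (g v) (m v + ((if y = v then 1 else 0) +
            ∑ e, if (bif o e then t (some e) else s (some e)) = v then 1 else 0)) +
          ∏ v, evalComp (g v) (m v + ((if x = v then 1 else 0) +
            ∑ e, if (bif o e then t (some e) else s (some e)) = v then 1 else 0))) := by
      rw [Fintype.sum_equiv Equiv.piOptionEquivProd _ (fun p : Bool × (E → Bool) =>
        ∏ v, evalComp (g v) (m v + ((if (bif p.1 then y else x) = v then 1 else 0) +
            ∑ e, if (bif p.2 e then t (some e) else s (some e)) = v then 1 else 0)))]
      · rw [Fintype.sum_prod_type, Fintype.sum_bool, ← Finset.sum_add_distrib]; rfl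
      · intro o
        refine Finset.prod_congr rfl fun v _ => ?_
        rw [Fintype.sum_option, hx, hy]; rfl
    refine Eq.trans ?_ (hrhs.symm.trans (by congr!))
    have h4' : ∀ c, (G c : ℤ) - 1 = ∑ v, (if π v = c then (g v : ℤ) - 1 else 0) + ((if π x = c then 1 else 0) +
        ∑ e : E, if π (s (some e)) = c then 1 else 0) := fun c => by
      rw [h4 c, Fintype.sum_option, hx]
    by_cases hne : x = y
    · rw [ih V C (fun e => s (some e)) (fun e => t (some e)) (fun v => g v + if x = v then 1 else 0) m π G M h1
        (fun e => h2 _) (fun φ hφ => h3 φ ?_) (fun c => ?_) h5]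
      · refine Finset.sum_congr rfl fun o _ => ?_
        rw [← hne, ← Finset.mul_prod_erase univ _ (mem_univ x), ← Finset.mul_prod_erase univ
          (fun v => evalComp (g v) (m v + ((if x = v then 1 else 0) +
            ∑ e, if (bif o e then t (some e) else s (some e)) = v then 1 else 0))) (mem_univ x), ← add_mul]
        congr 1
        · rw [if_pos rfl, evalComp_succ]
          congr 2 <;> ring
        · refine Finset.prod_congr rfl fun v hv => ?_
          rw [if_neg (Finset.ne_of_mem_erase hv).symm, add_zero, zero_add]
      · rintro (_ | e)
        · rw [← hx, ← hy, hne]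
        · exact hφ e
      · rw [h4' c, ← add_assoc]
        congr 1
        rw [show (if π x = c then (1 : ℤ) else 0) = ∑ v, if x = v then (if π v = c then 1 else 0) else 0 by simp,
          ← Finset.sum_add_distrib]
        refine Finset.sum_congr rfl fun v _ => ?_
        split_ifs <;> push_cast <;> ring
    -- Contraction of the edge: `y` is identified with `x`, which takes over its genus, its dots and
    -- its edges.
    · let q : V → {v // v ≠ y} := fun v => if h : v = y then ⟨x, hne⟩ else ⟨v, h⟩
      have hq : ∀ v, π (q v).1 = π v := fun v => by
        by_cases h : v = y
        · simp only [q, dif_pos h]; rw [h, hxy]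
        · simp only [q, dif_neg h]
      have hqs : ∀ v : {v // v ≠ y}, q v.1 = v := fun v => dif_neg v.2
      have hqx : ∀ (v : V) (w : {v // v ≠ y}), @ite ℕ (q v = w) (Classical.propDecidable _) 1 0 =
          (if v = w.1 then 1 else 0) + if w.1 = x then (if v = y then 1 else 0) else 0 := fun v w => by
        by_cases h : v = y
        · have hw : v ≠ w.1 := fun h' => w.2 (h'.symm.trans h)
          simp only [q, dif_pos h, if_pos h, if_neg hw, zero_add, Subtype.ext_iff]
          exact if_congr eq_comm rfl rfl
        · simp only [q, dif_neg h, if_neg h, ite_self, add_zero, Subtype.ext_iff]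
      have hsum : ∀ {A : Type} [AddCommMonoid A] (f : V → A) (c : C), (∑ v, if π v = c then f v else 0) =
          ∑ w : {v // v ≠ y}, if π w.1 = c then f w.1 + (if w.1 = x then f y else 0) else 0 := by
        intro A _ f c
        rw [Fintype.sum_eq_add_sum_subtype_ne _ y]
        have e1 : ∀ w : {v // v ≠ y}, (if π w.1 = c then f w.1 + (if w.1 = x then f y else 0) else 0) =
            (if w = ⟨x, hne⟩ then (if π y = c then f y else 0) else 0) + if π w.1 = c then f w.1 else 0 := by
          intro w
          by_cases hw : w = ⟨x, hne⟩
          · subst hw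
            rw [if_pos rfl, if_pos rfl, hxy]
            by_cases hc : π x = c
            · rw [if_pos hc, if_pos hc, if_pos hc, add_comm]
            · rw [if_neg hc, if_neg hc, if_neg hc, add_zero]
          · rw [if_neg hw, if_neg fun h => hw (Subtype.ext h), add_zero, zero_add]
        rw [Finset.sum_congr rfl fun w _ => e1 w, Finset.sum_add_distrib, Finset.sum_ite_eq',
          if_pos (mem_univ _)]
      rw [ih {v // v ≠ y} C (fun e => q (s (some e))) (fun e => q (t (some e)))
        (fun w => g w.1 + if w.1 = x then g y else 0) (fun w => m w.1 + if w.1 = x then m y else 0)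
        (fun w => π w.1) G M (fun c => ?_) (fun e => ?_) (fun φ hφ a b hab ha => ?_) (fun c => ?_) (fun c => ?_)]
      · refine Finset.sum_congr rfl fun o _ => ?_
        rw [Fintype.prod_eq_mul_prod_subtype_ne _ y, Fintype.prod_eq_mul_prod_subtype_ne
          (fun v => evalComp (g v) (m v + ((if x = v then 1 else 0) +
            ∑ e, if (bif o e then t (some e) else s (some e)) = v then 1 else 0))) y,
          ← Finset.mul_prod_erase univ _ (mem_univ (⟨x, hne⟩ : {v // v ≠ y})),
          ← Finset.mul_prod_erase univ (fun w : {v // v ≠ y} => evalComp (g w.1) (m w.1 + ((if x = w.1 then 1 else 0) +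
            ∑ e, if (bif o e then t (some e) else s (some e)) = w.1 then 1 else 0)))
            (mem_univ (⟨x, hne⟩ : {v // v ≠ y})),
          ← Finset.mul_prod_erase univ (fun w : {v // v ≠ y} => evalComp (g w.1) (m w.1 + ((if y = w.1 then 1 else 0) +
            ∑ e, if (bif o e then t (some e) else s (some e)) = w.1 then 1 else 0)))
            (mem_univ (⟨x, hne⟩ : {v // v ≠ y})), ← mul_assoc, ← mul_assoc]
        have hcnt : ∀ w : {v // v ≠ y}, (∑ e, @ite ℕ ((bif o e then q (t (some e)) else q (s (some e))) = w) (Classical.propDecidable _) 1 0) =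
            (∑ e, if (bif o e then t (some e) else s (some e)) = w.1 then 1 else 0) +
            if w.1 = x then (∑ e, if (bif o e then t (some e) else s (some e)) = y then 1 else 0) else 0 := by
          intro w
          rw [Finset.sum_congr rfl fun e _ => show _ = _ by
            rw [show (bif o e then q (t (some e)) else q (s (some e))) = q (bif o e then t (some e) else s (some e)) by
              cases o e <;> rfl, hqx], Finset.sum_add_distrib]
          congr 1
          split_ifs <;> simp
        have herase : ∀ f : {v // v ≠ y} → ℚ, ∀ f' : {v // v ≠ y} → ℚ, (∀ w, w.1 ≠ x → f w = f' w) →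
            ∏ w ∈ univ.erase (⟨x, hne⟩ : {v // v ≠ y}), f w = ∏ w ∈ univ.erase (⟨x, hne⟩ : {v // v ≠ y}), f' w :=
          fun f f' h => Finset.prod_congr rfl fun w hw => h w fun h' => Finset.ne_of_mem_erase hw (Subtype.ext h')
        rw [herase (fun w => evalComp (g w.1) (m w.1 + ((if y = w.1 then 1 else 0) +
            ∑ e, if (bif o e then t (some e) else s (some e)) = w.1 then 1 else 0)))
          (fun w => evalComp (g w.1) (m w.1 + ((if x = w.1 then 1 else 0) +
            ∑ e, if (bif o e then t (some e) else s (some e)) = w.1 then 1 else 0)))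
          fun w hw => by rw [if_neg w.2.symm, if_neg (Ne.symm hw)], ← add_mul]
        congr 1
        · rw [hcnt, if_pos rfl, if_pos rfl, if_pos rfl, if_pos rfl, if_pos rfl, if_neg hne, if_neg (Ne.symm hne), zero_add,
            zero_add, show ∀ a b c d : ℕ, a + b + (c + d) = (a + c) + (b + d) by intros; ring, evalComp_add,
            show ∀ a b : ℕ, a + (1 + b) = a + b + 1 by intros; ring,
            show ∀ a b : ℕ, a + (1 + b) = a + b + 1 by intros; ring]
          ring
        · refine herase _ _ fun w hw => ?_
          rw [hcnt, if_neg hw, if_neg hw, if_neg hw, if_neg (Ne.symm hw), add_zero, add_zero, add_zero, zero_add]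
      · obtain ⟨v, rfl⟩ := h1 c
        exact ⟨q v, hq v⟩
      · rw [hq, hq]; exact h2 _
      · have := h3 (fun v => φ (q v)) (by
          rintro (_ | e)
          · rw [← hx, ← hy]
            simp only [q, dif_neg hne, dif_pos]
          · exact hφ e) a.1 b.1 hab
        simp only [hqs] at this
        exact this ha
      · rw [h4' c, hsum, ← add_assoc]
        simp only [hq]
        congr 1
        rw [show (if π x = c then (1 : ℤ) else 0) = ∑ w : {v // v ≠ y},
          if w = ⟨x, hne⟩ then (if π w.1 = c then 1 else 0) else 0 by simp, ← Finset.sum_add_distrib]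
        refine Finset.sum_congr rfl fun w _ => ?_
        by_cases hw : w.1 = x
        · rw [if_pos hw, if_pos hw, if_pos (Subtype.ext hw)]
          split_ifs <;> push_cast <;> ring
        · rw [if_neg hw, if_neg fun h : w = ⟨x, hne⟩ => hw (congrArg Subtype.val h)]
          simp [hw]
      · rw [h5 c, hsum]

end GluingFormula
end TorusKh

/-! ### Matrix coefficients of the TQFT. -/

namespace TorusKh

section Coeff

namespace DSurf

variable {X Y Z : Type}

/-- The number of dots that the labels of the boundary circles put on a component. -/
noncomputable def labelDots {A C : Type} (p : A → C) (a : A → Bool) (l : Bool) : C → ℕ :=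
  fibreSum p fun x => if a x = l then 1 else 0

theorem card_eq_labelDots {A C : Type} [Finite A] (p : A → C) (a : A → Bool) (l : Bool) (c : C) :
    Nat.card {x // p x = c ∧ a x = l} = labelDots p a l c := by
  classical
  have := Fintype.ofFinite A
  rw [labelDots, fibreSum_eq, Nat.card_eq_fintype_card, Fintype.card_subtype, Finset.card_filter]
  exact Finset.sum_congr rfl fun x _ => by split_ifs <;> simp_all

theorem coeff_eq_prod [Finite X] [Finite Y] (S : DSurf X Y) [Fintype S.Comp] (a : X → Bool) (b : Y → Bool) :
    S.coeff a b = ∏ c, evalComp (S.genus c)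
      (S.dots c + labelDots S.bot a true c + labelDots S.top b false c) := by
  unfold coeff
  rw [finprod_eq_prod_of_fintype]
  simp only [card_eq_labelDots]

theorem coeff_congr [Finite X] [Finite Y] {S T : DSurf X Y} (i : Iso S T) : S.coeff = T.coeff := by
  funext a b
  have := Fintype.ofFinite S.Comp
  have := Fintype.ofFinite T.Comp
  rw [coeff_eq_prod, coeff_eq_prod]
  refine Fintype.prod_equiv i.e _ _ fun c => ?_
  rw [i.genus, i.dots, ← funext i.bot, ← funext i.top]
  congr 2
  · congr 1
    exact (fibreSum_comp_injective S.bot i.e i.e.injective _ c).symm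
  · exact (fibreSum_comp_injective S.top i.e i.e.injective _ c).symm

set_option maxHeartbeats 400000 in
/-- The TQFT is multiplicative under stacking. -/
theorem coeff_glue [Finite X] [Fintype Y] [DecidableEq Y] [Finite Z] (S : DSurf X Y) (T : DSurf Y Z) (a : X → Bool)
    (b : Z → Bool) : (glue S T).coeff a b = ∑ c : Y → Bool, S.coeff a c * T.coeff c b := by
  classical
  have := Fintype.ofFinite S.Comp
  have := Fintype.ofFinite T.Comp
  have : Fintype (GlueComp S T) := Fintype.ofFinite _
  have : Fintype (glue S T).Comp := this
  rw [coeff_eq_prod]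
  -- The graph has the components of both surfaces as vertices and the circles of `Y` as edges. The
  -- label $X$ of such a circle dots the upper end, and the label 1 dots the lower end, so
  -- labellings are the states.
  have key := isStateSum Y (S.Comp ⊕ T.Comp) (GlueComp S T) (fun y => Sum.inl (S.top y)) (fun y => Sum.inr (T.bot y))
    (Sum.elim S.genus T.genus) (Sum.elim (S.dots + labelDots S.bot a true) (T.dots + labelDots T.top b false))
    (Quot.mk _) (glue S T).genus
    ((glue S T).dots + labelDots (glue S T).bot a true + labelDots (glue S T).top b false) Quot.mk_surjective
    (fun y => ofBot_top S T y) (fun φ hφ u v h hu => ?_) (fun c => ?_) (fun c => ?_)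
  · refine Eq.trans ?_ (key.trans ?_)
    · exact Finset.prod_congr (by congr!) fun c _ => rfl
    · refine Finset.sum_congr (by congr!) fun c _ => ?_
      rw [Fintype.prod_sum_type, coeff_eq_prod, coeff_eq_prod]
      congr 1
      · refine Finset.prod_congr rfl fun u _ => ?_
        congr 1
        simp only [Sum.elim_inl, Pi.add_apply]
        congr 1
        rw [labelDots, fibreSum_eq]
        refine Finset.sum_congr rfl fun y _ => ?_
        cases c y <;> simp
      · refine Finset.prod_congr rfl fun u _ => ?_
        congr 1
        simp only [Sum.elim_inr, Pi.add_apply]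
        rw [add_right_comm]
        congr 2
        rw [labelDots, fibreSum_eq]
        refine Finset.sum_congr rfl fun y _ => ?_
        cases c y <;> simp
  · have h' := congrArg (Quot.lift φ (by rintro _ _ ⟨y, rfl, rfl⟩; exact hφ y)) h
    exact h'.mp hu
  · rw [congrFun (glue_genus S T) c]
    simp only [Pi.add_apply, fibreSum_eq, Fintype.sum_sum_type, Sum.elim_inl, Sum.elim_inr]
    congr 1
    refine Finset.sum_congr rfl fun y _ => ?_
    exact if_congr (iff_of_eq (congrArg (· = c) (ofBot_top S T y).symm)) rfl rfl
  · have e1 : labelDots (glue S T).bot a true = fibreSum (ofBot S T) (labelDots S.bot a true) :=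
      (fibreSum_fibreSum S.bot (ofBot S T) _).symm
    have e2 : labelDots (glue S T).top b false = fibreSum (ofTop S T) (labelDots T.top b false) :=
      (fibreSum_fibreSum T.top (ofTop S T) _).symm
    rw [e1, e2, glue_dots, add_assoc, add_add_add_comm, ← fibreSum_add, ← fibreSum_add]
    simp only [Pi.add_apply, fibreSum_eq, Fintype.sum_sum_type, Sum.elim_inl, Sum.elim_inr]
    rfl

theorem coeff_addSphere [Finite X] [Finite Y] (S : DSurf X Y) (m : ℕ) (a : X → Bool) (b : Y → Bool) :
    (S.addSphere m).coeff a b = evalComp 0 m * S.coeff a b := by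
  have := Fintype.ofFinite S.Comp
  have h0 : ∀ {A : Type} (p : A → S.Comp) (a : A → Bool) (l : Bool),
      labelDots (fun x => some (p x)) a l none = 0 := fun p a l =>
    (finsum_congr fun x => if_neg (by simp)).trans finsum_zero
  have h1 : ∀ {A : Type} (p : A → S.Comp) (a : A → Bool) (l : Bool) (c : S.Comp),
      labelDots (fun x => some (p x)) a l (some c) = labelDots p a l c := fun p a l c =>
    fibreSum_comp_injective p some (Option.some_injective _) _ c
  have : Fintype (S.addSphere m).Comp := inferInstanceAs (Fintype (Option S.Comp))
  rw [coeff_eq_prod, coeff_eq_prod]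
  refine (Finset.prod_congr (by congr!) fun _ _ => rfl).trans ((Fintype.prod_option _).trans ?_)
  simp only [h0, h1, add_zero, Option.elim]

/-- The pairing of labels. -/
theorem evalComp_label (l l' : Bool) : evalComp 0 ((if l = true then 1 else 0) + if l' = false then 1 else 0) =
    if l = l' then 1 else 0 := by
  cases l <;> cases l' <;> simp [evalComp]

theorem prod_label [Fintype X] (a b : X → Bool) : (∏ x, if a x = b x then (1 : ℚ) else 0) = if a = b then 1 else 0 := by
  by_cases h : a = b
  · rw [if_pos h]
    exact Finset.prod_eq_one fun x _ => if_pos (congrFun h x)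
  · rw [if_neg h]
    obtain ⟨x, hx⟩ := Function.ne_iff.1 h
    exact Finset.prod_eq_zero (Finset.mem_univ x) (if_neg hx)

theorem coeff_cylinder [Fintype X] (a b : X → Bool) : (cylinder X).coeff a b = if a = b then 1 else 0 := by
  classical
  rw [coeff_eq_prod]
  simp only [labelDots, fibreSum_id, zero_add, evalComp_label, prod_label]

open Finset in
theorem coeff_cut [Fintype X] [DecidableEq X] (x : X) (m m' : ℕ) (a b : X → Bool) : (cut x m m').coeff a b =
    evalComp 0 (m' + if b x = false then 1 else 0) * (evalComp 0 (m + if a x = true then 1 else 0) *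
      ∏ y ∈ univ.erase x, if a y = b y then 1 else 0) := by
  have : Fintype (cut x m m').Comp := inferInstanceAs (Fintype (Option X))
  rw [coeff_eq_prod]
  refine (Finset.prod_congr (by congr!) fun _ _ => rfl).trans ((Fintype.prod_option _).trans ?_)
  have hb : ∀ y, labelDots (cut x m m').bot a true (some y) = if a y = true then 1 else 0 := fun y =>
    fibreSum_injective _ (Option.some_injective _) _ y
  have hb' : labelDots (cut x m m').bot a true none = 0 := fibreSum_of_notMem _ _ _ (by simp)
  have ht' : labelDots (cut x m m').top b false none = if b x = false then 1 else 0 := by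
    rw [labelDots, fibreSum_eq, Finset.sum_eq_single x]
    · simp
    · intro y _ hy; simp [hy]
    · simp
  have ht : ∀ y, labelDots (cut x m m').top b false (some y) =
      if y = x then 0 else if b y = false then 1 else 0 := fun y => by
    rw [labelDots, fibreSum_eq, Finset.sum_eq_single y]
    · by_cases hy : y = x <;> simp [hy]
    · intro z _ hz
      by_cases h : z = x <;> simp [h, hz]
    · simp
  rw [← Finset.mul_prod_erase univ _ (mem_univ x)]
  simp only [hb, hb', ht, ht', Option.elim, if_true, add_zero]
  congr 2
  refine Finset.prod_congr rfl fun y hy => ?_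
  rw [if_neg (ne_of_mem_erase hy), if_neg (ne_of_mem_erase hy), zero_add, evalComp_label]

/-- The neck relation without its third term, since a sphere with two dots has the value 0 for
$X^2=0$. -/
theorem coeff_neck [Fintype X] (x : X) (a b : X → Bool) :
    (cylinder X).coeff a b = (cut x 1 0).coeff a b + (cut x 0 1).coeff a b := by
  classical
  rw [coeff_cut, coeff_cut, coeff_cylinder, ← mul_assoc, ← mul_assoc, ← add_mul]
  have h : evalComp 0 (0 + if b x = false then 1 else 0) * evalComp 0 (1 + if a x = true then 1 else 0) +
      evalComp 0 (1 + if b x = false then 1 else 0) * evalComp 0 (0 + if a x = true then 1 else 0) =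
      if a x = b x then 1 else 0 := by
    cases a x <;> cases b x <;> simp [evalComp]
  rw [h, Finset.mul_prod_erase Finset.univ (fun y => if a y = b y then (1 : ℚ) else 0) (Finset.mem_univ x), prod_label]

end DSurf
end Coeff
end TorusKh

/-! ### The TQFT as a functor on `Cob ℚ`. -/

namespace TorusKh

open Cob DSurf

section Functor

/-- The labellings of the circles of an object. -/
abbrev Lab (A : Cob ℚ) : Type := Circ ℚ A → Bool

/-- The labellings of the circles of a 1-manifold. -/
abbrev DLab (X : DCob) : Type := X.Circle → Bool

noncomputable instance (X : DCob) : Fintype (DLab X) := Fintype.ofFinite _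

/-- The TQFT on homeomorphism types of surfaces. -/
noncomputable def homCoeff {X Y : DCob} (φ : X ⟶ Y) : Matrix (DLab X) (DLab Y) ℚ :=
  _root_.Quotient.lift (s := DSurf.setoid X.Circle Y.Circle) (fun S => Matrix.of S.coeff)
    (fun S T (h : Nonempty (Iso S T)) => h.elim fun i => congrArg Matrix.of (coeff_congr i)) φ

theorem homCoeff_comp {X Y Z : DCob} (φ : X ⟶ Y) (ψ : Y ⟶ Z) :
    homCoeff (φ ≫ ψ) = homCoeff φ * homCoeff ψ := by
  induction φ using Quotient.inductionOn with | _ S =>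
  induction ψ using Quotient.inductionOn with | _ T =>
  classical
  have := Fintype.ofFinite Y.Circle
  ext a b
  refine (coeff_glue S T a b).trans ?_
  rw [Matrix.mul_apply]
  exact Finset.sum_congr (by congr!) fun _ _ => rfl

/-- The TQFT on formal combinations of surfaces. -/
noncomputable def freeCoeff {X Y : DCob} : ((X ⟶ Y) →₀ ℚ) →+ Matrix (DLab X) (DLab Y) ℚ :=
  (Finsupp.linearCombination ℚ homCoeff).toAddMonoidHom

theorem freeCoeff_single {X Y : DCob} (φ : X ⟶ Y) (r : ℚ) : freeCoeff (Finsupp.single φ r) = r • homCoeff φ :=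
  Finsupp.linearCombination_single _ _ _

theorem freeCoeff_sum {X Y Z : DCob} (f : (X ⟶ Y) →₀ ℚ) (g : (Y ⟶ Z) →₀ ℚ) :
    freeCoeff (f.sum fun φ r => g.sum fun ψ s => Finsupp.single (φ ≫ ψ) (r * s)) = freeCoeff f * freeCoeff g := by
  have h : ∀ {X Y : DCob} (f : (X ⟶ Y) →₀ ℚ), freeCoeff f = ∑ φ ∈ f.support, f φ • homCoeff φ := fun f =>
    Finsupp.linearCombination_apply _ f
  rw [h f, h g, Matrix.sum_mul, Finsupp.sum, map_sum]
  refine Finset.sum_congr rfl fun φ _ => ?_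
  rw [Matrix.mul_sum, Finsupp.sum, map_sum]
  refine Finset.sum_congr rfl fun ψ _ => ?_
  rw [freeCoeff_single, homCoeff_comp, Matrix.smul_mul, Matrix.mul_smul, smul_smul]

theorem freeCoeff_comp {X Y Z : DCob} (f : Free.of ℚ X ⟶ Free.of ℚ Y) (g : Free.of ℚ Y ⟶ Free.of ℚ Z) :
    freeCoeff (X := X) (Y := Z) (f ≫ g) = freeCoeff (X := X) (Y := Y) f * freeCoeff (X := Y) (Y := Z) g :=
  freeCoeff_sum f g

theorem freeCoeff_comp_congr {X Y Z : DCob} {f f' : Free.of ℚ X ⟶ Free.of ℚ Y} {g g' : Free.of ℚ Y ⟶ Free.of ℚ Z}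
    (hf : freeCoeff (X := X) (Y := Y) f = freeCoeff (X := X) (Y := Y) f')
    (hg : freeCoeff (X := Y) (Y := Z) g = freeCoeff (X := Y) (Y := Z) g') :
    freeCoeff (X := X) (Y := Z) (f ≫ g) = freeCoeff (X := X) (Y := Z) (f' ≫ g') := by
  rw [freeCoeff_comp, freeCoeff_comp, hf, hg]

theorem freeCoeff_surf {X Y : DCob} (S : DSurf X.Circle Y.Circle) :
    freeCoeff (single ℚ S) = Matrix.of S.coeff :=
  (freeCoeff_single _ _).trans (one_smul _ _)

/-- The spheres evaluate to 0 and 1, neck-cutting is `coeff_neck`, and closure under composition is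
the gluing formula. So the TQFT descends to the quotient. -/
theorem freeCoeff_eq {X Y : Free ℚ DCob} {f g : X ⟶ Y} (h : LocalRel ℚ f g) :
    freeCoeff (X := X) (Y := Y) f = freeCoeff (X := X) (Y := Y) g := by
  induction h with
  | sphere S =>
    refine (freeCoeff_surf _).trans ?_
    rw [map_zero]
    ext a b
    exact (coeff_addSphere S 0 a b).trans (zero_mul _)
  | dottedSphere S =>
    refine (freeCoeff_surf _).trans (Eq.trans ?_ (freeCoeff_surf _).symm)
    ext a b
    exact (coeff_addSphere S 1 a b).trans (one_mul _)
  | neck X x =>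
    have := Fintype.ofFinite X.Circle
    refine (freeCoeff_surf (cylinder X.Circle)).trans (Eq.trans ?_ (map_sub freeCoeff _ _).symm)
    refine Eq.trans ?_ (congrArg₂ (· - ·) (map_add freeCoeff _ _).symm rfl)
    refine Eq.trans ?_ (congrArg₂ (· - ·) (congrArg₂ (· + ·) (freeCoeff_surf _).symm (freeCoeff_surf _).symm)
      (freeCoeff_surf _).symm)
    ext a b
    refine (coeff_neck x a b).trans (Eq.trans ?_ (sub_eq_add_neg _ _).symm)
    have h2 : ((cut x 0 0).addSphere 2).coeff a b = 0 := (coeff_addSphere _ 2 a b).trans (by simp [evalComp])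
    change _ = (cut x 1 0).coeff a b + (cut x 0 1).coeff a b + -((cut x 0 0).addSphere 2).coeff a b
    rw [h2, neg_zero, add_zero]
  | refl => rfl
  | symm _ h => exact h.symm
  | trans _ _ h h' => exact h.trans h'
  | add _ _ h h' => exact (map_add freeCoeff _ _).trans ((congrArg₂ (· + ·) h h').trans (map_add freeCoeff _ _).symm)
  | comp_left f _ h =>
    exact freeCoeff_comp_congr rfl h
  | comp_right g _ h =>
    exact freeCoeff_comp_congr h rfl

variable {A B C : Cob ℚ}

noncomputable instance (A : Cob ℚ) : Fintype (Lab A) := Fintype.ofFinite _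

noncomputable instance (A : Cob ℚ) : DecidableEq (Lab A) := Classical.decEq _

/-- The TQFT of `ℚ[X] / (X ^ 2)` as an additive functor on `Cob ℚ`. -/
noncomputable def tqft : (A ⟶ B) →+ Matrix (Lab A) (Lab B) ℚ where
  toFun f := Quot.lift (fun f' : A.as ⟶ B.as => freeCoeff f')
    (fun _ _ h => freeCoeff_eq ((HomRel.compClosure_iff_self _ _ _).1 h)) f
  map_zero' := map_zero freeCoeff
  map_add' := by
    rintro ⟨f⟩ ⟨g⟩
    exact map_add freeCoeff f g

theorem tqft_comp (f : A ⟶ B) (g : B ⟶ C) : tqft (f ≫ g) = tqft f * tqft g := by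
  obtain ⟨f⟩ := f
  obtain ⟨g⟩ := g
  exact freeCoeff_comp f g

theorem tqft_surf (r : ℚ) (S : DSurf (Circ ℚ A) (Circ ℚ B)) : tqft (surf r S) = r • Matrix.of S.coeff := by
  refine (congrArg freeCoeff (Finsupp.smul_single r _ _)).trans ?_
  refine (freeCoeff_single _ _).trans ?_
  rw [smul_eq_mul, mul_one]
  rfl

theorem tqft_id : tqft (𝟙 A) = 1 := by
  have := Fintype.ofFinite (Circ ℚ A)
  rw [id_eq_surf, tqft_surf, one_smul]
  ext a b
  refine (coeff_cylinder a b).trans (Eq.trans ?_ (Matrix.one_apply (i := a) (j := b)).symm)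
  congr!

end Functor

end TorusKh

/-! ### Extension to formal direct sums, degrees, and comparison with the Khovanov complex. -/

namespace TorusKh

open Cob DSurf

section MatrixFunctor

theorem tqft_id_self {A : Cob ℚ} (a : Lab A) : tqft (𝟙 A) a a = 1 := by
  rw [tqft_id, Matrix.one_apply_eq]

theorem tqft_id_ne {A : Cob ℚ} {a b : Lab A} (h : a ≠ b) : tqft (𝟙 A) a b = 0 := by
  rw [tqft_id, Matrix.one_apply_ne h]

/-- The generators of the TQFT module of a formal direct sum. -/
abbrev Gens (M : Mat_ (Cob ℚ)) : Type := Σ i : M.ι, Lab (M.X i)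

instance (M : Mat_ (Cob ℚ)) : Finite M.ι := Finite.of_fintype _

noncomputable instance (M : Mat_ (Cob ℚ)) : Fintype (Gens M) := Fintype.ofFinite _

noncomputable instance (M : Mat_ (Cob ℚ)) : DecidableEq (Gens M) := Classical.decEq _

variable {L M N : Mat_ (Cob ℚ)}

/-- The matrix of the TQFT on a map of formal direct sums. -/
noncomputable def matTqft : (M ⟶ N) →+ Matrix (Gens N) (Gens M) ℚ where
  toFun f := Matrix.of fun h g => tqft (f g.1 h.1) g.2 h.2
  map_zero' := by
    ext h g
    exact congrFun (congrFun (map_zero tqft) g.2) h.2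
  map_add' f f' := by
    ext h g
    exact congrFun (congrFun (map_add tqft (f g.1 h.1) (f' g.1 h.1)) g.2) h.2

theorem matTqft_apply (f : M ⟶ N) (h : Gens N) (g : Gens M) : matTqft f h g = tqft (f g.1 h.1) g.2 h.2 := rfl

theorem matTqft_comp (f : L ⟶ M) (g : M ⟶ N) : matTqft (f ≫ g) = matTqft g * matTqft f := by
  ext c a
  rw [matTqft_apply, Mat_.comp_apply, map_sum, Matrix.sum_apply, Matrix.mul_apply]
  have e : ∑ b : Gens M, matTqft g c b * matTqft f b a =
      ∑ i, ∑ b : Lab (M.X i), matTqft g c ⟨i, b⟩ * matTqft f ⟨i, b⟩ a :=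
    (Finset.sum_congr (by congr!) fun _ _ => rfl).trans (Fintype.sum_sigma _)
  rw [e]
  refine Finset.sum_congr rfl fun i _ => ?_
  rw [tqft_comp, Matrix.mul_apply]
  exact Finset.sum_congr rfl fun b _ => mul_comm _ _

theorem matTqft_id : matTqft (𝟙 M) = 1 := by
  ext ⟨j, b⟩ ⟨i, a⟩
  rw [matTqft_apply]
  by_cases h : i = j
  · subst h
    rw [Mat_.id_apply_self, tqft_id, Matrix.one_apply, Matrix.one_apply]
    exact if_congr (by simp [eq_comm]) rfl rfl
  · rw [Mat_.id_apply_of_ne _ _ _ h, map_zero, Matrix.one_apply_ne (fun h' => h (congrArg Sigma.fst h').symm)]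
    rfl

/-- The TQFT on endomorphisms of a formal direct sum. -/
noncomputable def endTqft : End M →+* Matrix (Gens M) (Gens M) ℚ where
  toFun := fun f => matTqft f
  map_one' := matTqft_id
  map_mul' f g := matTqft_comp g f
  map_zero' := map_zero matTqft
  map_add' := map_add matTqft

/-- The TQFT as an additive functor to vector spaces. -/
noncomputable def linTqft (f : M ⟶ N) : (Gens M → ℚ) →ₗ[ℚ] (Gens N → ℚ) := (matTqft f).mulVecLin

theorem linTqft_comp (f : L ⟶ M) (g : M ⟶ N) : linTqft (f ≫ g) = linTqft g ∘ₗ linTqft f := by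
  rw [linTqft, matTqft_comp, Matrix.mulVecLin_mul]; rfl

theorem linTqft_id : linTqft (𝟙 M) = LinearMap.id := by
  rw [linTqft, matTqft_id, Matrix.mulVecLin_one]

theorem linTqft_add (f g : M ⟶ N) : linTqft (f + g) = linTqft f + linTqft g := by
  rw [linTqft, map_add, Matrix.mulVecLin_add]; rfl

theorem linTqft_sub (f g : M ⟶ N) : linTqft (f - g) = linTqft f - linTqft g := by
  rw [eq_sub_iff_add_eq, ← linTqft_add, sub_add_cancel]

theorem linTqft_zero : linTqft (0 : M ⟶ N) = 0 := by
  rw [linTqft, map_zero, Matrix.mulVecLin_zero]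

theorem linTqft_single [DecidableEq (Gens M)] (f : M ⟶ N) (g : Gens M) (h : Gens N) :
    linTqft f (Pi.single g 1) h = tqft (f g.1 h.1) g.2 h.2 := by
  rw [linTqft, Matrix.mulVecLin_apply, Matrix.mulVec_single_one]; rfl

end MatrixFunctor

section Degrees

/-- The quantum degree of a labelling. -/
noncomputable def labelDeg {X : Type} (a : X → Bool) : ℤ := ∑ᶠ x, if a x = true then 1 else -1

theorem sum_labelDots {X C : Type} [Finite X] [Fintype C] (p : X → C) (a : X → Bool) (l : Bool) :
    (∑ c, (labelDots p a l c : ℤ)) = ∑ᶠ x, if a x = l then (1 : ℤ) else 0 := by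
  have := Fintype.ofFinite X
  rw [← finsum_fibreSum p, finsum_eq_sum_of_fintype]
  refine Finset.sum_congr rfl fun c _ => ?_
  rw [labelDots, natCast_fibreSum]
  congr 1
  funext x
  split_ifs <;> rfl

/-- A component has non-zero value only if genus, dots and dots from labels add up to 1. Summing
these equations over the components gives the degree. -/
theorem deg_of_coeff_ne_zero {X Y : Type} [Finite X] [Finite Y] (S : DSurf X Y) {a : X → Bool} {b : Y → Bool}
    (h : S.coeff a b ≠ 0) : S.deg = labelDeg b - labelDeg a := by
  have := Fintype.ofFinite S.Comp
  have := Fintype.ofFinite X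
  have := Fintype.ofFinite Y
  rw [coeff_eq_prod, Finset.prod_ne_zero_iff] at h
  have h1 : ∀ c, (S.dots c : ℤ) + labelDots S.bot a true c + labelDots S.top b false c + ((S.genus c : ℤ) - 1) = 0 :=
    fun c => by
      have := h c (Finset.mem_univ c)
      have h2 : S.dots c + labelDots S.bot a true c + labelDots S.top b false c + S.genus c = 1 := by
        by_contra h'
        exact this (if_neg h')
      omega
  have h2 := Finset.sum_congr (rfl : (Finset.univ : Finset S.Comp) = _) fun c _ => h1 c
  simp only [Finset.sum_add_distrib, sum_labelDots, Finset.sum_const_zero] at h2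
  have ha : labelDeg a = 2 * (∑ᶠ x, if a x = true then (1 : ℤ) else 0) - Nat.card X := by
    simp only [labelDeg, finsum_eq_sum_of_fintype, Nat.card_eq_fintype_card, Fintype.card_eq_sum_ones, Nat.cast_sum,
      Finset.mul_sum, ← Finset.sum_sub_distrib]
    refine Finset.sum_congr rfl fun x _ => ?_
    split_ifs <;> norm_num
  have hb : labelDeg b = Nat.card Y - 2 * (∑ᶠ y, if b y = false then (1 : ℤ) else 0) := by
    simp only [labelDeg, finsum_eq_sum_of_fintype, Nat.card_eq_fintype_card, Fintype.card_eq_sum_ones, Nat.cast_sum,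
      Finset.mul_sum, ← Finset.sum_sub_distrib]
    refine Finset.sum_congr rfl fun y _ => ?_
    cases b y <;> simp
  rw [DSurf.deg_eq, ha, hb, finsum_eq_sum_of_fintype, finsum_eq_sum_of_fintype]
  linarith

theorem tqft_eq_zero_of_mem_homog {A B : Cob ℚ} {f : A ⟶ B} {m : ℤ} (hf : f ∈ homog m A B) {a : Lab A} {b : Lab B}
    (h : labelDeg b - labelDeg a ≠ m) : tqft f a b = 0 := by
  unfold homog at hf
  induction hf using AddSubgroup.closure_induction with
  | zero => rw [map_zero]; rfl
  | add f g _ _ hf hg => rw [map_add, Matrix.add_apply, hf, hg, add_zero]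
  | neg f _ hf => rw [map_neg, Matrix.neg_apply, hf, neg_zero]
  | mem f hf =>
    obtain ⟨r, S, hS, rfl⟩ := hf
    rw [tqft_surf]
    refine (congrArg (r * ·) ?_).trans (mul_zero r)
    by_contra h'
    exact h ((deg_of_coeff_ne_zero S h').symm.trans hS)

variable {C D : GrMat ℚ}

/-- The chains of bidegree `(i, j)` in the TQFT module of a graded object. -/
def gensPiece (C : GrMat ℚ) (i j : ℤ) : Submodule ℚ (Gens C.obj → ℚ) where
  carrier := {z | ∀ g, ¬ (C.t g.1 = i ∧ C.q g.1 + labelDeg g.2 = j) → z g = 0}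
  add_mem' := fun ha hb g hg => by simp [ha g hg, hb g hg]
  zero_mem' := fun _ _ => rfl
  smul_mem' := fun r z hz g hg => by simp [hz g hg]

theorem linTqft_mem {f : C.obj ⟶ D.obj} {a b : ℤ} (hf : HasBidegree f a b) {i j : ℤ} {z : Gens C.obj → ℚ}
    (hz : z ∈ gensPiece C i j) : linTqft f z ∈ gensPiece D (i + a) (j + b) := by
  intro h hh
  refine Finset.sum_eq_zero fun g _ => ?_
  by_cases hg : C.t g.1 = i ∧ C.q g.1 + labelDeg g.2 = j
  · refine mul_eq_zero_of_left ?_ _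
    change tqft (f g.1 h.1) g.2 h.2 = 0
    by_cases ht : D.t h.1 = C.t g.1 + a
    · refine tqft_eq_zero_of_mem_homog ((hf _ _).1 ht) fun h' => hh ⟨by rw [ht, hg.1], ?_⟩
      rw [← hg.2]; linarith
    · rw [(hf _ _).2 ht, map_zero]; rfl
  · exact mul_eq_zero_of_right _ (hz g hg)

end Degrees

section Khovanov

theorem tqft_zsmul_surf {A B : Cob ℚ} (n : ℤ) (S : DSurf (Circ ℚ A) (Circ ℚ B)) (a : Lab A) (b : Lab B) :
    tqft (n • surf (1 : ℚ) S) a b = n * S.coeff a b := by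
  rw [map_zsmul, tqft_surf, one_smul]
  exact zsmul_eq_mul _ _

theorem tqft_ite_surf {A B : Cob ℚ} (p : Prop) [Decidable p] (S : DSurf (Circ ℚ A) (Circ ℚ B)) (a : Lab A) (b : Lab B) :
    tqft (if p then surf (1 : ℚ) S else 0) a b = if p then S.coeff a b else 0 := by
  split_ifs
  · rw [tqft_surf, one_smul]; rfl
  · rw [map_zero]; rfl

variable (k : ℕ)

theorem map_loopU {A B : Type*} [Ring A] [Ring B] (φ : A →+* B) (χ : Crossing k → A) :
    φ (loopU χ) = loopU fun c => φ (χ c) := by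
  simp only [loopU, map_sum, map_mul, map_pow, map_neg, map_one]

/-- This identification and the next ones for $\bar u$ and $x$ let every identity on the bracket be
used on the Khovanov complex. -/
theorem ckhD_eq : ckhD k = linTqft (bracketD ℚ k) := by
  refine congrArg Matrix.mulVecLin ?_
  ext g' g
  refine Eq.symm ((congrFun (congrFun (map_sum tqft _ _) _) _).trans ?_)
  refine (Matrix.sum_apply _ _ _ _).trans (Finset.sum_congr rfl fun c _ => ?_)
  exact tqft_zsmul_surf (A := circles ℚ (ResCircle g.1)) (B := circles ℚ (ResCircle g'.1)) _ _ _ _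

theorem endTqft_chi (c : Crossing k) : endTqft (bracketChi ℚ k c) = khChi k c := by
  ext g' g
  exact tqft_zsmul_surf (A := circles ℚ (ResCircle g.1)) (B := circles ℚ (ResCircle g'.1)) _ _ _ _

theorem ckhU_eq : ckhU k = linTqft (bracketU ℚ k) := by
  refine congrArg Matrix.mulVecLin (Eq.symm ?_)
  refine (map_loopU k endTqft (bracketChi ℚ k)).trans (congrArg loopU (funext (endTqft_chi k)))

theorem ckhX_eq : ckhX k = linTqft (bracketX ℚ k) := by
  refine congrArg Matrix.mulVecLin ?_
  ext g' g
  refine Eq.trans ?_ (@tqft_ite_surf (circles ℚ (ResCircle g.1)) (circles ℚ (ResCircle g'.1)) (g.1 = g'.1)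
    (Classical.propDecidable _) (dottedSweep g.1 g'.1) g.2 g'.2).symm
  by_cases h : g.1 = g'.1
  · exact (if_pos h).trans (if_pos h).symm
  · exact (if_neg h).trans (if_neg h).symm

end Khovanov
end TorusKh

/-! ### The rational small model. -/

namespace TorusKh

open Cob DSurf

section RationalRetract

variable (k : ℕ)

theorem ckhD_comp_ckhD : ckhD k ∘ₗ ckhD k = 0 := by
  have h : linTqft (opd ℚ k * opd ℚ k : End (cubeObj ℚ k)) = linTqft (opd ℚ k) ∘ₗ linTqft (opd ℚ k) :=
    linTqft_comp _ _
  rw [opd_sq] at h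
  rw [ckhD_eq, bracketD_eq_opd]
  exact h.symm.trans linTqft_zero

theorem linTqft_commute {S T : End (cubeObj ℚ k)} (h : Commute S T) :
    linTqft S ∘ₗ linTqft T = linTqft T ∘ₗ linTqft S :=
  (linTqft_comp T S).symm.trans ((congrArg linTqft h.eq).trans (linTqft_comp S T))

theorem ckhD_comp_ckhU : ckhD k ∘ₗ ckhU k = ckhU k ∘ₗ ckhD k := by
  rw [ckhD_eq, ckhU_eq, bracketD_eq_opd, bracketU_eq]
  exact linTqft_commute k (opd_halfU.add_right opd_halfU)

theorem ckhD_comp_ckhX : ckhD k ∘ₗ ckhX k = ckhX k ∘ₗ ckhD k := by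
  rw [ckhD_eq, ckhX_eq, bracketD_eq_opd, bracketX_eq]
  exact linTqft_commute k (opd_opX _)

theorem ckhU_comp_ckhX : ckhU k ∘ₗ ckhX k = ckhX k ∘ₗ ckhU k := by
  rw [ckhU_eq, ckhX_eq, bracketU_eq, bracketX_eq]
  exact linTqft_commute k (halfU_opX.add_left halfU_opX)

theorem map_ckhD_redSub : (redSub k).map (ckhD k) ≤ redSub k := by
  rintro _ ⟨_, ⟨z, rfl⟩, rfl⟩
  exact ⟨ckhD k z, (LinearMap.congr_fun (ckhD_comp_ckhX k) z).symm⟩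

theorem map_ckhU_redSub : (redSub k).map (ckhU k) ≤ redSub k := by
  rintro _ ⟨_, ⟨z, rfl⟩, rfl⟩
  exact ⟨ckhU k z, (LinearMap.congr_fun (ckhU_comp_ckhX k) z).symm⟩

/-- The rational small model. -/
abbrev SKh : Type := Gens (smallObj ℚ k) → ℚ

/-- Besides the retraction, compatibility with $x$ is recorded for all three maps, so that they
restrict to the complexes for reduced homology. -/
theorem exists_rational_retract : ∃ (g : CKh k →ₗ[ℚ] SKh k) (f : SKh k →ₗ[ℚ] CKh k) (s : CKh k →ₗ[ℚ] CKh k),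
    (∀ w, g (f w) = w) ∧ (∀ z, f (g z) - z = ckhD k (s z) + s (ckhD k z)) ∧
    (∀ w, ckhD k (f w) = f (linTqft (opSD ℚ k) w)) ∧ (∀ z, g (ckhD k z) = linTqft (opSD ℚ k) (g z)) ∧
    (∀ w, ckhX k (f w) = f (linTqft (opSX ℚ k) w)) ∧ (∀ z, g (ckhX k z) = linTqft (opSX ℚ k) (g z)) ∧
    (∀ z, s (ckhX k z) = ckhX k (s z)) ∧ (∀ w, g (ckhU k (f w)) = linTqft (opSU ℚ k) w) ∧
    (∀ i j w, w ∈ gensPiece (small ℚ k) i j → f w ∈ ckhPiece k i j) ∧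
    (∀ i j z, z ∈ ckhPiece k i j → g z ∈ gensPiece (small ℚ k) i j) := by
  obtain ⟨g, s, h, hgx, hsx, hu⟩ := exists_strongDeformationRetract (R := ℚ) (k := k)
  have hD : ckhD k = linTqft (opd ℚ k) := (ckhD_eq k).trans (congrArg linTqft bracketD_eq_opd)
  have hX : ckhX k = linTqft (opX ℚ k (0, false)) := (ckhX_eq k).trans (congrArg linTqft bracketX_eq)
  have hU : ckhU k = linTqft (halfU (opΧ ℚ k) + halfU (opΧ ℚ k)) :=
    (ckhU_eq k).trans (congrArg linTqft bracketU_eq)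
  refine ⟨linTqft g, linTqft (mapF ℚ k), linTqft s, fun w => ?_, fun z => ?_, fun w => ?_, fun z => ?_,
    fun w => ?_, fun z => ?_, fun z => ?_, fun w => ?_, fun i j w hw => ?_, fun i j z hz => ?_⟩
  · exact LinearMap.congr_fun ((linTqft_comp (mapF ℚ k) g).symm.trans ((congrArg linTqft h.retract).trans linTqft_id)) w
  · have e : linTqft (g ≫ mapF ℚ k - 𝟙 (cubeObj ℚ k)) =
        linTqft ((opd ℚ k * s + s * opd ℚ k : End (cubeObj ℚ k)) : cubeObj ℚ k ⟶ cubeObj ℚ k) :=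
      congrArg linTqft h.homotopy
    have e1 : linTqft ((opd ℚ k * s + s * opd ℚ k : End (cubeObj ℚ k)) : cubeObj ℚ k ⟶ cubeObj ℚ k) =
        linTqft (opd ℚ k) ∘ₗ linTqft s + linTqft s ∘ₗ linTqft (opd ℚ k) :=
      (linTqft_add _ _).trans (congrArg₂ (· + ·) (linTqft_comp _ _) (linTqft_comp _ _))
    rw [linTqft_sub, linTqft_comp, linTqft_id, e1, ← hD] at e
    exact LinearMap.congr_fun e z
  · rw [hD]
    exact LinearMap.congr_fun ((linTqft_comp (mapF ℚ k) (opd ℚ k)).symm.trans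
      ((congrArg linTqft h.f_chain).trans (linTqft_comp (opSD ℚ k) (mapF ℚ k)))) w
  · rw [hD]
    exact LinearMap.congr_fun ((linTqft_comp (opd ℚ k) g).symm.trans
      ((congrArg linTqft h.g_chain).trans (linTqft_comp g (opSD ℚ k)))) z
  · rw [hX]
    exact LinearMap.congr_fun ((linTqft_comp (mapF ℚ k) (opX ℚ k (0, false))).symm.trans
      ((congrArg linTqft mapF_opX.symm).trans (linTqft_comp (opSX ℚ k) (mapF ℚ k)))) w
  · rw [hX]
    exact LinearMap.congr_fun ((linTqft_comp (opX ℚ k (0, false)) g).symm.trans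
      ((congrArg linTqft hgx).trans (linTqft_comp g (opSX ℚ k)))) z
  · rw [hX]
    exact LinearMap.congr_fun (linTqft_commute k hsx) z
  · rw [hU]
    have e : linTqft ((halfU (opΧ ℚ k) + halfU (opΧ ℚ k)) • mapF ℚ k) =
        linTqft (halfU (opΧ ℚ k) + halfU (opΧ ℚ k)) ∘ₗ linTqft (mapF ℚ k) := linTqft_comp _ _
    have e1 := (linTqft_comp ((halfU (opΧ ℚ k) + halfU (opΧ ℚ k)) • mapF ℚ k) g).symm.trans (congrArg linTqft hu)
    rw [e] at e1
    exact LinearMap.congr_fun e1 w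
  · have := linTqft_mem h.f_deg hw
    rwa [add_zero, add_zero] at this
  · have := linTqft_mem (C := bracket ℚ k) h.g_deg hz
    rwa [add_zero, add_zero] at this

end RationalRetract

section SmallOperators

/-- The matrix coefficients of the TQFT on an endomorphism of one circle. -/
noncomputable def unknotCoeff (l l' : Bool) : (unknot ℚ ⟶ unknot ℚ) →+ ℚ where
  toFun f := tqft f (fun _ : Unit => l) (fun _ : Unit => l')
  map_zero' := congrFun (congrFun (map_zero tqft) _) _
  map_add' f g := congrFun (congrFun (map_add tqft f g) _) _

theorem unknotCoeff_surf (l l' : Bool) (S : DSurf Unit Unit) :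
    unknotCoeff l l' (surf (1 : ℚ) S) = S.coeff (fun _ => l) (fun _ => l') := by
  refine (congrFun (congrFun (tqft_surf (A := unknot ℚ) (B := unknot ℚ) (1 : ℚ) S) _) _).trans ?_
  rw [one_smul]; rfl

theorem unknotCoeff_id (l l' : Bool) : unknotCoeff l l' (𝟙 (unknot ℚ)) = if l = l' then 1 else 0 := by
  by_cases h : l = l'
  · rw [if_pos h, h]
    exact tqft_id_self (A := unknot ℚ) _
  · rw [if_neg h]
    exact tqft_id_ne (A := unknot ℚ) fun h' => h (congrFun h' ())

theorem unknotCoeff_dotX (l l' : Bool) : unknotCoeff l l' (dotX ℚ) = if l = false ∧ l' = true then 1 else 0 := by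
  classical
  have h : ∀ (p : Unit → Unit) (a : Unit → Bool) (l : Bool), labelDots p a l () = if a () = l then 1 else 0 :=
    fun p a l => by
      rw [labelDots, fibreSum_eq, Fintype.sum_unique]
      exact if_pos rfl
  refine (unknotCoeff_surf l l' _).trans ((coeff_eq_prod _ _ _).trans ((Fintype.prod_unique _).trans ?_))
  refine (congrArg₂ evalComp (rfl : _ = 0) (congrArg₂ (· + ·) (congrArg₂ (· + ·) (congrArg (0 + ·) (if_pos rfl))
    (h _ _ _)) (h _ _ _))).trans ?_
  cases l <;> cases l' <;> simp [evalComp]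

/-- As $h=0$, the map $H$ is $2X$: it sends 1 to $2X$ and $X$ to 0. -/
theorem unknotCoeff_mapH (l l' : Bool) : unknotCoeff l l' (mapH ℚ) = if l = false ∧ l' = true then 2 else 0 := by
  have h : unknotCoeff l l' (hU ℚ) = 0 :=
    (unknotCoeff_surf l l' _).trans ((coeff_addSphere _ 2 _ _).trans (zero_mul _))
  rw [mapH, map_sub, map_add, h, unknotCoeff_dotX, sub_zero]
  split_ifs <;> norm_num

variable {k : ℕ}

variable (k) in
/-- The generator of the rational small model in homological degree `t` with label `l`
(zero if there is none). -/
def gen (t : ℕ) (l : Bool) : SKh k := fun h => if h.1.1.val = t ∧ h.2 () = l then 1 else 0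

theorem single_eq_gen (g : Gens (smallObj ℚ k)) : Pi.single g 1 = gen k g.1.1.val (g.2 ()) := by
  funext h
  rw [Pi.single_apply]
  refine if_congr ⟨fun hh => by rw [hh]; exact ⟨rfl, rfl⟩, fun ⟨h1, h2⟩ => ?_⟩ rfl rfl
  obtain ⟨i, a⟩ := g
  obtain ⟨j, b⟩ := h
  obtain rfl : j = i := Subtype.ext (Fin.ext h1)
  obtain rfl : b = a := funext fun _ => h2
  rfl

theorem gen_eq_single (t : ℕ) (l : Bool) (h : t ≤ 2 * k + 1) (h1 : t ≠ 1) :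
    gen k t l = Pi.single (⟨smallIndex t h h1, fun _ => l⟩ : Gens (smallObj ℚ k)) 1 :=
  (single_eq_gen (⟨smallIndex t h h1, fun _ => l⟩ : Gens (smallObj ℚ k))).symm

theorem ext_gen {V : Type} [AddCommGroup V] [Module ℚ V] {f g : SKh k →ₗ[ℚ] V}
    (h : ∀ t l, t ≤ 2 * k + 1 → t ≠ 1 → f (gen k t l) = g (gen k t l)) : f = g := by
  refine (Pi.basisFun ℚ (Gens (smallObj ℚ k))).ext fun a => ?_
  rw [Pi.basisFun_apply, single_eq_gen]
  exact h _ _ (by omega) a.1.2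

theorem linTqft_gen {T : smallObj ℚ k ⟶ smallObj ℚ k} {t : ℕ} {l : Bool} (h : t ≤ 2 * k + 1) (h1 : t ≠ 1)
    (a : Gens (smallObj ℚ k)) :
    linTqft T (gen k t l) a = unknotCoeff l (a.2 ()) (ent T (smallIndex t h h1) a.1) := by
  rw [gen_eq_single t l h h1]
  exact linTqft_single T ⟨smallIndex t h h1, fun _ => l⟩ a

theorem opSX_gen {t : ℕ} (h : t ≤ 2 * k + 1) (h1 : t ≠ 1) (l : Bool) :
    linTqft (opSX ℚ k) (gen k t l) = if l = false then gen k t true else 0 := by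
  funext a
  rw [linTqft_gen h h1]
  have e : gen k t true a = if a.1.1.val = t ∧ a.2 () = true then 1 else 0 := rfl
  by_cases hi : smallIndex t h h1 = a.1
  · have hi' : a.1.1.val = t := by rw [← hi]; rfl
    have e1 : ent (opSX ℚ k) (smallIndex t h h1) a.1 = dotX ℚ := if_pos hi
    rw [e1, unknotCoeff_dotX]
    cases l <;> simp [e, hi']
  · have hi' : a.1.1.val ≠ t := fun h' => hi (Subtype.ext (Fin.ext h'.symm))
    have e1 : ent (opSX ℚ k) (smallIndex t h h1) a.1 = 0 := if_neg hi
    rw [e1, map_zero]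
    cases l <;> simp [e, hi']

theorem opSD_gen {t : ℕ} (h : t ≤ 2 * k + 1) (h1 : t ≠ 1) (l : Bool) :
    linTqft (opSD ℚ k) (gen k t l) = if l = false ∧ 2 ≤ t ∧ Even t then (2 : ℚ) • gen k (t + 1) true else 0 := by
  funext a
  rw [linTqft_gen h h1]
  have e : gen k (t + 1) true a = if a.1.1.val = t + 1 ∧ a.2 () = true then 1 else 0 := rfl
  by_cases hi : 2 ≤ t ∧ Even t ∧ a.1.1.val = t + 1
  · have e1 : ent (opSD ℚ k) (smallIndex t h h1) a.1 = mapH ℚ := ent_opSD hi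
    rw [e1, unknotCoeff_mapH]
    cases l <;> simp [e, hi]
  · have e1 : ent (opSD ℚ k) (smallIndex t h h1) a.1 = 0 := ent_opSD_ne hi
    rw [e1, map_zero]
    split_ifs with h'
    · have : a.1.1.val ≠ t + 1 := fun h'' => hi ⟨h'.2.1, h'.2.2, h''⟩
      simp [e, this]
    · rfl

theorem opSU_gen {t : ℕ} (h : t ≤ 2 * k + 1) (h1 : t ≠ 1) (l : Bool) :
    linTqft (opSU ℚ k) (gen k t l) = if 2 ≤ t then (2 * (k + 1 - (t / 2 : ℕ)) : ℚ) • gen k (t - 2) l else 0 := by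
  funext a
  rw [linTqft_gen h h1]
  have e : gen k (t - 2) l a = if a.1.1.val = t - 2 ∧ a.2 () = l then 1 else 0 := rfl
  by_cases hi : t = a.1.1.val + 2
  · have e1 : ent (opSU ℚ k) (smallIndex t h h1) a.1 = (2 * (k + 1 - t / 2)) • 𝟙 (unknot ℚ) := ent_opSU hi
    have e2 : a.1.1.val = t - 2 := by omega
    have e3 : ((2 * (k + 1 - t / 2) : ℕ) : ℚ) = 2 * (k + 1 - (t / 2 : ℕ)) := by
      rw [Nat.cast_mul, Nat.cast_sub (by omega)]; push_cast; ring
    rw [e1, map_nsmul, unknotCoeff_id, if_pos (show 2 ≤ t by omega), Pi.smul_apply, e, ← e3]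
    refine (nsmul_eq_mul _ _).trans (congrArg (_ * ·) (if_congr ?_ rfl rfl))
    exact ⟨fun h => ⟨e2, h.symm⟩, fun h => h.2.symm⟩
  · have e1 : ent (opSU ℚ k) (smallIndex t h h1) a.1 = 0 := ent_opSU_ne hi
    rw [e1, map_zero]
    split_ifs with h'
    · have : a.1.1.val ≠ t - 2 := by omega
      simp [e, this]
    · rfl

theorem labelDeg_unit (a : Unit → Bool) : labelDeg a = if a () = true then 1 else -1 := by
  rw [labelDeg, finsum_eq_sum_of_fintype, Fintype.sum_unique]

theorem gen_mem (t : ℕ) (l : Bool) :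
    gen k t l ∈ gensPiece (small ℚ k) t (-(2 * k) - 2 * t + if l = true then 1 else -1) := by
  intro h hh
  refine if_neg fun h' => hh ⟨congrArg Nat.cast h'.1, ?_⟩
  refine congrArg₂ (· + ·) (congrArg (fun n : ℕ => -(2 * (k : ℤ)) - 2 * n) h'.1) ((labelDeg_unit h.2).trans ?_)
  rw [h'.2]

end SmallOperators
end TorusKh

/-! ### Homology bases from the small model. -/

namespace TorusKh

section Homology

variable {k : ℕ} {J : Type}

/-- The hypotheses make `p` descend to homology, `i` a section of it by cycles, and `i ∘ p`
homologous to the identity within `S`. -/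
theorem exists_homologyEquiv (S : Submodule ℚ (CKh k)) (i : (J → ℚ) →ₗ[ℚ] CKh k) (p : CKh k →ₗ[ℚ] (J → ℚ))
    (hi : ∀ w, i w ∈ cycles k S) (hp : ∀ y ∈ S, p (ckhD k y) = 0) (hpi : ∀ w, p (i w) = w)
    (hh : ∀ z ∈ cycles k S, ∃ y ∈ S, i (p z) - z = ckhD k y) :
    ∃ φ : SubHomology k S ≃ₗ[ℚ] (J → ℚ), (∀ z : cycles k S, φ (Submodule.Quotient.mk z) = p z) ∧
      ∀ w, φ.symm w = Submodule.Quotient.mk ⟨i w, hi w⟩ := by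
  let F : SubHomology k S →ₗ[ℚ] (J → ℚ) := Submodule.liftQ _ (p ∘ₗ (cycles k S).subtype) (by
    rintro z ⟨y, hy, hyz⟩
    change p (z : CKh k) = 0
    exact (congrArg p hyz.symm).trans (hp y hy))
  let G : (J → ℚ) →ₗ[ℚ] SubHomology k S := Submodule.mkQ _ ∘ₗ i.codRestrict _ hi
  refine ⟨LinearEquiv.ofLinearMap F G (LinearMap.ext fun w => hpi w) ?_, fun z => rfl, fun w => rfl⟩
  refine LinearMap.ext fun z => ?_
  induction z using Submodule.Quotient.induction_on with | _ z =>
  obtain ⟨y, hy, hyz⟩ := hh z z.2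
  exact (Submodule.Quotient.eq _).2 ⟨y, hy, hyz.symm⟩

theorem exists_basis_of_retract [Fintype J] [DecidableEq J] (S : Submodule ℚ (CKh k)) (i : (J → ℚ) →ₗ[ℚ] CKh k)
    (p : CKh k →ₗ[ℚ] (J → ℚ)) (hi : ∀ w, i w ∈ cycles k S) (hp : ∀ y ∈ S, p (ckhD k y) = 0) (hpi : ∀ w, p (i w) = w)
    (hh : ∀ z ∈ cycles k S, ∃ y ∈ S, i (p z) - z = ckhD k y) (hU : ∀ z ∈ S, ckhU k z ∈ S) (deg : J → ℤ × ℤ)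
    (hi_deg : ∀ a, i (Pi.single a 1) ∈ ckhPiece k (deg a).1 (deg a).2)
    (hp_deg : ∀ m n, ∀ z ∈ ckhPiece k m n, ∀ a, p z a ≠ 0 → deg a = (m, n)) :
    ∃ (e : Module.End ℚ (SubHomology k S)) (B : Module.Basis J ℚ (SubHomology k S)), IsInducedByU k S e ∧
      (∀ a, B a ∈ homPiece k S (deg a).1 (deg a).2) ∧
      (∀ m n, ∀ z ∈ homPiece k S m n, ∀ a, B.repr z a ≠ 0 → deg a = (m, n)) ∧
      ∀ a w, p (ckhU k (i (Pi.single a 1))) = w → e (B a) = ∑ b, w b • B b := by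
  obtain ⟨φ, h1, h2⟩ := exists_homologyEquiv S i p hi hp hpi hh
  have hB : ∀ a, Module.Basis.ofEquivFun φ a = φ.symm (Pi.single a 1) := fun a => by
    rw [Module.Basis.coe_ofEquivFun]
  have hDU : ∀ z, ckhD k (ckhU k z) = ckhU k (ckhD k z) := LinearMap.congr_fun (ckhD_comp_ckhU k)
  refine ⟨φ.symm.toLinearMap ∘ₗ (p ∘ₗ ckhU k ∘ₗ i) ∘ₗ φ.toLinearMap, Module.Basis.ofEquivFun φ, fun z => ?_, fun a => ?_,
    fun m n z hz a ha => ?_, fun a w hw => ?_⟩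
  · have hz : ckhU k z ∈ cycles k S := ⟨LinearMap.mem_ker.2 (by rw [hDU, LinearMap.mem_ker.1 z.2.1, map_zero]), hU z z.2.2⟩
    refine ⟨⟨ckhU k z, hz⟩, rfl, ?_⟩
    apply φ.injective
    obtain ⟨y, hy, hyz⟩ := hh z z.2
    refine (φ.apply_symm_apply _).trans ?_
    rw [h1]
    change p (ckhU k (i (φ (Submodule.Quotient.mk z)))) = p (ckhU k z)
    rw [h1, ← sub_eq_zero, ← map_sub, ← map_sub, hyz, ← hDU]
    exact hp _ (hU y hy)
  · rw [hB, h2]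
    exact ⟨⟨_, hi _⟩, hi_deg a, rfl⟩
  · obtain ⟨y, hy, rfl⟩ := hz
    refine hp_deg m n y hy a fun h => ha ?_
    rw [Module.Basis.ofEquivFun_repr_apply]
    exact (congrFun (h1 y) a).trans h
  · have : (φ.symm.toLinearMap ∘ₗ (p ∘ₗ ckhU k ∘ₗ i) ∘ₗ φ.toLinearMap) (Module.Basis.ofEquivFun φ a) = φ.symm w := by
      rw [hB]
      change φ.symm (p (ckhU k (i (φ (φ.symm _))))) = _
      rw [φ.apply_symm_apply, hw]
    rw [this, ← Module.Basis.equivFun_symm_apply, Module.Basis.equivFun_ofEquivFun]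

end Homology

section SmallHomology

variable {k : ℕ} {J : Type} [Fintype J] [DecidableEq J]

/-- The bidegree of a generator of the rational small model. -/
def genDeg (k t : ℕ) (l : Bool) : ℤ × ℤ := (t, -(2 * k) - 2 * t + if l = true then 1 else -1)

/-- The homology of the unreduced or reduced complex has a basis indexed by those generators
`gen k (t a) (l a)` of the small model that remain after a further cancellation `c`. -/
theorem exists_basis_of_small (S : Submodule ℚ (CKh k)) (S' : Submodule ℚ (SKh k))
    (hS : S = ⊤ ∧ S' = ⊤ ∨ S = redSub k ∧ S' = LinearMap.range (linTqft (opSX ℚ k))) (t : J → ℕ) (l : J → Bool)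
    (ht : ∀ a, t a ≤ 2 * k + 1) (ht1 : ∀ a, t a ≠ 1) (hinj : ∀ a b, t a = t b → l a = l b → a = b)
    (hmem : ∀ a, gen k (t a) (l a) ∈ S') (hd : ∀ a, linTqft (opSD ℚ k) (gen k (t a) (l a)) = 0)
    (hd' : ∀ w ∈ S', ∀ a, linTqft (opSD ℚ k) w ⟨smallIndex (t a) (ht a) (ht1 a), fun _ => l a⟩ = 0)
    (c : SKh k →ₗ[ℚ] SKh k) (hcS : ∀ w ∈ S', c w ∈ S')
    (hc : ∀ w ∈ S', w - ∑ a, w ⟨smallIndex (t a) (ht a) (ht1 a), fun _ => l a⟩ • gen k (t a) (l a) =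
      linTqft (opSD ℚ k) (c w) + c (linTqft (opSD ℚ k) w)) :
    ∃ (e : Module.End ℚ (SubHomology k S)) (B : Module.Basis J ℚ (SubHomology k S)), IsInducedByU k S e ∧
      (∀ a, B a ∈ homPiece k S (genDeg k (t a) (l a)).1 (genDeg k (t a) (l a)).2) ∧
      (∀ m n, ∀ z ∈ homPiece k S m n, ∀ a, B.repr z a ≠ 0 → genDeg k (t a) (l a) = (m, n)) ∧
      (∀ a b, t a = t b + 2 → l a = l b → e (B a) = (2 * (k + 1 - (t a / 2 : ℕ)) : ℚ) • B b) ∧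
      (∀ a, t a = 0 ∨ t a = 3 → e (B a) = 0) := by
  obtain ⟨g, f, s, hgf, hs, hDf, hgD, hxf, hgx, hsx, hu, hfd, hgd⟩ := exists_rational_retract k
  obtain ⟨hSf, hSg, hSs, hSU⟩ : (∀ w ∈ S', f w ∈ S) ∧ (∀ z ∈ S, g z ∈ S') ∧ (∀ z ∈ S, s z ∈ S) ∧
      ∀ z ∈ S, ckhU k z ∈ S := by
    rcases hS with ⟨rfl, rfl⟩ | ⟨rfl, rfl⟩
    · exact ⟨fun _ _ => trivial, fun _ _ => trivial, fun _ _ => trivial, fun _ _ => trivial⟩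
    · refine ⟨?_, ?_, ?_, fun z hz => map_ckhU_redSub k ⟨z, hz, rfl⟩⟩
      · rintro _ ⟨w, rfl⟩
        exact ⟨f w, hxf w⟩
      · rintro _ ⟨z, rfl⟩
        exact ⟨g z, (hgx z).symm⟩
      · rintro _ ⟨z, rfl⟩
        exact ⟨s z, (hsx z).symm⟩
  let γ : J → Gens (smallObj ℚ k) := fun a => ⟨smallIndex (t a) (ht a) (ht1 a), fun _ => l a⟩
  have hgen : ∀ m n a, gen k m n (γ a) = if t a = m ∧ l a = n then 1 else 0 := fun _ _ _ => rfl
  let ι : (J → ℚ) →ₗ[ℚ] SKh k := Fintype.linearCombination ℚ fun a => gen k (t a) (l a)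
  let π : SKh k →ₗ[ℚ] (J → ℚ) := LinearMap.funLeft ℚ ℚ γ
  have hιs : ∀ a, ι (Pi.single a 1) = gen k (t a) (l a) := fun a => by
    rw [Fintype.linearCombination_apply_single, one_smul]
  have hπ : ∀ a, π (gen k (t a) (l a)) = Pi.single a 1 := fun a => by
    funext b
    refine (hgen _ _ b).trans ?_
    rw [Pi.single_apply]
    exact if_congr ⟨fun h => hinj _ _ h.1 h.2, fun h => by rw [h]; exact ⟨rfl, rfl⟩⟩ rfl rfl
  have hπι : ∀ w, π (ι w) = w := LinearMap.congr_fun (f := π ∘ₗ ι) (g := LinearMap.id) <|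
    (Pi.basisFun ℚ J).ext fun a => by
      rw [Pi.basisFun_apply, LinearMap.comp_apply, hιs, hπ]; rfl
  have hdι : ∀ w, linTqft (opSD ℚ k) (ι w) = 0 := LinearMap.congr_fun (f := linTqft (opSD ℚ k) ∘ₗ ι) (g := 0) <|
    (Pi.basisFun ℚ J).ext fun a => by
      rw [Pi.basisFun_apply, LinearMap.comp_apply, hιs, hd]; rfl
  have hc' : ∀ w ∈ S', w - ι (π w) = linTqft (opSD ℚ k) (c w) + c (linTqft (opSD ℚ k) w) := hc
  have hιS : ∀ w, ι w ∈ S' := fun w => Submodule.sum_mem _ fun a _ => Submodule.smul_mem _ _ (hmem a)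
  obtain ⟨e, B, he, hBd, hBs, heB⟩ := exists_basis_of_retract S (f ∘ₗ ι) (π ∘ₗ g)
    (fun w => ⟨LinearMap.mem_ker.2 (by rw [LinearMap.comp_apply, hDf, hdι, map_zero]), hSf _ (hιS w)⟩)
    (fun y hy => by
      rw [LinearMap.comp_apply, hgD]
      exact funext fun a => hd' (g y) (hSg y hy) a)
    (fun w => by rw [LinearMap.comp_apply, LinearMap.comp_apply, hgf, hπι])
    -- The two homotopies combined: $fg-1$ is the boundary of $s$, and the further cancellation in
    -- the small model is carried over by $f$.
    (fun z hz => ⟨s z - f (c (g z)), S.sub_mem (hSs z hz.2) (hSf _ (hcS _ (hSg z hz.2))), by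
      have h0 : ckhD k z = 0 := hz.1
      have h1 := hc' (g z) (hSg z hz.2)
      rw [← hgD, h0, map_zero, map_zero, add_zero] at h1
      have h2 := hs z
      rw [h0, map_zero, add_zero] at h2
      rw [map_sub, hDf, ← h1, map_sub, ← h2]
      simp only [LinearMap.comp_apply]
      abel⟩)
    hSU (fun a => genDeg k (t a) (l a))
    (fun a => by
      rw [LinearMap.comp_apply, hιs]
      exact hfd _ _ _ (gen_mem _ _))
    (fun m n z hz a ha => by
      by_contra h
      refine ha (hgd m n z hz (γ a) fun h' => h ?_)
      refine Prod.ext h'.1 (Eq.trans ?_ h'.2)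
      exact congrArg (fun n : ℤ => -(2 * (k : ℤ)) - 2 * t a + n) (labelDeg_unit fun _ => l a).symm)
  have hpU : ∀ a, (π ∘ₗ g) (ckhU k ((f ∘ₗ ι) (Pi.single a 1))) = π (linTqft (opSU ℚ k) (gen k (t a) (l a))) := fun a => by
    rw [LinearMap.comp_apply, LinearMap.comp_apply, hu, hιs]
  refine ⟨e, B, he, hBd, hBs, fun a b hab hl => ?_, fun a ha => ?_⟩
  · rw [heB a _ (hpU a), opSU_gen (ht a) (ht1 a), if_pos (by omega), show t a - 2 = t b by omega, hl, map_smul, hπ,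
      Finset.sum_eq_single b]
    · simp
    · intro c _ hcb; simp [hcb]
    · simp
  · have : π (linTqft (opSU ℚ k) (gen k (t a) (l a))) = 0 := by
      rw [opSU_gen (ht a) (ht1 a)]
      split_ifs with h2
      · rw [map_smul]
        -- This is degree 3, whose target in degree 1 is empty.
        refine smul_eq_zero_of_right _ (funext fun b => (hgen _ _ b).trans (if_neg fun h => ?_))
        have := ht1 b
        omega
      · exact map_zero π
    rw [heB a _ (hpU a), this]
    simp

end SmallHomology
end TorusKh

/-! ### Strings and actions of $\mathfrak{sl}_2$. -/

namespace TorusKh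

section Sl2

open LieAlgebra.SpecialLinear (sl)

attribute [local instance 100] LieRing.ofAssociativeRing

variable {H : Type} [AddCommGroup H] [Module ℚ H]

/-- The raising element of `sl_2`. -/
abbrev slE : sl (Fin 2) ℚ := LieAlgebra.SpecialLinear.single 0 1 (by decide) 1

/-- The lowering element of `sl_2`. -/
abbrev slF : sl (Fin 2) ℚ := LieAlgebra.SpecialLinear.single 1 0 (by decide) 1

theorem slE_apply (i j : Fin 2) : slE.1 i j = if 0 = i ∧ 1 = j then 1 else 0 := rfl

theorem slF_apply (i j : Fin 2) : slF.1 i j = if 1 = i ∧ 0 = j then 1 else 0 := rfl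

theorem sl_apply_one_one (A : sl (Fin 2) ℚ) : A.1 1 1 = -A.1 0 0 := by
  have h : Matrix.trace A.1 = 0 := LinearMap.mem_ker.1 A.2
  rw [Matrix.trace_fin_two] at h
  linarith

theorem sl_bracket_apply (A B : sl (Fin 2) ℚ) (i j : Fin 2) :
    (⁅A, B⁆ : sl (Fin 2) ℚ).1 i j = A.1 i 0 * B.1 0 j + A.1 i 1 * B.1 1 j - (B.1 i 0 * A.1 0 j + B.1 i 1 * A.1 1 j) := by
  have h : (⁅A, B⁆ : sl (Fin 2) ℚ).1 = A.1 * B.1 - B.1 * A.1 := rfl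
  rw [h, Matrix.sub_apply, Matrix.mul_apply, Matrix.mul_apply, Fin.sum_univ_two, Fin.sum_univ_two]

theorem sl_ext {A B : sl (Fin 2) ℚ} (h1 : A.1 0 1 = B.1 0 1) (h2 : A.1 1 0 = B.1 1 0) (h3 : A.1 0 0 = B.1 0 0) :
    A = B := by
  refine Subtype.ext (Matrix.ext fun i j => ?_)
  fin_cases i <;> fin_cases j
  · exact h3
  · exact h1
  · exact h2
  · exact (sl_apply_one_one A).trans ((congrArg Neg.neg h3).trans (sl_apply_one_one B).symm)

/-- The third basis vector is the bracket of the first two, so an action is determined by the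
raising and the lowering operator. -/
theorem sl_decomp (A : sl (Fin 2) ℚ) : A = A.1 0 1 • slE + A.1 1 0 • slF + A.1 0 0 • ⁅slE, slF⁆ := by
  have h : ∀ (B C D : sl (Fin 2) ℚ) (r s t : ℚ) (i j : Fin 2),
      (r • B + s • C + t • D).1 i j = r * B.1 i j + s * C.1 i j + t * D.1 i j := fun _ _ _ _ _ _ _ _ => rfl
  refine sl_ext ?_ ?_ ?_ <;> simp [h, sl_bracket_apply, slE_apply, slF_apply]

/-- The representation of `sl_2` given by three operators that satisfy the standard relations. -/
def sl2Rep (e f h : Module.End ℚ H) (h1 : e * f - f * e = h) (h2 : h * e - e * h = (2 : ℚ) • e)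
    (h3 : h * f - f * h = (-2 : ℚ) • f) : Sl2Action H where
  toFun A := A.1 0 1 • e + A.1 1 0 • f + A.1 0 0 • h
  map_add' A B := by
    have : ∀ i j, (A + B).1 i j = A.1 i j + B.1 i j := fun _ _ => rfl
    simp only [this, add_smul]
    abel
  map_smul' r A := by
    have : ∀ i j, (r • A).1 i j = r * A.1 i j := fun _ _ => rfl
    simp only [this, mul_smul, smul_add, RingHom.id_apply]
  map_lie' {A B} := by
    change (⁅A, B⁆ : sl (Fin 2) ℚ).1 0 1 • e + (⁅A, B⁆ : sl (Fin 2) ℚ).1 1 0 • f + (⁅A, B⁆ : sl (Fin 2) ℚ).1 0 0 • h =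
      (A.1 0 1 • e + A.1 1 0 • f + A.1 0 0 • h) * (B.1 0 1 • e + B.1 1 0 • f + B.1 0 0 • h) -
      (B.1 0 1 • e + B.1 1 0 • f + B.1 0 0 • h) * (A.1 0 1 • e + A.1 1 0 • f + A.1 0 0 • h)
    simp only [sl_bracket_apply, sl_apply_one_one]
    have e1 : e * f = f * e + h := by rw [← h1]; abel
    have e2 : h * e = e * h + (2 : ℚ) • e := by rw [← h2]; abel
    have e3 : h * f = f * h + (-2 : ℚ) • f := by rw [← h3]; abel
    simp only [add_mul, mul_add, smul_mul_smul_comm, e1, e2, e3]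
    module

theorem sl2Rep_slE (e f h : Module.End ℚ H) (h1 h2 h3) : sl2Rep e f h h1 h2 h3 slE = e := by
  change slE.1 0 1 • e + slE.1 1 0 • f + slE.1 0 0 • h = e
  simp [slE_apply]

theorem sl2Rep_slF (e f h : Module.End ℚ H) (h1 h2 h3) : sl2Rep e f h h1 h2 h3 slF = f := by
  change slF.1 0 1 • e + slF.1 1 0 • f + slF.1 0 0 • h = f
  simp [slF_apply]

theorem sl2_hom_ext {ρ ρ' : Sl2Action H} (hE : ρ slE = ρ' slE) (hF : ρ slF = ρ' slF) : ρ = ρ' := by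
  refine LieHom.ext fun A => ?_
  rw [sl_decomp A]
  simp only [map_add, map_smul, LieHom.map_lie, hE, hF]

variable {J : Type} [Fintype J]

/-- An operator that acts on a basis by strings, where the basis vectors at the ends of the strings have no
basis vector in the next degree, extends uniquely to an action of `sl_2`. -/
theorem existsUnique_sl2 (P : ℤ → ℤ → Submodule ℚ H) (e : Module.End ℚ H) (B : Module.Basis J ℚ H) (deg : J → ℤ × ℤ)
    (hdeg : Function.Injective deg) (hB : ∀ a, B a ∈ P (deg a).1 (deg a).2)
    (hP : ∀ i j, ∀ z ∈ P i j, ∀ a, B.repr z a ≠ 0 → deg a = (i, j))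
    (pos len : J → ℕ) (next : J → Option J) (h0 : ∀ a, pos a = 0 → e (B a) = 0)
    (hnext : ∀ a b, next a = some b → pos b = pos a + 1 ∧ len b = len a ∧ pos b < len b ∧
      deg b = ((deg a).1 + 2, (deg a).2 - 4) ∧ e (B b) = (2 * (len b - pos b) : ℚ) • B a)
    (hprev : ∀ b, pos b ≠ 0 → ∃ a, next a = some b)
    (hend : ∀ a, next a = none → len a = pos a + 1 ∧ ∀ b, deg b ≠ ((deg a).1 + 2, (deg a).2 - 4)) :
    ∃! ρ : Sl2Action H, ExtendsToSl2 P e ρ := by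
  classical
  -- On strings $e$ has the factor $2(n-m)$. With $(m+1)/2$ for the lowering operator the product is
  -- the standard $(m+1)(n-m-1)$ of the irreducible module of dimension $n$, whose weights are
  -- $n-1-2m$.
  obtain ⟨f, hf⟩ : ∃ f : Module.End ℚ H, ∀ a, f (B a) = (next a).elim 0 fun b => ((pos a + 1) / 2 : ℚ) • B b :=
    ⟨B.constr ℚ fun a => (next a).elim 0 fun b => ((pos a + 1) / 2 : ℚ) • B b, fun a => B.constr_basis _ _ a⟩
  have hf_some : ∀ a b, next a = some b → f (B a) = ((pos a + 1) / 2 : ℚ) • B b := fun a b h => by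
    rw [hf, h]; rfl
  have hf_none : ∀ a, next a = none → f (B a) = 0 := fun a h => by rw [hf, h]; rfl
  obtain ⟨h, hh⟩ : ∃ h : Module.End ℚ H, ∀ a, h (B a) = (len a - 1 - 2 * pos a : ℚ) • B a :=
    ⟨B.constr ℚ fun a => (len a - 1 - 2 * pos a : ℚ) • B a, fun a => B.constr_basis _ _ a⟩
  have hef : ∀ a, e (f (B a)) = ((pos a + 1) * (len a - pos a - 1) : ℚ) • B a := fun a => by
    rcases hn : next a with _ | b
    · rw [hf_none a hn, map_zero, (hend a hn).1]
      push_cast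
      rw [show ((pos a + 1) * (pos a + 1 - pos a - 1) : ℚ) = 0 by ring, zero_smul]
    · obtain ⟨p1, p2, -, -, p5⟩ := hnext a b hn
      rw [hf_some a b hn, map_smul, p5, smul_smul, p1, p2]
      push_cast
      congr 1
      ring
  have hfe : ∀ a, f (e (B a)) = (pos a * (len a - pos a) : ℚ) • B a := fun a => by
    by_cases hp : pos a = 0
    · rw [h0 a hp, map_zero, hp, Nat.cast_zero, zero_mul, zero_smul]
    · obtain ⟨b, hb⟩ := hprev a hp
      obtain ⟨p1, p2, -, -, p5⟩ := hnext b a hb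
      rw [p5, map_smul, hf_some b a hb, smul_smul, p1]
      push_cast
      congr 1
      ring
  have r1 : e * f - f * e = h := B.ext fun a => by
    change e (f (B a)) - f (e (B a)) = h (B a)
    rw [hef, hfe, hh, ← sub_smul]
    congr 1
    ring
  have r2 : h * e - e * h = (2 : ℚ) • e := B.ext fun a => by
    change h (e (B a)) - e (h (B a)) = (2 : ℚ) • e (B a)
    rw [hh, map_smul]
    by_cases hp : pos a = 0
    · rw [h0 a hp, map_zero, smul_zero, smul_zero, sub_zero]
    · obtain ⟨b, hb⟩ := hprev a hp
      obtain ⟨p1, p2, -, -, p5⟩ := hnext b a hb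
      rw [p5, map_smul, hh, p1, p2]
      push_cast
      module
  have r3 : h * f - f * h = (-2 : ℚ) • f := B.ext fun a => by
    change h (f (B a)) - f (h (B a)) = (-2 : ℚ) • f (B a)
    rw [hh, map_smul]
    rcases hn : next a with _ | b
    · rw [hf_none a hn, map_zero, smul_zero, smul_zero, sub_zero]
    · obtain ⟨p1, p2, -, -, p5⟩ := hnext a b hn
      rw [hf_some a b hn, map_smul, hh, p1, p2]
      push_cast
      module
  have hrepr : ∀ i j, ∀ z ∈ P i j, (∀ a, deg a ≠ (i, j)) → z = 0 := fun i j z hz ha =>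
    B.repr.injective (Finsupp.ext fun a => by
      by_contra h
      rw [map_zero] at h
      exact ha a (hP i j z hz a h))
  have hrepr' : ∀ z a, z ∈ P (deg a).1 (deg a).2 → ∃ r : ℚ, z = r • B a := fun z a hz => by
    refine ⟨B.repr z a, B.repr.injective (Finsupp.ext fun b => ?_)⟩
    rw [map_smul, Finsupp.smul_apply, B.repr_self, smul_eq_mul]
    by_cases hb : a = b
    · subst hb; rw [Finsupp.single_eq_same, mul_one]
    · rw [Finsupp.single_eq_of_ne (Ne.symm hb), mul_zero]
      by_contra h
      exact hb (hdeg (hP _ _ z hz b h).symm)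
  refine ⟨sl2Rep e f h r1 r2 r3, ⟨sl2Rep_slE e f h r1 r2 r3, fun i j => ?_⟩, fun ρ hρ => ?_⟩
  · rintro _ ⟨z, hz, rfl⟩
    rw [SetLike.mem_coe] at hz
    rw [show sl2Rep e f h r1 r2 r3 (LieAlgebra.SpecialLinear.single 1 0 (by decide) 1) = f from sl2Rep_slF e f h r1 r2 r3, ← B.sum_repr z, map_sum]
    refine Submodule.sum_mem _ fun a _ => ?_
    rw [map_smul]
    by_cases ha : B.repr z a = 0
    · rw [ha, zero_smul]; exact Submodule.zero_mem _
    · refine Submodule.smul_mem _ _ ?_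
      have hd := hP i j z hz a ha
      rcases hn : next a with _ | b
      · rw [hf_none a hn]; exact Submodule.zero_mem _
      · rw [hf_some a b hn]
        refine Submodule.smul_mem _ _ ?_
        have := hB b
        rwa [(hnext a b hn).2.2.2.1, hd] at this
  · obtain ⟨F, hF⟩ : ∃ F, F = ρ slF := ⟨_, rfl⟩
    have hE : ρ slE = e := hρ.e_eq
    -- The basis vectors have distinct bidegrees, so a competing lowering operator sends each of
    -- them to a multiple of the next one in its string, or to zero at the end.
    have hFd : ∀ a, F (B a) ∈ P ((deg a).1 + 2) ((deg a).2 - 4) := fun a =>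
      hρ.f_deg _ _ ⟨B a, hB a, by rw [hF]⟩
    have hFe : ∀ a, ∃ r : ℚ, F (B a) = (next a).elim 0 fun b => r • B b := fun a => by
      rcases hn : next a with _ | b
      · exact ⟨0, hrepr _ _ _ (hFd a) (hend a hn).2⟩
      · have := hFd a
        rw [show (deg a).1 + 2 = (deg b).1 by rw [(hnext a b hn).2.2.2.1],
          show (deg a).2 - 4 = (deg b).2 by rw [(hnext a b hn).2.2.2.1]] at this
        exact hrepr' _ b this
    choose r hr using hFe
    have hr_some : ∀ a b, next a = some b → F (B a) = r a • B b := fun a b h => by rw [hr, h]; rfl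
    have hr_none : ∀ a, next a = none → F (B a) = 0 := fun a h => by rw [hr, h]; rfl
    have hr_e : ∀ a b, next a = some b → e (F (B a)) = (r a * (2 * (len b - pos b))) • B a := fun a b h => by
      rw [hr_some a b h, map_smul, (hnext a b h).2.2.2.2, smul_smul]
    have hκ : ∀ a, ∃ κ : ℚ, e (F (B a)) = κ • B a := fun a => by
      rcases hn : next a with _ | b
      · exact ⟨0, by rw [hr_none a hn, map_zero, zero_smul]⟩
      · exact ⟨_, hr_e a b hn⟩
    choose κ hκ using hκ
    have hκ_none : ∀ a, next a = none → κ a = 0 := fun a hn => by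
      have := hκ a
      rw [hr_none a hn, map_zero] at this
      exact (smul_eq_zero.1 this.symm).resolve_right (B.ne_zero a)
    have hκ_some : ∀ a b, next a = some b → κ a = r a * (2 * (len b - pos b)) := fun a b hn =>
      smul_left_injective ℚ (B.ne_zero a) ((hκ a).symm.trans (hr_e a b hn))
    have hFe0 : ∀ a, pos a = 0 → F (e (B a)) = 0 := fun a ha => by rw [h0 a ha, map_zero]
    have hFe1 : ∀ a b, next a = some b → F (e (B b)) = κ a • B b := fun a b hn => by
      rw [(hnext a b hn).2.2.2.2, map_smul, hr_some a b hn, smul_smul, hκ_some a b hn, mul_comm]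
    obtain ⟨G, hG⟩ : ∃ G : Module.End ℚ H, G = e * F - F * e := ⟨_, rfl⟩
    have hGB : ∀ a, G (B a) = e (F (B a)) - F (e (B a)) := fun a => by rw [hG]; rfl
    have hGv : ∀ a, ∃ v : ℚ, G (B a) = v • B a := fun a => by
      by_cases hp : pos a = 0
      · exact ⟨κ a, by rw [hGB, hFe0 a hp, hκ, sub_zero]⟩
      · obtain ⟨b, hb⟩ := hprev a hp
        exact ⟨κ a - κ b, by rw [hGB, hFe1 b a hb, hκ, sub_smul]⟩
    choose v hv using hGv
    have hv0 : ∀ a, pos a = 0 → v a = κ a := fun a hp => smul_left_injective ℚ (B.ne_zero a) <| by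
      change v a • B a = κ a • B a
      rw [← hv, hGB, hFe0 a hp, hκ, sub_zero]
    have hv1 : ∀ a b, next a = some b → v b = κ b - κ a := fun a b hn => smul_left_injective ℚ (B.ne_zero b) <| by
      change v b • B b = (κ b - κ a) • B b
      rw [← hv, hGB, hFe1 a b hn, hκ, sub_smul]
    have hGe : G * e - e * G = (2 : ℚ) • e := by
      have h1 : (⁅⁅slE, slF⁆, slE⁆ : sl (Fin 2) ℚ) = (2 : ℚ) • slE := by
        have h : ∀ (B : sl (Fin 2) ℚ) (r : ℚ) (i j : Fin 2), (r • B).1 i j = r * B.1 i j := fun _ _ _ _ => rfl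
        refine sl_ext ?_ ?_ ?_ <;> simp [h, sl_bracket_apply, slE_apply, slF_apply]
        norm_num
      have h2 := congrArg ρ h1
      rw [LieHom.map_lie, LieHom.map_lie, map_smul, hE, ← hF] at h2
      rw [hG]
      exact h2
    have hv2 : ∀ a b, next a = some b → v a = v b + 2 := fun a b hn => by
      obtain ⟨p1, p2, p3, -, p5⟩ := hnext a b hn
      have h1 : G (e (B b)) - e (G (B b)) = (2 : ℚ) • e (B b) := LinearMap.congr_fun hGe (B b)
      rw [hv, map_smul, p5, map_smul, hv, smul_smul, smul_smul, smul_smul, ← sub_smul] at h1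
      have h2 := smul_left_injective ℚ (B.ne_zero a) h1
      have h3 : (len b - pos b : ℚ) ≠ 0 := by
        have : (pos b : ℚ) < len b := by exact_mod_cast p3
        linarith
      have h4 : (v a - v b - 2) * (2 * (len b - pos b) : ℚ) = 0 := by linear_combination h2
      have h5 := (mul_eq_zero.1 h4).resolve_right (mul_ne_zero two_ne_zero h3)
      linarith
    -- Let $v_a$ be the eigenvalue of $[e,F]$ and $\kappa_a$ that of $eF$. Then $\kappa_a$ is the
    -- sum of the eigenvalues $v$ from the start of the string up to $a$, and these drop by 2 at
    -- each step.
    have claim1 : ∀ n a, pos a = n → κ a = (pos a + 1) * (v a + pos a) := by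
      intro n
      induction n with
      | zero => intro a ha; rw [hv0 a ha, ha]; push_cast; ring
      | succ n ih =>
        intro b hb
        obtain ⟨a, hn⟩ := hprev b (by omega)
        have p1 := (hnext a b hn).1
        have h1 := ih a (by omega)
        have h2 := hv1 a b hn
        have h3 := hv2 a b hn
        have h4 : (pos b : ℚ) = pos a + 1 := by rw [p1]; push_cast; ring
        rw [h4]
        rw [h3] at h1
        linear_combination h1 - h2
    -- At the end of the string $\kappa=0$, so claim 1 determines the last eigenvalue there and
    -- hence all the others.
    have claim2 : ∀ n a, len a - pos a = n → v a = len a - 1 - 2 * pos a := by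
      intro n
      induction n with
      | zero =>
        intro a ha
        rcases hn : next a with _ | b
        · have := (hend a hn).1; omega
        · obtain ⟨p1, p2, p3, -⟩ := hnext a b hn; omega
      | succ n ih =>
        intro a ha
        rcases hn : next a with _ | b
        · have h1 := claim1 _ a rfl
          rw [hκ_none a hn] at h1
          have h2 : (len a : ℚ) = pos a + 1 := by rw [(hend a hn).1]; push_cast; ring
          have h3 : (pos a + 1 : ℚ) ≠ 0 := by positivity
          have h4 := (mul_eq_zero.1 h1.symm).resolve_left h3
          linarith
        · obtain ⟨p1, p2, p3, -⟩ := hnext a b hn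
          have h1 := ih b (by omega)
          rw [hv2 a b hn, h1, p1, p2]
          push_cast
          ring
    have hFf : F = f := B.ext fun a => by
      rcases hn : next a with _ | b
      · rw [hr_none a hn, hf_none a hn]
      · obtain ⟨p1, p2, p3, -⟩ := hnext a b hn
        rw [hr_some a b hn, hf_some a b hn]
        congr 1
        have h1 := claim1 _ a rfl
        rw [claim2 _ a rfl, hκ_some a b hn] at h1
        have h3 : (len b - pos b : ℚ) ≠ 0 := by
          have : (pos b : ℚ) < len b := by exact_mod_cast p3
          linarith
        have h4 : (pos b : ℚ) = pos a + 1 := by rw [p1]; push_cast; ring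
        have h5 : (len b : ℚ) = len a := by rw [p2]
        refine mul_right_cancel₀ (mul_ne_zero two_ne_zero h3) (h1.trans ?_)
        rw [h4, h5]
        ring
    refine sl2_hom_ext (hE.trans (sl2Rep_slE e f h r1 r2 r3).symm) ?_
    rw [← hF, hFf]
    exact (sl2Rep_slF e f h r1 r2 r3).symm

end Sl2
end TorusKh

/-! ### Unreduced homology. -/

namespace TorusKh

section Strings

/-- The next element of `Fin n`. -/
def finNext {n : ℕ} (m : Fin n) : Option (Fin n) := if h : m.val + 1 < n then some ⟨m.val + 1, h⟩ else none

theorem finNext_eq_some {n : ℕ} {m m' : Fin n} : finNext m = some m' ↔ m'.val = m.val + 1 := by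
  unfold finNext
  split_ifs with h
  · rw [Option.some_inj]
    exact ⟨fun h => by rw [← h], fun h' => Fin.ext h'.symm⟩
  · exact iff_of_false (by simp) (by omega)

theorem finNext_eq_none {n : ℕ} {m : Fin n} : finNext m = none ↔ n = m.val + 1 := by
  unfold finNext
  split_ifs with h
  · exact iff_of_false (by simp) (by omega)
  · exact iff_of_true rfl (by omega)

variable {k : ℕ} {J : Type} [Fintype J]

theorem sum_gen_of_mem {t : J → ℕ} {l : J → Bool} {γ : J → Gens (smallObj ℚ k)}
    (hγ : ∀ m n a, gen k m n (γ a) = if t a = m ∧ l a = n then 1 else 0) (hinj : ∀ a b, t a = t b → l a = l b → a = b)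
    (a : J) : ∑ b, gen k (t a) (l a) (γ b) • gen k (t b) (l b) = gen k (t a) (l a) := by
  rw [Finset.sum_eq_single a]
  · rw [hγ, if_pos ⟨rfl, rfl⟩, one_smul]
  · intro b _ hb
    rw [hγ, if_neg fun h => hb (hinj _ _ h.1 h.2), zero_smul]
  · simp

theorem sum_gen_of_notMem {t : J → ℕ} {l : J → Bool} {γ : J → Gens (smallObj ℚ k)}
    (hγ : ∀ m n a, gen k m n (γ a) = if t a = m ∧ l a = n then 1 else 0) {m : ℕ} {n : Bool}
    (h : ∀ a, ¬ (t a = m ∧ l a = n)) : ∑ b, gen k m n (γ b) • gen k (t b) (l b) = 0 :=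
  Finset.sum_eq_zero fun b _ => by rw [hγ, if_neg (h b), zero_smul]

variable (k) in
/-- The cancellation of the non-zero part of the differential of the rational small model. -/
noncomputable def cancel : SKh k →ₗ[ℚ] SKh k := (Pi.basisFun ℚ (Gens (smallObj ℚ k))).constr ℚ fun g =>
  if g.2 () = true ∧ 3 ≤ g.1.1.val ∧ Odd g.1.1.val then (1 / 2 : ℚ) • gen k (g.1.1.val - 1) false else 0

theorem cancel_gen {t : ℕ} (h : t ≤ 2 * k + 1) (h1 : t ≠ 1) (l : Bool) :
    cancel k (gen k t l) = if l = true ∧ 3 ≤ t ∧ Odd t then (1 / 2 : ℚ) • gen k (t - 1) false else 0 := by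
  have := (Pi.basisFun ℚ (Gens (smallObj ℚ k))).constr_basis ℚ (fun g =>
    if g.2 () = true ∧ 3 ≤ g.1.1.val ∧ Odd g.1.1.val then (1 / 2 : ℚ) • gen k (g.1.1.val - 1) false else 0)
    ⟨smallIndex t h h1, fun _ => l⟩
  rw [Pi.basisFun_apply, single_eq_gen] at this
  exact this

/-- The number of a basis vector in its string. -/
def khPos (k : ℕ) : Fin (k + 1) ⊕ Fin 1 ⊕ Fin k → ℕ :=
  Sum.elim Fin.val (Sum.elim Fin.val Fin.val)

/-- The length of the string of a basis vector. -/
def khLen (k : ℕ) : Fin (k + 1) ⊕ Fin 1 ⊕ Fin k → ℕ :=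
  Sum.elim (fun _ => k + 1) (Sum.elim (fun _ => 1) fun _ => k)

/-- The next basis vector of a string. -/
def khNext (k : ℕ) : Fin (k + 1) ⊕ Fin 1 ⊕ Fin k → Option (Fin (k + 1) ⊕ Fin 1 ⊕ Fin k) :=
  Sum.elim (fun m => (finNext m).map Sum.inl)
    (Sum.elim (fun m => (finNext m).map fun n => Sum.inr (Sum.inl n)) fun m => (finNext m).map fun n => Sum.inr (Sum.inr n))

/-- The homological degree of a basis vector. -/
def khT (k : ℕ) : Fin (k + 1) ⊕ Fin 1 ⊕ Fin k → ℕ :=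
  Sum.elim (fun m => 2 * m.val) (Sum.elim (fun _ => 0) fun m => 2 * m.val + 3)

/-- The label of a basis vector. -/
def khL (k : ℕ) : Fin (k + 1) ⊕ Fin 1 ⊕ Fin k → Bool :=
  Sum.elim (fun _ => true) (Sum.elim (fun _ => false) fun _ => false)

theorem khT_le (a) : khT k a ≤ 2 * k + 1 := by
  rcases a with m | m | m <;> simp only [khT, Sum.elim_inl, Sum.elim_inr] <;> omega

theorem khT_ne (a) : khT k a ≠ 1 := by
  rcases a with m | m | m <;> simp only [khT, Sum.elim_inl, Sum.elim_inr] <;> omega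

theorem kh_injective (a b) (h1 : khT k a = khT k b) (h2 : khL k a = khL k b) : a = b := by
  rcases a with m | m | m <;> rcases b with n | n | n <;>
    simp only [khT, khL, Sum.elim_inl, Sum.elim_inr, reduceCtorEq] at h1 h2
  · rw [Fin.ext (show m.val = n.val by omega)]
  · rw [Subsingleton.elim m n]
  · rw [Fin.ext (show m.val = n.val by omega)]

theorem exists_kh {t : ℕ} (h : t ≤ 2 * k + 1) (l : Bool) (hl : l = true ∧ Even t ∨ l = false ∧ t = 0 ∨
    l = false ∧ 3 ≤ t ∧ Odd t) : ∃ a, khT k a = t ∧ khL k a = l := by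
  rcases hl with ⟨rfl, m, hm⟩ | ⟨rfl, rfl⟩ | ⟨rfl, h3, m, hm⟩
  · exact ⟨Sum.inl ⟨m, by omega⟩, by simp only [khT, Sum.elim_inl]; omega, rfl⟩
  · exact ⟨Sum.inr (Sum.inl 0), rfl, rfl⟩
  · exact ⟨Sum.inr (Sum.inr ⟨m - 1, by omega⟩), by simp only [khT, Sum.elim_inr]; omega, rfl⟩

theorem kh_parity (a) : khL k a = true ∧ Even (khT k a) ∨ khL k a = false ∧ khT k a = 0 ∨
    khL k a = false ∧ 3 ≤ khT k a ∧ Odd (khT k a) := by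
  rcases a with m | m | m
  · exact Or.inl ⟨rfl, m.val, two_mul _⟩
  · exact Or.inr (Or.inl ⟨rfl, rfl⟩)
  · exact Or.inr (Or.inr ⟨rfl, Nat.le_add_left _ _, m.val + 1, by simp only [khT, Sum.elim_inr]; ring⟩)

/-- The differential sends 1 in even degree $t\ge2$ to $2X$ in degree $t+1$. What remains is $X$ in
all even degrees, 1 in degree 0, and 1 in odd degrees from 3 on. -/
theorem exists_kh_basis (k : ℕ) : ∃ (e : Module.End ℚ (Kh k))
    (B : Module.Basis (Fin (k + 1) ⊕ Fin 1 ⊕ Fin k) ℚ (Kh k)), IsInducedByU k ⊤ e ∧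
      (∀ a, B a ∈ khPiece k (genDeg k (khT k a) (khL k a)).1 (genDeg k (khT k a) (khL k a)).2) ∧
      (∀ m n, ∀ z ∈ khPiece k m n, ∀ a, B.repr z a ≠ 0 → genDeg k (khT k a) (khL k a) = (m, n)) ∧
      (∀ a b, khT k a = khT k b + 2 → khL k a = khL k b →
        e (B a) = (2 * (k + 1 - (khT k a / 2 : ℕ)) : ℚ) • B b) ∧
      (∀ a, khT k a = 0 ∨ khT k a = 3 → e (B a) = 0) := by
  refine exists_basis_of_small ⊤ ⊤ (Or.inl ⟨rfl, rfl⟩) (khT k) (khL k) khT_le khT_ne kh_injective (fun _ => trivial)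
    (fun a => ?_) (fun w _ a => ?_) (cancel k) (fun _ _ => trivial) fun w _ => ?_
  · rw [opSD_gen (khT_le a) (khT_ne a), if_neg]
    rintro ⟨h1, h2, h3⟩
    rcases kh_parity a with ⟨h, -⟩ | ⟨-, h⟩ | ⟨-, -, h⟩
    · simp [h] at h1
    · omega
    · exact (Nat.not_even_iff_odd.2 h) h3
  · refine LinearMap.congr_fun (f := LinearMap.proj (R := ℚ) (φ := fun _ => ℚ) _ ∘ₗ linTqft (opSD ℚ k)) (g := 0)
      (ext_gen fun t l h h1 => ?_) w
    rw [LinearMap.comp_apply, opSD_gen h h1, LinearMap.zero_apply]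
    split_ifs with h2
    · refine mul_eq_zero_of_right (2 : ℚ) (if_neg ?_)
      rintro ⟨h3, h4⟩
      change khT k a = t + 1 at h3
      change khL k a = true at h4
      rcases kh_parity a with ⟨-, h⟩ | ⟨h, -⟩ | ⟨h, -⟩
      · rw [h3] at h
        exact (Nat.not_even_iff_odd.2 h2.2.2.add_one) h
      · simp [h] at h4
      · simp [h] at h4
    · rfl
  · have key := LinearMap.congr_fun (f := LinearMap.id - ∑ a, (LinearMap.proj (R := ℚ) (φ := fun _ => ℚ)
        (⟨smallIndex (khT k a) (khT_le a) (khT_ne a), fun _ => khL k a⟩ : Gens (smallObj ℚ k))).smulRight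
        (gen k (khT k a) (khL k a)))
      (g := linTqft (opSD ℚ k) ∘ₗ cancel k + cancel k ∘ₗ linTqft (opSD ℚ k)) (ext_gen fun t l h h1 => ?_) w
    · refine Eq.trans ?_ key
      rw [LinearMap.sub_apply, LinearMap.sum_apply]
      rfl
    · rw [LinearMap.sub_apply, LinearMap.sum_apply, LinearMap.add_apply, LinearMap.comp_apply, LinearMap.comp_apply,
        LinearMap.id_apply, cancel_gen h h1, opSD_gen h h1]
      change gen k t l - ∑ a, gen k t l (⟨smallIndex (khT k a) (khT_le a) (khT_ne a), fun _ => khL k a⟩ :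
        Gens (smallObj ℚ k)) • gen k (khT k a) (khL k a) = _
      by_cases hJ : ∃ a, khT k a = t ∧ khL k a = l
      · obtain ⟨a, rfl, rfl⟩ := hJ
        rw [sum_gen_of_mem (t := khT k) (l := khL k)
          (γ := fun a => ⟨smallIndex (khT k a) (khT_le a) (khT_ne a), fun _ => khL k a⟩)
          (fun _ _ _ => rfl) kh_injective a, sub_self, if_neg, if_neg, map_zero, map_zero, add_zero]
        · rintro ⟨h2, h3, h4⟩
          rcases kh_parity a with ⟨h, -⟩ | ⟨-, h⟩ | ⟨-, -, h⟩
          · simp [h] at h2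
          · omega
          · exact (Nat.not_even_iff_odd.2 h) h4
        · rintro ⟨h2, h3, h4⟩
          rcases kh_parity a with ⟨-, h⟩ | ⟨h, -⟩ | ⟨h, -⟩
          · exact (Nat.not_even_iff_odd.2 h4) h
          · simp [h] at h2
          · simp [h] at h2
      · rw [sum_gen_of_notMem (t := khT k) (l := khL k)
          (γ := fun a => ⟨smallIndex (khT k a) (khT_le a) (khT_ne a), fun _ => khL k a⟩)
          (fun _ _ _ => rfl) fun a ha => hJ ⟨a, ha⟩, sub_zero]
        have hJ' := fun hl => hJ (exists_kh h l hl)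
        -- The other generators, 1 in even degree $t\ge2$ and $X$ in odd degree $t\ge3$, are paired
        -- by the differential and its inverse up to the factor 2.
        rcases Nat.even_or_odd t with ht | ht <;> cases l
        · have h2 : 2 ≤ t := by
            obtain ⟨m, hm⟩ := ht
            by_contra h2
            exact hJ' (Or.inr (Or.inl ⟨rfl, by omega⟩))
          rw [if_neg (by simp), if_pos ⟨rfl, h2, ht⟩, map_zero, zero_add, map_smul,
            cancel_gen (by obtain ⟨m, hm⟩ := ht; omega) (by omega), if_pos ⟨rfl, by omega, ht.add_one⟩, smul_smul,
            Nat.add_sub_cancel]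
          norm_num
        · exact absurd (Or.inl ⟨rfl, ht⟩) hJ'
        · exact absurd (Or.inr (Or.inr ⟨rfl, by obtain ⟨m, hm⟩ := ht; omega, ht⟩)) hJ'
        · have h3 : 3 ≤ t := by obtain ⟨m, hm⟩ := ht; omega
          have h4 : Even (t - 1) := Nat.Odd.sub_odd ht odd_one
          rw [if_pos ⟨rfl, h3, ht⟩, if_neg (by simp), map_zero, add_zero, map_smul,
            opSD_gen (by omega) (by omega), if_pos ⟨rfl, by omega, h4⟩, smul_smul,
            Nat.sub_add_cancel (by omega)]
          norm_num

end Strings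
end TorusKh

namespace TorusKh

section UnreducedHomology

variable {k : ℕ}

theorem genDeg_eq_add_iff {t t' : ℕ} {l l' : Bool} :
    genDeg k t' l' = ((genDeg k t l).1 + 2, (genDeg k t l).2 - 4) ↔ t' = t + 2 ∧ l' = l := by
  rw [Prod.ext_iff]
  cases l <;> cases l' <;> simp [genDeg] <;> omega

theorem genDeg_inj {t t' : ℕ} {l l' : Bool} (h : genDeg k t l = genDeg k t' l') : t = t' ∧ l = l' := by
  rw [Prod.ext_iff] at h
  cases l <;> cases l' <;> simp [genDeg] at h ⊢ <;> omega

/-- The last equation turns the coefficient $k+1-\lfloor t/2\rfloor$ of the small model into length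
minus position; it holds in both long strings, and the string of length one has no successors. -/
theorem khNext_eq_some {a b : Fin (k + 1) ⊕ Fin 1 ⊕ Fin k} (h : khNext k a = some b) :
    khPos k b = khPos k a + 1 ∧ khLen k b = khLen k a ∧ khPos k b < khLen k b ∧ khT k b = khT k a + 2 ∧
      khL k b = khL k a ∧ k + 1 - khT k b / 2 = khLen k b - khPos k b := by
  rcases a with m | m | m <;> simp only [khNext, Sum.elim_inl, Sum.elim_inr] at h <;>
    obtain ⟨m', hm, rfl⟩ := Option.map_eq_some_iff.1 h <;> rw [finNext_eq_some] at hm <;>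
    simp only [khPos, khLen, khT, khL, Sum.elim_inl, Sum.elim_inr, true_and] <;> omega

theorem exists_khNext {b : Fin (k + 1) ⊕ Fin 1 ⊕ Fin k} (h : khPos k b ≠ 0) : ∃ a, khNext k a = some b := by
  rcases b with m | m | m
  all_goals simp only [khPos, Sum.elim_inl, Sum.elim_inr] at h
  · exact ⟨Sum.inl ⟨m - 1, by omega⟩, Option.map_eq_some_iff.2 ⟨m, finNext_eq_some.2 (by simp only; omega), rfl⟩⟩
  · omega
  · exact ⟨Sum.inr (Sum.inr ⟨m - 1, by omega⟩),
      Option.map_eq_some_iff.2 ⟨m, finNext_eq_some.2 (by simp only; omega), rfl⟩⟩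

/-- The next degree exceeds $2k+1$ for the long strings. For the single vector it is 2, where no
generator with label 1 survives. -/
theorem khNext_eq_none {a : Fin (k + 1) ⊕ Fin 1 ⊕ Fin k} (h : khNext k a = none) :
    khLen k a = khPos k a + 1 ∧ ∀ b, ¬ (khT k b = khT k a + 2 ∧ khL k b = khL k a) := by
  rcases a with m | m | m <;> simp only [khNext, Sum.elim_inl, Sum.elim_inr] at h
  all_goals
    rw [Option.map_eq_none_iff, finNext_eq_none] at h
    refine ⟨h, fun b hb => ?_⟩
    have := khT_le b
    rcases b with n | n | n
    all_goals
      simp only [khT, khL, Sum.elim_inl, Sum.elim_inr, reduceCtorEq, and_false, and_true] at hb this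
      try omega

theorem kh_bottom {a : Fin (k + 1) ⊕ Fin 1 ⊕ Fin k} (h : khPos k a = 0) : khT k a = 0 ∨ khT k a = 3 := by
  rcases a with m | m | m
  · exact Or.inl (congrArg (2 * ·) h)
  · exact Or.inl rfl
  · exact Or.inr (congrArg (2 * · + 3) h)

theorem exists_kh_strings (k : ℕ) : ∃ e : Module.End ℚ (Kh k), IsInducedByU k ⊤ e ∧
    (∀ i j : ℤ, khPiece k i j ≠ ⊥ → 2 * i + j = -2 * (k : ℤ) + 1 ∨ 2 * i + j = -2 * (k : ℤ) - 1) ∧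
    (∃ b : Module.Basis (Fin (k + 1) ⊕ Fin 1 ⊕ Fin k) ℚ (Kh k),
      IsString (khPiece k) e 0 (-2 * (k : ℤ) + 1) (fun m => b (Sum.inl m)) ∧
      IsString (khPiece k) e 0 (-2 * (k : ℤ) - 1) (fun m => b (Sum.inr (Sum.inl m))) ∧
      IsString (khPiece k) e 3 (-2 * (k : ℤ) - 7) (fun m => b (Sum.inr (Sum.inr m)))) ∧
    ∃! ρ : Sl2Action (Kh k), ExtendsToSl2 (khPiece k) e ρ := by
  obtain ⟨e, B, he, hB, hP, hstep, hbot⟩ := exists_kh_basis k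
  have hnext : ∀ a b, khNext k a = some b → e (B b) = (2 * (khLen k b - khPos k b) : ℚ) • B a := fun a b h => by
    obtain ⟨-, -, h3, h4, h5, h6⟩ := khNext_eq_some h
    rw [hstep b a h4 h5]
    have := khT_le b
    -- Stated with sums, so that it casts to the rationals without truncated subtraction.
    have h7 : k + 1 + khPos k b = khLen k b + khT k b / 2 := by omega
    have h8 : (k + 1 + khPos k b : ℚ) = khLen k b + (khT k b / 2 : ℕ) := by exact_mod_cast h7
    congr 1
    linarith
  have hmem : ∀ a {i j : ℤ}, (khT k a : ℤ) = i → (-(2 * k) - 2 * khT k a + if khL k a = true then 1 else -1 : ℤ) = j →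
      B a ∈ khPiece k i j := by
    rintro a _ _ rfl rfl
    exact hB a
  refine ⟨e, he, fun i j h => ?_, ⟨B, ⟨fun m => ?_, fun m h => hbot _ (kh_bottom h), fun m m' h => ?_⟩,
    ⟨fun m => ?_, fun m h => hbot _ (kh_bottom h), fun m m' h => ?_⟩,
    ⟨fun m => ?_, fun m h => hbot _ (kh_bottom h), fun m m' h => ?_⟩⟩, ?_⟩
  · obtain ⟨z, hz, hz0⟩ := Submodule.exists_mem_ne_zero_of_ne_bot h
    obtain ⟨a, ha⟩ : ∃ a, B.repr z a ≠ 0 := by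
      by_contra! h0
      exact hz0 (B.repr.map_eq_zero_iff.1 (Finsupp.ext h0))
    have hd := Prod.ext_iff.1 (hP i j z hz a ha)
    rcases a with m | m | m <;> simp [genDeg, khT, khL] at hd <;> omega
  · exact hmem (Sum.inl m) (by simp only [khT, Sum.elim_inl]; push_cast; ring)
      (by simp only [khT, khL, Sum.elim_inl, if_true]; push_cast; ring)
  · exact (hnext (Sum.inl m) (Sum.inl m') (Option.map_eq_some_iff.2 ⟨m', finNext_eq_some.2 h, rfl⟩)).trans (by simp [khLen, khPos])
  · exact hmem (Sum.inr (Sum.inl m)) (by simp only [khT, Sum.elim_inl, Sum.elim_inr]; omega)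
      (by simp only [khT, khL, Sum.elim_inl, Sum.elim_inr, reduceCtorEq, if_false]; omega)
  · omega
  · exact hmem (Sum.inr (Sum.inr m)) (by simp only [khT, Sum.elim_inr]; push_cast; ring)
      (by simp only [khT, khL, Sum.elim_inr, reduceCtorEq, if_false]; push_cast; ring)
  · exact (hnext (Sum.inr (Sum.inr m)) (Sum.inr (Sum.inr m')) (Option.map_eq_some_iff.2 ⟨m', finNext_eq_some.2 h, rfl⟩)).trans (by simp [khLen, khPos])
  · refine existsUnique_sl2 (khPiece k) e B (fun a => genDeg k (khT k a) (khL k a))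
      (fun a b h => kh_injective a b (genDeg_inj h).1 (genDeg_inj h).2) hB hP (khPos k) (khLen k) (khNext k)
      (fun a h => hbot a (kh_bottom h)) (fun a b h => ?_) (fun b h => exists_khNext h)
      fun a h => ⟨(khNext_eq_none h).1, fun b hb => (khNext_eq_none h).2 b (genDeg_eq_add_iff.1 hb)⟩
    obtain ⟨h1, h2, h3, h4, h5, -⟩ := khNext_eq_some h
    exact ⟨h1, h2, h3, genDeg_eq_add_iff.2 ⟨h4, h5⟩, hnext a b h⟩

end UnreducedHomology
end TorusKh

/-! ### Reduced homology. -/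

namespace TorusKh

section ReducedHomology

variable {k : ℕ}

/-- The number of a basis vector of the reduced homology in its string. -/
def rkhPos (k : ℕ) : Fin (k + 1) ⊕ Fin k → ℕ := Sum.elim Fin.val Fin.val

/-- The length of the string of a basis vector of the reduced homology. -/
def rkhLen (k : ℕ) : Fin (k + 1) ⊕ Fin k → ℕ := Sum.elim (fun _ => k + 1) fun _ => k

/-- The next basis vector of a string of the reduced homology. -/
def rkhNext (k : ℕ) : Fin (k + 1) ⊕ Fin k → Option (Fin (k + 1) ⊕ Fin k) :=
  Sum.elim (fun m => (finNext m).map Sum.inl) fun m => (finNext m).map Sum.inr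

/-- The homological degree of a basis vector of the reduced homology. -/
def rkhT (k : ℕ) : Fin (k + 1) ⊕ Fin k → ℕ := Sum.elim (fun m => 2 * m.val) fun m => 2 * m.val + 3

theorem rkhT_le (a) : rkhT k a ≤ 2 * k + 1 := by
  rcases a with m | m <;> simp only [rkhT, Sum.elim_inl, Sum.elim_inr] <;> omega

theorem rkhT_ne (a) : rkhT k a ≠ 1 := by
  rcases a with m | m <;> simp only [rkhT, Sum.elim_inl, Sum.elim_inr] <;> omega

theorem rkhT_injective (a b) (h : rkhT k a = rkhT k b) : a = b := by
  rcases a with m | m <;> rcases b with n | n <;> simp only [rkhT, Sum.elim_inl, Sum.elim_inr] at h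
  · rw [Fin.ext (show m.val = n.val by omega)]
  · omega
  · omega
  · rw [Fin.ext (show m.val = n.val by omega)]

theorem exists_rkhT {t : ℕ} (h : t ≤ 2 * k + 1) (h1 : t ≠ 1) : ∃ a, rkhT k a = t := by
  rcases Nat.even_or_odd t with ⟨m, hm⟩ | ⟨m, hm⟩
  · exact ⟨Sum.inl ⟨m, by omega⟩, by simp only [rkhT, Sum.elim_inl]; omega⟩
  · exact ⟨Sum.inr ⟨m - 1, by omega⟩, by simp only [rkhT, Sum.elim_inr]; omega⟩

/-- The image of $x$ is spanned by the generators with label $X$, and $2X\cdot X=0$. So the reduced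
small model has no differential, and every degree except 1 contributes a class. -/
theorem opSD_comp_opSX : linTqft (opSD ℚ k) ∘ₗ linTqft (opSX ℚ k) = 0 := ext_gen fun t l h h1 => by
  rw [LinearMap.comp_apply, opSX_gen h h1, LinearMap.zero_apply]
  split_ifs
  · rw [opSD_gen h h1, if_neg (by simp)]
  · rw [map_zero]

theorem exists_rkh_basis (k : ℕ) : ∃ (e : Module.End ℚ (RKh k))
    (B : Module.Basis (Fin (k + 1) ⊕ Fin k) ℚ (RKh k)), IsInducedByU k (redSub k) e ∧
      (∀ a, B a ∈ homPiece k (redSub k) (genDeg k (rkhT k a) true).1 (genDeg k (rkhT k a) true).2) ∧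
      (∀ m n, ∀ z ∈ homPiece k (redSub k) m n, ∀ a, B.repr z a ≠ 0 → genDeg k (rkhT k a) true = (m, n)) ∧
      (∀ a b, rkhT k a = rkhT k b + 2 → true = true →
        e (B a) = (2 * (k + 1 - (rkhT k a / 2 : ℕ)) : ℚ) • B b) ∧
      (∀ a, rkhT k a = 0 ∨ rkhT k a = 3 → e (B a) = 0) := by
  have hd : ∀ w, linTqft (opSD ℚ k) (linTqft (opSX ℚ k) w) = 0 := LinearMap.congr_fun opSD_comp_opSX
  refine exists_basis_of_small (redSub k) (LinearMap.range (linTqft (opSX ℚ k))) (Or.inr ⟨rfl, rfl⟩) (rkhT k)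
    (fun _ => true) rkhT_le rkhT_ne (fun a b h _ => rkhT_injective a b h)
    (fun a => ⟨gen k (rkhT k a) false, by rw [opSX_gen (rkhT_le a) (rkhT_ne a), if_pos rfl]⟩)
    (fun a => by rw [opSD_gen (rkhT_le a) (rkhT_ne a), if_neg (by simp)]) ?_ 0
    (fun w _ => Submodule.zero_mem _) ?_
  · rintro _ ⟨w, rfl⟩ a
    rw [hd]
    rfl
  · rintro _ ⟨w, rfl⟩
    rw [LinearMap.zero_apply, LinearMap.zero_apply, map_zero, add_zero, sub_eq_zero]
    refine (LinearMap.congr_fun (f := linTqft (opSX ℚ k)) (g := ∑ a, (LinearMap.proj (R := ℚ) (φ := fun _ => ℚ)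
        (⟨smallIndex (rkhT k a) (rkhT_le a) (rkhT_ne a), fun _ => true⟩ : Gens (smallObj ℚ k)) ∘ₗ
        linTqft (opSX ℚ k)).smulRight (gen k (rkhT k a) true)) (ext_gen fun t l h h1 => ?_) w).trans (LinearMap.sum_apply _ _ _)
    rw [LinearMap.sum_apply, opSX_gen h h1]
    obtain ⟨a, rfl⟩ := exists_rkhT h h1
    have hs : ∑ b, (if l = false then gen k (rkhT k a) true else 0)
        (⟨smallIndex (rkhT k b) (rkhT_le b) (rkhT_ne b), fun _ => true⟩ : Gens (smallObj ℚ k)) •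
        gen k (rkhT k b) true = if l = false then gen k (rkhT k a) true else 0 := by
      split_ifs
      · exact sum_gen_of_mem (t := rkhT k) (l := fun _ => true)
          (γ := fun a => ⟨smallIndex (rkhT k a) (rkhT_le a) (rkhT_ne a), fun _ => true⟩)
          (fun _ _ _ => rfl) (fun a b h _ => rkhT_injective a b h) a
      · exact Finset.sum_eq_zero fun b _ => zero_smul _ _
    rw [← hs]
    refine Finset.sum_congr rfl fun b _ => ?_
    rw [LinearMap.smulRight_apply, LinearMap.comp_apply, opSX_gen h h1]
    rfl

theorem rkhNext_eq_some {a b : Fin (k + 1) ⊕ Fin k} (h : rkhNext k a = some b) :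
    rkhPos k b = rkhPos k a + 1 ∧ rkhLen k b = rkhLen k a ∧ rkhPos k b < rkhLen k b ∧ rkhT k b = rkhT k a + 2 ∧
      k + 1 - rkhT k b / 2 = rkhLen k b - rkhPos k b := by
  rcases a with m | m <;> simp only [rkhNext, Sum.elim_inl, Sum.elim_inr] at h <;>
    obtain ⟨m', hm, rfl⟩ := Option.map_eq_some_iff.1 h <;> rw [finNext_eq_some] at hm <;>
    simp only [rkhPos, rkhLen, rkhT, Sum.elim_inl, Sum.elim_inr, true_and] <;> omega

theorem exists_rkhNext {b : Fin (k + 1) ⊕ Fin k} (h : rkhPos k b ≠ 0) : ∃ a, rkhNext k a = some b := by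
  rcases b with m | m
  all_goals simp only [rkhPos, Sum.elim_inl, Sum.elim_inr] at h
  · exact ⟨Sum.inl ⟨m - 1, by omega⟩, Option.map_eq_some_iff.2 ⟨m, finNext_eq_some.2 (by simp only; omega), rfl⟩⟩
  · exact ⟨Sum.inr ⟨m - 1, by omega⟩, Option.map_eq_some_iff.2 ⟨m, finNext_eq_some.2 (by simp only; omega), rfl⟩⟩

theorem rkhNext_eq_none {a : Fin (k + 1) ⊕ Fin k} (h : rkhNext k a = none) :
    rkhLen k a = rkhPos k a + 1 ∧ ∀ b, rkhT k b ≠ rkhT k a + 2 := by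
  rcases a with m | m <;> simp only [rkhNext, Sum.elim_inl, Sum.elim_inr] at h
  all_goals
    rw [Option.map_eq_none_iff, finNext_eq_none] at h
    refine ⟨h, fun b hb => ?_⟩
    have := rkhT_le b
    rcases b with n | n <;> simp only [rkhT, Sum.elim_inl, Sum.elim_inr] at hb this <;> omega

theorem rkh_bottom {a : Fin (k + 1) ⊕ Fin k} (h : rkhPos k a = 0) : rkhT k a = 0 ∨ rkhT k a = 3 := by
  rcases a with m | m
  · exact Or.inl (congrArg (2 * ·) h)
  · exact Or.inr (congrArg (2 * · + 3) h)

theorem exists_rkh_strings (k : ℕ) : ∃ e : Module.End ℚ (RKh k), IsInducedByU k (redSub k) e ∧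
    (∀ i j : ℤ, rkhPiece k i j ≠ ⊥ → 2 * i + j = -2 * (k : ℤ)) ∧
    (∃ b : Module.Basis (Fin (k + 1) ⊕ Fin k) ℚ (RKh k),
      IsString (rkhPiece k) e 0 (-2 * (k : ℤ)) (fun m => b (Sum.inl m)) ∧
      IsString (rkhPiece k) e 3 (-2 * (k : ℤ) - 6) (fun m => b (Sum.inr m))) ∧
    ∃! ρ : Sl2Action (RKh k), ExtendsToSl2 (rkhPiece k) e ρ := by
  obtain ⟨e, B, he, hB, hP, hstep, hbot⟩ := exists_rkh_basis k
  have hnext : ∀ a b, rkhNext k a = some b → e (B b) = (2 * (rkhLen k b - rkhPos k b) : ℚ) • B a := fun a b h => by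
    obtain ⟨-, -, h3, h4, h6⟩ := rkhNext_eq_some h
    rw [hstep b a h4 rfl]
    have := rkhT_le b
    have h7 : k + 1 + rkhPos k b = rkhLen k b + rkhT k b / 2 := by omega
    have h8 : (k + 1 + rkhPos k b : ℚ) = rkhLen k b + (rkhT k b / 2 : ℕ) := by exact_mod_cast h7
    congr 1
    linarith
  have hmem : ∀ a {i j : ℤ}, (rkhT k a : ℤ) = i → (-(2 * k) - 2 * rkhT k a : ℤ) = j → B a ∈ rkhPiece k i j := by
    rintro a _ _ rfl rfl
    exact hB a
  -- The shift by 1 in the reduced grading cancels the degree $+1$ of the label $X$.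
  have hdeg : ∀ i j, ∀ z ∈ rkhPiece k i j, ∀ a, B.repr z a ≠ 0 →
      ((rkhT k a : ℤ), (-(2 * k) - 2 * rkhT k a : ℤ)) = (i, j) := fun i j z hz a ha => by
    have h := Prod.ext_iff.1 (hP i (j + 1) z hz a ha)
    exact Prod.ext h.1 (add_right_cancel h.2)
  refine ⟨e, he, fun i j h => ?_, ⟨B, ⟨fun m => ?_, fun m h => hbot _ (rkh_bottom h), fun m m' h => ?_⟩,
    ⟨fun m => ?_, fun m h => hbot _ (rkh_bottom h), fun m m' h => ?_⟩⟩, ?_⟩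
  · obtain ⟨z, hz, hz0⟩ := Submodule.exists_mem_ne_zero_of_ne_bot h
    obtain ⟨a, ha⟩ : ∃ a, B.repr z a ≠ 0 := by
      by_contra! h0
      exact hz0 (B.repr.map_eq_zero_iff.1 (Finsupp.ext h0))
    obtain ⟨h1, h2⟩ := Prod.ext_iff.1 (hdeg i j z hz a ha)
    simp only at h1 h2
    omega
  · exact hmem (Sum.inl m) (by simp only [rkhT, Sum.elim_inl]; push_cast; ring)
      (by simp only [rkhT, Sum.elim_inl]; push_cast; ring)
  · exact (hnext (Sum.inl m) (Sum.inl m') (Option.map_eq_some_iff.2 ⟨m', finNext_eq_some.2 h, rfl⟩)).trans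
      (by simp [rkhLen, rkhPos])
  · exact hmem (Sum.inr m) (by simp only [rkhT, Sum.elim_inr]; push_cast; ring)
      (by simp only [rkhT, Sum.elim_inr]; push_cast; ring)
  · exact (hnext (Sum.inr m) (Sum.inr m') (Option.map_eq_some_iff.2 ⟨m', finNext_eq_some.2 h, rfl⟩)).trans
      (by simp [rkhLen, rkhPos])
  · refine existsUnique_sl2 (rkhPiece k) e B (fun a => ((rkhT k a : ℤ), (-(2 * k) - 2 * rkhT k a : ℤ)))
      (fun a b h => rkhT_injective a b (Nat.cast_injective (Prod.ext_iff.1 h).1)) (fun a => hmem a rfl rfl) hdeg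
      (rkhPos k) (rkhLen k) (rkhNext k) (fun a h => hbot a (rkh_bottom h)) (fun a b h => ?_)
      (fun b h => exists_rkhNext h)
      fun a h => ⟨(rkhNext_eq_none h).1, fun b hb => (rkhNext_eq_none h).2 b (by
        have := (Prod.ext_iff.1 hb).1
        simp only at this
        omega)⟩
    obtain ⟨h1, h2, h3, h4, -⟩ := rkhNext_eq_some h
    refine ⟨h1, h2, h3, ?_, hnext a b h⟩
    rw [h4]
    push_cast
    exact Prod.ext rfl (by simp only; ring)

end ReducedHomology
end TorusKh

theorem mainTheorem7 (k : ℕ) :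
    -- the bracket, over an arbitrary commutative ring
    (∀ (R : Type*) [CommRing R],
      TorusKh.IsCA1Module (TorusKh.bracket R k) (TorusKh.bracketD R k) (TorusKh.bracketX R k)
        (TorusKh.bracketXi R k) (TorusKh.bracketU R k) ∧
      TorusKh.IsCA1Module (TorusKh.small R k) (TorusKh.smallD R k) (TorusKh.smallX R k)
        0 (TorusKh.smallU R k) ∧
      ∃ (g : (TorusKh.bracket R k).obj ⟶ (TorusKh.small R k).obj)
        (f : (TorusKh.small R k).obj ⟶ (TorusKh.bracket R k).obj)
        (s : End (TorusKh.bracket R k).obj),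
        TorusKh.IsStrongDeformationRetract (TorusKh.bracket R k) (TorusKh.small R k)
          (TorusKh.bracketD R k) (TorusKh.smallD R k) g f s ∧
        f ≫ TorusKh.bracketX R k ≫ g = TorusKh.smallX R k ∧
        f ≫ TorusKh.bracketXi R k ≫ g = 0 ∧
        f ≫ TorusKh.bracketU R k ≫ g = TorusKh.smallU R k) ∧
    -- the rational Khovanov complex
    (TorusKh.ckhD k ∘ₗ TorusKh.ckhD k = 0 ∧
      TorusKh.ckhD k ∘ₗ TorusKh.ckhU k = TorusKh.ckhU k ∘ₗ TorusKh.ckhD k ∧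
      (TorusKh.redSub k).map (TorusKh.ckhD k) ≤ TorusKh.redSub k ∧
      (TorusKh.redSub k).map (TorusKh.ckhU k) ≤ TorusKh.redSub k) ∧
    -- unreduced homology
    (∃ e : Module.End ℚ (TorusKh.Kh k),
      TorusKh.IsInducedByU k ⊤ e ∧
      (∀ i j : ℤ, TorusKh.khPiece k i j ≠ ⊥ →
        2 * i + j = -2 * (k : ℤ) + 1 ∨ 2 * i + j = -2 * (k : ℤ) - 1) ∧
      (∃ b : Module.Basis (Fin (k + 1) ⊕ Fin 1 ⊕ Fin k) ℚ (TorusKh.Kh k),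
        TorusKh.IsString (TorusKh.khPiece k) e 0 (-2 * (k : ℤ) + 1)
          (fun m => b (Sum.inl m)) ∧
        TorusKh.IsString (TorusKh.khPiece k) e 0 (-2 * (k : ℤ) - 1)
          (fun m => b (Sum.inr (Sum.inl m))) ∧
        TorusKh.IsString (TorusKh.khPiece k) e 3 (-2 * (k : ℤ) - 7)
          (fun m => b (Sum.inr (Sum.inr m)))) ∧
      ∃! ρ : TorusKh.Sl2Action (TorusKh.Kh k), TorusKh.ExtendsToSl2 (TorusKh.khPiece k) e ρ) ∧
    -- reduced homology
    (∃ e : Module.End ℚ (TorusKh.RKh k),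
      TorusKh.IsInducedByU k (TorusKh.redSub k) e ∧
      (∀ i j : ℤ, TorusKh.rkhPiece k i j ≠ ⊥ → 2 * i + j = -2 * (k : ℤ)) ∧
      (∃ b : Module.Basis (Fin (k + 1) ⊕ Fin k) ℚ (TorusKh.RKh k),
        TorusKh.IsString (TorusKh.rkhPiece k) e 0 (-2 * (k : ℤ)) (fun m => b (Sum.inl m)) ∧
        TorusKh.IsString (TorusKh.rkhPiece k) e 3 (-2 * (k : ℤ) - 6)
          (fun m => b (Sum.inr m))) ∧
      ∃! ρ : TorusKh.Sl2Action (TorusKh.RKh k),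
        TorusKh.ExtendsToSl2 (TorusKh.rkhPiece k) e ρ) := by
  exact ⟨fun R _ => ⟨TorusKh.bracket_isCA1Module, TorusKh.small_isCA1Module, TorusKh.exists_bracket_retract⟩,
    ⟨TorusKh.ckhD_comp_ckhD k, TorusKh.ckhD_comp_ckhU k, TorusKh.map_ckhD_redSub k, TorusKh.map_ckhU_redSub k⟩,
    TorusKh.exists_kh_strings k, TorusKh.exists_rkh_strings k⟩
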